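/- **Conventions.** Let $G$ be a finite group and let $k$ be a field of characteristic $0$ which is a splitting field for $G$ (that is, $\dim_k\mathrm{End}_G(V)=1$ for every irreducible finite-dimensional $k[G]$-module $V$; e.g. $k$ algebraically closed). $\mathbf{Vect}$ and $\mathrm{Rep}(G)$ denote finite-dimensional vector spaces and representations over $k$. Let $(\rho)_{\rho\in\mathrm{Irr}\,G}$ be a complete irredundant system of models for the irreducible representations of $G$. For a finite set $S$ let $\mathrm{Sh}(S)=\mathbf{Vect}^S$ and $\mathrm{Sh}_G(S)=\mathrm{Rep}(G)^S$ be the categories of $S$-indexed families (sheaves on $S$). For a $k$-linear category $\mathcal A$ a functor $F:\mathcal A\to\mathbf{Vect}$ is polynomial if for some $d$ all maps $\mathrm{Hom}(X,Y)\to\mathrm{Hom}(FX,FY)$ are polynomial of degree $\le d$; it is homogeneous of degree $d$ if $F(cf)=c^dF(f)$ for $c\in k$. Polynomial functors on $\mathrm{Sh}(S)$ and on $\mathrm{Sh}_G(S)$ form the graded categories $\mathcal P(\mathrm{Sh}(S))$ and $\mathcal P(\mathrm{Sh}_G(S))$. $\mathrm{FinSet}^{\sqcup}$ is the category of finite families $(S_i)_{i\in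 I}$ of finite sets; a morphism $(S_i)_I\to(T_j)_J$ is a map of pointed sets $\varphi:I_*\to J_*$ with maps $S_i\to T_{j}$ whenever $\varphi(i)=j\in J$. $\mathbf{2Vect}_{gr}^{\otimes}$ is the bicategory of finite families of graded 2-vector spaces ($k$-linear categories which are direct sums of subcategories $\mathcal C_d$, $d\ge 0$, each equivalent to a finite sum of copies of $\mathbf{Vect}$); a 1-morphism $(\mathcal C_i)_I\to(\mathcal D_j)_J$ is a map $\varphi:I_*\to J_*$ with multi-exact $k$-linear functors $\prod_{\varphi(i)=j}\mathcal C_i\to\mathcal D_j$ that are finite sums of homogeneous ones, and 2-morphisms are natural transformations over a fixed $\varphi$. Both lie over finite pointed sets. An SSH structure is a pseudofunctor $\mathrm{FinSet}^{\sqcup}\to\mathbf{2Vect}_{gr}^{\otimes}$ over finite pointed sets which takes all maps to degree-zero maps, takes coCartesian arrows to coCartesian arrows, and takes Cartesian squares of finite sets (one-term families) to squares satisfying the Beck–Chevalley condition. An equivalence of SSH structures is a pseudonatural transformation over the identity of finite pointed sets whose components are equivalences of degree zero. $\mathcal H$ is the pseudofunctor with $\mathcal H(S)=\mathcal P(\mathrm{Sh}(S))$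 that sends $(\varphi_i:S_i\to T)_i$ to $(F_i)_i\mapsto\big(V\mapsto\bigotimes_iF_i(\varphi_i^*V)\big)$, with the evident coherence isomorphisms; $\mathcal H_G$ is defined in the same way with $\mathrm{Sh}_G$ in place of $\mathrm{Sh}$. Put $\mathcal P=\mathcal H(\{1\})$ and $\mathcal P_G=\mathcal H_G(\{1\})$. **Theorem.** 1. For every finite set $S$ the functor $Y:\mathrm{Sh}_G(S)\to\mathrm{Sh}(S\times\mathrm{Irr}\,G)$, $Y(V)_{(s,\rho)}=\mathrm{Hom}_G(\rho,V_s)$, is an equivalence. 2. $(S_i)_i\mapsto(\mathcal P(\mathrm{Sh}(S_i\times\mathrm{Irr}\,G)))_i$ (that is, $\mathcal H$ composed with $-\times\mathrm{Irr}\,G$) and $\mathcal H_G$ are SSH structures, and precomposition with $Y$, together with the evident compatibility isomorphisms, is an equivalence of SSH structures from the first to the second. 3. The product and the unit which the SSH structures induce on $\mathcal P_G$ and on $\mathcal P(\mathrm{Sh}(\mathrm{Irr}\,G))$ are the pointwise tensor product and its unit, and precomposition with $V\mapsto(\mathrm{Hom}_G(\rho,V))_\rho$ is an equivalence $\mathcal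 P(\mathrm{Sh}(\mathrm{Irr}\,G))\simeq\mathcal P_G$ that admits the structure of a symmetric monoidal functor. 4. $\mathcal P(\mathrm{Sh}(\mathrm{Irr}\,G))$ is the tensor power $\mathcal P^{\otimes\mathrm{Irr}\,G}$: the image under $\mathcal H$ of the arrow $(\{\rho\})_{\rho\in\mathrm{Irr}\,G}\to(\mathrm{Irr}\,G)$ is coCartesian, i.e. exhibits $\mathcal P(\mathrm{Sh}(\mathrm{Irr}\,G))$ as the graded Deligne tensor product of copies of $\mathcal P$ indexed by $\mathrm{Irr}\,G$. -/

import Mathlib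

open CategoryTheory Limits Bicategory

universe v w u

noncomputable section

namespace SSH

/-- `F` is `k`-linear in each variable. -/
def IsMultilinear (k : Type u) [Field k] {I : Type} {C : I → Type w} [∀ i, Category.{v} (C i)]
    [∀ i, Preadditive (C i)] [∀ i, Linear k (C i)] {D : Type w} [Category.{v} D] [Preadditive D]
    [Linear k D] (F : (∀ i, C i) ⥤ D) : Prop :=
  ∀ X Y : ∀ i, C i, ∃ m : MultilinearMap k (fun i => X i ⟶ Y i) (F.obj X ⟶ F.obj Y),
    ∀ f : X ⟶ Y, F.map f = m f

/-- A `k`-linear category with a distinguished class of objects of degree `d` for every `d`.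
Graded 2-vector spaces are singled out among these by `IsGradedTwoVect` below. -/
structure GrLinCat (k : Type u) [Field k] where
  carrier : Type w
  [cat : Category.{v} carrier]
  [preadditive : Preadditive carrier]
  [linear : Linear k carrier]
  deg : ℕ → ObjectProperty carrier

attribute [instance] GrLinCat.cat GrLinCat.preadditive GrLinCat.linear

/-- A finite family of graded categories. As for finite pointed sets below, the base point and the
zero category sitting over it are left out, and maps of pointed sets are partial maps. -/
structure GrFam (k : Type u) [Field k] where
  I : Type
  [fin : Finite I]
  C : I → GrLinCat.{v, w} k

attribute [instance] GrFam.fin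

variable {k : Type u} [Field k]

/-- A 1-morphism of families: a map `base` of the pointed index sets (`none` is the base point) and,
for each `j`, a functor which is linear in each variable, from the product of the categories over
`j` to the `j`-th category. Between semisimple categories the latter are the multi-exact functors. -/
structure MHom (X Y : GrFam.{v, w} k) where
  base : X.I → Option Y.I
  fn (j : Y.I) : (∀ i : {i // base i = some j}, (X.C i).carrier) ⥤ (Y.C j).carrier
  lin (j : Y.I) : IsMultilinear k (fn j)

/-- A 2-morphism between 1-morphisms over the same map of pointed index sets: natural
transformations of the functors of several variables. -/
@[ext]
structure MHom₂ {X Y : GrFam.{v, w} k} (f g : MHom X Y) where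
  base_eq : f.base = g.base
  app (j : Y.I) (A : ∀ i : {i // f.base i = some j}, (X.C i).carrier) :
    (f.fn j).obj A ⟶ (g.fn j).obj (fun i => A ⟨i.1, (congrFun base_eq i.1).trans i.2⟩)
  naturality (j : Y.I) {A B : ∀ i : {i // f.base i = some j}, (X.C i).carrier} (a : A ⟶ B) :
    (f.fn j).map a ≫ app j B = app j A ≫ (g.fn j).map (fun i => a ⟨i.1, (congrFun base_eq i.1).trans i.2⟩)

instance (X Y : GrFam.{v, w} k) : Category (MHom X Y) where
  Hom f g := MHom₂ f g
  id f := ⟨rfl, fun _ _ => 𝟙 _, fun j A B a => (Category.comp_id _).trans (Category.id_comp _).symm⟩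
  comp α β := ⟨α.base_eq.trans β.base_eq, fun j A => α.app j A ≫ β.app j _, fun j A B a => by
    rw [← Category.assoc, α.naturality, Category.assoc, β.naturality, Category.assoc]⟩
  id_comp α := by ext; exact Category.id_comp _
  comp_id α := by ext; exact Category.comp_id _
  assoc α β γ := by ext; exact Category.assoc _ _ _

def MHom.id (X : GrFam.{v, w} k) : MHom X X where
  base := some
  fn j := Pi.eval _ (⟨j, rfl⟩ : {i // some i = some j})
  lin j A B := ⟨{ toFun := fun f => f ⟨j, rfl⟩
                  map_update_add' := by
                    intro _ m i x y
                    have : i = ⟨j, rfl⟩ := Subtype.ext (Option.some.inj i.2)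
                    subst this; simp only [Function.update_self]; rfl
                  map_update_smul' := by
                    intro _ m i x y
                    have : i = ⟨j, rfl⟩ := Subtype.ext (Option.some.inj i.2)
                    subst this; simp only [Function.update_self]; rfl }, fun f => rfl⟩

theorem bind_some {X Y Z : Type} {φ : X → Option Y} {ψ : Y → Option Z} {i : X} {j : Y} {l : Z}
    (h : φ i = some j) (h' : ψ j = some l) : (φ i).bind ψ = some l := by
  rw [h]; exact h'

theorem exists_mid {X Y Z : Type} {φ : X → Option Y} {ψ : Y → Option Z} {l : Z}
    (i : {i // (φ i).bind ψ = some l}) : ∃ j : {j // ψ j = some l}, φ i = some j.1 := by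
  obtain ⟨j, h1, h2⟩ := Option.bind_eq_some_iff.1 i.2
  exact ⟨⟨j, h2⟩, h1⟩

theorem nest_update {I J L : Type} {φ : I → Option J} {ψ : J → Option L} {l : L}
    {M : {i // (φ i).bind ψ = some l} → Type*} {N : {j // ψ j = some l} → Type*}
    (n : ∀ j : {j // ψ j = some l},
      (∀ i : {i // φ i = some j.1}, M ⟨i.1, bind_some i.2 j.2⟩) → N j)
    [DecidableEq {i // (φ i).bind ψ = some l}] [DecidableEq {j // ψ j = some l}]
    [∀ j : {j // ψ j = some l}, DecidableEq {i // φ i = some j.1}]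
    (a : ∀ i, M i) (i : {i // (φ i).bind ψ = some l})
    (j : {j // ψ j = some l}) (hij : φ i = some j.1) (x : M i) :
    (fun j => n j fun i' => Function.update a i x ⟨i'.1, bind_some i'.2 j.2⟩) =
    Function.update (fun j => n j fun i' => a ⟨i'.1, bind_some i'.2 j.2⟩) j
      (n j (Function.update (fun i' => a ⟨i'.1, bind_some i'.2 j.2⟩) ⟨i.1, hij⟩ x)) := by
  funext j'
  by_cases h : j' = j
  · subst h
    rw [Function.update_self]
    congr 1
    funext i'
    by_cases h' : i' = ⟨i.1, hij⟩
    · subst h'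
      rw [Function.update_self (⟨i.1, hij⟩ : {i // φ i = some j'.1})]
      exact Function.update_self i x a
    · rw [Function.update_of_ne h', Function.update_of_ne]
      intro h2
      exact h' (Subtype.ext (congrArg (fun z => z.1) h2 :))
  · rw [Function.update_of_ne h]
    congr 1
    funext i'
    rw [Function.update_of_ne]
    intro h2
    apply h
    have h3 := i'.2
    rw [(congrArg (fun z => z.1) h2 : i'.1 = i.1), hij] at h3
    exact (Subtype.ext (Option.some.inj h3)).symm

/-- Plugging multilinear maps, one for each fibre, into a multilinear map. -/
def nestMultilinear {I J L : Type} {φ : I → Option J} {ψ : J → Option L} {l : L}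
    {M : {i // (φ i).bind ψ = some l} → Type*} {N : {j // ψ j = some l} → Type*} {P : Type*}
    [∀ i, AddCommGroup (M i)] [∀ i, Module k (M i)] [∀ j, AddCommGroup (N j)]
    [∀ j, Module k (N j)] [AddCommGroup P] [Module k P] (m : MultilinearMap k N P)
    (n : ∀ j : {j // ψ j = some l}, MultilinearMap k
      (fun i : {i // φ i = some j.1} => M ⟨i.1, bind_some i.2 j.2⟩) (N j)) :
    MultilinearMap k M P where
  toFun a := m fun j => n j fun i => a ⟨i.1, bind_some i.2 j.2⟩
  map_update_add' a i x y := by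
    classical
    obtain ⟨j, hij⟩ := exists_mid i
    simp only [nest_update (fun j => n j) a i j hij, MultilinearMap.map_update_add]
  map_update_smul' a i c x := by
    classical
    obtain ⟨j, hij⟩ := exists_mid i
    simp only [nest_update (fun j => n j) a i j hij, MultilinearMap.map_update_smul]

/-- Composition of functors of several variables. -/
def MHom.compFn {X Y Z : GrFam.{v, w} k} (f : MHom X Y) (g : MHom Y Z) (l : Z.I) :
    (∀ i : {i // (f.base i).bind g.base = some l}, (X.C i).carrier) ⥤ (Z.C l).carrier where
  obj A := (g.fn l).obj fun j => (f.fn j).obj fun i => A ⟨i.1, bind_some i.2 j.2⟩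
  map a := (g.fn l).map fun j => (f.fn j).map fun i => a ⟨i.1, bind_some i.2 j.2⟩
  map_id A := by
    refine Eq.trans ?_ ((g.fn l).map_id _)
    congr 1
    funext j
    exact (f.fn j).map_id _
  map_comp a b := by
    rw [← (g.fn l).map_comp]
    congr 1
    funext j
    exact (f.fn j).map_comp _ _

theorem MHom.compFn_lin {X Y Z : GrFam.{v, w} k} (f : MHom X Y) (g : MHom Y Z) (l : Z.I) :
    IsMultilinear k (f.compFn g l) := by
  intro A B
  obtain ⟨m, hm⟩ := g.lin l (fun j => (f.fn j).obj fun i => A ⟨i.1, bind_some i.2 j.2⟩)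
    (fun j => (f.fn j).obj fun i => B ⟨i.1, bind_some i.2 j.2⟩)
  choose n hn using fun j : {j // g.base j = some l} =>
    f.lin j.1 (fun i => A ⟨i.1, bind_some i.2 j.2⟩) (fun i => B ⟨i.1, bind_some i.2 j.2⟩)
  refine ⟨nestMultilinear m n, fun a => (hm _).trans (congrArg m ?_)⟩
  funext j
  exact hn j _

def MHom.comp {X Y Z : GrFam.{v, w} k} (f : MHom X Y) (g : MHom Y Z) : MHom X Z where
  base i := (f.base i).bind g.base
  fn := f.compFn g
  lin := f.compFn_lin g

/-- A natural family of isomorphisms gives an invertible 2-morphism. -/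
def mkIso {X Y : GrFam.{v, w} k} (f g : MHom X Y) (h : f.base = g.base)
    (e : ∀ j (A : ∀ i : {i // f.base i = some j}, (X.C i).carrier),
      (f.fn j).obj A ≅ (g.fn j).obj (fun i => A ⟨i.1, (congrFun h i.1).trans i.2⟩))
    (nat : ∀ j {A B : ∀ i : {i // f.base i = some j}, (X.C i).carrier} (a : A ⟶ B),
      (f.fn j).map a ≫ (e j B).hom =
        (e j A).hom ≫ (g.fn j).map (fun i => a ⟨i.1, (congrFun h i.1).trans i.2⟩)) :
    f ≅ g where
  hom := ⟨h, fun j A => (e j A).hom, fun j _ _ a => nat j a⟩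
  inv := ⟨h.symm, fun j A => (e j fun i => A ⟨i.1, (congrFun h.symm i.1).trans i.2⟩).inv,
    fun j A B a => by
      rw [Iso.comp_inv_eq, Category.assoc, Iso.eq_inv_comp]
      exact (nat j (A := fun i => A ⟨i.1, _⟩) (B := fun i => B ⟨i.1, _⟩) fun i => a ⟨i.1, _⟩).symm⟩
  hom_inv_id := by
    apply MHom₂.ext
    funext j A
    exact (e j A).hom_inv_id
  inv_hom_id := by
    apply MHom₂.ext
    funext j A
    exact (e j _).inv_hom_id


instance : Bicategory (GrFam.{v, w} k) where
  Hom := MHom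
  id := MHom.id
  comp := MHom.comp
  homCategory X Y := inferInstanceAs (Category (MHom X Y))
  whiskerLeft {X Y Z} f g h η :=
    { base_eq := funext fun i => congrArg (Option.bind (f.base i)) η.base_eq
      app l A := η.app l _
      naturality l A B a := η.naturality l _ }
  whiskerRight {X Y Z} f g η h :=
    { base_eq := funext fun i => congrArg (Option.bind · h.base) (congrFun η.base_eq i)
      app l A := (h.fn l).map fun j => η.app j.1 _
      naturality l A B a := by
        refine ((h.fn l).map_comp _ _).symm.trans (Eq.trans ?_ ((h.fn l).map_comp _ _))
        congr 1
        funext j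
        exact η.naturality j.1 _ }
  associator f g h := mkIso _ _ (funext fun i => Option.bind_assoc _ _ _) (fun j A => Iso.refl _)
    fun j A B a => (Category.comp_id _).trans (Category.id_comp _).symm
  leftUnitor f := mkIso _ _ rfl (fun j A => Iso.refl _)
    fun j A B a => (Category.comp_id _).trans (Category.id_comp _).symm
  rightUnitor f := mkIso _ _ (funext fun i => Option.bind_fun_some (f.base i)) (fun j A => Iso.refl _)
    fun j A B a => (Category.comp_id _).trans (Category.id_comp _).symm
  whiskerLeft_id f g := rfl
  whiskerLeft_comp f _ _ _ η θ := rfl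
  id_whiskerLeft η := by
    apply MHom₂.ext; funext j A
    exact ((Category.id_comp _).trans (Category.comp_id _)).symm
  comp_whiskerLeft f g _ _ η := by
    apply MHom₂.ext; funext j A
    exact ((Category.id_comp _).trans (Category.comp_id _)).symm
  id_whiskerRight f g := by
    apply MHom₂.ext; funext j A; exact (g.fn j).map_id _
  comp_whiskerRight η θ i := by
    apply MHom₂.ext; funext j A; exact (i.fn j).map_comp _ _
  whiskerRight_id η := by
    apply MHom₂.ext; funext j A
    exact ((Category.id_comp _).trans (Category.comp_id _)).symm
  whiskerRight_comp η g h := by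
    apply MHom₂.ext; funext j A
    exact ((Category.id_comp _).trans (Category.comp_id _)).symm
  whisker_assoc f _ _ η h := by
    apply MHom₂.ext; funext j A
    exact ((Category.id_comp _).trans (Category.comp_id _)).symm
  whisker_exchange η θ := by
    apply MHom₂.ext; funext j A; exact (θ.naturality j fun l => η.app l.1 _).symm
  pentagon f g h i := by
    apply MHom₂.ext; funext j A
    exact ((congrArg (· ≫ _) ((i.fn j).map_id _)).trans (Category.id_comp _))
  triangle f g := by
    apply MHom₂.ext; funext j A
    exact (Category.id_comp _).trans ((g.fn j).map_id _).symm


section Poly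

/-- `f` is a polynomial map of degree at most `d` between vector spaces: a finite sum of
polynomials of degree at most `d` in linear functionals, with coefficients in `W`. -/
def IsPolyMap (k : Type u) [Field k] {V : Type*} {W : Type*} [AddCommGroup V] [Module k V]
    [AddCommGroup W] [Module k W] (d : ℕ) (f : V → W) : Prop :=
  ∃ (n : ℕ) (p : Fin n → MvPolynomial (Module.Dual k V) k) (b : Fin n → W),
    (∀ a, (p a).totalDegree ≤ d) ∧ ∀ x, f x = ∑ a, (p a).eval (fun l => l x) • b a

theorem IsPolyMap.of_fintype {V W : Type*} [AddCommGroup V] [Module k V]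
    [AddCommGroup W] [Module k W] {d : ℕ} {f : V → W} {α : Type*} [Fintype α]
    (p : α → MvPolynomial (Module.Dual k V) k) (b : α → W) (hp : ∀ a, (p a).totalDegree ≤ d)
    (h : ∀ x, f x = ∑ a, (p a).eval (fun l => l x) • b a) : IsPolyMap k d f := by
  let e := Fintype.equivFin α
  refine ⟨_, p ∘ e.symm, b ∘ e.symm, fun a => hp _, fun x => ?_⟩
  rw [h, ← e.symm.sum_comp]
  rfl

theorem IsPolyMap.comp_linear {V V' W : Type*} [AddCommGroup V] [Module k V] [AddCommGroup V']
    [Module k V'] [AddCommGroup W] [Module k W] {d : ℕ} {f : V → W} (hf : IsPolyMap k d f)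
    (L : V' →ₗ[k] V) : IsPolyMap k d (fun x => f (L x)) := by
  obtain ⟨n, p, b, hp, h⟩ := hf
  refine ⟨n, fun a => (p a).rename fun l => l.comp L, b,
    fun a => ((p a).totalDegree_rename_le _).trans (hp a), fun x => ?_⟩
  refine (h (L x)).trans (Finset.sum_congr rfl fun a _ => ?_)
  rw [MvPolynomial.eval_rename]
  rfl

theorem IsPolyMap.multilinear {ι : Type*} [Fintype ι] {V P : Type*} {W : ι → Type*}
    [AddCommGroup V] [Module k V] [∀ i, AddCommGroup (W i)] [∀ i, Module k (W i)]
    [AddCommGroup P] [Module k P] {d : ι → ℕ} {f : ∀ i, V → W i}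
    (hf : ∀ i, IsPolyMap k (d i) (f i)) (m : MultilinearMap k W P) :
    IsPolyMap k (∑ i, d i) (fun x => m fun i => f i x) := by
  classical
  choose n p b hp h using hf
  refine IsPolyMap.of_fintype (α := ∀ i, Fin (n i)) (fun r => ∏ i, p i (r i))
    (fun r => m fun i => b i (r i)) (fun r => ?_) (fun x => ?_)
  · exact (MvPolynomial.totalDegree_finsetProd _ _).trans (Finset.sum_le_sum fun i _ => hp i _)
  · simp only [h, MultilinearMap.map_sum, MultilinearMap.map_smul_univ, map_prod]

instance piPreadditive {I : Type} (C : I → Type w) [∀ i, Category.{v} (C i)]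
    [∀ i, Preadditive (C i)] : Preadditive (∀ i, C i) where
  homGroup X Y := inferInstanceAs (AddCommGroup (∀ i, X i ⟶ Y i))
  add_comp _ _ _ f g h := funext fun i => Preadditive.add_comp _ _ _ (f i) (g i) (h i)
  comp_add _ _ _ f g h := funext fun i => Preadditive.comp_add _ _ _ (f i) (g i) (h i)

instance piLinear {I : Type} (C : I → Type w) [∀ i, Category.{v} (C i)]
    [∀ i, Preadditive (C i)] [∀ i, Linear k (C i)] : Linear k (∀ i, C i) where
  homModule X Y := inferInstanceAs (Module k (∀ i, X i ⟶ Y i))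
  smul_comp _ _ _ c f g := funext fun i => Linear.smul_comp _ _ _ c (f i) (g i)
  comp_smul _ _ _ f c g := funext fun i => Linear.comp_smul _ _ _ (f i) c (g i)

/-- Sheaves on the finite (discrete) set `S` with values in `𝒜`, that is, families of objects. -/
abbrev Sh (S : Type) (𝒜 : Type w) := S → 𝒜

variable {𝒜 : Type (u + 1)} [Category.{u} 𝒜] [Preadditive 𝒜] [Linear k 𝒜]

/-- Pullback of sheaves. -/
abbrev pull {S T : Type} (a : S → T) : Sh T 𝒜 ⥤ Sh S 𝒜 := Pi.comap (fun _ => 𝒜) a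

/-- `F` is a polynomial functor: its maps on hom spaces are polynomial, of bounded degree. -/
def isPoly (k : Type u) [Field k] (𝒜 : Type (u + 1)) [Category.{u} 𝒜] [Preadditive 𝒜]
    [Linear k 𝒜] : ObjectProperty (𝒜 ⥤ FGModuleCat.{u} k) := fun F =>
  ∃ d : ℕ, ∀ X Y : 𝒜, IsPolyMap k d (fun f : X ⟶ Y => F.map f)

/-- The category of polynomial functors from `𝒜` to finite-dimensional vector spaces. -/
abbrev PolyFun (k : Type u) [Field k] (𝒜 : Type (u + 1)) [Category.{u} 𝒜] [Preadditive 𝒜]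
    [Linear k 𝒜] := (isPoly k 𝒜).FullSubcategory

/-- Homogeneous polynomial functors of degree `d`. -/
def isHomog (k : Type u) [Field k] (𝒜 : Type (u + 1)) [Category.{u} 𝒜] [Preadditive 𝒜]
    [Linear k 𝒜] (d : ℕ) : ObjectProperty (PolyFun k 𝒜) := fun F =>
  ∀ (X Y : 𝒜) (c : k) (f : X ⟶ Y), F.obj.map (c • f) = c ^ d • F.obj.map f

/-- The graded category of polynomial functors. -/
def grPoly (k : Type u) [Field k] (𝒜 : Type (u + 1)) [Category.{u} 𝒜] [Preadditive 𝒜]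
    [Linear k 𝒜] : GrLinCat.{u + 1, u + 1} k where
  carrier := PolyFun k 𝒜
  deg := isHomog k 𝒜

/-- Finite pointed sets, given by the complement `I` of the base point. -/
structure FinPt where
  I : Type
  [fin : Finite I]

attribute [instance] FinPt.fin

instance : Category FinPt where
  Hom X Y := X.I → Option Y.I
  id X := some
  comp f g i := (f i).bind g
  id_comp f := rfl
  comp_id f := funext fun i => Option.bind_fun_some (f i)
  assoc f g h := funext fun i => Option.bind_assoc (f i) g h

/-- Finite families of finite sets. -/
structure FinCop where
  I : Type
  [fin : Finite I]
  S : I → Type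
  [finS : ∀ i, Finite (S i)]

attribute [instance] FinCop.fin FinCop.finS

namespace FinCop

/-- A map of pointed index sets together with a map of sets `X.S i → Y.S j` whenever `i` is sent
to `j`. -/
@[ext]
structure Hom (X Y : FinCop) where
  base : X.I → Option Y.I
  fn (i : X.I) (j : Y.I) (h : base i = some j) : X.S i → Y.S j

theorem get_some {I J L : Type} {φ : I → Option J} {ψ : J → Option L} {l : L} {i : I}
    (h : (φ i).bind ψ = some l) :
    ∃ hs : (φ i).isSome, φ i = some ((φ i).get hs) ∧ ψ ((φ i).get hs) = some l := by
  obtain ⟨j, h1, h2⟩ := Option.bind_eq_some_iff.1 h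
  refine ⟨by rw [h1]; rfl, (Option.some_get _).symm, ?_⟩
  simpa [h1] using h2

def Hom.comp {X Y Z : FinCop} (f : Hom X Y) (g : Hom Y Z) : Hom X Z where
  base i := (f.base i).bind g.base
  fn i l h s := g.fn ((f.base i).get (get_some h).1) l (get_some h).2.2
    (f.fn i _ (get_some h).2.1 s)

theorem Hom.comp_fn {X Y Z : FinCop} (f : Hom X Y) (g : Hom Y Z) {i : X.I} {j : Y.I} {l : Z.I}
    (hij : f.base i = some j) (hjl : g.base j = some l)
    (h : (f.comp g).base i = some l) :
    (f.comp g).fn i l h = g.fn j l hjl ∘ f.fn i j hij := by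
  obtain ⟨hs, h1, h2⟩ := get_some h
  have hj : (f.base i).get hs = j := Option.some.inj (h1.symm.trans hij)
  subst hj
  rfl

def Hom.id (X : FinCop) : Hom X X where
  base := some
  fn i j h := fun s => Option.some.inj h ▸ s

instance : Category FinCop where
  Hom := Hom
  id := Hom.id
  comp := Hom.comp
  id_comp f := rfl
  comp_id {X Y} f := by
    refine Hom.ext (funext fun i => Option.bind_fun_some (f.base i)) ?_
    refine Function.hfunext rfl fun i i' hi => ?_
    obtain rfl := eq_of_heq hi
    refine Function.hfunext rfl fun j j' hj => ?_
    obtain rfl := eq_of_heq hj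
    have e : (f.comp (Hom.id Y)).base i = f.base i := Option.bind_fun_some (f.base i)
    refine Function.hfunext (by rw [e]) fun h h' _ => heq_of_eq ?_
    exact f.comp_fn (Hom.id Y) h' rfl h
  assoc {W X Y Z} f g h := by
    refine Hom.ext (funext fun i => Option.bind_assoc _ _ _) ?_
    refine Function.hfunext rfl fun i i' hi => ?_
    obtain rfl := eq_of_heq hi
    refine Function.hfunext rfl fun l l' hl => ?_
    obtain rfl := eq_of_heq hl
    have e : ((f.comp g).comp h).base i = (f.comp (g.comp h)).base i := Option.bind_assoc _ _ _
    refine Function.hfunext (by rw [e]) fun h1 h2 _ => heq_of_eq ?_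
    obtain ⟨k, hk, hk'⟩ := Option.bind_eq_some_iff.1 h1
    obtain ⟨j, hj, hj'⟩ := Option.bind_eq_some_iff.1 hk
    rw [(f.comp g).comp_fn h hk hk', f.comp_fn g hj hj' hk, f.comp_fn (g.comp h) hj (bind_some hj' hk')]
    exact congrArg (· ∘ f.fn i j hj) (g.comp_fn h hj' hk' (bind_some hj' hk')).symm

/-- The projection to finite pointed sets. -/
def proj : FinCop ⥤ FinPt where
  obj X := ⟨X.I⟩
  map f := f.base

end FinCop

open TensorProduct

-- Tensor products of finite families of vector spaces

/-- The linear map underlying a morphism. -/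
abbrev el {V W : FGModuleCat.{u} k} (f : V ⟶ W) : (V : Type u) →ₗ[k] (W : Type u) := f.hom.hom

/-- The tensor product of a finite family of finite-dimensional vector spaces. -/
def tens {ι : Type} [Finite ι] (V : ι → FGModuleCat.{u} k) : FGModuleCat.{u} k :=
  FGModuleCat.of k (⨂[k] i, (V i : Type u))

section tens

variable {ι : Type} [Finite ι] {V W Z : ι → FGModuleCat.{u} k}

/-- Pure tensors. -/
def tmk (x : ∀ i, (V i : Type u)) : (tens V : Type u) := PiTensorProduct.tprod k x

theorem tens_ext {U : FGModuleCat.{u} k} {f g : tens V ⟶ U}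
    (h : ∀ x : ∀ i, (V i : Type u), el f (tmk x) = el g (tmk x)) : f = g :=
  FGModuleCat.hom_ext (PiTensorProduct.ext (MultilinearMap.ext h))

def tensMap (f : ∀ i, V i ⟶ W i) : tens V ⟶ tens W :=
  FGModuleCat.ofHom (PiTensorProduct.map fun i => el (f i))

theorem tensMap_tmk (f : ∀ i, V i ⟶ W i) (x : ∀ i, (V i : Type u)) :
    el (tensMap f) (tmk x) = tmk fun i => el (f i) (x i) :=
  PiTensorProduct.map_tprod _ _

theorem tensMap_id : tensMap (fun i => 𝟙 (V i)) = 𝟙 (tens V) :=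
  tens_ext fun x => tensMap_tmk _ x

theorem tensMap_comp (f : ∀ i, V i ⟶ W i) (g : ∀ i, W i ⟶ Z i) :
    tensMap (fun i => f i ≫ g i) = tensMap f ≫ tensMap g :=
  tens_ext fun x => (tensMap_tmk _ x).trans
    ((congrArg (el (tensMap g)) (tensMap_tmk f x)).trans (tensMap_tmk g _)).symm

def homEquivLin (V W : FGModuleCat.{u} k) : (V ⟶ W) ≃ₗ[k] (V →ₗ[k] W) where
  toFun f := el f
  invFun f := FGModuleCat.ofHom f
  map_add' _ _ := rfl
  map_smul' _ _ := rfl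

variable (V W) in
def tensMulti : MultilinearMap k (fun i => V i ⟶ W i) (tens V ⟶ tens W) :=
  ((homEquivLin _ _).symm.toLinearMap.compMultilinearMap
    (PiTensorProduct.mapMultilinear k (fun i => (V i : Type u)) (fun i => (W i : Type u)))).compLinearMap
    fun i => (homEquivLin (V i) (W i)).toLinearMap

theorem tensMulti_apply (f : ∀ i, V i ⟶ W i) : tensMulti V W f = tensMap f := rfl

/-- A tensor product with a single factor. -/
def tensSingle [Subsingleton ι] (V : ι → FGModuleCat.{u} k) (i : ι) : tens V ≅ V i :=
  (PiTensorProduct.subsingletonEquiv (R := k) (s := fun i => (V i : Type u)) i).toFGModuleCatIso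

theorem tensSingle_tmk [Subsingleton ι] (i : ι) (x : ∀ i, (V i : Type u)) :
    el (tensSingle V i).hom (tmk x) = x i :=
  PiTensorProduct.subsingletonEquiv_apply_tprod (R := k) (s := fun i => (V i : Type u)) i x

end tens

section nest

variable {I J L : Type} [Finite I] [Finite J] {φ : I → Option J} {ψ : J → Option L} {l : L}

theorem nest_bijective (κ : {i // (φ i).bind ψ = some l} → Type*) :
    Function.Bijective (fun (x : ∀ i, κ i) (j : {j // ψ j = some l}) (i : {i // φ i = some j.1}) =>
      x ⟨i.1, bind_some i.2 j.2⟩) := by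
  constructor
  · intro x y h
    funext i
    obtain ⟨j, hj⟩ := exists_mid i
    exact congrFun (congrFun h j) ⟨i.1, hj⟩
  · intro y
    refine ⟨fun i => y (exists_mid i).choose ⟨i.1, (exists_mid i).choose_spec⟩, ?_⟩
    funext j i
    have : ∀ (j' : {j // ψ j = some l}) (h : φ i.1 = some j'.1),
        y j' ⟨i.1, h⟩ = y j i := by
      intro j' h
      obtain rfl : j' = j := Subtype.ext (Option.some.inj (h.symm.trans i.2))
      rfl
    exact this _ _

def nestMap (M : {i // (φ i).bind ψ = some l} → Type u)
    [∀ i, AddCommGroup (M i)] [∀ i, Module k (M i)] :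
    (⨂[k] i, M i) →ₗ[k]
      ⨂[k] j : {j // ψ j = some l}, ⨂[k] i : {i // φ i = some j.1}, M ⟨i.1, bind_some i.2 j.2⟩ :=
  PiTensorProduct.lift (nestMultilinear (PiTensorProduct.tprod k) fun _ => PiTensorProduct.tprod k)

theorem nestMap_tprod (M : {i // (φ i).bind ψ = some l} → Type u)
    [∀ i, AddCommGroup (M i)] [∀ i, Module k (M i)] (x : ∀ i, M i) :
    nestMap (k := k) M (PiTensorProduct.tprod k x) =
      PiTensorProduct.tprod k fun j : {j // ψ j = some l} =>
        PiTensorProduct.tprod k fun i : {i // φ i = some j.1} => x ⟨i.1, bind_some i.2 j.2⟩ :=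
  PiTensorProduct.lift.tprod _

theorem nestMap_bijective (M : {i // (φ i).bind ψ = some l} → Type u)
    [∀ i, AddCommGroup (M i)] [∀ i, Module k (M i)] :
    Function.Bijective (nestMap (k := k) M) := by
  let b := fun i => Module.Basis.ofVectorSpace k (M i)
  let B := Basis.piTensorProduct b
  let B' := Basis.piTensorProduct fun j : {j // ψ j = some l} =>
    Basis.piTensorProduct fun i : {i // φ i = some j.1} => b ⟨i.1, bind_some i.2 j.2⟩
  let e := B.equiv B' (Equiv.ofBijective _ (nest_bijective (φ := φ) (ψ := ψ) (l := l) _))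
  have : nestMap (k := k) M = e.toLinearMap := by
    refine B.ext fun p => ?_
    rw [LinearEquiv.coe_coe, Module.Basis.equiv_apply, Basis.piTensorProduct_apply, nestMap_tprod,
      Basis.piTensorProduct_apply]
    simp only [Basis.piTensorProduct_apply]
    rfl
  rw [this]
  exact e.bijective

variable (M : {i // (φ i).bind ψ = some l} → FGModuleCat.{u} k)

/-- A tensor product over the fibre of a composite is an iterated tensor product. -/
def tensNest : tens M ≅ tens fun j : {j // ψ j = some l} =>
    tens fun i : {i // φ i = some j.1} => M ⟨i.1, bind_some i.2 j.2⟩ :=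
  (LinearEquiv.ofBijective _ (nestMap_bijective (k := k) fun i => (M i : Type u))).toFGModuleCatIso

theorem tensNest_tmk (x : ∀ i, (M i : Type u)) :
    el (tensNest M).hom (tmk x) = tmk fun j : {j // ψ j = some l} =>
      tmk fun i : {i // φ i = some j.1} => x ⟨i.1, bind_some i.2 j.2⟩ :=
  nestMap_tprod _ x

end nest

def tensCongr {ι : Type} [Finite ι] {V W : ι → FGModuleCat.{u} k} (e : ∀ i, V i ≅ W i) :
    tens V ≅ tens W where
  hom := tensMap fun i => (e i).hom
  inv := tensMap fun i => (e i).inv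
  hom_inv_id := (tensMap_comp _ _).symm.trans
    ((congrArg tensMap (funext fun i => (e i).hom_inv_id)).trans tensMap_id)
  inv_hom_id := (tensMap_comp _ _).symm.trans
    ((congrArg tensMap (funext fun i => (e i).inv_hom_id)).trans tensMap_id)

-- External tensor products of polynomial functors

def extObj {ι : Type} [Finite ι] {S : ι → Type} {T : Type} (a : ∀ i, S i → T)
    (F : ∀ i, PolyFun k (Sh (S i) 𝒜)) : Sh T 𝒜 ⥤ FGModuleCat.{u} k where
  obj V := tens fun i => (F i).obj.obj ((pull (a i)).obj V)
  map g := tensMap fun i => (F i).obj.map ((pull (a i)).map g)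
  map_id V := (congrArg tensMap (funext fun i => (F i).obj.map_id ((pull (a i)).obj V))).trans
    tensMap_id
  map_comp f g := (congrArg tensMap (funext fun i => (F i).obj.map_comp ((pull (a i)).map f)
    ((pull (a i)).map g))).trans (tensMap_comp _ _)

def pullLin {S T : Type} (a : S → T) (V W : Sh T 𝒜) :
    (V ⟶ W) →ₗ[k] ((pull a).obj V ⟶ (pull a).obj W) where
  toFun f := (pull a).map f
  map_add' _ _ := rfl
  map_smul' _ _ := rfl

theorem extObj_isPoly {ι : Type} [Finite ι] {S : ι → Type} {T : Type} (a : ∀ i, S i → T)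
    (F : ∀ i, PolyFun k (Sh (S i) 𝒜)) : isPoly k (Sh T 𝒜) (extObj a F) := by
  have := Fintype.ofFinite ι
  choose d hd using fun i => (F i).property
  refine ⟨∑ i, d i, fun V W => ?_⟩
  exact IsPolyMap.multilinear (fun i => (hd i _ _).comp_linear (pullLin (a i) V W))
    (tensMulti (fun i => (F i).obj.obj ((pull (a i)).obj V))
      (fun i => (F i).obj.obj ((pull (a i)).obj W)))

/-- The functor `(F_i)_i ↦ (V ↦ ⨂_i F_i(a_i^* V))`. -/
def extProd {ι : Type} [Finite ι] {S : ι → Type} {T : Type} (a : ∀ i, S i → T) :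
    (∀ i, PolyFun k (Sh (S i) 𝒜)) ⥤ PolyFun k (Sh T 𝒜) where
  obj F := ⟨extObj a F, extObj_isPoly a F⟩
  map {F F'} α := ObjectProperty.homMk
    { app V := tensMap fun i => (α i).hom.app ((pull (a i)).obj V)
      naturality V W g := (tensMap_comp _ _).symm.trans ((congrArg tensMap (funext fun i =>
        (α i).hom.naturality ((pull (a i)).map g))).trans (tensMap_comp _ _)) }
  map_id F := by
    ext V : 3
    exact tensMap_id
  map_comp α β := by
    ext V : 3
    exact tensMap_comp _ _

theorem ext_lin {ι : Type} [Finite ι] {S : ι → Type} {T : Type} (a : ∀ i, S i → T) :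
    IsMultilinear k (extProd (k := k) (𝒜 := 𝒜) a) := by
  intro F F'
  let L : ∀ V i, (F i ⟶ F' i) →ₗ[k] ((F i).obj.obj ((pull (a i)).obj V) ⟶ (F' i).obj.obj ((pull (a i)).obj V)) :=
    fun V i => { toFun := fun f => f.hom.app _, map_add' := fun _ _ => rfl, map_smul' := fun _ _ => rfl }
  refine ⟨{ toFun := fun α => (extProd a).map α, map_update_add' := ?_, map_update_smul' := ?_ }, fun _ => rfl⟩
  · intro _ m i x y
    ext V : 3
    exact ((tensMulti (fun i => (F i).obj.obj ((pull (a i)).obj V))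
      (fun i => (F' i).obj.obj ((pull (a i)).obj V))).compLinearMap (L V)).map_update_add m i x y
  · intro _ m i x y
    ext V : 3
    exact ((tensMulti (fun i => (F i).obj.obj ((pull (a i)).obj V))
      (fun i => (F' i).obj.obj ((pull (a i)).obj V))).compLinearMap (L V)).map_update_smul m i x y

section nestIso

variable {I J L : Type} [Finite I] [Finite J] {φ : I → Option J} {ψ : J → Option L} {l : L}
  {M : {i // (φ i).bind ψ = some l} → FGModuleCat.{u} k}
  {N : ∀ j : {j // ψ j = some l}, {i // φ i = some j.1} → FGModuleCat.{u} k}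

def nestIso (h : ∀ (j : {j // ψ j = some l}) (i : {i // φ i = some j.1}), M ⟨i.1, bind_some i.2 j.2⟩ ≅ N j i) :
    tens M ≅ tens fun j => tens (N j) :=
  tensNest M ≪≫ tensCongr fun j => tensCongr (h j)

theorem nestIso_tmk (h : ∀ (j : {j // ψ j = some l}) (i : {i // φ i = some j.1}), M ⟨i.1, bind_some i.2 j.2⟩ ≅ N j i) (x : ∀ i, (M i : Type u)) :
    el (nestIso h).hom (tmk x) = tmk fun j : {j // ψ j = some l} => tmk fun i : {i // φ i = some j.1} =>
      el (h j i).hom (x ⟨i.1, bind_some i.2 j.2⟩) :=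
  (congrArg (el (tensCongr fun j => tensCongr (h j)).hom) (tensNest_tmk M x)).trans
    ((tensMap_tmk _ _).trans (congrArg tmk (funext fun _ => tensMap_tmk _ _)))

theorem nestIso_nat {M' : {i // (φ i).bind ψ = some l} → FGModuleCat.{u} k}
    {N' : ∀ j : {j // ψ j = some l}, {i // φ i = some j.1} → FGModuleCat.{u} k}
    (h : ∀ (j : {j // ψ j = some l}) (i : {i // φ i = some j.1}), M ⟨i.1, bind_some i.2 j.2⟩ ≅ N j i)
    (h' : ∀ (j : {j // ψ j = some l}) (i : {i // φ i = some j.1}), M' ⟨i.1, bind_some i.2 j.2⟩ ≅ N' j i)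
    (m : ∀ i, M i ⟶ M' i) (n : ∀ (j : {j // ψ j = some l}) (i : {i // φ i = some j.1}), N j i ⟶ N' j i)
    (e : ∀ (j : {j // ψ j = some l}) (i : {i // φ i = some j.1}), m ⟨i.1, bind_some i.2 j.2⟩ ≫ (h' j i).hom = (h j i).hom ≫ n j i) :
    tensMap m ≫ (nestIso h').hom = (nestIso h).hom ≫ tensMap fun j => tensMap (n j) := by
  refine tens_ext fun x => ?_
  refine (congrArg (el (nestIso h').hom) (tensMap_tmk m x)).trans ((nestIso_tmk h' _).trans ?_)
  refine Eq.trans ?_ ((congrArg (el (tensMap fun j => tensMap (n j))) (nestIso_tmk h x)).trans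
    ((tensMap_tmk _ _).trans (congrArg tmk (funext fun _ => tensMap_tmk _ _)))).symm
  exact congrArg tmk (funext fun j => congrArg tmk (funext fun i =>
    congrArg (fun z => el z (x ⟨i.1, bind_some i.2 j.2⟩)) (e j i)))

end nestIso

def shEq {S T : Type} {a b : S → T} (h : a = b) (V : Sh T 𝒜) : (pull a).obj V ⟶ (pull b).obj V :=
  fun s => eqToHom (congrArg V (congrFun h s))

theorem shEq_nat {S T : Type} {a b : S → T} (h : a = b) {V W : Sh T 𝒜} (g : V ⟶ W) :
    (pull a).map g ≫ shEq h W = shEq h V ≫ (pull b).map g := by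
  subst h
  exact (Category.comp_id ((pull a).map g)).trans (Category.id_comp ((pull a).map g)).symm

def shIso {S T : Type} {a b : S → T} (h : a = b) (V : Sh T 𝒜) :
    (pull a).obj V ≅ (pull b).obj V where
  hom := shEq h V
  inv := shEq h.symm V
  hom_inv_id := funext fun _ => (eqToHom_trans _ _).trans (eqToHom_refl _ _)
  inv_hom_id := funext fun _ => (eqToHom_trans _ _).trans (eqToHom_refl _ _)

/-- A natural family of isomorphisms is an isomorphism of polynomial functors. -/
abbrev polyIso {𝒞 : Type (u + 1)} [Category.{u} 𝒞] [Preadditive 𝒞] [Linear k 𝒞]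
    {F G : PolyFun k 𝒞} (e : ∀ V, F.obj.obj V ≅ G.obj.obj V)
    (nat : ∀ {V W : 𝒞} (g : V ⟶ W),
      F.obj.map g ≫ (e W).hom = (e V).hom ≫ G.obj.map g) : F ≅ G :=
  ObjectProperty.isoMk _ (NatIso.ofComponents e nat)

theorem poly_ext {𝒞 : Type (u + 1)} [Category.{u} 𝒞] [Preadditive 𝒞] [Linear k 𝒞]
    {F G : PolyFun k 𝒞} {α β : F ⟶ G} (h : ∀ V, α.hom.app V = β.hom.app V) : α = β := by
  ext V : 3
  exact h V

section
variable {X Y Z : FinCop} (f : FinCop.Hom X Y) (g : FinCop.Hom Y Z) (l : Z.I)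
  (A : ∀ i : {i // (f.comp g).base i = some l}, PolyFun k (Sh (X.S i) 𝒜))

def compIso :
    (extProd fun i : {i // (f.comp g).base i = some l} => (f.comp g).fn i.1 l i.2).obj A ≅
    (extProd fun j : {j // g.base j = some l} => g.fn j.1 l j.2).obj fun j =>
      (extProd fun i : {i // f.base i = some j.1} => f.fn i.1 j.1 i.2).obj fun i =>
        A ⟨i.1, bind_some i.2 j.2⟩ :=
  polyIso (fun V => nestIso (φ := f.base) (ψ := g.base) (l := l)
      (M := fun i => (A i).obj.obj ((pull ((f.comp g).fn i.1 l i.2)).obj V))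
      fun j i => (A ⟨i.1, bind_some i.2 j.2⟩).obj.mapIso
        (shIso (f.comp_fn g i.2 j.2 (bind_some i.2 j.2)) V))
    fun a => nestIso_nat _ _ _ _ fun j i => by
      refine ((A ⟨i.1, bind_some i.2 j.2⟩).obj.map_comp _ _).symm.trans
        (Eq.trans ?_ ((A ⟨i.1, bind_some i.2 j.2⟩).obj.map_comp _ _))
      exact congrArg (A ⟨i.1, bind_some i.2 j.2⟩).obj.map (shEq_nat (f.comp_fn g i.2 j.2 (bind_some i.2 j.2)) a)

theorem compIso_tmk (V : Sh (Z.S l) 𝒜)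
    (x : ∀ i, ((A i).obj.obj ((pull ((f.comp g).fn i.1 l i.2)).obj V) : Type u)) :
    el ((compIso f g l A).hom.hom.app V) (tmk x) =
      tmk fun j : {j // g.base j = some l} => tmk fun i : {i // f.base i = some j.1} =>
        el ((A ⟨i.1, bind_some i.2 j.2⟩).obj.map
          (shEq (f.comp_fn g i.2 j.2 (bind_some i.2 j.2)) V)) (x ⟨i.1, bind_some i.2 j.2⟩) :=
  nestIso_tmk (φ := f.base) (ψ := g.base) (l := l) _ x

variable {A} in
theorem compIso_nat {B : ∀ i : {i // (f.comp g).base i = some l}, PolyFun k (Sh (X.S i) 𝒜)}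
    (a : A ⟶ B) :
    (extProd fun i : {i // (f.comp g).base i = some l} => (f.comp g).fn i.1 l i.2).map a ≫
      (compIso f g l B).hom = (compIso f g l A).hom ≫
    (extProd fun j : {j // g.base j = some l} => g.fn j.1 l j.2).map fun j =>
    (extProd fun i : {i // f.base i = some j.1} => f.fn i.1 j.1 i.2).map fun i =>
      a ⟨i.1, bind_some i.2 j.2⟩ :=
  poly_ext fun V => nestIso_nat (φ := f.base) (ψ := g.base) (l := l) _ _ _ _ fun j i =>
    ((a ⟨i.1, bind_some i.2 j.2⟩).hom.naturality
      (shEq (f.comp_fn g i.2 j.2 (bind_some i.2 j.2)) V)).symm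

end

variable (k 𝒜) in
/-- The family of categories `P(Sh(S_i))`. -/
abbrev HObj (X : FinCop) : GrFam.{u + 1, u + 1} k := ⟨X.I, fun i => grPoly k (Sh (X.S i) 𝒜)⟩

variable (k 𝒜) in
/-- External tensor product of polynomial functors. -/
abbrev HMap {X Y : FinCop} (f : FinCop.Hom X Y) : HObj k 𝒜 X ⟶ HObj k 𝒜 Y :=
  (⟨f.base, fun j => extProd fun i : {i // f.base i = some j} => f.fn i.1 j i.2,
    fun _ => ext_lin _⟩ : MHom (HObj k 𝒜 X) (HObj k 𝒜 Y))

variable (k 𝒜) in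
def HComp {X Y Z : FinCop} (f : FinCop.Hom X Y) (g : FinCop.Hom Y Z) :
    HMap k 𝒜 (f.comp g) ≅ HMap k 𝒜 f ≫ HMap k 𝒜 g :=
  mkIso (HMap k 𝒜 (f.comp g)) (MHom.comp (HMap k 𝒜 f) (HMap k 𝒜 g)) rfl
    (fun l A => compIso f g l A) fun l _ _ a => compIso_nat f g l a

theorem subsingleton_fibre {I : Type} (j : I) : Subsingleton {i : I // some i = some j} :=
  ⟨fun i i' => Subtype.ext (Option.some.inj (i.2.trans i'.2.symm))⟩

section
variable {X : FinCop} (j : X.I)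
  (A : ∀ i : {i // (FinCop.Hom.id X).base i = some j}, PolyFun k (Sh (X.S i) 𝒜))

def idMap (V : Sh (X.S j) 𝒜) :
    (tens fun i : {i : X.I // some i = some j} =>
      (A i).obj.obj ((pull ((FinCop.Hom.id X).fn i.1 j i.2)).obj V)) ≅ (A ⟨j, rfl⟩).obj.obj V :=
  haveI := subsingleton_fibre j
  tensSingle (fun i : {i : X.I // some i = some j} =>
      (A i).obj.obj ((pull ((FinCop.Hom.id X).fn i.1 j i.2)).obj V)) ⟨j, rfl⟩

theorem idMap_tmk (V : Sh (X.S j) 𝒜)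
    (x : ∀ i, ((A i).obj.obj ((pull ((FinCop.Hom.id X).fn i.1 j i.2)).obj V) : Type u)) :
    el (idMap j A V).hom (tmk x) = x ⟨j, rfl⟩ :=
  haveI := subsingleton_fibre j
  tensSingle_tmk (V := fun i : {i : X.I // some i = some j} =>
      (A i).obj.obj ((pull ((FinCop.Hom.id X).fn i.1 j i.2)).obj V)) ⟨j, rfl⟩ x

def idIso : (extProd fun i : {i // (FinCop.Hom.id X).base i = some j} =>
    (FinCop.Hom.id X).fn i.1 j i.2).obj A ≅ A ⟨j, rfl⟩ :=
  polyIso (idMap j A) fun {V W} a => tens_ext fun x => by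
    refine (congrArg (el (idMap j A W).hom) (tensMap_tmk _ x)).trans ((idMap_tmk j A W _).trans ?_)
    exact (congrArg (el ((A ⟨j, rfl⟩).obj.map a)) (idMap_tmk j A V x)).symm

theorem idIso_nat {A B : ∀ i : {i // (FinCop.Hom.id X).base i = some j}, PolyFun k (Sh (X.S i) 𝒜)}
    (a : A ⟶ B) :
    (extProd fun i : {i // (FinCop.Hom.id X).base i = some j} =>
      (FinCop.Hom.id X).fn i.1 j i.2).map a ≫ (idIso j B).hom = (idIso j A).hom ≫ a ⟨j, rfl⟩ :=
  poly_ext fun V => tens_ext fun x => by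
    refine (congrArg (el (idMap j B V).hom) (tensMap_tmk _ x)).trans ((idMap_tmk j B V _).trans ?_)
    exact (congrArg (el ((a ⟨j, rfl⟩).hom.app V)) (idMap_tmk j A V x)).symm

end

variable (k 𝒜) in
def HId (X : FinCop) : HMap k 𝒜 (FinCop.Hom.id X) ≅ 𝟙 (HObj k 𝒜 X) :=
  mkIso (HMap k 𝒜 (FinCop.Hom.id X)) (MHom.id (HObj k 𝒜 X)) rfl
    (fun j A => idIso j A) fun j _ _ a => idIso_nat j a

/-- The component of a 2-morphism at a family of functors and a sheaf. -/
abbrev ev₂ {X Y : FinCop} {f g : HObj k 𝒜 X ⟶ HObj k 𝒜 Y} (α : f ⟶ g) (j : Y.I)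
    (A : ∀ i : {i // MHom.base f i = some j}, PolyFun k (Sh (X.S i) 𝒜)) (V : Sh (Y.S j) 𝒜) :=
  (MHom₂.app α j A).hom.app V

theorem ev₂_eqToHom {X Y : FinCop} {f g : FinCop.Hom X Y} (p : f = g)
    (p' : HMap k 𝒜 f = HMap k 𝒜 g) (j : Y.I)
    (A : ∀ i : {i // f.base i = some j}, PolyFun k (Sh (X.S i) 𝒜)) (V : Sh (Y.S j) 𝒜)
    (h : ∀ i (h : f.base i = some j) (h' : g.base i = some j), f.fn i j h = g.fn i j h')
    (h' : ∀ {i}, g.base i = some j → f.base i = some j)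
    (x : ∀ i, ((A i).obj.obj ((pull (f.fn i.1 j i.2)).obj V) : Type u)) :
    el (ev₂ (eqToHom p') j A V) (tmk x) =
      tmk fun i : {i // g.base i = some j} =>
        el ((A ⟨i.1, h' i.2⟩).obj.map (shEq (h i.1 (h' i.2) i.2) V)) (x ⟨i.1, h' i.2⟩) := by
  subst p
  refine congrArg tmk (funext fun i => ?_)
  exact (congrArg (fun z => el z (x i)) ((A i).obj.map_id _)).symm

theorem H_left {X Y : FinCop} (f : FinCop.Hom X Y)
    (p : HMap k 𝒜 ((FinCop.Hom.id X).comp f) = HMap k 𝒜 f) :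
    (HComp k 𝒜 (FinCop.Hom.id X) f).hom ≫ (HId k 𝒜 X).hom ▷ HMap k 𝒜 f ≫ (λ_ (HMap k 𝒜 f)).hom =
      eqToHom p := by
  apply MHom₂.ext
  funext j A
  refine poly_ext fun V => tens_ext fun x => ?_
  refine Eq.trans ?_ (ev₂_eqToHom (Category.id_comp (X := X) f) p j A V (fun _ _ _ => rfl)
    (fun h => h) x).symm
  refine Eq.trans (congrArg (el (tensMap _)) (compIso_tmk (FinCop.Hom.id X) f j A V x)) ?_
  refine (tensMap_tmk _ _).trans (congrArg tmk (funext fun i => ?_))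
  exact idMap_tmk _ _ _ _

theorem H_right {X Y : FinCop} (f : FinCop.Hom X Y)
    (p : HMap k 𝒜 (f.comp (FinCop.Hom.id Y)) = HMap k 𝒜 f) :
    (HComp k 𝒜 f (FinCop.Hom.id Y)).hom ≫ HMap k 𝒜 f ◁ (HId k 𝒜 Y).hom ≫ (ρ_ (HMap k 𝒜 f)).hom =
      eqToHom p := by
  apply MHom₂.ext
  funext j A
  refine poly_ext fun V => tens_ext fun x => ?_
  have hb : ∀ {i}, f.base i = some j → (f.comp (FinCop.Hom.id Y)).base i = some j :=
    fun h => bind_some h rfl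
  refine Eq.trans ?_ (ev₂_eqToHom (Category.comp_id (X := X) f) p j A V
    (fun i h h' => FinCop.Hom.comp_fn f _ h' rfl h) hb x).symm
  refine Eq.trans (congrArg (el (idMap j _ V).hom) (compIso_tmk f (FinCop.Hom.id Y) j A V x)) ?_
  exact (idMap_tmk j _ V _)

theorem eqToHom_23 {𝒞 : Type*} [Category* 𝒞] {V V₁ V₂ V₃ W : 𝒞}
    (g₁ : V = V₁) (g₂ : V₁ = W) (h₁ : V = V₂) (h₂ : V₂ = V₃) (h₃ : V₃ = W) :
    eqToHom g₁ ≫ eqToHom g₂ = eqToHom h₁ ≫ eqToHom h₂ ≫ eqToHom h₃ := by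
  simp

theorem map_23 {𝒞 : Type (u + 1)} [Category.{u} 𝒞] (F : 𝒞 ⥤ FGModuleCat.{u} k)
    {V V₁ V₂ V₃ W : 𝒞} {g₁ : V ⟶ V₁} {g₂ : V₁ ⟶ W} {h₁ : V ⟶ V₂} {h₂ : V₂ ⟶ V₃} {h₃ : V₃ ⟶ W}
    (e : g₁ ≫ g₂ = h₁ ≫ h₂ ≫ h₃) (x : (F.obj V : Type u)) :
    el (F.map g₂) (el (F.map g₁) x) = el (F.map h₃) (el (F.map h₂) (el (F.map h₁) x)) := by
  have : F.map g₁ ≫ F.map g₂ = F.map h₁ ≫ F.map h₂ ≫ F.map h₃ := by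
    rw [← F.map_comp, e, F.map_comp, F.map_comp]
  exact congrArg (fun z => el z x) this

theorem H_assoc {W X Y Z : FinCop} (f : FinCop.Hom W X) (g : FinCop.Hom X Y) (h : FinCop.Hom Y Z)
    (p : HMap k 𝒜 ((f.comp g).comp h) = HMap k 𝒜 (f.comp (g.comp h))) :
    (HComp k 𝒜 (f.comp g) h).hom ≫ (HComp k 𝒜 f g).hom ▷ HMap k 𝒜 h ≫
      (α_ (HMap k 𝒜 f) (HMap k 𝒜 g) (HMap k 𝒜 h)).hom =
    eqToHom p ≫ (HComp k 𝒜 f (g.comp h)).hom ≫ HMap k 𝒜 f ◁ (HComp k 𝒜 g h).hom := by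
  apply MHom₂.ext
  funext l A
  refine poly_ext fun V => tens_ext fun x => ?_
  have q : (f.comp g).comp h = f.comp (g.comp h) := Category.assoc (W := W) f g h
  have hb : ∀ {i}, (f.comp (g.comp h)).base i = some l → ((f.comp g).comp h).base i = some l := by
    intro i; rw [q]; exact id
  have hf : ∀ i (h1 : ((f.comp g).comp h).base i = some l)
    (h2 : (f.comp (g.comp h)).base i = some l),
      ((f.comp g).comp h).fn i l h1 = (f.comp (g.comp h)).fn i l h2 := by
    rw [q]; exact fun _ _ _ => rfl
  refine Eq.trans (congrArg (el (tensMap _)) (compIso_tmk (f.comp g) h l A V x)) ?_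
  refine (tensMap_tmk _ _).trans ?_
  let A' : ∀ i : {i // (f.comp (g.comp h)).base i = some l}, PolyFun k (Sh (W.S i) 𝒜) :=
    fun i => A ⟨i.1, hb i.2⟩
  let A'' : ∀ j : {j // (g.comp h).base j = some l}, PolyFun k (Sh (X.S j) 𝒜) := fun j =>
    (extProd fun i : {i // f.base i = some j.1} => f.fn i.1 j.1 i.2).obj fun i =>
      A' ⟨i.1, bind_some i.2 j.2⟩
  let x' : ∀ i, ((A' i).obj.obj ((pull ((f.comp (g.comp h)).fn i.1 l i.2)).obj V) : Type u) :=
    fun i => el ((A' i).obj.map (shEq (hf i.1 (hb i.2) i.2) V)) (x ⟨i.1, hb i.2⟩)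
  let x'' : ∀ j, ((A'' j).obj.obj ((pull ((g.comp h).fn j.1 l j.2)).obj V) : Type u) :=
    fun j => tmk fun i : {i // f.base i = some j.1} =>
      el ((A' ⟨i.1, bind_some i.2 j.2⟩).obj.map
        (shEq (f.comp_fn (g.comp h) i.2 j.2 (bind_some i.2 j.2)) V)) (x' ⟨i.1, bind_some i.2 j.2⟩)
  have e1 : el (ev₂ (eqToHom p) l A V) (tmk x) = tmk x' :=
    ev₂_eqToHom q p l A V hf hb x
  have e2 : el ((compIso f (g.comp h) l A').hom.hom.app V) (tmk x') = tmk x'' :=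
    compIso_tmk f (g.comp h) l A' V x'
  have e3 := compIso_tmk g h l A'' V x''
  refine Eq.trans ?_ (congrArg (el ((compIso g h l A'').hom.hom.app V))
    ((congrArg (el ((compIso f (g.comp h) l A').hom.hom.app V)) e1).trans e2)).symm
  refine Eq.trans ?_ e3.symm
  refine congrArg tmk (funext fun m => ?_)
  refine Eq.trans (compIso_tmk f g m.1 _ _ _) ?_
  refine congrArg tmk (funext fun j => ?_)
  refine Eq.trans ?_ (tensMap_tmk _ _).symm
  refine congrArg tmk (funext fun i => ?_)
  refine map_23 (A ⟨i.1, bind_some (bind_some i.2 j.2) m.2⟩).obj ?_ _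
  exact funext fun s => eqToHom_23 _ _ _ _
    (congrArg V (congrFun (g.comp_fn h j.2 m.2 (bind_some j.2 m.2)) (f.fn i.1 j.1 i.2 s)))

theorem iso_aux {𝒞 : Type*} [Category* 𝒞] {X₁ X₂ X₃ X₄ X₅ X₆ : 𝒞} {a : X₁ ⟶ X₂} {b : X₂ ⟶ X₃}
    {c : X₃ ⟶ X₄} {e : X₁ ⟶ X₅} {d₁ : X₅ ≅ X₆} {d₂ : X₆ ≅ X₄}
    (h : a ≫ b ≫ c = e ≫ d₁.hom ≫ d₂.hom) : a ≫ b ≫ c ≫ d₂.inv ≫ d₁.inv = e := by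
  have := h =≫ (d₂.inv ≫ d₁.inv)
  simpa using this

variable (k 𝒜) in
/-- The pseudofunctor `(S_i)_i ↦ (P(Sh(S_i)))_i`. -/
def H : Pseudofunctor (LocallyDiscrete FinCop) (GrFam.{u + 1, u + 1} k) :=
  pseudofunctorOfIsLocallyDiscrete (fun X => HObj k 𝒜 X.as) (fun f => HMap k 𝒜 f.as)
    (fun X => HId k 𝒜 X.as) (fun f g => HComp k 𝒜 f.as g.as)
    (fun f g h => iso_aux (d₁ := HComp k 𝒜 f.as (g.as.comp h.as))
      (d₂ := whiskerLeftIso (HMap k 𝒜 f.as) (HComp k 𝒜 g.as h.as)) (H_assoc f.as g.as h.as _))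
    (fun f => H_left f.as _) (fun f => H_right f.as _)

section pre
variable {ℬ : Type (u + 1)} [Category.{u} ℬ] [Preadditive ℬ] [Linear k ℬ]

/-- Precomposition of polynomial functors with a linear functor. -/
def precomp (L : 𝒜 ⥤ ℬ) [L.Additive] [L.Linear k] : PolyFun k ℬ ⥤ PolyFun k 𝒜 where
  obj F := ⟨L ⋙ F.obj, by
    obtain ⟨d, hd⟩ := F.property
    exact ⟨d, fun X Y => (hd _ _).comp_linear (L.mapLinearMap k)⟩⟩
  map α := ObjectProperty.homMk (Functor.whiskerLeft L α.hom)
  map_id _ := rfl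
  map_comp _ _ := rfl

end pre

/-- The product with a fixed set `T`. -/
abbrev timesObj (X : FinCop) (T : Type) [Finite T] : FinCop := ⟨X.I, fun i => X.S i × T⟩

abbrev timesMap {X Y : FinCop} (f : FinCop.Hom X Y) (T : Type) [Finite T] :
    FinCop.Hom (timesObj X T) (timesObj Y T) :=
  ⟨f.base, fun i j h s => (f.fn i j h s.1, s.2)⟩

theorem timesMap_id (X : FinCop) (T : Type) [Finite T] :
    timesMap (FinCop.Hom.id X) T = FinCop.Hom.id (timesObj X T) := by
  refine FinCop.Hom.ext rfl (heq_of_eq ?_)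
  funext i j h s
  obtain rfl : i = j := Option.some.inj h
  rfl

def timesFun (T : Type) [Finite T] : FinCop ⥤ FinCop where
  obj X := timesObj X T
  map f := timesMap f T
  map_id X := timesMap_id X T
  map_comp _ _ := rfl

variable (k) in
/-- The pseudofunctor `(S_i)_i ↦ (P(Sh(S_i × T)))_i`. -/
def HTimes (T : Type) [Finite T] : Pseudofunctor (LocallyDiscrete FinCop) (GrFam.{u + 1, u + 1} k) :=
  (timesFun T).toPseudofunctor.comp (H k (FGModuleCat.{u} k))

variable {G : Type u} [Group G] {Irr : Type} (ρ : Irr → FDRep k G)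

/-- The functor `V ↦ ((s, r) ↦ Hom(ρ_r, V_s))`. -/
def homSh (S : Type) : Sh S (FDRep k G) ⥤ Sh (S × Irr) (FGModuleCat.{u} k) where
  obj V p := FGModuleCat.of k (ρ p.2 ⟶ V p.1)
  map g p := FGModuleCat.ofHom (Linear.rightComp k (ρ p.2) (g p.1))
  map_id V := by
    funext p
    refine FGModuleCat.hom_ext (LinearMap.ext fun (x : ρ p.2 ⟶ V p.1) => ?_)
    exact Category.comp_id x
  map_comp {U V W} f g := by
    funext p
    refine FGModuleCat.hom_ext (LinearMap.ext fun (x : ρ p.2 ⟶ U p.1) => ?_)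
    exact (Category.assoc x (f p.1) (g p.1)).symm

instance (S : Type) : (homSh ρ S).Additive where
  map_add {V W f g} := by
    funext p
    refine FGModuleCat.hom_ext (LinearMap.ext fun (x : ρ p.2 ⟶ V p.1) => ?_)
    exact Preadditive.comp_add _ _ _ x (f p.1) (g p.1)

instance (S : Type) : (homSh ρ S).Linear k where
  map_smul {V W} f c := by
    funext p
    refine FGModuleCat.hom_ext (LinearMap.ext fun (x : ρ p.2 ⟶ V p.1) => ?_)
    exact Linear.comp_smul _ _ _ x c (f p.1)

section
variable [Finite Irr]

/-- Precomposition with `homSh`, in the shape of a component of a 1-morphism. -/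
def YFn (X : FinCop) (j : X.I) :
    (∀ i : {i : X.I // some i = some j}, PolyFun k (Sh (X.S i × Irr) (FGModuleCat.{u} k))) ⥤
      PolyFun k (Sh (X.S j) (FDRep k G)) :=
  Pi.eval (fun i : {i : X.I // some i = some j} => PolyFun k (Sh (X.S i × Irr) (FGModuleCat.{u} k)))
    ⟨j, rfl⟩ ⋙ precomp (homSh ρ (X.S j))

theorem YFn_lin (X : FinCop) (j : X.I) : IsMultilinear k (YFn ρ X j) := by
  intro A B
  obtain ⟨m, hm⟩ := (MHom.id (HObj k (FGModuleCat.{u} k) (timesObj X Irr))).lin j A B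
  let L : (A ⟨j, rfl⟩ ⟶ B ⟨j, rfl⟩) →ₗ[k] ((precomp (homSh ρ (X.S j))).obj (A ⟨j, rfl⟩) ⟶
      (precomp (homSh ρ (X.S j))).obj (B ⟨j, rfl⟩)) :=
    { toFun := fun α => (precomp (homSh ρ (X.S j))).map α
      map_add' := fun _ _ => rfl
      map_smul' := fun _ _ => rfl }
  exact ⟨L.compMultilinearMap m, fun f => congrArg L (hm f)⟩

/-- Precomposition with the functors `homSh ρ (X.S i)`, from `(P(Sh(S_i × Irr)))_i` to
`(P(Sh_G(S_i)))_i`. -/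
def YMap (X : FinCop) : HObj k (FGModuleCat.{u} k) (timesObj X Irr) ⟶ HObj k (FDRep k G) X :=
  (⟨some, YFn ρ X, YFn_lin ρ X⟩ :
    MHom (HObj k (FGModuleCat.{u} k) (timesObj X Irr)) (HObj k (FDRep k G) X))

theorem homSh_shEq {S T : Type} {a b : S → T} (h : a = b)
    (h' : (fun s : S × Irr => (a s.1, s.2)) = fun s => (b s.1, s.2)) (V : Sh T (FDRep k G)) :
    shEq h' ((homSh ρ T).obj V) = (homSh ρ S).map (shEq h V) := by
  subst h
  exact ((homSh ρ S).map_id ((pull a).obj V)).symm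

theorem HTimes_mapComp {X Y Z : LocallyDiscrete FinCop} (f : X ⟶ Y) (g : Y ⟶ Z) :
    ((HTimes k Irr).mapComp f g).hom =
      (HComp k (FGModuleCat.{u} k) (timesMap f.as Irr) (timesMap g.as Irr)).hom :=
  Category.id_comp _

section
variable {ι : Type} [Finite ι] {S : ι → Type} {T : Type} (a : ∀ i, S i → T)
  (A : ∀ i, PolyFun k (Sh (S i × Irr) (FGModuleCat.{u} k)))

def preIso : (precomp (homSh ρ T)).obj ((extProd fun i (s : S i × Irr) => (a i s.1, s.2)).obj A) ≅
    (extProd a).obj fun i => (precomp (homSh ρ (S i))).obj (A i) :=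
  polyIso (fun V => Iso.refl (tens fun i => (A i).obj.obj ((homSh ρ (S i)).obj ((pull (a i)).obj V))))
    fun _ => (Category.comp_id _).trans (Category.id_comp _).symm

theorem preIso_tmk (V : Sh T (FDRep k G))
    (x : ∀ i, ((A i).obj.obj ((homSh ρ (S i)).obj ((pull (a i)).obj V)) : Type u)) :
    el ((preIso ρ a A).hom.hom.app V) (tmk x) = tmk x := rfl

variable {A} in
theorem preIso_nat {B : ∀ i, PolyFun k (Sh (S i × Irr) (FGModuleCat.{u} k))} (α : A ⟶ B) :
    (precomp (homSh ρ T)).map ((extProd fun i (s : S i × Irr) => (a i s.1, s.2)).map α) ≫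
      (preIso ρ a B).hom =
    (preIso ρ a A).hom ≫ (extProd a).map fun i => (precomp (homSh ρ (S i))).map (α i) :=
  poly_ext fun V => (Category.comp_id _).trans (Category.id_comp _).symm

end

def YNat {X Z : FinCop} (f : FinCop.Hom X Z) :
    HMap k (FGModuleCat.{u} k) (timesMap f Irr) ≫ YMap ρ Z ≅
      YMap ρ X ≫ HMap k (FDRep k G) f :=
  mkIso (MHom.comp (HMap k (FGModuleCat.{u} k) (timesMap f Irr)) (YMap ρ Z))
    (MHom.comp (YMap ρ X) (HMap k (FDRep k G) f)) (funext fun i => Option.bind_fun_some (f.base i))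
    (fun j A => preIso ρ (fun i : {i // f.base i = some j} => f.fn i.1 j i.2)
      fun i => A ⟨i.1, bind_some i.2 rfl⟩)
    fun j _ _ α => preIso_nat ρ (fun i : {i // f.base i = some j} => f.fn i.1 j i.2)
      fun i => α ⟨i.1, bind_some i.2 rfl⟩

theorem preIso_comp {X Y Z : FinCop} (f : FinCop.Hom X Y) (g : FinCop.Hom Y Z) (l : Z.I)
    (A : ∀ i : {i // (f.comp g).base i = some l},
      PolyFun k (Sh (X.S i × Irr) (FGModuleCat.{u} k))) :
    (preIso ρ (fun i : {i // (f.comp g).base i = some l} => (f.comp g).fn i.1 l i.2) A).hom ≫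
      (compIso f g l fun i => (precomp (homSh ρ (X.S i))).obj (A i)).hom =
    (precomp (homSh ρ (Z.S l))).map (compIso (timesMap f Irr) (timesMap g Irr) l A).hom ≫
      (preIso ρ (fun j : {j // g.base j = some l} => g.fn j.1 l j.2) fun j =>
        (extProd fun i : {i // f.base i = some j.1} => (timesMap f Irr).fn i.1 j.1 i.2).obj fun i =>
          A ⟨i.1, bind_some i.2 j.2⟩).hom ≫
      (extProd fun j : {j // g.base j = some l} => g.fn j.1 l j.2).map fun j =>
        (preIso ρ (fun i : {i // f.base i = some j.1} => f.fn i.1 j.1 i.2) fun i =>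
          A ⟨i.1, bind_some i.2 j.2⟩).hom := by
  refine poly_ext fun V => tens_ext fun x => ?_
  have h1 := compIso_tmk f g l (fun i => (precomp (homSh ρ (X.S i))).obj (A i)) V x
  have h2 := compIso_tmk (timesMap f Irr) (timesMap g Irr) l A ((homSh ρ (Z.S l)).obj V) x
  refine Eq.trans h1 (Eq.symm ((congrArg (el (tensMap _)) h2).trans ?_))
  refine (tensMap_tmk _ _).trans ?_
  refine congrArg tmk (funext fun j => congrArg tmk (funext fun i => ?_))
  exact congrArg (fun z => el ((A ⟨i.1, bind_some i.2 j.2⟩).obj.map z)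
    (x ⟨i.1, bind_some i.2 j.2⟩))
    (homSh_shEq ρ (f.comp_fn g i.2 j.2 (bind_some i.2 j.2))
      ((timesMap f Irr).comp_fn (timesMap g Irr) i.2 j.2 (bind_some i.2 j.2)) V)

theorem six_ids {𝒞 : Type*} [Category* 𝒞] {a b c d e : 𝒞} {p : a ⟶ b} {q : b ⟶ c}
    {r : a ⟶ d} {s : d ⟶ e} {t : e ⟶ c} (h : p ≫ q = r ≫ s ≫ t) :
    p ≫ q = r ≫ 𝟙 _ ≫ s ≫ 𝟙 _ ≫ t ≫ 𝟙 _ := by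
  simpa using h

theorem YNat_comp {X Y Z : FinCop} (f : FinCop.Hom X Y) (g : FinCop.Hom Y Z) :
    (YNat ρ (f.comp g)).hom ≫ YMap ρ X ◁ (HComp k (FDRep k G) f g).hom =
      (HComp k (FGModuleCat.{u} k) (timesMap f Irr) (timesMap g Irr)).hom ▷ YMap ρ Z ≫
        (α_ _ _ _).hom ≫ HMap k (FGModuleCat.{u} k) (timesMap f Irr) ◁ (YNat ρ g).hom ≫
        (α_ _ _ _).inv ≫ (YNat ρ f).hom ▷ HMap k (FDRep k G) g ≫ (α_ _ _ _).hom := by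
  apply MHom₂.ext
  funext l A
  exact six_ids (preIso_comp ρ f g l fun i => A ⟨i.1, bind_some i.2 rfl⟩)

theorem shEq_self {S T : Type} (a : S → T) (h : a = a) (F : Sh S 𝒜 ⥤ FGModuleCat.{u} k)
    (V : Sh T 𝒜) (x : (F.obj ((pull a).obj V) : Type u)) : el (F.map (shEq h V)) x = x :=
  congrArg (fun z => el z x) (F.map_id _)

/-- `θ` acts on pure tensors by the canonical identifications. -/
def IsCanonical {X Y : FinCop} (f g : FinCop.Hom X Y) (θ : HMap k 𝒜 f ⟶ HMap k 𝒜 g) : Prop :=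
  ∀ (j : Y.I) (A : ∀ i : {i // f.base i = some j}, PolyFun k (Sh (X.S i) 𝒜)) (V : Sh (Y.S j) 𝒜)
    (h : ∀ i (h : f.base i = some j) (h' : g.base i = some j), f.fn i j h = g.fn i j h')
    (h' : ∀ {i}, g.base i = some j → f.base i = some j)
    (x : ∀ i, ((A i).obj.obj ((pull (f.fn i.1 j i.2)).obj V) : Type u)),
    el (ev₂ θ j A V) (tmk x) =
      tmk fun i : {i // g.base i = some j} =>
        el ((A ⟨i.1, h' i.2⟩).obj.map (shEq (h i.1 (h' i.2) i.2) V)) (x ⟨i.1, h' i.2⟩)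

theorem isCanonical_eqToHom {X Y : FinCop} {f g : FinCop.Hom X Y} (p : f = g)
    (p' : HMap k 𝒜 f = HMap k 𝒜 g) : IsCanonical f g (eqToHom p') :=
  fun j A V h h' x => ev₂_eqToHom p p' j A V h h' x

theorem YNat_id' (X : FinCop)
    (θ : HMap k (FGModuleCat.{u} k) (timesMap (FinCop.Hom.id X) Irr) ⟶
      HMap k (FGModuleCat.{u} k) (FinCop.Hom.id (timesObj X Irr))) (hθ : IsCanonical (timesMap (FinCop.Hom.id X) Irr) (FinCop.Hom.id (timesObj X Irr)) θ) :
    (YNat ρ (FinCop.Hom.id X)).hom ≫ YMap ρ X ◁ (HId k (FDRep k G) X).hom =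
      (θ ≫ (HId k (FGModuleCat.{u} k) (timesObj X Irr)).hom) ▷ YMap ρ X ≫
        (λ_ (YMap ρ X)).hom ≫ (ρ_ (YMap ρ X)).inv := by
  apply MHom₂.ext
  funext l A
  refine poly_ext fun V => tens_ext fun x => ?_
  let A₀ : ∀ i : {i // (FinCop.Hom.id (timesObj X Irr)).base i = some l},
      PolyFun k (Sh (X.S i × Irr) (FGModuleCat.{u} k)) := fun i => A ⟨i.1, bind_some i.2 rfl⟩
  let A' : ∀ i : {i // (FinCop.Hom.id X).base i = some l}, PolyFun k (Sh (X.S i) (FDRep k G)) :=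
    fun i => (precomp (homSh ρ (X.S i))).obj (A₀ i)
  refine Eq.trans (idMap_tmk l A' V fun i => x ⟨i.1, i.2⟩) ?_
  have e := hθ l A₀ ((homSh ρ (X.S l)).obj V)
    (fun i h _ => by obtain rfl : i = l := Option.some.inj h; rfl) (fun h => h)
    (fun i => x ⟨i.1, i.2⟩)
  refine Eq.trans ?_ (congrArg (el (idMap (X := timesObj X Irr) l A₀ ((homSh ρ (X.S l)).obj V)).hom) e).symm
  refine Eq.trans ?_ (idMap_tmk (X := timesObj X Irr) l A₀ _ _).symm
  exact (shEq_self (id : X.S l × Irr → X.S l × Irr) rfl (A₀ ⟨l, rfl⟩).obj _ (x ⟨l, rfl⟩)).symm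

theorem YNat_id (X : LocallyDiscrete FinCop) :
    (YNat ρ (FinCop.Hom.id X.as)).hom ≫ YMap ρ X.as ◁ (HId k (FDRep k G) X.as).hom =
      ((HTimes k Irr).mapId X).hom ▷ YMap ρ X.as ≫
        (λ_ (YMap ρ X.as)).hom ≫ (ρ_ (YMap ρ X.as)).inv :=
  YNat_id' ρ X.as (eqToHom (congrArg (HMap k (FGModuleCat.{u} k)) (timesMap_id X.as Irr)))
    (isCanonical_eqToHom (timesMap_id X.as Irr) _)

/-- The transformation given by precomposition with the functors `homSh ρ S`. -/
def Ystar : Pseudofunctor.StrongTrans (HTimes k Irr) (H k (FDRep k G)) where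
  app X := YMap ρ X.as
  naturality f := YNat ρ f.as
  naturality_naturality {X Y f g} η := by
    obtain rfl := obj_ext_of_isDiscrete η
    obtain rfl : η = 𝟙 _ := Subsingleton.elim _ _
    exact (congrArg (· ≫ (YNat ρ f.as).hom) (id_whiskerRight _ _)).trans
      ((Category.id_comp _).trans ((Category.comp_id _).symm.trans
        (congrArg ((YNat ρ f.as).hom ≫ ·) (whiskerLeft_id _ _).symm)))
  naturality_id X := YNat_id ρ X
  naturality_comp f g := by
    rw [HTimes_mapComp]
    exact YNat_comp ρ f.as g.as

end

theorem IsPolyMap.bilinear {V W₁ W₂ P : Type*} [AddCommGroup V] [Module k V] [AddCommGroup W₁]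
    [Module k W₁] [AddCommGroup W₂] [Module k W₂] [AddCommGroup P] [Module k P] {d e : ℕ}
    {f : V → W₁} {g : V → W₂} (hf : IsPolyMap k d f) (hg : IsPolyMap k e g)
    (B : W₁ →ₗ[k] W₂ →ₗ[k] P) : IsPolyMap k (d + e) (fun x => B (f x) (g x)) := by
  obtain ⟨n, p, b, hp, h⟩ := hf
  obtain ⟨n', p', b', hp', h'⟩ := hg
  refine IsPolyMap.of_fintype (α := Fin n × Fin n') (fun r => p r.1 * p' r.2)
    (fun r => B (b r.1) (b' r.2)) (fun r => ?_) (fun x => ?_)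
  · exact (MvPolynomial.totalDegree_mul _ _).trans (add_le_add (hp _) (hp' _))
  · simp only [h, h', map_sum, map_smul, LinearMap.sum_apply, LinearMap.smul_apply,
      Fintype.sum_prod_type, Finset.smul_sum, smul_smul, map_mul]
    rw [Finset.sum_comm]
    exact Finset.sum_congr rfl fun a _ => Finset.sum_congr rfl fun c _ => by rw [mul_comm]

instance : (isPoly k 𝒜).IsMonoidal where
  prop_unit := ⟨0, fun X Y => ⟨1, fun _ => 1, fun _ => 𝟙 _, fun _ => by simp, fun f => by simp⟩⟩
  prop_tensor F G hF hG := by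
    obtain ⟨d, hd⟩ := hF
    obtain ⟨e, he⟩ := hG
    refine ⟨d + e, fun X Y => ?_⟩
    let B : (F.obj X ⟶ F.obj Y) →ₗ[k] (G.obj X ⟶ G.obj Y) →ₗ[k]
        (MonoidalCategory.tensorObj (F.obj X) (G.obj X) ⟶ MonoidalCategory.tensorObj (F.obj Y) (G.obj Y)) :=
      LinearMap.mk₂ k (fun f g => MonoidalCategory.tensorHom f g) (fun _ _ _ => MonoidalPreadditive.add_tensor _ _ _)
        (fun c f g => by
          rw [MonoidalCategory.tensorHom_def, MonoidalCategory.tensorHom_def, CategoryTheory.MonoidalLinear.smul_whiskerRight, Linear.smul_comp])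
        (fun _ _ _ => MonoidalPreadditive.tensor_add _ _ _)
        (fun c f g => by
          rw [MonoidalCategory.tensorHom_def, MonoidalCategory.tensorHom_def, CategoryTheory.MonoidalLinear.whiskerLeft_smul, Linear.comp_smul])
    exact (hd X Y).bilinear (he X Y) B



-- Graded 2-vector spaces

/-- The degree `d` part of a graded category. -/
abbrev GrLinCat.part (C : GrLinCat.{v, w} k) (d : ℕ) := (C.deg d).FullSubcategory

/-- A graded 2-vector space: each degree is a semisimple category with finitely many simple
objects, equivalent to a finite sum of copies of the category of finite-dimensional vector spaces,
and the category is the direct sum of its degrees. -/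
structure IsGradedTwoVect (C : GrLinCat.{v, w} k) : Prop where
  closed (d : ℕ) : (C.deg d).IsClosedUnderIsomorphisms
  part (d : ℕ) : ∃ (n : ℕ) (e : C.part d ≌ (Fin n → FGModuleCat.{u} k)) (_ : e.functor.Additive),
    e.functor.Linear k
  hom_eq_zero {d e : ℕ} (h : d ≠ e) {X Y : C.carrier} (hX : C.deg d X) (hY : C.deg e Y)
    (f : X ⟶ Y) : f = 0
  hasFiniteBiproducts : HasFiniteBiproducts C.carrier
  decomp (X : C.carrier) : ∃ (n : ℕ) (d : Fin n → ℕ) (Y : Fin n → C.carrier) (b : Bicone Y),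
    (∀ a, C.deg (d a) (Y a)) ∧ Nonempty b.IsBilimit ∧ Nonempty (b.pt ≅ X)

/-- A functor of several variables which shifts the total degree by the integer `r`. -/
def IsHomogeneousOfDegree {I : Type} (C : I → GrLinCat.{v, w} k) (D : GrLinCat.{v, w} k) (r : ℤ)
    (W : (∀ i, (C i).carrier) ⥤ D.carrier) : Prop :=
  ∀ (d : I → ℕ) (X : ∀ i, (C i).carrier), (∀ i, (C i).deg (d i) (X i)) →
    (∃ e : ℕ, (e : ℤ) = (∑ᶠ i, (d i : ℤ)) + r ∧ D.deg e (W.obj X)) ∨ IsZero (W.obj X)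

/-- Each component is a finite direct sum of homogeneous multilinear functors. -/
def IsBounded {X Y : GrFam.{v, w} k} (f : X ⟶ Y) : Prop :=
  ∀ j : Y.I, ∃ (n : ℕ) (r : Fin n → ℤ)
    (W : Fin n → ((∀ i : {i // MHom.base f i = some j}, (X.C i).carrier) ⥤ (Y.C j).carrier))
    (b : Bicone W),
    (∀ a, IsMultilinear k (W a) ∧
      IsHomogeneousOfDegree (fun i : {i // MHom.base f i = some j} => X.C i) (Y.C j) (r a) (W a)) ∧
    Nonempty b.IsBilimit ∧ Nonempty (b.pt ≅ MHom.fn f j)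

/-- Each component preserves the total degree. -/
def IsDegreeZero {X Y : GrFam.{v, w} k} (f : X ⟶ Y) : Prop :=
  ∀ (j : Y.I) (d : {i // MHom.base f i = some j} → ℕ)
    (A : ∀ i : {i // MHom.base f i = some j}, (X.C i).carrier),
    (∀ i : {i // MHom.base f i = some j}, (X.C i.1).deg (d i) (A i)) → (Y.C j).deg (∑ᶠ i, d i) ((MHom.fn f j).obj A)

/-- The universal property of a coCartesian arrow over finite pointed sets: precomposition with `u`
is an equivalence from the category of arrows `Y ⟶ Z` over `g` to that of arrows `X ⟶ Z` over the
composite of `g` with the arrow underlying `u`. -/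
structure IsCoCartesian {X Y : GrFam.{v, w} k} (u : X ⟶ Y) : Prop where
  fullyFaithful {Z : GrFam.{v, w} k} (_ : ∀ l, IsGradedTwoVect (Z.C l)) (f g : Y ⟶ Z)
    (_ : IsBounded f) (_ : IsBounded g) (_ : MHom.base f = MHom.base g) :
    Function.Bijective (fun η : f ⟶ g => u ◁ η)
  essSurj {Z : GrFam.{v, w} k} (_ : ∀ l, IsGradedTwoVect (Z.C l)) (g : Y.I → Option Z.I)
    (f : X ⟶ Z) (_ : IsBounded f) (_ : MHom.base f = fun i => (MHom.base u i).bind g) :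
    ∃ f' : Y ⟶ Z, IsBounded f' ∧ MHom.base f' = g ∧ Nonempty (u ≫ f' ≅ f)

-- Symmetric self-adjoint Hopf structures

/-- The one-term family consisting of `S`. -/
abbrev FinCop.single (S : Type) [Finite S] : FinCop := ⟨Unit, fun _ => S⟩

/-- A map of finite sets, in the fibre over the one-element family. -/
abbrev FinCop.singleMap {S T : Type} [Finite S] [Finite T] (a : S → T) : single S ⟶ single T :=
  (⟨some, fun _ _ _ => a⟩ : FinCop.Hom (single S) (single T))

/-- The right Beck-Chevalley condition for the image of a commutative square. -/
def BeckChevalley (F : Pseudofunctor (LocallyDiscrete FinCop) (GrFam.{v, w} k))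
    {S T R U : LocallyDiscrete FinCop} {a : S ⟶ T} {c : S ⟶ R} {b : T ⟶ U} {d : R ⟶ U}
    (sq : CommSq a c b d) : Prop :=
  ∃ (rc : F.obj R ⟶ F.obj S) (rb : F.obj U ⟶ F.obj T)
    (adj₁ : Bicategory.Adjunction (F.map c) rc) (adj₂ : Bicategory.Adjunction (F.map b) rb),
    IsBounded rc ∧ IsBounded rb ∧
      IsIso (mateEquiv adj₁ adj₂ (F.isoMapOfCommSq sq).hom)

/-- `F` is a symmetric self-adjoint Hopf structure: a morphism over finite pointed sets from
families of finite sets to families of graded 2-vector spaces. -/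
structure IsSSH (F : Pseudofunctor (LocallyDiscrete FinCop) (GrFam.{v, w} k)) : Prop where
  index_obj (X : FinCop) : (F.obj ⟨X⟩).I = X.I
  index_map {X Y : FinCop} (f : X ⟶ Y) (i : X.I) :
    MHom.base (F.map f.toLoc) (cast (index_obj X).symm i) =
      (FinCop.Hom.base f i).map (cast (index_obj Y).symm)
  gradedTwoVect (X : FinCop) (i : (F.obj ⟨X⟩).I) : IsGradedTwoVect ((F.obj ⟨X⟩).C i)
  degreeZero {X Y : FinCop} (f : X ⟶ Y) : IsDegreeZero (F.map f.toLoc)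
  coCartesian {X Y : FinCop} (f : X ⟶ Y)
    (_ : FinCop.proj.IsStronglyCocartesian (FinCop.proj.map f) f) : IsCoCartesian (F.map f.toLoc)
  beckChevalley {S T R U : Type} [Finite S] [Finite T] [Finite R] [Finite U] {a : S → T}
    {c : S → R} {b : T → U} {d : R → U} (_ : IsPullback (C := Type) (↾a) (↾c) (↾b) (↾d))
    (sq : CommSq (FinCop.singleMap a).toLoc (FinCop.singleMap c).toLoc
      (FinCop.singleMap b).toLoc (FinCop.singleMap d).toLoc) : BeckChevalley F sq

/-- A transformation is an equivalence of symmetric self-adjoint Hopf structures: it lies over the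
identity of finite pointed sets and its components are equivalences of degree zero. -/
structure IsSSHEquivalence {F F' : Pseudofunctor (LocallyDiscrete FinCop) (GrFam.{v, w} k)}
    (η : Pseudofunctor.StrongTrans F F') (hF : IsSSH F) (hF' : IsSSH F') : Prop where
  index (X : FinCop) (i : X.I) :
    MHom.base (η.app ⟨X⟩) (cast (hF.index_obj X).symm i) = some (cast (hF'.index_obj X).symm i)
  degreeZero (X : FinCop) : IsDegreeZero (η.app ⟨X⟩)
  equiv (X : FinCop) : ∃ g : F'.obj ⟨X⟩ ⟶ F.obj ⟨X⟩, IsDegreeZero g ∧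
    Nonempty (η.app ⟨X⟩ ≫ g ≅ 𝟙 _) ∧ Nonempty (g ≫ η.app ⟨X⟩ ≅ 𝟙 _)

-- Representations of a finite group

/-- `ρ` is a system of models for the irreducible representations of `G`. -/
structure IsIrrSystem : Prop where
  simple (r : Irr) : Simple (ρ r)
  inj {r s : Irr} : Nonempty (ρ r ≅ ρ s) → r = s
  complete (V : FDRep k G) : Simple V → ∃ r, Nonempty (V ≅ ρ r)

/-- `k` is a splitting field for `G`. -/
def IsSplittingField (k : Type u) [Field k] (G : Type u) [Group G] : Prop :=
  ∀ V : FDRep k G, Simple V → Module.finrank k (V ⟶ V) = 1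

/-- The functor `V ↦ (r ↦ Hom(ρ_r, V))` from sheaves of representations on a point. -/
def homPt : Sh Unit (FDRep k G) ⥤ Sh Irr (FGModuleCat.{u} k) :=
  homSh ρ Unit ⋙ pull fun r => ((), r)

instance : (homPt ρ).Additive where
  map_add {_ _ f g} := congrArg ((pull fun r : Irr => ((), r)).map)
    ((homSh ρ Unit).map_add (f := f) (g := g))

instance : (homPt ρ).Linear k where
  map_smul f c := congrArg ((pull fun r : Irr => ((), r)).map) ((homSh ρ Unit).map_smul c f)

/-- The arrow `(S, S) → S` given by the identity of `S` twice. -/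
def foldMap (S : Type) [Finite S] : FinCop.Hom ⟨Fin 2, fun _ => S⟩ (FinCop.single S) :=
  ⟨fun _ => some (), fun _ _ _ => id⟩

/-- The arrow from the empty family to `S`. -/
def unitMap (S : Type) [Finite S] : FinCop.Hom ⟨Fin 0, fun _ => S⟩ (FinCop.single S) :=
  ⟨fun _ => some (), fun _ _ _ => id⟩

/-- The family of arrows `{r} → T`, presenting `T` as a disjoint union of points. -/
def pointsMap (T : Type) [Finite T] : FinCop.Hom ⟨T, fun _ => Unit⟩ (FinCop.single T) :=
  ⟨fun _ => some (), fun r _ _ _ => r⟩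

variable (k 𝒜) in
/-- The product of two objects of `P(Sh(S))` and the unit given by the Hopf structure are the
pointwise tensor product of functors and its unit. -/
def InducesPointwiseTensor (S : Type) [Finite S] : Prop :=
  (∃ e : Pi.comap (fun _ : Fin 2 => PolyFun k (Sh S 𝒜))
        (fun i : {i : Fin 2 // (foldMap S).base i = some ()} => i.1) ⋙
        MHom.fn (HMap k 𝒜 (foldMap S)) () ≅
      Functor.prod' (Pi.eval _ 0) (Pi.eval _ 1) ⋙
        MonoidalCategory.tensor (PolyFun k (Sh S 𝒜)),
    ∀ (F : Fin 2 → PolyFun k (Sh S 𝒜)) (V : Sh S 𝒜) (x : ∀ i, ((F i).obj.obj V : Type u)),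
      el ((e.hom.app F).hom.app V) (tmk fun i => x i.1) = x 0 ⊗ₜ[k] x 1) ∧
  ∃ e : (MHom.fn (HMap k 𝒜 (unitMap S)) ()).obj (fun i => i.1.elim0) ≅
      MonoidalCategory.tensorUnit (PolyFun k (Sh S 𝒜)),
    ∀ V : Sh S 𝒜, el (e.hom.hom.app V) (tmk fun i => i.1.elim0) = (1 : k)

end Poly
end SSH
end

/-! Everything rests on one notion, `IsSplitBasis`: a family of objects with only scalar
endomorphisms and no nonzero maps between different members, such that every object is a finite
direct sum of them. Vector spaces have such a finite family, the line (`isSplitBasis_line`), and so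
do representations of `G`, the irreducibles (`isSplitBasis_irr`, by Maschke's theorem and the
splitting hypothesis). Hence `X ↦ (Hom(e r, X))_r` is an equivalence, which is the first assertion.
Precomposition with an equivalence is an equivalence, preserves degrees and is strictly compatible
with pointwise tensor products; this handles the comparison `Ystar` and the symmetric monoidal
structure.

The real work is to see that polynomial functors on a category with a finite split basis again have
a split basis, finite in each degree (`exists_splitBasis_poly`). Scalars act on a polynomial functor
polynomially, so interpolation yields idempotents that split it into homogeneous parts
(`exists_homog_decomp`). In degree `d`, polarization writes `d!` times the identity of `F X` as a
sum of maps factoring through `F` of words, that is, of sums of `d` basis objects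
(`sum_toWord_ofWord`). Arbitrary linear maps on words therefore average to natural transformations,
as in Maschke's theorem. Consequently subfunctors have complements (`Stable.exists_idempotent`), and
every nonzero functor receives a nonzero map from one of the finitely many functors `V ↦ ⨂ Hom(e (w
a), V)`.

Endomorphisms of a simple functor must be scalars although `k` is not assumed algebraically closed.
For this, scale one summand `E` of `Y ⊞ E`. The vectors of top weight form a simple functor of `Y`
of smaller degree, because a generic map factors into unipotent, scaling and diagonal maps
(`wtProj_map_mem`). By induction an endomorphism acts on these vectors as a scalar, hence has an
eigenvector, hence is a scalar (`SimpFun.scalar`).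

For a disjoint union `T = ⊔ S_j`, external products of basis functors form a split basis on `T`
(`isSplitBasis_extProd`). Maps between them are computed at a large constant sheaf, where fixing all
tensor factors but one reduces the question to that factor; each simple functor on `T` occurs
because the generators on `T` are quotients of external products of generators. A multilinear
functor between categories with split bases is determined by arbitrary values at tuples of basis
objects (`IsMultilinear.exists_natTrans`, `exists_multilinear_functor`), so a 1-morphism carrying
tuples of basis objects to a basis is coCartesian (`IsBasisMap.isCoCartesian`). This also gives the
assertion on tensor powers.

For Beck–Chevalley, summation over fibres `c_*` is left adjoint to `c^*`, so precomposition with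
`c_*` is right adjoint to precomposition with `c^*`. The mate of a square is induced by the base
change map, which is an isomorphism when the fibres correspond bijectively (`mate_apply`,
`isIso_baseChange`). -/

open CategoryTheory Limits Bicategory

noncomputable section

set_option linter.unusedSectionVars false

namespace SSH

variable {k : Type u} [Field k]

/-! ### Vector-valued polynomial functions of one variable and interpolation. -/

section VPoly

variable {W : Type*} [AddCommGroup W] [Module k W]

/-- A polynomial function of one variable with values in a vector space. -/
def IsVPoly (D : ℕ) (h : k → W) : Prop :=
  ∃ w : Fin (D + 1) → W, ∀ s, h s = ∑ e : Fin (D + 1), s ^ (e : ℕ) • w e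

/-- The coefficients of a vector-valued polynomial function, by interpolation. -/
def coefAt (D : ℕ) (h : k → W) (j : Fin (D + 1)) : W :=
  ∑ i, (Matrix.vandermonde fun i : Fin (D + 1) => ((i : ℕ) : k))⁻¹ j i • h ((i : ℕ) : k)

/-- Coefficients are recovered from values at distinct nodes by the inverse Vandermonde matrix;
being fixed linear combinations of values, they inherit every linear property of the values. -/
theorem vandermonde_interp {D : ℕ} (x : Fin (D + 1) → k) (hx : Function.Injective x)
    (w : Fin (D + 1) → W) (j : Fin (D + 1)) :
    ∑ i, (Matrix.vandermonde x)⁻¹ j i • ∑ e : Fin (D + 1), x i ^ (e : ℕ) • w e = w j := by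
  have hdet : IsUnit (Matrix.vandermonde x).det :=
    (Matrix.det_vandermonde_ne_zero_iff.2 hx).isUnit
  have h1 := Matrix.nonsing_inv_mul _ hdet
  simp only [Finset.smul_sum, smul_smul]
  rw [Finset.sum_comm]
  simp only [← Finset.sum_smul]
  have : ∀ e : Fin (D + 1), ∑ i, (Matrix.vandermonde x)⁻¹ j i * x i ^ (e : ℕ) =
      (1 : Matrix (Fin (D + 1)) (Fin (D + 1)) k) j e := by
    intro e
    rw [← h1, Matrix.mul_apply]
    rfl
  simp [this, Matrix.one_apply]

theorem coefAt_eq [CharZero k] {D : ℕ} {h : k → W} {w : Fin (D + 1) → W}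
    (hw : ∀ s, h s = ∑ e : Fin (D + 1), s ^ (e : ℕ) • w e) (j : Fin (D + 1)) : coefAt D h j = w j := by
  simp only [coefAt, hw]
  exact vandermonde_interp _ (Nat.cast_injective.comp Fin.val_injective) w j

theorem IsVPoly.eq_sum [CharZero k] {D : ℕ} {h : k → W} (hh : IsVPoly D h) (s : k) :
    h s = ∑ j : Fin (D + 1), s ^ (j : ℕ) • coefAt D h j := by
  obtain ⟨w, hw⟩ := hh
  simp only [coefAt_eq hw]
  exact hw s

/-- The interpolation nodes can be chosen away from a single bad point. This replaces Zariski
density in all later arguments. -/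
theorem coef_mem_of_forall_ne [CharZero k] {D : ℕ} {h : k → W} {w : Fin (D + 1) → W}
    (hw : ∀ s, h s = ∑ e : Fin (D + 1), s ^ (e : ℕ) • w e) (N : Submodule k W) (s₀ : k)
    (hN : ∀ s, s ≠ s₀ → h s ∈ N) (j : Fin (D + 1)) : w j ∈ N := by
  -- These nodes are distinct and differ from `s₀`, since positive integers are nonzero in
  -- characteristic zero.
  let x : Fin (D + 1) → k := fun i => s₀ + 1 + ((i : ℕ) : k)
  have hx : Function.Injective x := fun i j hij =>
    Fin.val_injective (Nat.cast_injective (add_left_cancel hij))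
  rw [← vandermonde_interp x hx w j]
  refine N.sum_mem fun i _ => N.smul_mem _ ?_
  rw [← hw]
  refine hN _ fun h => ?_
  have h2 : ((i : ℕ) : k) + 1 = 0 := by
    have : s₀ + 1 + ((i : ℕ) : k) = s₀ := h
    linear_combination this
  exact Nat.cast_add_one_ne_zero _ h2

theorem IsVPoly.mem_of_forall_ne [CharZero k] {D : ℕ} {h : k → W} (hh : IsVPoly D h)
    (N : Submodule k W) (s₀ : k) (hN : ∀ s, s ≠ s₀ → h s ∈ N) (s : k) : h s ∈ N := by
  obtain ⟨w, hw⟩ := hh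
  rw [hw]
  exact N.sum_mem fun j _ => N.smul_mem _ (coef_mem_of_forall_ne hw N s₀ hN j)

theorem IsVPoly.eq_of_forall_ne [CharZero k] {D : ℕ} {h : k → W} (hh : IsVPoly D h)
    (s₀ : k) (b : W) (hb : ∀ s, s ≠ s₀ → h s = b) (s : k) : h s = b := by
  have h2 : IsVPoly D (fun s => h s - b) := by
    obtain ⟨w, hw⟩ := hh
    refine ⟨w - Pi.single 0 b, fun s => ?_⟩
    simp [hw, smul_sub, Finset.sum_sub_distrib, Fin.sum_univ_succ]
  have := h2.mem_of_forall_ne ⊥ s₀ (fun s hs => by simp [hb s hs]) s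
  simpa [sub_eq_zero] using this

theorem IsVPoly.map {W' : Type*} [AddCommGroup W'] [Module k W'] {D : ℕ} {h : k → W}
    (hh : IsVPoly D h) (L : W →ₗ[k] W') : IsVPoly D (fun s => L (h s)) := by
  obtain ⟨w, hw⟩ := hh
  exact ⟨fun e => L (w e), fun s => by simp [hw]⟩

/-- Interpolation is linear, so coefficients of a natural family of polynomial functions are again
natural. -/
theorem coefAt_map {W' : Type*} [AddCommGroup W'] [Module k W'] (D : ℕ) (h : k → W)
    (L : W →ₗ[k] W') (j) : coefAt D (fun s => L (h s)) j = L (coefAt D h j) := by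
  simp [coefAt]

/-- Expand over the set `I` of slots in which `x` is chosen; such a term carries the power `s ^ (d -
|I|)`. -/
theorem IsVPoly.multilinear_diag {V : Type*} [AddCommGroup V] [Module k V] {d : ℕ}
    (m : MultilinearMap k (fun _ : Fin d => V) W) (x y : V) :
    IsVPoly d (fun s : k => m fun _ => x + s • y) := by
  classical
  refine ⟨fun e => ∑ I : Finset (Fin d), if I.card = d - e ∧ e ≤ d then
    m (I.piecewise (fun _ => x) (fun _ => y)) else 0, fun s => ?_⟩
  have h1 : (fun _ : Fin d => x + s • y) = (fun _ => x) + (fun _ => s • y) := rfl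
  show m (fun _ => x + s • y) = _
  rw [h1, MultilinearMap.map_add_univ]
  simp only [Finset.smul_sum]
  rw [Finset.sum_comm]
  refine Finset.sum_congr rfl fun I _ => ?_
  have hI : I.card ≤ d := by simpa using I.card_le_univ
  rw [Finset.sum_eq_single ⟨d - I.card, by omega⟩]
  · rw [if_pos ⟨by simp; omega, by simp⟩]
    have h2 : I.piecewise (fun _ => x) (fun _ : Fin d => s • y) =
      fun i => (if i ∈ I then (1 : k) else s) • (I.piecewise (fun _ => x) (fun _ : Fin d => y) i) := by
      funext i
      by_cases hi : i ∈ I <;> simp [hi]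
    rw [h2, MultilinearMap.map_smul_univ]
    congr 1
    rw [Finset.prod_ite]
    simp only [Finset.prod_const_one, one_mul, Finset.prod_const]
    congr 1
    rw [Finset.filter_not, Finset.filter_mem_eq_inter, Finset.univ_inter,
      Finset.card_sdiff_of_subset (Finset.subset_univ _)]
    simp
  · intro e _ he
    rw [if_neg, smul_zero]
    rintro ⟨h3, h4⟩
    apply he
    ext
    simp
    omega
  · simp

end VPoly

/-! ### Homogeneous polynomial maps as diagonals of multilinear maps; polarization. -/

section Homogeneous

variable {V W : Type*} [AddCommGroup V] [Module k V] [AddCommGroup W] [Module k W]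

theorem exists_multilinear_monomial (d : ℕ) (s : Multiset (Module.Dual k V)) (hs : s.card = d) :
    ∃ m : MultilinearMap k (fun _ : Fin d => V) k, ∀ x, m (fun _ => x) = (s.map fun l => l x).prod := by
  have hl : s.toList.length = d := by rw [Multiset.length_toList, hs]
  have hs' : s = (s.toList : Multiset (Module.Dual k V)) := s.coe_toList.symm
  generalize s.toList = l at hl hs'
  subst hl hs'
  refine ⟨(MultilinearMap.mkPiAlgebra k (Fin l.length) k).compLinearMap
    fun i => l.get i, fun x => ?_⟩
  simp only [MultilinearMap.compLinearMap_apply, MultilinearMap.mkPiAlgebra_apply,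
    Multiset.map_coe, Multiset.prod_coe]
  rw [← List.prod_ofFn]
  congr 1
  conv_rhs => rw [← List.ofFn_get l, List.map_ofFn]
  rfl

theorem exists_multilinear_homogeneous {d : ℕ} (p : MvPolynomial (Module.Dual k V) k)
    (hp : p.IsHomogeneous d) :
    ∃ m : MultilinearMap k (fun _ : Fin d => V) k, ∀ x, m (fun _ => x) = p.eval (fun l => l x) := by
  classical
  have key : ∀ s : p.support, ∃ m : MultilinearMap k (fun _ : Fin d => V) k, ∀ x, m (fun _ => x) =
      ((Finsupp.toMultiset s.1).map fun l => l x).prod := by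
    intro s
    refine exists_multilinear_monomial d _ ?_
    have := hp (MvPolynomial.mem_support_iff.1 s.2)
    rw [Finsupp.card_toMultiset]
    rw [← this, Finsupp.weight_apply]
    simp [Finsupp.sum]
  choose m hm using key
  refine ⟨∑ s : p.support, p.coeff s.1 • m s, fun x => ?_⟩
  rw [MvPolynomial.eval_eq, sum_apply, ← Finset.sum_coe_sort p.support]
  refine Finset.sum_congr rfl fun s _ => ?_
  rw [smul_apply, hm, smul_eq_mul, Finsupp.toMultiset_map, Finsupp.prod_toMultiset]
  congr 1
  rw [Finsupp.prod_mapDomain_index (by simp) (by intros; rw [pow_add])]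
  rfl

theorem eval_smul_eq (p : MvPolynomial (Module.Dual k V) k) {D : ℕ} (hD : p.totalDegree ≤ D) (c : k)
    (x : V) : p.eval (fun l => l (c • x)) =
      ∑ e : Fin (D + 1), c ^ (e : ℕ) * (p.homogeneousComponent e).eval (fun l => l x) := by
  have h1 : p = ∑ e ∈ Finset.range (D + 1), p.homogeneousComponent e := by
    conv_lhs => rw [← MvPolynomial.sum_homogeneousComponent p]
    refine Finset.sum_subset (Finset.range_subset_range.2 (by omega)) fun e _ he => ?_
    exact MvPolynomial.homogeneousComponent_eq_zero _ _ (by simpa using he)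
  conv_lhs => rw [h1]
  rw [map_sum, Finset.sum_range]
  refine Finset.sum_congr rfl fun e _ => ?_
  obtain ⟨m, hm⟩ := exists_multilinear_homogeneous _
    (MvPolynomial.homogeneousComponent_isHomogeneous (e : ℕ) p)
  rw [← hm, ← hm]
  simpa using m.map_smul_univ (fun _ => c) (fun _ => x)

/-- The homogeneous components of a polynomial map. -/
theorem IsPolyMap.exists_components {d : ℕ} {f : V → W} (hf : IsPolyMap k d f) :
    ∃ m : ∀ e : Fin (d + 1), MultilinearMap k (fun _ : Fin (e : ℕ) => V) W,
      ∀ (c : k) x, f (c • x) = ∑ e : Fin (d + 1), c ^ (e : ℕ) • m e (fun _ => x) := by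
  obtain ⟨n, p, b, hp, h⟩ := hf
  choose m hm using fun (e : Fin (d + 1)) (a : Fin n) => exists_multilinear_homogeneous _
    (MvPolynomial.homogeneousComponent_isHomogeneous (e : ℕ) (p a))
  refine ⟨fun e => ∑ a, (LinearMap.toSpanSingleton k W (b a)).compMultilinearMap (m e a), fun c x => ?_⟩
  simp only [h, eval_smul_eq _ (hp _), sum_apply, LinearMap.compMultilinearMap_apply, hm,
    LinearMap.toSpanSingleton_apply, Finset.sum_smul, Finset.smul_sum, smul_smul]
  rw [Finset.sum_comm]

theorem IsPolyMap.isVPoly_smul {d : ℕ} {f : V → W} (hf : IsPolyMap k d f) (x : V) :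
    IsVPoly d (fun c : k => f (c • x)) := by
  obtain ⟨m, hm⟩ := hf.exists_components
  exact ⟨fun e => m e (fun _ => x), fun c => hm c x⟩

/-- Compare the coefficient of `c ^ d` in the expansion of `f (c • x)` into components with the one
given by homogeneity. -/
theorem IsPolyMap.exists_multilinear [CharZero k] {d D : ℕ} {f : V → W} (hf : IsPolyMap k D f)
    (hd : ∀ (c : k) x, f (c • x) = c ^ d • f x) :
    ∃ m : MultilinearMap k (fun _ : Fin d => V) W, ∀ x, f x = m (fun _ => x) := by
  obtain ⟨m, hm⟩ := hf.exists_components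
  have hmono : ∀ {E : ℕ} (h : d ≤ E) x (c : k), c ^ d • f x =
      ∑ e : Fin (E + 1), c ^ (e : ℕ) • (Pi.single (⟨d, by omega⟩ : Fin (E + 1)) (f x) : Fin (E + 1) → W) e := by
    intro E h x c
    rw [Finset.sum_eq_single ⟨d, by omega⟩]
    · simp
    · intro b _ hb
      simp [hb]
    · simp
  by_cases hdD : d ≤ D
  · refine ⟨m ⟨d, by omega⟩, fun x => ?_⟩
    have h1 := coefAt_eq (fun c => hm c x) ⟨d, by omega⟩
    rw [← h1, coefAt_eq (fun c => (hd c x).trans (hmono hdD x c))]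
    simp
  -- Here `D < d`: padding the components with zeros up to degree `d`, the coefficient of `c ^ d` is
  -- both `0` and `f x`, so `f` vanishes.
  · refine ⟨0, fun x => ?_⟩
    push Not at hdD
    let w : Fin (d + 1) → W := fun e => if h : (e : ℕ) < D + 1 then m ⟨e, h⟩ (fun _ => x) else 0
    have h2 : ∀ c : k, f (c • x) = ∑ e : Fin (d + 1), c ^ (e : ℕ) • w e := by
      intro c
      rw [hm, ← Finset.sum_range (fun e => c ^ e • if h : e < D + 1 then m ⟨e, h⟩ (fun _ => x) else 0),
        ← Finset.sum_subset (Finset.range_subset_range.2 (by omega : D + 1 ≤ d + 1)), Finset.sum_range]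
      · exact Finset.sum_congr rfl fun e _ => by rw [dif_pos e.2]
      · intro e _ he
        rw [dif_neg (by simpa using he), smul_zero]
    have h1 := coefAt_eq h2 (Fin.last d)
    rw [coefAt_eq (fun c => (hd c x).trans (hmono le_rfl x c))] at h1
    simpa [w, Fin.last, Nat.not_le.2 hdD] using h1

/-- Full polarization. -/
def polar (k : Type u) [Field k] {V W : Type*} [AddCommGroup V] [AddCommGroup W] [Module k W] (d : ℕ)
    (f : V → W) (x : Fin d → V) : W :=
  ∑ I : Finset (Fin d), (-1 : k) ^ Iᶜ.card • f (∑ i ∈ I, x i)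

/-- Inclusion–exclusion: after expanding `m`, the index map `v` occurs for all `I` containing its
image, and the signs cancel unless `v` is surjective, hence a permutation. -/
theorem polar_eq_sum_perm {d : ℕ} {f : V → W} {m : MultilinearMap k (fun _ : Fin d => V) W}
    (hm : ∀ x, f x = m (fun _ => x)) (x : Fin d → V) :
    polar k d f x = ∑ σ : Equiv.Perm (Fin d), m (x ∘ σ) := by
  classical
  have h1 : ∀ I : Finset (Fin d), f (∑ i ∈ I, x i) =
      ∑ v : Fin d → Fin d, if Finset.univ.image v ⊆ I then m (x ∘ v) else 0 := by
    intro I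
    rw [hm, MultilinearMap.map_sum_finset, ← Finset.sum_filter]
    refine Finset.sum_congr ?_ fun _ _ => rfl
    ext v
    simp [Finset.image_subset_iff]
  -- Taking complements turns this into the alternating sum over all subsets of the complement of
  -- the image.
  have h2 : ∀ v : Fin d → Fin d, (∑ I : Finset (Fin d), if Finset.univ.image v ⊆ I then (-1 : k) ^ Iᶜ.card else 0) =
      if Finset.univ.image v = Finset.univ then 1 else 0 := by
    intro v
    rw [← Finset.sum_filter]
    have h3 := congrArg (Int.cast : ℤ → k)
      (Finset.sum_powerset_neg_one_pow_card (x := (Finset.univ.image v)ᶜ))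
    push_cast at h3
    simp only [Finset.compl_eq_empty_iff] at h3
    rw [← h3]
    refine Finset.sum_bij (fun I _ => Iᶜ) ?_ ?_ ?_ ?_
    · intro I hI
      simpa using hI
    · intro I _ J _ h
      exact compl_injective h
    · intro J hJ
      refine ⟨Jᶜ, ?_, compl_compl J⟩
      simp only [Finset.mem_powerset] at hJ
      simp only [Finset.mem_filter, Finset.mem_univ, true_and]
      exact Finset.subset_compl_comm.1 hJ
    · intro I _
      rfl
  unfold polar
  simp only [h1, Finset.smul_sum]
  rw [Finset.sum_comm]
  have h4 : ∀ v : Fin d → Fin d, (∑ I : Finset (Fin d), (-1 : k) ^ Iᶜ.card •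
      if Finset.univ.image v ⊆ I then m (x ∘ v) else 0) =
      if Finset.univ.image v = Finset.univ then m (x ∘ v) else 0 := by
    intro v
    have : ∀ I : Finset (Fin d), ((-1 : k) ^ Iᶜ.card •
      if Finset.univ.image v ⊆ I then m (x ∘ v) else 0) =
        (if Finset.univ.image v ⊆ I then (-1 : k) ^ Iᶜ.card else 0) • m (x ∘ v) := by
      intro I
      split_ifs <;> simp
    simp only [this, ← Finset.sum_smul, h2]
    split_ifs <;> simp
  simp only [h4]
  rw [← Finset.sum_filter]
  symm
  refine Finset.sum_bij (fun σ _ => (σ : Fin d → Fin d)) ?_ ?_ ?_ ?_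
  · intro σ _
    simp only [Finset.mem_filter, Finset.mem_univ, true_and]
    exact Finset.image_univ_of_surjective σ.surjective
  · intro σ _ τ _ h
    exact Equiv.coe_fn_injective h
  · intro v hv
    simp only [Finset.mem_filter, Finset.mem_univ, true_and] at hv
    have hs : Function.Surjective v := fun y => by
      have : y ∈ Finset.univ.image v := by rw [hv]; exact Finset.mem_univ y
      simpa using this
    exact ⟨Equiv.ofBijective v (Finite.surjective_iff_bijective.1 hs), Finset.mem_univ _, rfl⟩
  · intro σ _
    rfl

/-- `f` is the restriction of a `d`-linear map to the diagonal. -/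
def IsDiag (k : Type u) [Field k] {V W : Type*} [AddCommGroup V] [Module k V] [AddCommGroup W]
    [Module k W] (d : ℕ) (f : V → W) : Prop :=
  ∃ m : MultilinearMap k (fun _ : Fin d => V) W, ∀ x, f x = m (fun _ => x)

theorem IsDiag.exists_polar {d : ℕ} {f : V → W} (hf : IsDiag k d f) :
    ∃ m : MultilinearMap k (fun _ : Fin d => V) W, ∀ x, polar k d f x = m x := by
  obtain ⟨m, hm⟩ := hf
  refine ⟨∑ σ : Equiv.Perm (Fin d), m.domDomCongr σ, fun x => ?_⟩
  rw [polar_eq_sum_perm hm, sum_apply]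
  rfl

theorem IsDiag.polar_diag {d : ℕ} {f : V → W} (hf : IsDiag k d f) (x : V) :
    polar k d f (fun _ => x) = (d.factorial : k) • f x := by
  obtain ⟨m, hm⟩ := hf
  rw [polar_eq_sum_perm hm, hm]
  simp [Function.comp_def, Fintype.card_perm, Nat.cast_smul_eq_nsmul]


/-- Polarization is defined from the values of `f` alone, without choosing a multilinear map; this
makes it natural. -/
theorem polar_map {V V' W' : Type*} [AddCommGroup V] [AddCommGroup V'] [AddCommGroup W'] [Module k W'] {d : ℕ} (f : V → W) (f' : V' → W')
    (L : W →ₗ[k] W') (K : V →+ V') (h : ∀ x, f' (K x) = L (f x)) (x : Fin d → V) :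
    L (polar k d f x) = polar k d f' fun i => K (x i) := by
  simp [polar, ← h]

theorem IsDiag.isVPoly {d : ℕ} {f : V → W} (hf : IsDiag k d f) (x y : V) :
    IsVPoly d (fun s : k => f (x + s • y)) := by
  obtain ⟨m, hm⟩ := hf
  simp only [hm]
  exact IsVPoly.multilinear_diag m x y

end Homogeneous

/-! ### Direct sum decompositions and split bases of linear categories. -/

section SplitBasis

variable {C : Type*} [Category* C] [Preadditive C] {R : Type*}

/-- A finite direct sum decomposition of `X` into members of the family `e`. -/
structure Decomp (e : R → C) (X : C) where
  n : Type
  [fin : Fintype n]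
  l : n → R
  ι : ∀ a, e (l a) ⟶ X
  π : ∀ a, X ⟶ e (l a)
  ι_π : ∀ a, ι a ≫ π a = 𝟙 _
  ι_π_ne : ∀ a b, a ≠ b → ι a ≫ π b = 0
  total : ∑ a, π a ≫ ι a = 𝟙 X

attribute [instance] Decomp.fin

theorem Decomp.of_fintype {e : R → C} {X : C} {A : Type} [Fintype A] (l : A → R)
    (ι : ∀ a, e (l a) ⟶ X) (π : ∀ a, X ⟶ e (l a)) (ι_π : ∀ a, ι a ≫ π a = 𝟙 _)
    (ι_π_ne : ∀ a b, a ≠ b → ι a ≫ π b = 0) (total : ∑ a, π a ≫ ι a = 𝟙 X) :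
    Nonempty (Decomp e X) :=
  ⟨⟨A, l, ι, π, ι_π, ι_π_ne, total⟩⟩

/-- Decompositions can be composed. -/
theorem Decomp.refine {R' : Type*} {e : R → C} {e' : R' → C} {X : C} (D : Decomp e X)
    (h : ∀ a, Nonempty (Decomp e' (e (D.l a)))) : Nonempty (Decomp e' X) := by
  classical
  let E := fun a => (h a).some
  refine Decomp.of_fintype (A := Σ a, (E a).n) (fun p => (E p.1).l p.2)
    (fun p => (E p.1).ι p.2 ≫ D.ι p.1) (fun p => D.π p.1 ≫ (E p.1).π p.2) ?_ ?_ ?_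
  · intro p
    rw [Category.assoc, ← Category.assoc (D.ι _), D.ι_π, Category.id_comp, (E p.1).ι_π]
  · rintro ⟨a, b⟩ ⟨a', b'⟩ hne
    dsimp only
    rw [Category.assoc, ← Category.assoc (D.ι _)]
    by_cases h : a = a'
    · subst h
      rw [D.ι_π, Category.id_comp, (E a).ι_π_ne]
      rintro rfl
      exact hne rfl
    · rw [D.ι_π_ne _ _ h, zero_comp, comp_zero]
  · rw [Fintype.sum_sigma, ← D.total]
    refine Finset.sum_congr rfl fun a _ => ?_
    have := congrArg (fun z => D.π a ≫ z ≫ D.ι a) (E a).total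
    simpa [Preadditive.comp_sum, Preadditive.sum_comp] using this

theorem Decomp.single {e : R → C} {X : C} (r : R) (i : e r ≅ X) : Nonempty (Decomp e X) :=
  Decomp.of_fintype (A := Unit) (fun _ => r) (fun _ => i.hom) (fun _ => i.inv) (by simp)
    (fun _ _ h => absurd rfl h) (by simp)

theorem Decomp.exists_comp_ne_zero {e : R → C} {X Y : C} (D : Decomp e X) {f : X ⟶ Y} (hf : f ≠ 0) :
    ∃ a, D.ι a ≫ f ≠ 0 := by
  by_contra! h
  apply hf
  rw [← Category.id_comp f, ← D.total, Preadditive.sum_comp]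
  exact Finset.sum_eq_zero fun a _ => by rw [Category.assoc, h, comp_zero]

/-- `X` is not zero and has no nontrivial idempotents. -/
def Indec (X : C) : Prop := 𝟙 X ≠ 0 ∧ ∀ e : X ⟶ X, e ≫ e = e → e = 0 ∨ e = 𝟙 X

/-- Split off a nontrivial idempotent and its complement; both pieces have smaller `δ`, so the
process stops. -/
theorem exists_indec_decomp [IsIdempotentComplete C] (δ : C → ℕ)
    (hδ : ∀ (X Y : C) (i : Y ⟶ X) (p : X ⟶ Y), i ≫ p = 𝟙 Y → p ≫ i ≠ 𝟙 X → δ Y < δ X) (X : C) :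
    Nonempty (Decomp (fun Y : {Y : C // Indec Y} => Y.1) X) := by
  induction hn : δ X using Nat.strong_induction_on generalizing X with
  | h n ih =>
    subst hn
    by_cases h0 : 𝟙 X = 0
    · exact Decomp.of_fintype (A := Empty) nofun nofun nofun nofun nofun (by simp [h0])
    by_cases h1 : Indec X
    · exact Decomp.single ⟨X, h1⟩ (Iso.refl X)
    · simp only [Indec, not_and, not_forall] at h1
      obtain ⟨e, he, h2⟩ := h1 h0
      rw [not_or] at h2
      obtain ⟨Y, i, p, hip, hpi⟩ := IsIdempotentComplete.idempotents_split X e he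
      have he' : (𝟙 X - e) ≫ (𝟙 X - e) = 𝟙 X - e := by
        simp [Preadditive.sub_comp, Preadditive.comp_sub, he]
      obtain ⟨Y', i', p', hip', hpi'⟩ := IsIdempotentComplete.idempotents_split X _ he'
      have d1 := ih _ (hδ X Y i p hip (by rw [hpi]; exact h2.2)) Y rfl
      have d2 := ih _ (hδ X Y' i' p' hip' (by
        rw [hpi']; intro h; apply h2.1; simpa using h)) Y' rfl
      -- Orthogonality of the two images comes from `e ≫ (𝟙 - e) = 0`.
      have z1 : i ≫ p' = 0 := by
        have : i ≫ (p ≫ i) ≫ (p' ≫ i') ≫ p' = 0 := by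
          rw [hpi, hpi', ← Category.assoc e]
          simp [Preadditive.comp_sub, he]
        simpa [hip', reassoc_of% hip] using this
      have z2 : i' ≫ p = 0 := by
        have : i' ≫ (p' ≫ i') ≫ (p ≫ i) ≫ p = 0 := by
          rw [hpi, hpi', ← Category.assoc (𝟙 X - e)]
          simp [Preadditive.sub_comp, he]
        simpa [hip, reassoc_of% hip'] using this
      obtain ⟨D⟩ := Decomp.of_fintype (e := fun b : Bool => if b then Y else Y') (X := X) (A := Bool) id
        (fun b => match b with | true => i | false => i')
        (fun b => match b with | true => p | false => p')
        (fun b => match b with | true => hip | false => hip')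
        (fun a b h => match a, b, h with
          | true, true, h => absurd rfl h | false, false, h => absurd rfl h
          | true, false, _ => z1 | false, true, _ => z2)
        (by rw [Fintype.sum_bool]; simp [hpi, hpi'])
      exact D.refine fun a => match D.l a with | true => d1 | false => d2

variable [Linear k C]

variable (k) in
/-- The members of the family `e` are nonisomorphic absolutely simple objects, and each object is
a finite direct sum of them. -/
structure IsSplitBasis (e : R → C) : Prop where
  hom_zero {r s : R} (_ : r ≠ s) (f : e r ⟶ e s) : f = 0
  hom_self (r : R) (f : e r ⟶ e r) : ∃ c : k, f = c • 𝟙 (e r)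
  one_ne (r : R) : 𝟙 (e r) ≠ 0
  decomp (X : C) : Nonempty (Decomp e X)

namespace IsSplitBasis

variable {e : R → C} (hB : IsSplitBasis k e)

include hB in
theorem bijective_smul (r : R) : Function.Bijective (LinearMap.toSpanSingleton k (e r ⟶ e r) (𝟙 _)) := by
  constructor
  · intro a b h
    exact smul_left_injective k (hB.one_ne r) h
  · intro f
    obtain ⟨c, hc⟩ := hB.hom_self r f
    exact ⟨c, hc.symm⟩

open Classical in
/-- The scalar by which a map between members of a split basis acts. -/
def sc {r s : R} : (e r ⟶ e s) →ₗ[k] k :=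
  if h : r = s then
    (LinearEquiv.ofBijective _ (hB.bijective_smul r)).symm.toLinearMap.comp
      (Linear.rightComp k (e r) (eqToHom (congrArg e h.symm)))
  else 0

variable (e) in
open Classical in
/-- The identity if `r = s` and zero otherwise. -/
def unit (Z : R → C) (r s : R) : Z r ⟶ Z s := if h : r = s then eqToHom (congrArg Z h) else 0

theorem unit_self (Z : R → C) (r : R) : unit Z r r = 𝟙 _ := by simp [unit]

theorem unit_ne (Z : R → C) {r s : R} (h : r ≠ s) : unit Z r s = 0 := by simp [unit, h]

theorem sc_smul_unit {r s : R} (f : e r ⟶ e s) : f = hB.sc f • unit e r s := by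
  by_cases h : r = s
  · subst h
    have h1 := (LinearEquiv.ofBijective _ (hB.bijective_smul r)).apply_symm_apply f
    have h2 : hB.sc f = (LinearEquiv.ofBijective _ (hB.bijective_smul r)).symm f := by simp [sc]
    rw [h2, unit_self]
    exact h1.symm
  · rw [hB.hom_zero h f, unit_ne e h, smul_zero]

theorem sc_smul_id {r : R} (c : k) : hB.sc (c • 𝟙 (e r)) = c := by
  have h := hB.sc_smul_unit (c • 𝟙 (e r))
  rw [unit_self] at h
  exact (smul_left_injective k (hB.one_ne r) h).symm

theorem sc_id {r : R} : hB.sc (𝟙 (e r)) = 1 := by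
  simpa using hB.sc_smul_id (r := r) 1

theorem sc_ne {r s : R} (h : r ≠ s) (f : e r ⟶ e s) : hB.sc f = 0 := by simp [sc, h]

theorem sc_comp {r s t : R} (f : e r ⟶ e s) (g : e s ⟶ e t) :
    hB.sc (f ≫ g) = hB.sc f * hB.sc g := by
  by_cases h : r = s
  · by_cases h' : s = t
    · subst h h'
      obtain ⟨c, rfl⟩ := hB.hom_self r f
      obtain ⟨c', rfl⟩ := hB.hom_self r g
      rw [Linear.smul_comp, Linear.comp_smul, smul_smul, Category.comp_id, hB.sc_smul_id,
        hB.sc_smul_id, hB.sc_smul_id]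
    · rw [hB.hom_zero h' g]; simp
  · rw [hB.hom_zero h f]; simp

theorem sc_injective {r s : R} {f g : e r ⟶ e s} (h : hB.sc f = hB.sc g) : f = g := by
  rw [hB.sc_smul_unit f, hB.sc_smul_unit g, h]

include hB in
theorem hom_ext {X Y : C} {f g : X ⟶ Y} (h : ∀ r (x : e r ⟶ X), x ≫ f = x ≫ g) : f = g := by
  obtain ⟨D⟩ := hB.decomp X
  rw [← Category.id_comp f, ← Category.id_comp g, ← D.total, Preadditive.sum_comp,
    Preadditive.sum_comp]
  exact Finset.sum_congr rfl fun a _ => by rw [Category.assoc, Category.assoc, h]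

-- No compatibility among the `T r` is needed: maps between members of the basis are zero or scalar,
-- and a linear map commutes with scalars.
include hB in
theorem exists_hom {X Y : C} (T : ∀ r, (e r ⟶ X) →ₗ[k] (e r ⟶ Y)) :
    ∃ f : X ⟶ Y, ∀ r (x : e r ⟶ X), x ≫ f = T r x := by
  obtain ⟨D⟩ := hB.decomp X
  refine ⟨∑ a, D.π a ≫ T _ (D.ι a), fun r x => ?_⟩
  rw [Preadditive.comp_sum]
  have h1 : x = ∑ a, (x ≫ D.π a) ≫ D.ι a := by
    conv_lhs => rw [← Category.comp_id x, ← D.total, Preadditive.comp_sum]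
    exact Finset.sum_congr rfl fun a _ => by rw [Category.assoc]
  conv_rhs => rw [h1, map_sum]
  refine Finset.sum_congr rfl fun a _ => ?_
  rw [← Category.assoc]
  generalize x ≫ D.π a = g
  have key : ∀ (s : R) (g : e r ⟶ e s) (y : e s ⟶ X), g ≫ T s y = T r (g ≫ y) := by
    intro s g y
    by_cases h : r = s
    · subst h
      obtain ⟨c, rfl⟩ := hB.hom_self r g
      simp
    · simp [hB.hom_zero h g]
  exact key _ _ _

include hB in
theorem finite_hom_left (r : R) (X : C) : Module.Finite k (e r ⟶ X) := by
  obtain ⟨D⟩ := hB.decomp X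
  let L : (e r ⟶ X) →ₗ[k] (D.n → k) := LinearMap.pi fun a => hB.sc.comp (Linear.rightComp k _ (D.π a))
  refine Module.Finite.of_injective L fun x y h => ?_
  rw [← Category.comp_id x, ← Category.comp_id y, ← D.total, Preadditive.comp_sum, Preadditive.comp_sum]
  refine Finset.sum_congr rfl fun a _ => ?_
  rw [← Category.assoc, ← Category.assoc]
  congr 1
  exact hB.sc_injective (congrFun h a)

include hB in
theorem finite_hom (X Y : C) : Module.Finite k (X ⟶ Y) := by
  obtain ⟨D⟩ := hB.decomp X
  have := fun a => hB.finite_hom_left (D.l a) Y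
  let L : (X ⟶ Y) →ₗ[k] (∀ a, e (D.l a) ⟶ Y) := LinearMap.pi fun a => Linear.leftComp k _ (D.ι a)
  refine Module.Finite.of_injective L fun x y h => ?_
  rw [← Category.id_comp x, ← Category.id_comp y, ← D.total, Preadditive.sum_comp, Preadditive.sum_comp]
  refine Finset.sum_congr rfl fun a _ => ?_
  rw [Category.assoc, Category.assoc]
  exact congrArg (D.π a ≫ ·) (congrFun h a)

-- Take the direct sum of `d r` copies of each `e r`; by orthogonality only the copies of `e r` are
-- seen by maps from `e r`.
open Classical in
include hB in
theorem exists_finrank_eq [HasFiniteBiproducts C] [Finite R] (d : R → ℕ) :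
    ∃ X : C, ∀ r, Module.finrank k (e r ⟶ X) = d r := by
  have := Fintype.ofFinite R
  let f : (Σ r, Fin (d r)) → C := fun p => e p.1
  refine ⟨⨁ f, fun r => ?_⟩
  let L : (e r ⟶ ⨁ f) →ₗ[k] (Fin (d r) → k) :=
    LinearMap.pi fun b => hB.sc.comp (Linear.rightComp k _ (biproduct.π f ⟨r, b⟩))
  have hL : Function.Bijective L := by
    constructor
    · intro x y h
      refine biproduct.hom_ext _ _ fun ⟨s, b⟩ => ?_
      by_cases hrs : r = s
      · subst hrs
        exact hB.sc_injective (congrFun h b)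
      · exact (hB.hom_zero hrs _).trans (hB.hom_zero hrs _).symm
    · intro y
      refine ⟨∑ b, y b • biproduct.ι f ⟨r, b⟩, ?_⟩
      funext b
      have : L (∑ b, y b • biproduct.ι f ⟨r, b⟩) b =
        ∑ b', y b' * hB.sc (biproduct.ι f ⟨r, b'⟩ ≫ biproduct.π f ⟨r, b⟩) := by
        simp [L]
      rw [this, Finset.sum_eq_single b]
      · have h2 : biproduct.ι f ⟨r, b⟩ ≫ biproduct.π f ⟨r, b⟩ = 𝟙 (e r) := biproduct.ι_π_self f _
        rw [h2, hB.sc_id, mul_one]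
      · intro b' _ hb
        rw [biproduct.ι_π_ne f (by simpa using hb)]
        simp
      · simp
  rw [(LinearEquiv.ofBijective L hL).finrank_eq]
  simp

end IsSplitBasis
end SplitBasis

/-! ### Multilinear functors are determined freely by tuples of basis objects. -/

section Multi

open IsSplitBasis

variable {J : Type} [Finite J] {D : J → Type w} [∀ j, Category.{v} (D j)] [∀ j, Preadditive (D j)]
  [∀ j, Linear k (D j)] {Z : Type w} [Category.{v} Z] [Preadditive Z] [Linear k Z]

theorem IsMultilinear.map_sum {E : (∀ j, D j) ⥤ Z} (hE : IsMultilinear k E) [Fintype J]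
    [DecidableEq J] {X Y : ∀ j, D j} {n : J → Type} [∀ j, Fintype (n j)]
    (f : ∀ j, n j → (X j ⟶ Y j)) :
    E.map (X := X) (Y := Y) (fun j => ∑ a, f j a) = ∑ v : ∀ j, n j, E.map (X := X) (Y := Y) fun j => f j (v j) := by
  obtain ⟨m, hm⟩ := hE X Y
  simp only [hm]
  exact m.map_sum f

theorem IsMultilinear.map_smul_univ {E : (∀ j, D j) ⥤ Z} (hE : IsMultilinear k E) [Fintype J]
    {X Y : ∀ j, D j} (c : J → k) (f : ∀ j, X j ⟶ Y j) :
    E.map (X := X) (Y := Y) (fun j => c j • f j) = (∏ j, c j) • E.map (X := X) (Y := Y) f := by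
  obtain ⟨m, hm⟩ := hE X Y
  simp only [hm]
  exact m.map_smul_univ c f

theorem IsMultilinear.map_zero {E : (∀ j, D j) ⥤ Z} (hE : IsMultilinear k E)
    {X Y : ∀ j, D j} {f : X ⟶ Y} (j : J) (h : f j = 0) : E.map f = 0 := by
  obtain ⟨m, hm⟩ := hE X Y
  rw [hm]
  exact m.map_coord_zero j h

variable {R : J → Type*} {e : ∀ j, R j → D j} (hB : ∀ j, IsSplitBasis k (e j))

/-- The tuple of basis objects with given indices. -/
abbrev tup (e : ∀ j, R j → D j) (ρ : ∀ j, R j) : ∀ j, D j := fun j => e j (ρ j)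

-- Maps between different tuples are killed by some slot, and endomorphisms of a tuple act by a
-- product of scalars on both sides, so naturality is automatic.
include hB in
theorem IsMultilinear.basis_naturality {E₁ E₂ : (∀ j, D j) ⥤ Z} (h₁ : IsMultilinear k E₁)
    (h₂ : IsMultilinear k E₂) (α : ∀ ρ : ∀ j, R j, E₁.obj (tup e ρ) ⟶ E₂.obj (tup e ρ))
    {ρ σ : ∀ j, R j} (f : tup e ρ ⟶ tup e σ) : E₁.map f ≫ α σ = α ρ ≫ E₂.map f := by
  have := Fintype.ofFinite J
  by_cases h : ρ = σ
  · subst h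
    choose c hc using fun j => (hB j).hom_self (ρ j) (f j)
    have hf : f = fun j => c j • (𝟙 (tup e ρ) : tup e ρ ⟶ tup e ρ) j := funext hc
    have e1 := h₁.map_smul_univ c (𝟙 (tup e ρ) : tup e ρ ⟶ tup e ρ)
    have e2 := h₂.map_smul_univ c (𝟙 (tup e ρ) : tup e ρ ⟶ tup e ρ)
    rw [hf, e1, e2]
    simp
  · obtain ⟨j, hj⟩ := Function.ne_iff.1 h
    rw [h₁.map_zero j ((hB j).hom_zero hj _), h₂.map_zero j ((hB j).hom_zero hj _)]
    simp

/-- A decomposition of each object of a tuple. -/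
abbrev TupDecomp (e : ∀ j, R j → D j) (X : ∀ j, D j) := ∀ j, Decomp (e j) (X j)

theorem IsMultilinear.total {E : (∀ j, D j) ⥤ Z} (hE : IsMultilinear k E) [Fintype J] [DecidableEq J]
    {X : ∀ j, D j} (d : TupDecomp e X) :
    ∑ v : ∀ j, (d j).n, E.map (X := X) (Y := tup e fun j => (d j).l (v j)) (fun j => (d j).π (v j)) ≫
      E.map (X := tup e fun j => (d j).l (v j)) (Y := X) (fun j => (d j).ι (v j)) = 𝟙 _ := by
  have h := hE.map_sum (X := X) (Y := X) fun j a => (d j).π a ≫ (d j).ι a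
  have h2 : (fun j => ∑ a, (d j).π a ≫ (d j).ι a) = (𝟙 X : X ⟶ X) := funext fun j => (d j).total
  rw [h2, E.map_id] at h
  rw [h]
  refine Finset.sum_congr rfl fun v _ => ?_
  rw [← E.map_comp]
  rfl

include hB in
/-- Natural transformations of multilinear functors are determined by their components at tuples of
basis objects. -/
theorem IsMultilinear.natTrans_ext {E₁ E₂ : (∀ j, D j) ⥤ Z} (h₁ : IsMultilinear k E₁)
    {α β : E₁ ⟶ E₂} (h : ∀ ρ, α.app (tup e ρ) = β.app (tup e ρ)) : α = β := by
  classical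
  have := Fintype.ofFinite J
  ext X
  let d : TupDecomp e X := fun j => ((hB j).decomp (X j)).some
  rw [← Category.id_comp (α.app X), ← Category.id_comp (β.app X), ← h₁.total d,
    Preadditive.sum_comp, Preadditive.sum_comp]
  refine Finset.sum_congr rfl fun v _ => ?_
  rw [Category.assoc, Category.assoc, α.naturality, β.naturality, h]

include hB in
/-- Any family of morphisms between the values of multilinear functors at tuples of basis objects
extends to a natural transformation. -/
theorem IsMultilinear.exists_natTrans {E₁ E₂ : (∀ j, D j) ⥤ Z} (h₁ : IsMultilinear k E₁)
    (h₂ : IsMultilinear k E₂) (α : ∀ ρ : ∀ j, R j, E₁.obj (tup e ρ) ⟶ E₂.obj (tup e ρ)) :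
    ∃ η : E₁ ⟶ E₂, ∀ ρ, η.app (tup e ρ) = α ρ := by
  classical
  have := Fintype.ofFinite J
  let d : ∀ X : ∀ j, D j, TupDecomp e X := fun X j => ((hB j).decomp (X j)).some
  let app : ∀ X, E₁.obj X ⟶ E₂.obj X := fun X => ∑ v : ∀ j, (d X j).n,
    E₁.map (X := X) (Y := tup e fun j => (d X j).l (v j)) (fun j => (d X j).π (v j)) ≫
      α (fun j => (d X j).l (v j)) ≫
      E₂.map (X := tup e fun j => (d X j).l (v j)) (Y := X) (fun j => (d X j).ι (v j))
  -- Naturality against maps into basis tuples. It yields both general naturality and, for the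
  -- identity, the value at a basis tuple.
  have nat_left : ∀ {X : ∀ j, D j} {σ} (f : X ⟶ tup e σ), E₁.map f ≫ α σ = app X ≫ E₂.map f := by
    intro X σ f
    conv_lhs => rw [← Category.id_comp (E₁.map f), ← h₁.total (d X)]
    simp only [app, Preadditive.sum_comp, Category.assoc]
    refine Finset.sum_congr rfl fun v _ => ?_
    rw [← E₂.map_comp]
    refine congrArg (E₁.map (X := X) (Y := tup e fun j => (d X j).l (v j)) (fun j => (d X j).π (v j)) ≫ ·) ?_
    rw [← basis_naturality hB h₁ h₂ α, E₁.map_comp, Category.assoc]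
  refine ⟨⟨app, fun X Y f => ?_⟩, fun ρ => ?_⟩
  · simp only [app]
    conv_rhs => rw [← Category.comp_id (E₂.map f), ← h₂.total (d Y)]
    rw [Preadditive.comp_sum, Preadditive.comp_sum, Preadditive.comp_sum]
    refine Finset.sum_congr rfl fun v _ => ?_
    rw [← E₁.map_comp_assoc, ← Category.assoc, nat_left, E₂.map_comp]
    simp only [app, Category.assoc]
  · have := nat_left (𝟙 (tup e ρ))
    simpa using this.symm

include hB in
theorem IsMultilinear.exists_iso {E₁ E₂ : (∀ j, D j) ⥤ Z} (h₁ : IsMultilinear k E₁)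
    (h₂ : IsMultilinear k E₂) (α : ∀ ρ : ∀ j, R j, E₁.obj (tup e ρ) ≅ E₂.obj (tup e ρ)) :
    ∃ η : E₁ ≅ E₂, ∀ ρ, η.hom.app (tup e ρ) = (α ρ).hom := by
  obtain ⟨η, hη⟩ := exists_natTrans hB h₁ h₂ fun ρ => (α ρ).hom
  obtain ⟨θ, hθ⟩ := exists_natTrans hB h₂ h₁ fun ρ => (α ρ).inv
  exact ⟨⟨η, θ, natTrans_ext hB h₁ fun ρ => by simp [hη, hθ],
    natTrans_ext hB h₂ fun ρ => by simp [hη, hθ]⟩, hη⟩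

section spread

variable [Fintype J] {X Y W : ∀ j, D j}

/-- The scalar of a tuple of maps between basis objects. -/
def tsc {ρ σ : ∀ j, R j} (f : ∀ j, e j (ρ j) ⟶ e j (σ j)) : k := ∏ j, (hB j).sc (f j)

theorem tsc_ne {ρ σ : ∀ j, R j} (h : ρ ≠ σ) (f : ∀ j, e j (ρ j) ⟶ e j (σ j)) : tsc hB f = 0 := by
  obtain ⟨j, hj⟩ := Function.ne_iff.1 h
  exact Finset.prod_eq_zero (Finset.mem_univ j) ((hB j).sc_ne hj _)

/-- Inserting a decomposition of the identity in each slot and multiplying out; this becomes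
composition of matrices in `spread`. -/
theorem sum_tsc [DecidableEq J] (d : TupDecomp e X) {ρ σ : ∀ j, R j} (f : ∀ j, e j (ρ j) ⟶ X j)
    (g : ∀ j, X j ⟶ e j (σ j)) :
    ∑ v : ∀ j, (d j).n, tsc hB (σ := fun j => (d j).l (v j)) (fun j => f j ≫ (d j).π (v j)) *
      tsc hB (ρ := fun j => (d j).l (v j)) (fun j => (d j).ι (v j) ≫ g j) = tsc hB fun j => f j ≫ g j := by
  simp only [tsc, ← Finset.prod_mul_distrib, ← sc_comp]
  refine (Finset.prod_univ_sum (fun j => (Finset.univ : Finset (d j).n))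
    (fun j a => (hB j).sc ((f j ≫ (d j).π a) ≫ (d j).ι a ≫ g j))).symm.trans
    (Finset.prod_congr rfl fun j _ => ?_)
  rw [← map_sum]
  congr 1
  have := congrArg (fun z => f j ≫ z ≫ g j) (d j).total
  simpa [Preadditive.sum_comp, Preadditive.comp_sum] using this

theorem tsc_id {ρ : ∀ j, R j} : tsc hB (fun j => 𝟙 (e j (ρ j))) = 1 := by
  simp [tsc, sc_id]

/-- `tsc` as a multilinear map. -/
def tscMulti {ρ σ : ∀ j, R j} (f : ∀ j, e j (ρ j) ⟶ X j) (g : ∀ j, Y j ⟶ e j (σ j)) :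
    MultilinearMap k (fun j => X j ⟶ Y j) k :=
  (MultilinearMap.mkPiAlgebra k J k).compLinearMap fun j =>
    ((hB j).sc.comp (Linear.leftComp k _ (f j))).comp (Linear.rightComp k _ (g j))

-- `unit` composes badly when the middle index differs from the outer ones; a coefficient vanishing
-- in that case repairs it.
omit [Finite J] [Fintype J] in
theorem unit_comp_unit {P : Type*} {T : P → Z} {p q r : P} (c : k) (h : p ≠ q → c = 0) :
    c • (unit T p q ≫ unit T q r) = c • unit T p r := by
  by_cases h' : p = q
  · subst h'
    rw [unit_self, Category.id_comp]
  · rw [h h', zero_smul, zero_smul]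

/-- The morphism between direct sums given by a matrix of scalars. -/
def mat {P : Type*} {T : P → Z} {A B : Z} (a : Decomp T A) (b : Decomp T B) :
    (a.n → b.n → k) →ₗ[k] (A ⟶ B) where
  toFun M := ∑ i, ∑ j, M i j • (a.π i ≫ unit T (a.l i) (b.l j) ≫ b.ι j)
  map_add' M N := by simp [add_smul, Finset.sum_add_distrib]
  map_smul' c M := by simp [Finset.smul_sum, smul_smul]

theorem mat_apply {P : Type*} {T : P → Z} {A B : Z} (a : Decomp T A) (b : Decomp T B)
    (M : a.n → b.n → k) : mat a b M = ∑ i, ∑ j, M i j • (a.π i ≫ unit T (a.l i) (b.l j) ≫ b.ι j) := rfl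

/-- Only the first matrix has to respect labels: where it is nonzero the intermediate label equals
the first, so composing units loses nothing. -/
theorem mat_comp {P : Type*} {T : P → Z} {A B C : Z} (a : Decomp T A) (b : Decomp T B)
    (c : Decomp T C) (M : a.n → b.n → k) (N : b.n → c.n → k)
    (hM : ∀ i j, a.l i ≠ b.l j → M i j = 0) :
    mat a b M ≫ mat b c N = mat a c fun i l => ∑ j, M i j * N j l := by
  simp only [mat_apply, Preadditive.sum_comp, Finset.sum_smul]
  refine Finset.sum_congr rfl fun i _ => ?_
  conv_rhs => rw [Finset.sum_comm]
  refine Finset.sum_congr rfl fun j _ => ?_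
  simp only [Preadditive.comp_sum]
  rw [Finset.sum_eq_single j]
  · refine Finset.sum_congr rfl fun l _ => ?_
    have h1 : (a.π i ≫ unit T (a.l i) (b.l j) ≫ b.ι j) ≫ b.π j ≫ unit T (b.l j) (c.l l) ≫ c.ι l =
        a.π i ≫ (unit T (a.l i) (b.l j) ≫ unit T (b.l j) (c.l l)) ≫ c.ι l := by
      simp only [Category.assoc]
      rw [← Category.assoc (b.ι j), b.ι_π, Category.id_comp]
    have h2 : M i j • (a.π i ≫ (unit T (a.l i) (b.l j) ≫ unit T (b.l j) (c.l l)) ≫ c.ι l) =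
        M i j • (a.π i ≫ unit T (a.l i) (c.l l) ≫ c.ι l) := by
      rw [← Linear.comp_smul, ← Linear.smul_comp, unit_comp_unit _ (hM i j), Linear.smul_comp,
        Linear.comp_smul]
    rw [Linear.smul_comp, Linear.comp_smul, h1, smul_comm, h2, smul_smul, mul_comm]
  · intro j' _ hj
    refine Finset.sum_eq_zero fun l _ => ?_
    have h1 : (a.π i ≫ unit T (a.l i) (b.l j) ≫ b.ι j) ≫ b.π j' ≫ unit T (b.l j') (c.l l) ≫ c.ι l = 0 := by
      simp only [Category.assoc]
      rw [← Category.assoc (b.ι j), b.ι_π_ne _ _ hj.symm]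
      simp
    rw [Linear.smul_comp, Linear.comp_smul, h1]
    simp
  · simp

open Classical in
theorem mat_id {P : Type*} {T : P → Z} {A : Z} (a : Decomp T A) :
    mat (k := k) a a (fun i j => if i = j then 1 else 0) = 𝟙 A := by
  rw [mat_apply, ← a.total]
  refine Finset.sum_congr rfl fun i _ => ?_
  rw [Finset.sum_eq_single i]
  · simp [unit_self]
  · intro j _ hj
    simp [hj.symm]
  · simp

variable [HasFiniteBiproducts Z] (T : (∀ j, R j) → Z)

open Classical in
/-- The sum of the `T ρ`, over the labels `ρ` occurring in a tuple of decompositions. -/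
abbrev spreadObj (d : TupDecomp e X) :
    Decomp T (⨁ fun v : ∀ j, (d j).n => T fun j => (d j).l (v j)) where
  n := ∀ j, (d j).n
  l v j := (d j).l (v j)
  ι v := biproduct.ι (fun v : ∀ j, (d j).n => T fun j => (d j).l (v j)) v
  π v := biproduct.π (fun v : ∀ j, (d j).n => T fun j => (d j).l (v j)) v
  ι_π v := biproduct.ι_π_self _ v
  ι_π_ne v v' h := biproduct.ι_π_ne _ h
  total := biproduct.total

/-- The multilinear functor with prescribed values at tuples of basis objects. -/
def spread (d : ∀ X : ∀ j, D j, TupDecomp e X) : (∀ j, D j) ⥤ Z where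
  obj X := ⨁ fun v : ∀ j, (d X j).n => T fun j => (d X j).l (v j)
  -- The entry is a product of one scalar for each slot, so it depends multilinearly on `f` and
  -- vanishes for different labels.
  map {X Y} f := mat (spreadObj T (d X)) (spreadObj T (d Y)) fun v v' =>
    tsc hB (ρ := fun j => (d X j).l (v j)) (σ := fun j => (d Y j).l (v' j))
      (fun j => (d X j).ι (v j) ≫ f j ≫ (d Y j).π (v' j))
  map_id X := by
    classical
    refine Eq.trans (congrArg (mat _ _) ?_) (mat_id (spreadObj T (d X)))
    funext v v'
    have : (fun j => (d X j).ι (v j) ≫ (𝟙 X : X ⟶ X) j ≫ (d X j).π (v' j)) =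
        fun j => (d X j).ι (v j) ≫ (d X j).π (v' j) := funext fun j =>
          congrArg ((d X j).ι (v j) ≫ ·) (Category.id_comp _)
    rw [this]
    split_ifs with h
    · subst h
      simp only [Decomp.ι_π]
      exact tsc_id hB
    · obtain ⟨j, hj⟩ := Function.ne_iff.1 h
      refine Finset.prod_eq_zero (Finset.mem_univ j) ?_
      exact (congrArg _ ((d X j).ι_π_ne _ _ hj)).trans (map_zero _)
  map_comp {X Y W} f g := by
    classical
    refine Eq.trans ?_ (mat_comp (spreadObj T (d X)) (spreadObj T (d Y)) (spreadObj T (d W)) _ _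
      fun v v' h => tsc_ne hB h _).symm
    congr 1
    funext v w
    have := sum_tsc hB (d Y) (ρ := fun j => (d X j).l (v j)) (σ := fun j => (d W j).l (w j))
      (fun j => (d X j).ι (v j) ≫ f j) (fun j => g j ≫ (d W j).π (w j))
    simp only [Category.assoc] at this
    refine Eq.trans ?_ this.symm
    congr 1
    funext j
    exact congrArg ((d X j).ι (v j) ≫ ·) (Category.assoc _ _ _)

theorem spread_lin (d : ∀ X : ∀ j, D j, TupDecomp e X) : IsMultilinear k (spread hB T d) := by
  classical
  intro X Y
  refine ⟨(mat (spreadObj T (d X)) (spreadObj T (d Y))).compMultilinearMap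
    (MultilinearMap.pi fun v => MultilinearMap.pi fun v' => tscMulti hB
      (fun j => (d X j).ι (v j)) (fun j => (d Y j).π (v' j))), fun f => rfl⟩

/-- The value of `spread` at a tuple of basis objects. -/
theorem spread_iso (d : ∀ X : ∀ j, D j, TupDecomp e X) (ρ : ∀ j, R j) :
    Nonempty ((spread hB T d).obj (tup e ρ) ≅ T ρ) := by
  classical
  let D₁ : Decomp T (T ρ) := ⟨Unit, fun _ => ρ, fun _ => 𝟙 _, fun _ => 𝟙 _, fun _ => by simp,
    fun _ _ h => absurd rfl h, by simp⟩
  let δ := d (tup e ρ)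
  refine ⟨⟨mat (spreadObj T δ) D₁ fun v _ => tsc hB (ρ := fun j => (δ j).l (v j)) fun j => (δ j).ι (v j),
    mat D₁ (spreadObj T δ) fun _ v => tsc hB (σ := fun j => (δ j).l (v j)) fun j => (δ j).π (v j), ?_, ?_⟩⟩
  · refine (mat_comp (spreadObj T δ) D₁ (spreadObj T δ) _ _ fun v v' h => tsc_ne hB h _).trans ?_
    refine Eq.trans (congrArg (mat _ _) ?_) (mat_id (spreadObj T δ))
    funext v v'
    have h1 : ∀ v v' : (∀ j, (δ j).n), (∑ _ : Unit, tsc hB (ρ := fun j => (δ j).l (v j)) (fun j => (δ j).ι (v j)) *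
        tsc hB (σ := fun j => (δ j).l (v' j)) fun j => (δ j).π (v' j)) =
        tsc hB (ρ := fun j => (δ j).l (v j)) (σ := fun j => (δ j).l (v' j))
          fun j => (δ j).ι (v j) ≫ (δ j).π (v' j) := by
      intro v v'
      simp only [tsc, sc_comp, Finset.prod_mul_distrib]
      simp
    refine (h1 v v').trans ?_
    split_ifs with h
    · subst h
      simp only [Decomp.ι_π]
      exact tsc_id hB
    · obtain ⟨j, hj⟩ := Function.ne_iff.1 h
      refine Finset.prod_eq_zero (Finset.mem_univ j) ?_
      exact (congrArg _ ((δ j).ι_π_ne _ _ hj)).trans (map_zero _)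
  · refine (mat_comp D₁ (spreadObj T δ) D₁ _ _ fun v v' h => tsc_ne hB h _).trans ?_
    refine Eq.trans (congrArg (mat _ _) ?_) (mat_id D₁)
    funext i j
    have := sum_tsc hB δ (ρ := ρ) (σ := ρ) (fun j => 𝟙 _) (fun j => 𝟙 _)
    simp only [Category.id_comp, Category.comp_id] at this
    rw [if_pos rfl]
    exact this.trans (tsc_id hB)

end spread

include hB in
/-- There is a multilinear functor with prescribed values at tuples of basis objects. -/
theorem exists_multilinear_functor [HasFiniteBiproducts Z] (T : (∀ j, R j) → Z) :
    ∃ E : (∀ j, D j) ⥤ Z, IsMultilinear k E ∧ ∀ ρ, Nonempty (E.obj (tup e ρ) ≅ T ρ) := by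
  have := Fintype.ofFinite J
  let d : ∀ X : ∀ j, D j, TupDecomp e X := fun X j => ((hB j).decomp (X j)).some
  exact ⟨spread hB T d, spread_lin hB T d, spread_iso hB T d⟩
end Multi

/-! ### Polarized functors, words, and averaging to natural transformations. -/

section Polar

variable {ℬ : Type (u + 1)} [Category.{u} ℬ] [Preadditive ℬ] [Linear k ℬ]

variable (k) in
/-- `F` is given on morphisms by the diagonals of `d`-linear maps. -/
def IsDiagFun (d : ℕ) (F : ℬ ⥤ FGModuleCat.{u} k) : Prop :=
  ∀ X Y : ℬ, IsDiag k d (fun f : X ⟶ Y => F.map f)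

theorem isDiagFun_of_isHomog [CharZero k] {d : ℕ} {F : PolyFun k ℬ} (hF : isHomog k ℬ d F) :
    IsDiagFun k d F.obj := fun X Y => by
  obtain ⟨D, hD⟩ := F.property
  exact (hD X Y).exists_multilinear fun c f => hF X Y c f

/-- The polarization of the action of `F` on morphisms. -/
def pol (d : ℕ) (F : ℬ ⥤ FGModuleCat.{u} k) {X Y : ℬ} (f : Fin d → (X ⟶ Y)) : F.obj X ⟶ F.obj Y :=
  polar k d (fun f : X ⟶ Y => F.map f) f

variable {d : ℕ} {F G : ℬ ⥤ FGModuleCat.{u} k}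

/-- Functoriality of `F` passes to its polarization since composition on either side is additive. -/
theorem map_comp_pol {X Y Z : ℬ} (g : X ⟶ Y) (f : Fin d → (Y ⟶ Z)) :
    F.map g ≫ pol d F f = pol d F fun a => g ≫ f a :=
  polar_map (fun f : Y ⟶ Z => F.map f) (fun f : X ⟶ Z => F.map f)
    (Linear.leftComp k _ (F.map g)) (Preadditive.leftComp _ g) (fun _ => F.map_comp _ _) f

theorem pol_comp_map {X Y Z : ℬ} (f : Fin d → (X ⟶ Y)) (g : Y ⟶ Z) :
    pol d F f ≫ F.map g = pol d F fun a => f a ≫ g :=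
  polar_map (fun f : X ⟶ Y => F.map f) (fun f : X ⟶ Z => F.map f)
    (Linear.rightComp k _ (F.map g)) (Preadditive.rightComp _ g) (fun _ => F.map_comp _ _) f

theorem pol_naturality (α : F ⟶ G) {X Y : ℬ} (f : Fin d → (X ⟶ Y)) :
    pol d F f ≫ α.app Y = α.app X ≫ pol d G f := by
  simp [pol, polar, Preadditive.sum_comp, Preadditive.comp_sum]

theorem pol_diag (hF : IsDiagFun k d F) {X Y : ℬ} (f : X ⟶ Y) :
    pol d F (fun _ => f) = (d.factorial : k) • F.map f :=
  (hF X Y).polar_diag f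

theorem exists_pol (hF : IsDiagFun k d F) (X Y : ℬ) :
    ∃ m : MultilinearMap k (fun _ : Fin d => X ⟶ Y) (F.obj X ⟶ F.obj Y), ∀ f, pol d F f = m f :=
  (hF X Y).exists_polar

theorem pol_sum (hF : IsDiagFun k d F) {X Y : ℬ} {A : Type} [Fintype A] (f : Fin d → A → (X ⟶ Y)) :
    pol d F (fun a => ∑ b, f a b) = ∑ v : Fin d → A, pol d F fun a => f a (v a) := by
  obtain ⟨m, hm⟩ := exists_pol hF X Y
  simp only [hm]
  exact m.map_sum f

theorem pol_smul (hF : IsDiagFun k d F) {X Y : ℬ} (c : Fin d → k) (f : Fin d → (X ⟶ Y)) :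
    pol d F (fun a => c a • f a) = (∏ a, c a) • pol d F f := by
  obtain ⟨m, hm⟩ := exists_pol hF X Y
  simp only [hm]
  exact m.map_smul_univ c f

theorem pol_zero (hF : IsDiagFun k d F) {X Y : ℬ} {f : Fin d → (X ⟶ Y)} (a : Fin d) (h : f a = 0) :
    pol d F f = 0 := by
  obtain ⟨m, hm⟩ := exists_pol hF X Y
  rw [hm]
  exact m.map_coord_zero a h

/-- A subfunctor, as a family of subspaces. -/
def Stable (F : ℬ ⥤ FGModuleCat.{u} k) (N : ∀ X, Submodule k (F.obj X : Type u)) : Prop :=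
  ∀ ⦃X Y : ℬ⦄ (f : X ⟶ Y) (u : (F.obj X : Type u)), u ∈ N X → el (F.map f) u ∈ N Y

theorem el_sum_apply {V W : FGModuleCat.{u} k} {ι : Type*} (s : Finset ι) (f : ι → (V ⟶ W))
    (x : (V : Type u)) : el (∑ i ∈ s, f i) x = ∑ i ∈ s, el (f i) x :=
  map_sum ((LinearMap.applyₗ x).comp (homEquivLin V W).toLinearMap) f s

theorem el_smul_apply {V W : FGModuleCat.{u} k} (c : k) (f : V ⟶ W) (x : (V : Type u)) :
    el (c • f) x = c • el f x := rfl

theorem el_ext {V W : FGModuleCat.{u} k} {f g : V ⟶ W} (h : ∀ x : (V : Type u), el f x = el g x) : f = g :=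
  FGModuleCat.hom_ext (LinearMap.ext h)

theorem el_naturality (α : F ⟶ G) {X Y : ℬ} (f : X ⟶ Y) (x : (F.obj X : Type u)) :
    el (α.app Y) (el (F.map f) x) = el (G.map f) (el (α.app X) x) :=
  congrArg (fun z => el z x) (α.naturality f)

theorem Stable.pol {N : ∀ X, Submodule k (F.obj X : Type u)} (hN : Stable F N) {X Y : ℬ}
    (f : Fin d → (X ⟶ Y)) {u : (F.obj X : Type u)} (hu : u ∈ N X) : el (pol d F f) u ∈ N Y := by
  rw [SSH.pol, polar, el_sum_apply]
  exact (N Y).sum_mem fun I _ => (N Y).smul_mem _ (hN _ u hu)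

theorem el_map_comp {X Y Z : ℬ} (f : X ⟶ Y) (g : Y ⟶ Z) (u : (F.obj X : Type u)) :
    el (F.map (f ≫ g)) u = el (F.map g) (el (F.map f) u) :=
  congrArg (fun z => el z u) (F.map_comp f g)

theorem el_map_id {X : ℬ} (u : (F.obj X : Type u)) : el (F.map (𝟙 X)) u = u :=
  congrArg (fun z => el z u) (F.map_id X)

variable [HasFiniteBiproducts ℬ] {R : Type} {e : R → ℬ}

/-- The direct sum of the letters of a word. -/
abbrev word (e : R → ℬ) (w : Fin d → R) : ℬ := ⨁ fun a => e (w a)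

/-- Splitting a vector into its components along the letters of a word. -/
def toWord (F : ℬ ⥤ FGModuleCat.{u} k) {w : Fin d → R} {X : ℬ} (y : ∀ a, X ⟶ e (w a)) :
    F.obj X ⟶ F.obj (word e w) :=
  pol d F fun a => y a ≫ biproduct.ι (fun a => e (w a)) a

/-- Inserting maps from the letters of a word. -/
def ofWord (F : ℬ ⥤ FGModuleCat.{u} k) {w : Fin d → R} {X : ℬ} (x : ∀ a, e (w a) ⟶ X) :
    F.obj (word e w) ⟶ F.obj X :=
  pol d F fun a => biproduct.π (fun a => e (w a)) a ≫ x a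

theorem ofWord_comp_map {w : Fin d → R} {X Y : ℬ} (x : ∀ a, e (w a) ⟶ X) (f : X ⟶ Y) :
    ofWord F x ≫ F.map f = ofWord F fun a => x a ≫ f := by
  simp [ofWord, pol_comp_map]

theorem map_comp_toWord {w : Fin d → R} {X Y : ℬ} (y : ∀ a, X ⟶ e (w a)) (f : Y ⟶ X) :
    F.map f ≫ toWord F y = toWord F fun a => f ≫ y a := by
  simp [toWord, map_comp_pol]

/-- Of the alternating sum defining `ofWord`, only the term using all letters survives: if a letter
is omitted, one slot of the polarization becomes zero. -/
theorem toWord_ofWord (hF : IsDiagFun k d F) {w : Fin d → R} {X Y : ℬ} (y : ∀ a, X ⟶ e (w a))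
    (x : ∀ a, e (w a) ⟶ Y) : toWord F y ≫ ofWord F x = pol d F fun a => y a ≫ x a := by
  classical
  have h1 : ∀ I : Finset (Fin d), toWord F y ≫ F.map (∑ i ∈ I, biproduct.π (fun a => e (w a)) i ≫ x i) =
      pol d F fun a => if a ∈ I then y a ≫ x a else 0 := by
    intro I
    rw [toWord, pol_comp_map]
    congr 1
    funext a
    rw [Preadditive.comp_sum]
    split_ifs with ha
    · rw [Finset.sum_eq_single a]
      · simp
      · intro b _ hb
        simp [biproduct.ι_π_ne_assoc _ hb.symm]
      · intro h; exact absurd ha h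
    · refine Finset.sum_eq_zero fun b hb => ?_
      have : a ≠ b := fun h => ha (h ▸ hb)
      simp [biproduct.ι_π_ne_assoc _ this]
  rw [ofWord, pol, polar, Preadditive.comp_sum, Finset.sum_eq_single Finset.univ]
  · rw [Linear.comp_smul, h1]
    simp
  · intro I _ hI
    obtain ⟨a, ha⟩ : ∃ a, a ∉ I := by
      by_contra! h
      exact hI (Finset.eq_univ_of_forall h)
    rw [Linear.comp_smul, h1, pol_zero hF a (if_neg ha), smul_zero]
  · simp

theorem ofWord_sum (hF : IsDiagFun k d F) {w : Fin d → R} {X : ℬ} {A : Type} [Fintype A]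
    (x : ∀ a, A → (e (w a) ⟶ X)) :
    ofWord F (fun a => ∑ b, x a b) = ∑ v : Fin d → A, ofWord F fun a => x a (v a) := by
  simp only [ofWord, Preadditive.comp_sum]
  exact pol_sum hF fun a b => biproduct.π (fun a => e (w a)) a ≫ x a b

theorem toWord_sum (hF : IsDiagFun k d F) {w : Fin d → R} {X : ℬ} {A : Type} [Fintype A]
    (x : ∀ a, A → (X ⟶ e (w a))) :
    toWord F (fun a => ∑ b, x a b) = ∑ v : Fin d → A, toWord F fun a => x a (v a) := by
  simp only [toWord, Preadditive.sum_comp]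
  exact pol_sum hF fun a b => x a b ≫ biproduct.ι (fun a => e (w a)) a

/-- `ofWord` as a multilinear map. -/
theorem exists_ofWord (hF : IsDiagFun k d F) (w : Fin d → R) (X : ℬ) :
    ∃ m : MultilinearMap k (fun a => e (w a) ⟶ X) (F.obj (word e w) ⟶ F.obj X),
      ∀ x, ofWord F x = m x := by
  obtain ⟨m, hm⟩ := exists_pol hF (word e w) X
  exact ⟨m.compLinearMap fun a => Linear.leftComp k X (biproduct.π (fun a => e (w a)) a), fun x => hm _⟩

variable (hB : IsSplitBasis k e)

-- Maps between letters are scalars or zero, and both `toWord` and `ofWord` are multilinear in the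
-- letters, so the scalars can be moved across an arbitrary linear map `q w`.
include hB in
theorem word_exchange (hF : IsDiagFun k d F) (hG : IsDiagFun k d G)
    (q : ∀ w : Fin d → R, G.obj (word e w) ⟶ F.obj (word e w))
    {w w' : Fin d → R} {X Y : ℬ} (y : ∀ a, X ⟶ e (w a)) (g : ∀ a, e (w a) ⟶ e (w' a))
    (x : ∀ a, e (w' a) ⟶ Y) :
    toWord G y ≫ q w ≫ ofWord F (fun a => g a ≫ x a) =
      toWord G (fun a => y a ≫ g a) ≫ q w' ≫ ofWord F x := by
  by_cases h : w = w'
  · subst h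
    choose c hc using fun a => hB.hom_self (w a) (g a)
    have h1 : ofWord F (fun a => g a ≫ x a) = (∏ a, c a) • ofWord F x := by
      rw [ofWord, ofWord, ← pol_smul hF]
      congr 1; funext a; simp [hc a]
    have h2 : toWord G (fun a => y a ≫ g a) = (∏ a, c a) • toWord G y := by
      rw [toWord, toWord, ← pol_smul hG]
      congr 1; funext a; simp [hc a]
    rw [h1, h2]
    simp
  · obtain ⟨a, ha⟩ := Function.ne_iff.1 h
    have h0 := hB.hom_zero ha (g a)
    have h1 : ofWord F (fun a => g a ≫ x a) = 0 := pol_zero hF a (by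
      show biproduct.π (fun a => e (w a)) a ≫ g a ≫ x a = 0
      rw [h0]; simp)
    have h2 : toWord G (fun a => y a ≫ g a) = 0 := pol_zero hG a (by
      show (y a ≫ g a) ≫ biproduct.ι (fun a => e (w' a)) a = 0
      rw [h0]; simp)
    rw [h1, h2]
    simp

variable (e) in
/-- The morphism obtained by averaging over the words of a decomposition. -/
def avgApp (q : ∀ w : Fin d → R, G.obj (word e w) ⟶ F.obj (word e w)) {X : ℬ} (D : Decomp e X) :
    G.obj X ⟶ F.obj X :=
  ∑ v : Fin d → D.n, toWord G (w := fun a => D.l (v a)) (fun a => D.π (v a)) ≫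
    q (fun a => D.l (v a)) ≫ ofWord F (w := fun a => D.l (v a)) (fun a => D.ι (v a))

-- Decomposing `X` on one side and `Y` on the other turns both composites into double sums, which
-- agree term by term by `word_exchange`. No naturality of `q` is used.
include hB in
theorem avgApp_naturality (hF : IsDiagFun k d F) (hG : IsDiagFun k d G)
    (q : ∀ w : Fin d → R, G.obj (word e w) ⟶ F.obj (word e w)) {X Y : ℬ} (D : Decomp e X)
    (D' : Decomp e Y) (f : X ⟶ Y) : G.map f ≫ avgApp e q D' = avgApp e q D ≫ F.map f := by
  have h1 : avgApp e q D ≫ F.map f = ∑ v : Fin d → D.n, ∑ v' : Fin d → D'.n,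
      toWord G (w := fun a => D.l (v a)) (fun a => D.π (v a)) ≫
        q (fun a => D.l (v a)) ≫ ofWord F (w := fun a => D.l (v a))
          (fun a => (D.ι (v a) ≫ f ≫ D'.π (v' a)) ≫ D'.ι (v' a)) := by
    rw [avgApp, Preadditive.sum_comp]
    refine Finset.sum_congr rfl fun v _ => ?_
    rw [← Preadditive.comp_sum, ← Preadditive.comp_sum, Category.assoc, Category.assoc,
      ofWord_comp_map]
    congr 2
    rw [← ofWord_sum hF (w := fun a => D.l (v a)) fun a b => (D.ι (v a) ≫ f ≫ D'.π b) ≫ D'.ι b]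
    congr 1
    funext a
    have := congrArg (fun z => D.ι (v a) ≫ f ≫ z) D'.total
    simpa [Preadditive.comp_sum] using this.symm
  have h2 : G.map f ≫ avgApp e q D' = ∑ v' : Fin d → D'.n, ∑ v : Fin d → D.n,
      toWord G (w := fun a => D'.l (v' a)) (fun a => D.π (v a) ≫ D.ι (v a) ≫ f ≫ D'.π (v' a)) ≫
        q (fun a => D'.l (v' a)) ≫ ofWord F (w := fun a => D'.l (v' a))
          (fun a => D'.ι (v' a)) := by
    rw [avgApp, Preadditive.comp_sum]
    refine Finset.sum_congr rfl fun v' _ => ?_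
    rw [← Preadditive.sum_comp, ← Category.assoc, map_comp_toWord]
    congr 1
    rw [← toWord_sum hG (w := fun a => D'.l (v' a)) fun a b => D.π b ≫ D.ι b ≫ f ≫ D'.π (v' a)]
    congr 1
    funext a
    have := congrArg (fun z => z ≫ f ≫ D'.π (v' a)) D.total
    simpa [Preadditive.sum_comp] using this.symm
  rw [h1, h2, Finset.sum_comm]
  refine Finset.sum_congr rfl fun v _ => Finset.sum_congr rfl fun v' _ => ?_
  exact (word_exchange hB hF hG q (w := fun a => D.l (v a)) (w' := fun a => D'.l (v' a))
    (fun a => D.π (v a)) (fun a => D.ι (v a) ≫ f ≫ D'.π (v' a)) (fun a => D'.ι (v' a))).symm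

/-- Polarize the decomposition of the identity of `X`; on the diagonal the polarization is `d!`
times `F`. Thus, up to an invertible factor, `F X` is recovered from words. -/
theorem sum_toWord_ofWord (hF : IsDiagFun k d F) {X : ℬ} (D : Decomp e X) :
    ∑ v : Fin d → D.n, toWord F (w := fun a => D.l (v a)) (fun a => D.π (v a)) ≫
      ofWord F (w := fun a => D.l (v a)) (fun a => D.ι (v a)) = (d.factorial : k) • 𝟙 (F.obj X) := by
  have h := pol_sum hF (fun (_ : Fin d) (b : D.n) => D.π b ≫ D.ι b)
  rw [D.total, pol_diag hF, F.map_id] at h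
  rw [h]
  exact Finset.sum_congr rfl fun v _ => toWord_ofWord hF (w := fun a => D.l (v a)) _ _

theorem el_avgApp (q : ∀ w : Fin d → R, G.obj (word e w) ⟶ F.obj (word e w)) {X : ℬ}
    (D : Decomp e X) (u : (G.obj X : Type u)) : el (avgApp e q D) u =
      ∑ v : Fin d → D.n, el (ofWord F (w := fun a => D.l (v a)) fun a => D.ι (v a))
        (el (q fun a => D.l (v a))
          (el (toWord G (w := fun a => D.l (v a)) fun a => D.π (v a)) u)) :=
  el_sum_apply _ _ _

theorem el_sum_toWord_ofWord (hF : IsDiagFun k d F) {X : ℬ} (D : Decomp e X)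
    (u : (F.obj X : Type u)) :
    ∑ v : Fin d → D.n, el (ofWord F (w := fun a => D.l (v a)) fun a => D.ι (v a))
      (el (toWord F (w := fun a => D.l (v a)) fun a => D.π (v a)) u) = (d.factorial : k) • u :=
  (el_sum_apply _ _ _).symm.trans (congrArg (fun z => el z u) (sum_toWord_ofWord hF D))

theorem Stable.ofWord {N : ∀ X, Submodule k (F.obj X : Type u)} (hN : Stable F N) {w : Fin d → R}
    {X : ℬ} (x : ∀ a, e (w a) ⟶ X) {u : (F.obj (word e w) : Type u)} (hu : u ∈ N _) :
    el (ofWord F x) u ∈ N X :=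
  hN.pol _ hu

theorem Stable.toWord {N : ∀ X, Submodule k (F.obj X : Type u)} (hN : Stable F N) {w : Fin d → R}
    {X : ℬ} (y : ∀ a, X ⟶ e (w a)) {u : (F.obj X : Type u)} (hu : u ∈ N _) :
    el (toWord F y) u ∈ N _ :=
  hN.pol _ hu

theorem exists_projection {V : FGModuleCat.{u} k} (N : Submodule k (V : Type u)) :
    ∃ q : V ⟶ V, (∀ u, el q u ∈ N) ∧ ∀ u ∈ N, el q u = u := by
  obtain ⟨f, hf⟩ := LinearMap.exists_leftInverse_of_injective N.subtype (Submodule.ker_subtype _)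
  exact ⟨FGModuleCat.ofHom (N.subtype ∘ₗ f), fun u => (f u).2, fun u hu =>
    congrArg Subtype.val (LinearMap.congr_fun hf ⟨u, hu⟩)⟩

include hB in
/-- Subfunctors of homogeneous functors have complements. -/
theorem Stable.exists_idempotent [CharZero k] (hF : IsDiagFun k d F)
    {N : ∀ X, Submodule k (F.obj X : Type u)} (hN : Stable F N) :
    ∃ p : F ⟶ F, (∀ X u, el (p.app X) u ∈ N X) ∧ ∀ X, ∀ u ∈ N X, el (p.app X) u = u := by
  -- Merely linear projections on words; averaging makes them natural, and dividing by `d!` makes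
  -- the result the identity on `N`.
  choose q hq1 hq2 using fun w : Fin d → R => exists_projection (N (word e w))
  have hd : (d.factorial : k) ≠ 0 := Nat.cast_ne_zero.2 d.factorial_ne_zero
  let p : F ⟶ F :=
    { app X := (d.factorial : k)⁻¹ • avgApp e q (hB.decomp X).some
      naturality X Y f := by
        rw [Linear.comp_smul, Linear.smul_comp, avgApp_naturality hB hF hF] }
  have hp : ∀ X u, el (p.app X) u =
      (d.factorial : k)⁻¹ • el (avgApp e q (hB.decomp X).some) u := fun X u => rfl
  refine ⟨p, fun X u => ?_, fun X u hu => ?_⟩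
  · rw [hp, el_avgApp]
    exact (N X).smul_mem _ ((N X).sum_mem fun v _ => hN.ofWord _ (hq1 _ _))
  · rw [hp, el_avgApp, inv_smul_eq_iff₀ hd, ← el_sum_toWord_ofWord hF (hB.decomp X).some]
    exact Finset.sum_congr rfl fun v _ => congrArg _ (hq2 _ _ (hN.toWord _ hu))

end Polar

/-! ### Further closure properties of polynomial maps. -/

theorem IsVPoly.sub {W : Type*} [AddCommGroup W] [Module k W] {D : ℕ} {h h' : k → W}
    (hh : IsVPoly D h) (hh' : IsVPoly D h') : IsVPoly D (fun s => h s - h' s) := by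
  obtain ⟨w, hw⟩ := hh
  obtain ⟨w', hw'⟩ := hh'
  exact ⟨w - w', fun s => by simp [hw, hw', smul_sub, Finset.sum_sub_distrib]⟩

theorem isVPoly_pow_smul {W : Type*} [AddCommGroup W] [Module k W] {D j : ℕ} (hj : j ≤ D) (b : W) :
    IsVPoly D (fun s : k => s ^ j • b) := by
  refine ⟨Pi.single ⟨j, by omega⟩ b, fun s => ?_⟩
  rw [Finset.sum_eq_single (⟨j, by omega⟩ : Fin (D + 1))]
  · simp
  · intro i _ hi
    simp [hi]
  · simp

/-- Homogeneity for nonzero scalars suffices, since both sides are polynomial in `c`. -/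
theorem IsPolyMap.isDiag [CharZero k] {V W : Type*} [AddCommGroup V] [Module k V] [AddCommGroup W]
    [Module k W] {d D : ℕ} {f : V → W} (hf : IsPolyMap k D f) (hD : d ≤ D)
    (hd : ∀ (c : k) x, c ≠ 0 → f (c • x) = c ^ d • f x) : IsDiag k d f := by
  refine hf.exists_multilinear fun c x => sub_eq_zero.1 ?_
  exact ((hf.isVPoly_smul x).sub (isVPoly_pow_smul hD (f x))).eq_of_forall_ne 0 0
    (fun s hs => sub_eq_zero.2 (hd s x hs)) c

theorem isPolyMap_affine {V W : Type*} [AddCommGroup V] [Module k V] [AddCommGroup W]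
    [Module k W] [Module.Finite k V] (A : V →ₗ[k] W) (b : W) : IsPolyMap k 1 (fun x => A x + b) := by
  let β := Module.finBasis k V
  refine IsPolyMap.of_fintype (α := Option (Fin (Module.finrank k V)))
    (fun o => o.elim 1 fun i => MvPolynomial.X (β.coord i)) (fun o => o.elim b fun i => A (β i)) ?_ ?_
  · rintro (_ | i)
    · simp
    · simp
  · intro x
    rw [Fintype.sum_option]
    have := congrArg A (β.sum_repr x)
    simp only [map_sum, map_smul] at this
    simp [this, add_comm]

theorem IsDiag.smul {V W : Type*} [AddCommGroup V] [Module k V] [AddCommGroup W]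
    [Module k W] {d : ℕ} {f : V → W} (hf : IsDiag k d f) (c : k) (x : V) : f (c • x) = c ^ d • f x := by
  obtain ⟨m, hm⟩ := hf
  rw [hm, hm, m.map_smul_univ (fun _ => c)]
  simp

/-! ### Weights for the scaling of one summand. -/

section Weights

variable {ℬ : Type (u + 1)} [Category.{u} ℬ] [Preadditive ℬ] [Linear k ℬ] [HasBinaryBiproducts ℬ]

/-- Scaling the second summand. -/
def tau (Y E : ℬ) (s : k) : Y ⊞ E ⟶ Y ⊞ E :=
  biprod.fst ≫ biprod.inl + s • (biprod.snd ≫ biprod.inr)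

theorem tau_one (Y E : ℬ) : tau Y E (1 : k) = 𝟙 _ := by
  rw [tau, one_smul, biprod.total]

theorem tau_comp (Y E : ℬ) (s t : k) : tau Y E s ≫ tau Y E t = tau Y E (s * t) := by
  simp [tau, smul_smul, mul_comm]

theorem tau_map (E : ℬ) {Y X : ℬ} (g : Y ⟶ X) (s : k) :
    tau Y E s ≫ biprod.map g (𝟙 E) = biprod.map g (𝟙 E) ≫ tau X E s := by
  simp [tau, biprod.map_eq]

theorem upper_tau {Y E : ℬ} (a : Y ⟶ E) (t : k) :
    (𝟙 _ + biprod.fst ≫ a ≫ biprod.inr) ≫ tau Y E t =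
      tau Y E t ≫ (𝟙 _ + t • (biprod.fst ≫ a ≫ biprod.inr)) := by
  simp [tau]
  abel

theorem tau_lower {Y E : ℬ} (b : E ⟶ Y) (t : k) :
    tau Y E t ≫ (𝟙 _ + biprod.snd ≫ b ≫ biprod.inl) =
      (𝟙 _ + t • (biprod.snd ≫ b ≫ biprod.inl)) ≫ tau Y E t := by
  simp [tau]
  abel

/-- Gauss elimination on the `2 × 2` matrix of `f`, with the scalar corner at `E` as pivot; `g` is
the Schur complement. -/
theorem eq_upper_lower {Y X E : ℬ} (f : Y ⊞ E ⟶ X ⊞ E) {s : k} (hs : s ≠ 0)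
    (h : biprod.inr ≫ f ≫ biprod.snd = s • 𝟙 E) :
    ∃ (a : Y ⟶ E) (g : Y ⟶ X) (b : E ⟶ X), f = (𝟙 _ + biprod.fst ≫ a ≫ biprod.inr) ≫ tau Y E s ≫
      biprod.map g (𝟙 E) ≫ (𝟙 _ + biprod.snd ≫ b ≫ biprod.inl) := by
  refine ⟨s⁻¹ • (biprod.inl ≫ f ≫ biprod.snd), biprod.inl ≫ f ≫ biprod.fst -
    s⁻¹ • ((biprod.inl ≫ f ≫ biprod.snd) ≫ (biprod.inr ≫ f ≫ biprod.fst)),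
    s⁻¹ • (biprod.inr ≫ f ≫ biprod.fst), ?_⟩
  refine biprod.hom_ext' _ _ (biprod.hom_ext _ _ ?_ ?_) (biprod.hom_ext _ _ ?_ ?_)
  · simp [tau, smul_smul, hs]
  · simp [tau, smul_smul, hs]
  · simp [tau, smul_smul, hs]
  · simp [tau, smul_smul, hs, h]

variable {F : ℬ ⥤ FGModuleCat.{u} k} {d : ℕ}

theorem isVPoly_map (hF : IsDiagFun k d F) {X Y : ℬ} (f g : X ⟶ Y) :
    IsVPoly d (fun s : k => F.map (f + s • g)) :=
  (hF X Y).isVPoly f g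

def elAt {V W : FGModuleCat.{u} k} (u : (V : Type u)) : (V ⟶ W) →ₗ[k] (W : Type u) :=
  (LinearMap.applyₗ u).comp (homEquivLin V W).toLinearMap

theorem elAt_apply {V W : FGModuleCat.{u} k} (u : (V : Type u)) (f : V ⟶ W) : elAt u f = el f u := rfl

variable (F) in
/-- The vectors of weight `j` under scaling of the summand `E`. -/
def wt (E : ℬ) (j : ℕ) (Y : ℬ) : Submodule k (F.obj (Y ⊞ E) : Type u) where
  carrier := {u | ∀ s : k, el (F.map (tau Y E s)) u = s ^ j • u}
  add_mem' {x y} hx hy s := by rw [map_add, hx, hy, smul_add]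
  zero_mem' s := by rw [map_zero, smul_zero]
  smul_mem' c x hx s := by rw [map_smul, hx, smul_comm]

variable {E : ℬ}

theorem wt_map {j : ℕ} {Y X : ℬ} (g : Y ⟶ X) {u : (F.obj (Y ⊞ E) : Type u)} (hu : u ∈ wt F E j Y) :
    el (F.map (biprod.map g (𝟙 E))) u ∈ wt F E j X := by
  intro s
  rw [← el_map_comp, ← tau_map, el_map_comp, hu s, map_smul]

variable (F E) in
/-- The projection to the vectors of weight `j`. -/
def wtProj (d : ℕ) (j : Fin (d + 1)) (Y : ℬ) : F.obj (Y ⊞ E) ⟶ F.obj (Y ⊞ E) :=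
  coefAt d (fun s : k => F.map (tau Y E s)) j

variable [CharZero k]

/-- Scaling by `2` already separates weights, as powers of `2` are distinct in characteristic zero.
-/
theorem wt_disjoint {i j : ℕ} (hij : i ≠ j) {Y : ℬ} {u : (F.obj (Y ⊞ E) : Type u)}
    (hi : u ∈ wt F E i Y) (hj : u ∈ wt F E j Y) : u = 0 := by
  have h : ((2 : k) ^ i - 2 ^ j) • u = 0 := by rw [sub_smul, ← hi 2, ← hj 2, sub_self]
  refine (smul_eq_zero.1 h).resolve_left (sub_ne_zero.2 fun h => hij ?_)
  exact Nat.pow_right_injective le_rfl (by exact_mod_cast h)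

section

variable (hF : IsDiagFun k d F)
include hF

theorem map_tau (Y : ℬ) (s : k) :
    F.map (tau Y E s) = ∑ j : Fin (d + 1), s ^ (j : ℕ) • wtProj F E d j Y :=
  (isVPoly_map hF _ _).eq_sum s

theorem wtProj_comp_tau (j : Fin (d + 1)) (Y : ℬ) (s : k) :
    wtProj F E d j Y ≫ F.map (tau Y E s) = s ^ (j : ℕ) • wtProj F E d j Y := by
  refine (coefAt_map d (fun t : k => F.map (tau Y E t)) (Linear.rightComp k _ (F.map (tau Y E s))) j).symm.trans
    (coefAt_eq (w := fun j : Fin (d + 1) => s ^ (j : ℕ) • wtProj F E d j Y) (fun t => ?_) j)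
  show F.map (tau Y E t) ≫ F.map (tau Y E s) = _
  rw [← F.map_comp, tau_comp, map_tau hF]
  simp [mul_pow, smul_smul]

theorem tau_comp_wtProj (j : Fin (d + 1)) (Y : ℬ) (s : k) :
    F.map (tau Y E s) ≫ wtProj F E d j Y = s ^ (j : ℕ) • wtProj F E d j Y := by
  refine (coefAt_map d (fun t : k => F.map (tau Y E t)) (Linear.leftComp k _ (F.map (tau Y E s))) j).symm.trans
    (coefAt_eq (w := fun j : Fin (d + 1) => s ^ (j : ℕ) • wtProj F E d j Y) (fun t => ?_) j)
  show F.map (tau Y E s) ≫ F.map (tau Y E t) = _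
  rw [← F.map_comp, tau_comp, map_tau hF]
  simp [mul_pow, smul_smul, mul_comm]

theorem wtProj_mem (j : Fin (d + 1)) (Y : ℬ) (u : (F.obj (Y ⊞ E) : Type u)) :
    el (wtProj F E d j Y) u ∈ wt F E j Y := fun s =>
  congrArg (fun z => el z u) (wtProj_comp_tau hF j Y s)

theorem el_wtProj_tau (j : Fin (d + 1)) (Y : ℬ) (s : k) (u : (F.obj (Y ⊞ E) : Type u)) :
    el (wtProj F E d j Y) (el (F.map (tau Y E s)) u) = s ^ (j : ℕ) • el (wtProj F E d j Y) u :=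
  congrArg (fun z => el z u) (tau_comp_wtProj hF j Y s)

theorem sum_wtProj (Y : ℬ) (u : (F.obj (Y ⊞ E) : Type u)) :
    ∑ j : Fin (d + 1), el (wtProj F E d j Y) u = u := by
  have h := map_tau (E := E) hF Y 1
  simp only [one_pow, one_smul, tau_one, F.map_id] at h
  exact (el_sum_apply _ _ _).symm.trans (congrArg (fun z => el z u) h.symm)

theorem wtProj_of_mem {j : Fin (d + 1)} {Y : ℬ} {u : (F.obj (Y ⊞ E) : Type u)}
    (hu : u ∈ wt F E j Y) : el (wtProj F E d j Y) u = u := by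
  refine Eq.trans (Finset.sum_eq_single (s := Finset.univ) (f := fun i => el (wtProj F E d i Y) u) j
    (fun i _ hi => ?_) fun h => absurd (Finset.mem_univ _) h).symm (sum_wtProj hF Y u)
  refine wt_disjoint (Fin.val_ne_of_ne hi) (wtProj_mem hF i Y u) fun s => ?_
  rw [wtProj_mem hF i Y u s, ← el_wtProj_tau hF, hu s, map_smul]

theorem wt_eq_bot {j : ℕ} (hj : d < j) (Y : ℬ) : wt F E j Y = ⊥ := by
  refine (Submodule.eq_bot_iff _).2 fun u hu => ?_
  rw [← sum_wtProj hF Y u]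
  refine Finset.sum_eq_zero fun i _ => wt_disjoint (i := i) (j := j) (by omega) (wtProj_mem hF i Y u) fun s => ?_
  rw [wtProj_mem hF i Y u s, ← el_wtProj_tau hF, hu s, map_smul]

/-- A map `a : Y ⟶ E` raises the weight: conjugation by `tau` rescales `t`, so the coefficient of `t
^ i` in the action of `1 + t a` on `v` has weight `D + i`. As no weight exceeds `D`, only the
constant coefficient `v` remains. -/
theorem upper_fixes {D : ℕ} (hD : ∀ j, D < j → ∀ Y, wt F E j Y = ⊥) {Y : ℬ} (a : Y ⟶ E)
    {v : (F.obj (Y ⊞ E) : Type u)} (hv : v ∈ wt F E D Y) :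
    el (F.map (𝟙 _ + biprod.fst ≫ a ≫ biprod.inr)) v = v := by
  let h : k → (F.obj (Y ⊞ E) : Type u) := fun t =>
    el (F.map (𝟙 _ + t • (biprod.fst ≫ a ≫ biprod.inr))) v
  have hh : IsVPoly d h := (isVPoly_map hF (𝟙 (Y ⊞ E)) (biprod.fst ≫ a ≫ biprod.inr)).map (elAt v)
  have h1 : ∀ t, el (F.map (tau Y E t)) (h 1) = t ^ D • h t := by
    intro t
    have := upper_tau a t
    show el (F.map (tau Y E t)) (el (F.map (𝟙 _ + (1 : k) • (biprod.fst ≫ a ≫ biprod.inr))) v) = _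
    rw [one_smul, ← el_map_comp, this, el_map_comp, hv t, map_smul]
  -- For `t ≠ 0` cancel `t ^ D` in `h1`; polynomiality in `t` supplies `t = 0`.
  have h2 : ∀ s t, el (F.map (tau Y E s)) (h t) = s ^ D • h (s * t) := by
    intro s t
    refine sub_eq_zero.1 ((IsVPoly.sub (hh.map (el (F.map (tau Y E s))))
      (h' := fun t => s ^ D • h (s * t)) ?_).eq_of_forall_ne 0 0 (fun t ht => sub_eq_zero.2 ?_) t)
    · obtain ⟨w, hw⟩ := hh
      exact ⟨fun i => (s ^ D * s ^ (i : ℕ)) • w i, fun t => by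
        simp only [hw, Finset.smul_sum, smul_smul]
        exact Finset.sum_congr rfl fun x _ => by congr 1; ring⟩
    · have h3 : el (F.map (tau Y E s)) (el (F.map (tau Y E t)) (h 1)) = (t * s) ^ D • h (t * s) := by
        rw [← el_map_comp, tau_comp, h1]
      rw [h1, map_smul, mul_pow, mul_smul, mul_comm t s] at h3
      exact smul_right_injective _ (pow_ne_zero D ht) h3
  have h4 : ∀ i : Fin (d + 1), coefAt d h i ∈ wt F E (D + i) Y := by
    intro i s
    rw [← coefAt_map]
    simp only [h2]
    refine coefAt_eq (w := fun i : Fin (d + 1) => s ^ (D + i : ℕ) • coefAt d h i) (fun t => ?_) i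
    rw [hh.eq_sum (s * t)]
    simp only [Finset.smul_sum, smul_smul]
    exact Finset.sum_congr rfl fun x _ => by congr 1; ring
  have h5 : ∀ t, h t = coefAt d h 0 := by
    intro t
    rw [hh.eq_sum t, Fin.sum_univ_succ]
    have : ∀ i : Fin d, coefAt d h i.succ = 0 := fun i =>
      (Submodule.eq_bot_iff _).1 (hD (D + (i.succ : ℕ)) (by simp) Y) _ (h4 i.succ)
    simp [this]
  have h6 : h 0 = v := by
    show el (F.map (𝟙 _ + (0 : k) • (biprod.fst ≫ a ≫ biprod.inr))) v = v
    rw [zero_smul, add_zero, el_map_id]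
  have h7 : h 1 = el (F.map (𝟙 _ + biprod.fst ≫ a ≫ biprod.inr)) v := by
    show el (F.map (𝟙 _ + (1 : k) • (biprod.fst ≫ a ≫ biprod.inr))) v = _
    rw [one_smul]
  rw [← h7, h5 1, ← h5 0, h6]

/-- A map `b : E ⟶ X` lowers the weight. Conjugation by `tau` shows that the weight `D` component of
`F(1 + t b) u` does not depend on `t ≠ 0`; being polynomial in `t`, it equals its value `u` at `t =
0`. -/
theorem lower_fixes (D : Fin (d + 1)) {X : ℬ} (b : E ⟶ X) {u : (F.obj (X ⊞ E) : Type u)}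
    (hu : u ∈ wt F E D X) :
    el (wtProj F E d D X) (el (F.map (𝟙 _ + biprod.snd ≫ b ≫ biprod.inl)) u) = u := by
  let g : k → (F.obj (X ⊞ E) : Type u) := fun t =>
    el (F.map (𝟙 _ + t • (biprod.snd ≫ b ≫ biprod.inl))) u
  have hg : IsVPoly d g := (isVPoly_map hF (𝟙 (X ⊞ E)) (biprod.snd ≫ b ≫ biprod.inl)).map (elAt u)
  have h1 : g 1 = el (F.map (𝟙 _ + biprod.snd ≫ b ≫ biprod.inl)) u := by
    show el (F.map (𝟙 _ + (1 : k) • (biprod.snd ≫ b ≫ biprod.inl))) u = _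
    rw [one_smul]
  have h0 : g 0 = u := by
    show el (F.map (𝟙 _ + (0 : k) • (biprod.snd ≫ b ≫ biprod.inl))) u = u
    rw [zero_smul, add_zero, el_map_id]
  have h2 := (hg.map (el (wtProj F E d D X))).eq_of_forall_ne 0 (el (wtProj F E d D X) (g 1))
    (fun t ht => ?_) 0
  · rw [← h1, ← h2, h0, wtProj_of_mem hF hu]
  · have h3 : el (F.map (tau X E t)) (g t) = t ^ (D : ℕ) • g 1 := by
      rw [h1, ← map_smul, ← hu t, ← el_map_comp, ← el_map_comp, tau_lower]
    have h4 := congrArg (el (wtProj F E d D X)) h3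
    rw [el_wtProj_tau hF, map_smul] at h4
    exact smul_right_injective _ (pow_ne_zero (D : ℕ) ht) h4

/-- Vectors of top weight which are moved around by all of `F` and projected to the top weight are
moved by maps between the first summands only. -/
theorem wtProj_map_mem (hE : ∀ f : E ⟶ E, ∃ c : k, f = c • 𝟙 E) {D : Fin (d + 1)}
    (hD : ∀ j, (D : ℕ) < j → ∀ Y, wt F E j Y = ⊥)
    {N : ∀ Y, Submodule k (F.obj (Y ⊞ E) : Type u)} (hN : ∀ Y, N Y ≤ wt F E D Y)
    (hN' : ∀ ⦃Y X : ℬ⦄ (g : Y ⟶ X) u, u ∈ N Y → el (F.map (biprod.map g (𝟙 E))) u ∈ N X)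
    {Y X : ℬ} (f : Y ⊞ E ⟶ X ⊞ E) {v : (F.obj (Y ⊞ E) : Type u)} (hv : v ∈ N Y) :
    el (wtProj F E d D X) (el (F.map f) v) ∈ N X := by
  -- With an invertible corner, the upper factor fixes `v`, `tau` scales it, the diagonal factor
  -- preserves `N`, and the lower factor does not change the component of weight `D`.
  have key : ∀ (s : k) (f : Y ⊞ E ⟶ X ⊞ E), s ≠ 0 → biprod.inr ≫ f ≫ biprod.snd = s • 𝟙 E →
      el (wtProj F E d D X) (el (F.map f) v) ∈ N X := by
    intro s f hs h
    obtain ⟨a, g, b, rfl⟩ := eq_upper_lower f hs h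
    rw [el_map_comp, upper_fixes hF hD a (hN Y hv), el_map_comp, hN Y hv s, map_smul, map_smul,
      el_map_comp, lower_fixes hF D b (wt_map g (hN Y hv))]
    exact (N X).smul_mem _ (hN' g v hv)
  obtain ⟨s, hs⟩ := hE (biprod.inr ≫ f ≫ biprod.snd)
  -- Adding `t` times the identity of `E` makes the corner invertible except for `t = -s`; the
  -- membership then extends to `t = 0` even if `s = 0`.
  have h1 := ((isVPoly_map hF f (biprod.snd ≫ biprod.inr)).map
    ((el (wtProj F E d D X)).comp (elAt v))).mem_of_forall_ne (N X) (-s) (fun t ht => ?_) 0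
  · simpa [elAt_apply] using h1
  · refine key (s + t) _ (fun h => ht (eq_neg_of_add_eq_zero_right h)) ?_
    simp [hs, add_smul]

end

end Weights

/-! ### Simple functors, generated subfunctors and eigenvectors. -/

section Simp

variable {ℬ : Type (u + 1)} [Category.{u} ℬ] [Preadditive ℬ] [Linear k ℬ]

/-- `F` is nonzero and has no nontrivial subfunctors. -/
def SimpFun (F : ℬ ⥤ FGModuleCat.{u} k) : Prop :=
  (∃ (X : ℬ) (u : (F.obj X : Type u)), u ≠ 0) ∧
    ∀ N : ∀ X, Submodule k (F.obj X : Type u), Stable F N → (∀ X, N X = ⊥) ∨ ∀ X, N X = ⊤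

variable {F : ℬ ⥤ FGModuleCat.{u} k}

theorem stable_eigen (α : F ⟶ F) (c : k) :
    Stable F fun X => LinearMap.ker (el (α.app X) - c • LinearMap.id) := by
  intro X Y f u hu
  have h1 : el (α.app X) u = c • u := sub_eq_zero.1 hu
  refine sub_eq_zero.2 ?_
  show el (α.app Y) (el (F.map f) u) = c • el (F.map f) u
  rw [el_naturality, h1, map_smul]

/-- One eigenvector suffices: the eigenspaces of a natural endomorphism form a subfunctor, which is
nonzero and hence everything. -/
theorem SimpFun.eq_smul (hF : SimpFun F) (α : F ⟶ F) {X : ℬ} {u : (F.obj X : Type u)} (hu : u ≠ 0)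
    {c : k} (h : el (α.app X) u = c • u) : α = c • 𝟙 F := by
  have h1 : u ∈ LinearMap.ker (el (α.app X) - c • LinearMap.id) := sub_eq_zero.2 h
  have h2 := (hF.2 _ (stable_eigen α c)).resolve_left fun h2 => hu (by
    rw [h2 X] at h1; exact h1)
  ext Y : 2
  refine el_ext fun x => ?_
  have h3 : x ∈ LinearMap.ker (el (α.app Y) - c • LinearMap.id) := by
    rw [h2 Y]; trivial
  exact sub_eq_zero.1 h3

/-- The subfunctor generated by a family of vectors. -/
def genBy (F : ℬ ⥤ FGModuleCat.{u} k) {A : Type*} (Y : A → ℬ) (v : ∀ a, (F.obj (Y a) : Type u)) :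
    ∀ X, Submodule k (F.obj X : Type u) := fun X =>
  Submodule.span k (Set.range fun p : Σ a, (Y a ⟶ X) => el (F.map p.2) (v p.1))

theorem genBy_stable {A : Type*} (Y : A → ℬ) (v : ∀ a, (F.obj (Y a) : Type u)) :
    Stable F (genBy F Y v) := by
  intro X X' f u hu
  refine Submodule.span_induction (p := fun u _ => el (F.map f) u ∈ genBy F Y v X') ?_ ?_ ?_ ?_ hu
  · rintro _ ⟨⟨a, g⟩, rfl⟩
    exact Submodule.subset_span ⟨⟨a, g ≫ f⟩, el_map_comp _ _ _⟩
  · rw [map_zero]; exact Submodule.zero_mem _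
  · intro x y _ _ hx hy
    rw [map_add]; exact Submodule.add_mem _ hx hy
  · intro c x _ hx
    rw [map_smul]; exact Submodule.smul_mem _ c hx

theorem mem_genBy {A : Type*} (Y : A → ℬ) (v : ∀ a, (F.obj (Y a) : Type u)) (a : A) :
    v a ∈ genBy F Y v (Y a) :=
  Submodule.subset_span ⟨⟨a, 𝟙 _⟩, el_map_id _⟩

theorem SimpFun.genBy_eq_top (hF : SimpFun F) {A : Type*} {Y : A → ℬ}
    {v : ∀ a, (F.obj (Y a) : Type u)} {a : A} (h : v a ≠ 0) (X : ℬ) : genBy F Y v X = ⊤ := by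
  refine (hF.2 _ (genBy_stable Y v)).resolve_left (fun h2 => h ?_) X
  have := mem_genBy (F := F) Y v a
  rw [h2] at this
  exact this

/-- In degree zero every endomorphism of `X` acts as the identity, so a nonzero `u` generates only
its own line in `F X`; by simplicity this line is all of `F X`, and `u` is an eigenvector. -/
theorem SimpFun.scalar_zero (hF : SimpFun F) (hd : IsDiagFun k 0 F) (α : F ⟶ F) :
    ∃ c : k, α = c • 𝟙 F := by
  obtain ⟨X, u, hu⟩ := hF.1
  have h1 : el (α.app X) u ∈ genBy F (fun _ : Unit => X) (fun _ => u) X := by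
    rw [hF.genBy_eq_top (a := ()) hu]; trivial
  have h2 : ∀ f : X ⟶ X, F.map f = F.map (𝟙 X) := fun f => by
    obtain ⟨m, hm⟩ := hd X X
    exact (hm f).trans ((congrArg m (Subsingleton.elim _ _)).trans (hm (𝟙 X)).symm)
  have h3 : genBy F (fun _ : Unit => X) (fun _ => u) X ≤ Submodule.span k {u} := by
    refine Submodule.span_le.2 ?_
    rintro _ ⟨⟨a, f⟩, rfl⟩
    show el (F.map f) u ∈ _
    rw [h2, el_map_id]
    exact Submodule.mem_span_singleton_self u
  obtain ⟨c, hc⟩ := Submodule.mem_span_singleton.1 (h3 h1)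
  exact ⟨c, hF.eq_smul α hu hc.symm⟩

end Simp

/-! ### Top-weight vectors and absolute simplicity. -/

section Top

variable {ℬ : Type (u + 1)} [Category.{u} ℬ] [Preadditive ℬ] [Linear k ℬ] [HasBinaryBiproducts ℬ]
  {F : ℬ ⥤ FGModuleCat.{u} k} {d : ℕ}

theorem biprod_map_id_left (E Y : ℬ) : biprod.map (𝟙 Y) (𝟙 E) = 𝟙 (Y ⊞ E) := by
  rw [biprod.map_eq]; simp

theorem biprod_map_comp_left (E : ℬ) {X Y Z : ℬ} (f : X ⟶ Y) (g : Y ⟶ Z) :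
    biprod.map (f ≫ g) (𝟙 E) = biprod.map f (𝟙 E) ≫ biprod.map g (𝟙 E) := by
  simp [biprod.map_eq]

variable (F) in
/-- The functor of vectors of weight `j`. -/
def wtFun (E : ℬ) (j : ℕ) : ℬ ⥤ FGModuleCat.{u} k where
  obj Y := FGModuleCat.of k (wt F E j Y)
  map {Y X} f := FGModuleCat.ofHom
    ((el (F.map (biprod.map f (𝟙 E)))).restrict (p := wt F E j Y) (q := wt F E j X)
      fun _ hu => wt_map f hu)
  map_id Y := el_ext fun u => Subtype.ext (by
    show el (F.map (biprod.map (𝟙 Y) (𝟙 E))) u.1 = u.1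
    rw [biprod_map_id_left, el_map_id])
  map_comp f g := el_ext fun u => Subtype.ext (by
    show el (F.map (biprod.map (f ≫ g) (𝟙 E))) u.1 = _
    rw [biprod_map_comp_left, el_map_comp]
    rfl)

variable [CharZero k] (hfin : ∀ X Y : ℬ, Module.Finite k (X ⟶ Y))

-- Scaling `f` by `c` is scaling of the whole map `Y ⊞ E ⟶ X ⊞ E` by `c` combined with `tau` at
-- `c⁻¹`, which gives `c ^ d` times `c ^ (-D)` on vectors of weight `D`. Polynomiality holds because
-- the extended map is affine in `f`.
include hfin in
theorem wtFun_isDiagFun (hF : IsDiagFun k d F) (E : ℬ) (D : Fin (d + 1)) :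
    IsDiagFun k (d - D) (wtFun F E D) := by
  intro Y X
  have := hfin Y X
  let Q : (F.obj (X ⊞ E) : Type u) →ₗ[k] wt F E D X :=
    (el (wtProj F E d D X)).codRestrict _ (wtProj_mem hF D X)
  let Λ : (F.obj (Y ⊞ E) ⟶ F.obj (X ⊞ E)) →ₗ[k] ((wtFun F E D).obj Y ⟶ (wtFun F E D).obj X) :=
    (homEquivLin ((wtFun F E D).obj Y) ((wtFun F E D).obj X)).symm.toLinearMap.comp
      ((LinearMap.llcomp k _ _ _ Q).comp ((LinearMap.lcomp k _ (wt F E D Y).subtype).comp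
        (homEquivLin _ _).toLinearMap))
  let A : (Y ⟶ X) →ₗ[k] (Y ⊞ E ⟶ X ⊞ E) :=
    (Linear.leftComp k _ biprod.fst).comp (Linear.rightComp k _ biprod.inl)
  have h1 : ∀ f : Y ⟶ X, biprod.map f (𝟙 E) = A f + biprod.snd ≫ biprod.inr := fun f => by
    rw [biprod.map_eq]; simp [A]
  have h2 : ∀ f : Y ⟶ X, (wtFun F E D).map f = Λ (F.map (biprod.map f (𝟙 E))) := fun f =>
    el_ext fun u => Subtype.ext (wtProj_of_mem hF (wt_map f u.2)).symm
  obtain ⟨m, hm⟩ := hF (Y ⊞ E) (X ⊞ E)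
  have h3 := IsPolyMap.multilinear (fun _ : Fin d => isPolyMap_affine A (biprod.snd ≫ biprod.inr))
    (Λ.compMultilinearMap m)
  have h4 : (fun f : Y ⟶ X => (wtFun F E D).map f) =
      fun f => (Λ.compMultilinearMap m) fun _ => A f + biprod.snd ≫ biprod.inr := by
    funext f
    rw [h2, h1]
    exact congrArg Λ (hm _)
  rw [h4]
  refine h3.isDiag (by simp) fun c f hc => ?_
  have h5 := congrFun h4 f
  have h6 := congrFun h4 (c • f)
  rw [← h5, ← h6]
  refine el_ext fun u => Subtype.ext ?_
  show el (F.map (biprod.map (c • f) (𝟙 E))) u.1 = c ^ (d - (D : ℕ)) • el (F.map (biprod.map f (𝟙 E))) u.1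
  have h7 : biprod.map (c • f) (𝟙 E) = c • (tau Y E c⁻¹ ≫ biprod.map f (𝟙 E)) := by
    simp [biprod.map_eq, tau, smul_smul, hc]
  rw [h7, (hF _ _).smul, el_smul_apply, el_map_comp, u.2, map_smul, smul_smul]
  congr 1
  rw [inv_pow, ← div_eq_mul_inv, pow_sub₀ _ hc (by omega), div_eq_mul_inv]

/-- A nonzero top-weight vector `v` generates all of `F`. Projecting the generated vectors to weight
`D` keeps them in the subfunctor generated within top weights, by `wtProj_map_mem`, and every
top-weight vector is its own projection. -/
theorem wtFun_simp (hF : IsDiagFun k d F) (hs : SimpFun F) {E : ℬ}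
    (hE : ∀ f : E ⟶ E, ∃ c : k, f = c • 𝟙 E) {D : Fin (d + 1)}
    (hD : ∀ j, (D : ℕ) < j → ∀ Y, wt F E j Y = ⊥) (h0 : ∃ Y, wt F E D Y ≠ ⊥) :
    SimpFun (wtFun F E D) := by
  refine ⟨?_, fun M hM => ?_⟩
  · obtain ⟨Y, hY⟩ := h0
    obtain ⟨u, hu, hu0⟩ := (Submodule.ne_bot_iff _).1 hY
    exact ⟨Y, ⟨u, hu⟩, fun h => hu0 (congrArg Subtype.val h)⟩
  · by_cases h : ∀ X, M X = ⊥
    · exact Or.inl h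
    refine Or.inr fun X => ?_
    simp only [not_forall] at h
    obtain ⟨Y, hY⟩ := h
    obtain ⟨v, hv, hv0⟩ := (Submodule.ne_bot_iff _).1 hY
    let N : ∀ Y, Submodule k (F.obj (Y ⊞ E) : Type u) := fun Y => (M Y).map (wt F E D Y).subtype
    have hN : ∀ Y, N Y ≤ wt F E D Y := by
      rintro Y _ ⟨x, _, rfl⟩
      exact x.2
    have hN' : ∀ ⦃Y X : ℬ⦄ (g : Y ⟶ X) u, u ∈ N Y → el (F.map (biprod.map g (𝟙 E))) u ∈ N X := by
      rintro Y X g _ ⟨x, hx, rfl⟩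
      exact ⟨_, hM g x hx, rfl⟩
    refine (Submodule.eq_top_iff').2 fun u => ?_
    have h1 : (u.1 : F.obj (X ⊞ E)) ∈ genBy F (fun _ : Unit => Y ⊞ E) (fun _ => v.1) (X ⊞ E) := by
      rw [hs.genBy_eq_top (a := ()) fun h => hv0 (Subtype.ext h)]; trivial
    have h2 : ∀ x ∈ genBy F (fun _ : Unit => Y ⊞ E) (fun _ => v.1) (X ⊞ E),
        el (wtProj F E d D X) x ∈ N X := by
      intro x hx
      refine Submodule.span_induction (p := fun x _ => el (wtProj F E d D X) x ∈ N X) ?_ ?_ ?_ ?_ hx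
      · rintro _ ⟨⟨_, f⟩, rfl⟩
        exact wtProj_map_mem hF hE hD hN hN' f ⟨v, hv, rfl⟩
      · rw [map_zero]; exact Submodule.zero_mem _
      · intro x y _ _ hx hy
        rw [map_add]; exact Submodule.add_mem _ hx hy
      · intro c x _ hx
        rw [map_smul]; exact Submodule.smul_mem _ c hx
    have h3 := h2 _ h1
    rw [wtProj_of_mem hF u.2] at h3
    obtain ⟨x, hx, hxu⟩ := h3
    obtain rfl : x = u := Subtype.ext hxu
    exact hx

/-- The restriction of an endomorphism to the vectors of a given weight. -/
def wtEnd (α : F ⟶ F) (E : ℬ) (j : ℕ) : wtFun F E j ⟶ wtFun F E j where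
  app Y := FGModuleCat.ofHom ((el (α.app (Y ⊞ E))).restrict (p := wt F E j Y) (q := wt F E j Y)
    fun u hu s => by rw [← el_naturality, hu s, map_smul])
  naturality Y X f := el_ext fun u => Subtype.ext (el_naturality α _ _)

variable {R : Type} {e : R → ℬ}

/-- If scaling summands has no effect, the basis summands of `X` can be replaced by zero one after
another, so the identity acts like the zero map, which acts as zero in positive degree. -/
theorem map_eq_zero_of_tau (hd : d ≠ 0) (hF : IsDiagFun k d F) (hB : IsSplitBasis k e)
    (h : ∀ r Y (s t : k), F.map (tau Y (e r) s) = F.map (tau Y (e r) t)) (X : ℬ) :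
    𝟙 (F.obj X) = 0 := by
  classical
  obtain ⟨D⟩ := hB.decomp X
  have key : ∀ I : Finset D.n, F.map (∑ i ∈ I, D.π i ≫ D.ι i) = F.map 0 := by
    intro I
    induction I using Finset.induction_on with
    | empty => simp
    | insert a I ha ih =>
      rw [Finset.sum_insert ha, ← ih]
      set p := ∑ i ∈ I, D.π i ≫ D.ι i with hp
      have hpp : p ≫ p = p := by
        rw [hp, Preadditive.sum_comp]
        refine Finset.sum_congr rfl fun i hi => ?_
        rw [Preadditive.comp_sum, Finset.sum_eq_single i]
        · rw [Category.assoc, ← Category.assoc (D.ι i), D.ι_π, Category.id_comp]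
        · intro j _ hj
          rw [Category.assoc, ← Category.assoc (D.ι i), D.ι_π_ne _ _ hj.symm]
          simp
        · exact fun h => absurd hi h
      -- Factoring `p + s π ι` through `tau` on `X ⊞ e` lets the summand be switched off by passing
      -- from `s = 1` to `s = 0`.
      have h1 : ∀ s : k, biprod.lift p (D.π a) ≫ tau X (e (D.l a)) s ≫ biprod.desc p (D.ι a) =
          p + s • (D.π a ≫ D.ι a) := fun s => by simp [tau, hpp]
      have h2 := h1 1
      have h3 := h1 0
      rw [one_smul] at h2
      rw [zero_smul, add_zero] at h3
      have h4 := (F.map_comp _ _).trans (congrArg (F.map (biprod.lift p (D.π a)) ≫ ·)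
        (F.map_comp (tau X (e (D.l a)) (1 : k)) (biprod.desc p (D.ι a))))
      have h5 := (F.map_comp _ _).trans (congrArg (F.map (biprod.lift p (D.π a)) ≫ ·)
        (F.map_comp (tau X (e (D.l a)) (0 : k)) (biprod.desc p (D.ι a))))
      rw [h2, h _ _ 1 0] at h4
      rw [h3] at h5
      rw [add_comm, h4, h5]
  have h1 := key Finset.univ
  rw [D.total, F.map_id] at h1
  rw [h1]
  have h2 := (hF X X).smul (0 : k) 0
  rwa [smul_zero, zero_pow hd, zero_smul] at h2

-- Some nonzero weight must occur by `map_eq_zero_of_tau`, and weights are bounded by `d`; take the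
-- largest one for that basis object.
open Classical in
theorem exists_top_weight (hd : d ≠ 0) (hF : IsDiagFun k d F) (hs : SimpFun F)
    (hB : IsSplitBasis k e) : ∃ (r : R) (D : Fin (d + 1)), (D : ℕ) ≠ 0 ∧
      (∀ j, (D : ℕ) < j → ∀ Y, wt F (e r) j Y = ⊥) ∧ ∃ Y, wt F (e r) D Y ≠ ⊥ := by
  have h1 : ∃ r, ∃ j : ℕ, j ≠ 0 ∧ ∃ Y, wt F (e r) j Y ≠ ⊥ := by
    by_contra! h
    obtain ⟨X, u, hu⟩ := hs.1
    apply hu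
    have h2 := map_eq_zero_of_tau hd hF hB (fun r Y s t => ?_) X
    · exact congrArg (fun z => el z u) h2
    · rw [map_tau hF, map_tau hF]
      refine Finset.sum_congr rfl fun j _ => ?_
      by_cases hj : (j : ℕ) = 0
      · rw [hj, pow_zero, pow_zero]
      · have : wtProj F (e r) d j Y = 0 := el_ext fun x => by
          have := wtProj_mem hF j Y x
          rw [h r j hj Y] at this
          exact this
        rw [this, smul_zero, smul_zero]
  obtain ⟨r, j, hj, Y, hY⟩ := h1
  have hle : ∀ {j Y}, wt F (e r) j Y ≠ ⊥ → j ≤ d := fun {j Y} h => by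
    by_contra! hlt
    exact h (wt_eq_bot hF hlt Y)
  let P : ℕ → Prop := fun j => ∃ Y, wt F (e r) j Y ≠ ⊥
  have hP : P (Nat.findGreatest P d) := Nat.findGreatest_spec (hle hY) ⟨Y, hY⟩
  refine ⟨r, ⟨Nat.findGreatest P d, Nat.lt_succ_of_le (Nat.findGreatest_le _)⟩, ?_, fun i hi Z => ?_, hP⟩
  · have : j ≤ Nat.findGreatest P d := Nat.le_findGreatest (hle hY) ⟨Y, hY⟩
    show Nat.findGreatest P d ≠ 0
    omega
  · by_contra hZ
    exact absurd (Nat.le_findGreatest (hle hZ) (P := P) ⟨Z, hZ⟩) (not_le.2 hi)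

/-- Simple homogeneous polynomial functors are absolutely simple. -/
theorem SimpFun.scalar (hB : IsSplitBasis k e) (hF : IsDiagFun k d F) (hs : SimpFun F) (α : F ⟶ F) :
    ∃ c : k, α = c • 𝟙 F := by
  induction d using Nat.strong_induction_on generalizing F with
  | h d ih =>
    by_cases hd : d = 0
    · subst hd
      exact hs.scalar_zero hF α
    obtain ⟨r, D, hD0, hD, h0⟩ := exists_top_weight hd hF hs hB
    have hw := wtFun_simp hF hs (hB.hom_self r) hD h0
    -- The degree drops because `D ≠ 0`. The scalar found on top-weight vectors provides an
    -- eigenvector of `α` in `F` itself.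
    obtain ⟨c, hc⟩ := ih (d - D) (by omega) (wtFun_isDiagFun (fun X Y => hB.finite_hom X Y) hF (e r) D)
      hw (wtEnd α (e r) D)
    obtain ⟨Y, hY⟩ := h0
    obtain ⟨u, hu, hu0⟩ := (Submodule.ne_bot_iff _).1 hY
    refine ⟨c, hs.eq_smul α hu0 ?_⟩
    have h1 := congrArg (fun z : wtFun F (e r) D ⟶ wtFun F (e r) D => (el (z.app Y) ⟨u, hu⟩ : wt F (e r) D Y).1) hc
    exact h1

end Top

/-! ### Full subcategories closed under direct sums or retracts. -/

section Closed

variable {C : Type*} [Category* C] [Preadditive C] (P : ObjectProperty C)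

theorem fullSubcategory_sum_hom {X Y : P.FullSubcategory} {ι : Type*} (s : Finset ι)
    (f : ι → (X ⟶ Y)) : (∑ i ∈ s, f i).hom = ∑ i ∈ s, (f i).hom :=
  map_sum (P.ι.mapAddHom (X := X) (Y := Y)) f s

theorem hasFiniteBiproducts_of_closed [HasFiniteBiproducts C]
    (hP : ∀ (n : ℕ) (F : Fin n → C), (∀ j, P (F j)) → P (⨁ F)) :
    HasFiniteBiproducts P.FullSubcategory := by
  refine ⟨fun n => ⟨fun F => ?_⟩⟩
  let F' : Fin n → C := fun j => (F j).obj
  let b : Bicone F :=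
    { pt := ⟨⨁ F', hP n F' fun j => (F j).property⟩
      π j := ObjectProperty.homMk (biproduct.π F' j)
      ι j := ObjectProperty.homMk (biproduct.ι F' j)
      ι_π i j := by
        ext
        show biproduct.ι F' i ≫ biproduct.π F' j = _
        rw [biproduct.ι_π]
        split_ifs with h
        · subst h; rfl
        · rfl }
  refine HasBiproduct.mk ⟨b, isBilimitOfTotal b ?_⟩
  refine ObjectProperty.hom_ext _ ?_
  rw [fullSubcategory_sum_hom]
  exact biproduct.total (f := F')

theorem isIdempotentComplete_of_closed [IsIdempotentComplete C]
    (hP : ∀ (X Y : C) (i : Y ⟶ X) (p : X ⟶ Y), i ≫ p = 𝟙 Y → P X → P Y) :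
    IsIdempotentComplete P.FullSubcategory := by
  refine ⟨fun X p hp => ?_⟩
  obtain ⟨Y, i, q, h1, h2⟩ := IsIdempotentComplete.idempotents_split X.obj p.hom
    (congrArg (fun z => z.hom) hp)
  exact ⟨⟨Y, hP _ _ i q h1 X.property⟩, ObjectProperty.homMk i, ObjectProperty.homMk q,
    by ext; exact h1, by ext; exact h2⟩

end Closed

/-! ### Split bases from finitely many generators. -/

section Generators

variable {C : Type*} [Category* C] [Preadditive C] [Linear k C]

/-- By Schur's lemma, an indecomposable object receiving a nonzero map from a generator is
isomorphic to an indecomposable summand of it. There are finitely many such summands, and one is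
kept from each isomorphism class. -/
theorem exists_splitBasis_of_generators [IsIdempotentComplete C] (δ : C → ℕ)
    (hδ : ∀ (X Y : C) (i : Y ⟶ X) (p : X ⟶ Y), i ≫ p = 𝟙 Y → p ≫ i ≠ 𝟙 X → δ Y < δ X)
    {A : Type} [Finite A] (T : A → C) (hT : ∀ X : C, Indec X → ∃ (a : A) (f : T a ⟶ X), f ≠ 0)
    (schur : ∀ {X Y : C} (f : X ⟶ Y), Indec X → Indec Y → f ≠ 0 → IsIso f)
    (hend : ∀ {X : C} (f : X ⟶ X), Indec X → ∃ c : k, f = c • 𝟙 X) :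
    ∃ (n : ℕ) (e : Fin n → C), IsSplitBasis k e := by
  have hD := exists_indec_decomp δ hδ
  let D := fun a => (hD (T a)).some
  let P := Σ a, (D a).n
  let obj : P → C := fun p => ((D p.1).l p.2).1
  have hobj : ∀ p, Indec (obj p) := fun p => ((D p.1).l p.2).2
  let S : Setoid P :=
    { r p q := Nonempty (obj p ≅ obj q)
      iseqv := ⟨fun p => ⟨Iso.refl _⟩, fun ⟨i⟩ => ⟨i.symm⟩, fun ⟨i⟩ ⟨j⟩ => ⟨i ≪≫ j⟩⟩ }
  let Q := Quotient S
  let eQ := Finite.equivFin Q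
  let e : Fin (Nat.card Q) → C := fun i => obj (eQ.symm i).out
  have hsurj : ∀ X, Indec X → ∃ i, Nonempty (e i ≅ X) := by
    intro X hX
    obtain ⟨a, f, hf⟩ := hT X hX
    obtain ⟨b, hb⟩ := (D a).exists_comp_ne_zero hf
    have := schur _ ((D a).l b).2 hX hb
    refine ⟨eQ (Quotient.mk S ⟨a, b⟩), ?_⟩
    obtain ⟨i⟩ : Nonempty (obj (eQ.symm (eQ (Quotient.mk S ⟨a, b⟩))).out ≅ obj ⟨a, b⟩) := by
      rw [Equiv.symm_apply_apply]
      exact Quotient.mk_out (s := S) (⟨a, b⟩ : P)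
    exact ⟨i ≪≫ asIso ((D a).ι b ≫ f)⟩
  refine ⟨_, e, ?_, fun r f => hend f (hobj _), fun r => (hobj _).1, fun X => ?_⟩
  · intro r s hrs f
    by_contra hf
    have := schur f (hobj _) (hobj _) hf
    apply hrs
    apply eQ.symm.injective
    rw [← Quotient.out_eq (eQ.symm r), ← Quotient.out_eq (eQ.symm s)]
    exact Quotient.sound (s := S) ⟨asIso f⟩
  · obtain ⟨E⟩ := hD X
    refine E.refine fun a => ?_
    obtain ⟨i, ⟨h⟩⟩ := hsurj _ (E.l a).2
    exact Decomp.single i h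

end Generators

/-! ### A finite split basis identifies the category with a power of vector spaces. -/

section Equiv

variable {C : Type*} [Category* C] [Preadditive C] [Linear k C] {n : ℕ} {e : Fin n → C}
  (hB : IsSplitBasis k e)

/-- Coordinates on the space of maps out of a member of a split basis. -/
def IsSplitBasis.coord (r : Fin n) (X : C) :
    (e r ⟶ X) ≃ₗ[k] (Fin (Module.finrank k (e r ⟶ X)) → k) :=
  haveI := hB.finite_hom_left r X
  (Module.finBasis k (e r ⟶ X)).equivFun

/-- The coordinate functor of a split basis. -/
def IsSplitBasis.coordFun : C ⥤ (Fin n → FGModuleCat.{u} k) where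
  obj X r := FGModuleCat.of k (Fin (Module.finrank k (e r ⟶ X)) → k)
  map {X Y} f r := FGModuleCat.ofHom ((hB.coord r Y).toLinearMap.comp
    ((Linear.rightComp k (e r) f).comp (hB.coord r X).symm.toLinearMap))
  map_id X := funext fun r => FGModuleCat.hom_ext (LinearMap.ext fun x => by
    show hB.coord r X ((hB.coord r X).symm x ≫ 𝟙 X) = x
    simp)
  map_comp {X Y Z} f g := funext fun r => FGModuleCat.hom_ext (LinearMap.ext fun x => by
    show hB.coord r Z ((hB.coord r X).symm x ≫ f ≫ g) =
      hB.coord r Z ((hB.coord r Y).symm (hB.coord r Y ((hB.coord r X).symm x ≫ f)) ≫ g)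
    simp)

theorem IsSplitBasis.coordFun_apply {X Y : C} (f : X ⟶ Y) (r : Fin n) (x : e r ⟶ X) :
    el (hB.coordFun.map f r) (hB.coord r X x) = hB.coord r Y (x ≫ f) := by
  show hB.coord r Y ((hB.coord r X).symm (hB.coord r X x) ≫ f) = _
  simp

theorem pi_hom_ext {I : Type} {X Y : I → FGModuleCat.{u} k} {f g : X ⟶ Y}
    (h : ∀ i (x : (X i : Type u)), el (f i) x = el (g i) x) : f = g :=
  funext fun i => el_ext (h i)

-- Faithfulness, fullness and essential surjectivity are `hom_ext`, `exists_hom` and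
-- `exists_finrank_eq`. Coordinates are used because the spaces `e r ⟶ X` need not lie in the
-- universe of `k`.
include hB in
theorem IsSplitBasis.exists_equiv [HasFiniteBiproducts C] :
    ∃ (E : C ≌ (Fin n → FGModuleCat.{u} k)) (_ : E.functor.Additive), E.functor.Linear k := by
  have h1 : hB.coordFun.Faithful := ⟨fun {X Y f g} h => hB.hom_ext fun r x => by
    have := congrArg (fun z => el (z r) (hB.coord r X x)) h
    rw [hB.coordFun_apply, hB.coordFun_apply] at this
    exact (hB.coord r Y).injective this⟩
  have h2 : hB.coordFun.Full := ⟨fun {X Y} g => by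
    obtain ⟨f, hf⟩ := hB.exists_hom (X := X) (Y := Y) fun r =>
      (hB.coord r Y).symm.toLinearMap.comp ((el (g r)).comp (hB.coord r X).toLinearMap)
    refine ⟨f, pi_hom_ext fun r x => ?_⟩
    obtain ⟨x, rfl⟩ := (hB.coord r X).surjective x
    refine (hB.coordFun_apply f r x).trans ?_
    rw [hf]
    exact (hB.coord r Y).apply_symm_apply _⟩
  have h3 : hB.coordFun.EssSurj := ⟨fun V => by
    obtain ⟨X, hX⟩ := hB.exists_finrank_eq fun r => Module.finrank k (V r : Type u)
    let i : ∀ r, (Fin (Module.finrank k (e r ⟶ X)) → k) ≃ₗ[k] (V r : Type u) := fun r =>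
      LinearEquiv.ofFinrankEq _ _ (by rw [Module.finrank_fin_fun, hX])
    exact ⟨X, ⟨⟨fun r => (i r).toFGModuleCatIso.hom, fun r => (i r).toFGModuleCatIso.inv,
      funext fun r => (i r).toFGModuleCatIso.hom_inv_id,
      funext fun r => (i r).toFGModuleCatIso.inv_hom_id⟩⟩⟩⟩
  have h4 : hB.coordFun.IsEquivalence := {}
  refine ⟨hB.coordFun.asEquivalence, ⟨fun {X Y f g} => pi_hom_ext fun r x => ?_⟩,
    ⟨fun {X Y} f c => pi_hom_ext fun r x => ?_⟩⟩
  · obtain ⟨x, rfl⟩ := (hB.coord r X).surjective x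
    refine (hB.coordFun_apply (f + g) r x).trans ?_
    rw [Preadditive.comp_add, map_add]
    exact (congrArg₂ (· + ·) (hB.coordFun_apply f r x) (hB.coordFun_apply g r x)).symm
  · obtain ⟨x, rfl⟩ := (hB.coord r X).surjective x
    refine (hB.coordFun_apply (c • f) r x).trans ?_
    rw [Linear.comp_smul, map_smul]
    exact (congrArg (c • ·) (hB.coordFun_apply f r x)).symm

end Equiv

/-! ### Operations on polynomial maps. -/

section PolyMap

variable {V W W' : Type*} [AddCommGroup V] [Module k V] [AddCommGroup W] [Module k W]
  [AddCommGroup W'] [Module k W'] {d : ℕ}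

theorem IsPolyMap.map {f : V → W} (hf : IsPolyMap k d f) (L : W →ₗ[k] W') :
    IsPolyMap k d fun x => L (f x) := by
  obtain ⟨n, p, b, hp, h⟩ := hf
  exact ⟨n, p, fun a => L (b a), hp, fun x => by simp [h]⟩

theorem IsPolyMap.mono {e : ℕ} {f : V → W} (hf : IsPolyMap k d f) (h : d ≤ e) : IsPolyMap k e f := by
  obtain ⟨n, p, b, hp, h'⟩ := hf
  exact ⟨n, p, b, fun a => (hp a).trans h, h'⟩

theorem IsPolyMap.sum {A : Type*} [Fintype A] {f : A → V → W} (hf : ∀ a, IsPolyMap k d (f a)) :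
    IsPolyMap k d fun x => ∑ a, f a x := by
  choose n p b hp h using hf
  exact IsPolyMap.of_fintype (α := Σ a, Fin (n a)) (fun q => p q.1 q.2) (fun q => b q.1 q.2)
    (fun q => hp q.1 q.2) fun x => by simp [h, Fintype.sum_sigma]

end PolyMap

/-! ### Direct sums and retracts of polynomial functors. -/

section Closure

variable {ℬ : Type (u + 1)} [Category.{u} ℬ] [Preadditive ℬ] [Linear k ℬ]

theorem retract_map {X Y : ℬ ⥤ FGModuleCat.{u} k} {i : Y ⟶ X} {p : X ⟶ Y} (h : i ≫ p = 𝟙 Y)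
    {A B : ℬ} (f : A ⟶ B) : Y.map f = i.app A ≫ X.map f ≫ p.app B := by
  rw [← Category.assoc, ← i.naturality, Category.assoc, ← NatTrans.comp_app, h]
  exact (Category.comp_id _).symm

theorem isPoly_retract {X Y : ℬ ⥤ FGModuleCat.{u} k} {i : Y ⟶ X} {p : X ⟶ Y} (h : i ≫ p = 𝟙 Y)
    (hX : isPoly k ℬ X) : isPoly k ℬ Y := by
  obtain ⟨d, hd⟩ := hX
  refine ⟨d, fun A B => ?_⟩
  have := (hd A B).map ((Linear.leftComp k _ (i.app A)).comp (Linear.rightComp k _ (p.app B)))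
  have h' : (fun f : A ⟶ B => Y.map f) = fun f => i.app A ≫ X.map f ≫ p.app B :=
    funext fun f => retract_map h f
  rw [h']
  exact this

instance : HasFiniteBiproducts (FGModuleCat.{u} k) := HasFiniteBiproducts.of_hasFiniteProducts

instance : HasFiniteBiproducts (ℬ ⥤ FGModuleCat.{u} k) := HasFiniteBiproducts.of_hasFiniteProducts

theorem biprod_map_eq {n : ℕ} (F : Fin n → ℬ ⥤ FGModuleCat.{u} k) {A B : ℬ} (f : A ⟶ B) :
    (⨁ F).map f = ∑ j, (biproduct.π F j).app A ≫ (F j).map f ≫ (biproduct.ι F j).app B := by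
  have h := congrArg (fun z : ⨁ F ⟶ ⨁ F => (⨁ F).map f ≫ z.app B) (biproduct.total (f := F))
  rw [NatTrans.app_sum, Preadditive.comp_sum] at h
  refine ((Category.comp_id _).symm.trans h.symm).trans (Finset.sum_congr rfl fun j _ => ?_)
  rw [NatTrans.comp_app, ← Category.assoc, (biproduct.π F j).naturality, Category.assoc]

theorem isPoly_biproduct {n : ℕ} (F : Fin n → ℬ ⥤ FGModuleCat.{u} k) (hF : ∀ j, isPoly k ℬ (F j)) :
    isPoly k ℬ (⨁ F) := by
  choose d hd using hF
  refine ⟨∑ j, d j, fun A B => ?_⟩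
  simp only [biprod_map_eq]
  refine IsPolyMap.sum fun j => ?_
  exact ((hd j A B).mono (Finset.single_le_sum (fun _ _ => Nat.zero_le _) (Finset.mem_univ j))).map
    ((Linear.leftComp k _ ((biproduct.π F j).app A)).comp
      (Linear.rightComp k _ ((biproduct.ι F j).app B)))

instance : HasFiniteBiproducts (PolyFun k ℬ) :=
  hasFiniteBiproducts_of_closed _ fun _ F hF => isPoly_biproduct F hF

instance : IsIdempotentComplete (PolyFun k ℬ) :=
  isIdempotentComplete_of_closed _ fun _ _ _ _ h hX => isPoly_retract h hX

theorem poly_comp_app {X Y Z : PolyFun k ℬ} (f : X ⟶ Y) (g : Y ⟶ Z) (A : ℬ) :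
    (f ≫ g).hom.app A = f.hom.app A ≫ g.hom.app A := rfl

theorem isHomog_retract {d : ℕ} {X Y : PolyFun k ℬ} {i : Y ⟶ X} {p : X ⟶ Y} (h : i ≫ p = 𝟙 Y)
    (hX : isHomog k ℬ d X) : isHomog k ℬ d Y := by
  intro A B c f
  have h' : i.hom ≫ p.hom = 𝟙 Y.obj := congrArg (fun z => z.hom) h
  rw [retract_map h', retract_map h', hX, Linear.smul_comp, Linear.comp_smul]

theorem polyFun_map_eq {n : ℕ} (F : Fin n → PolyFun k ℬ) {A B : ℬ} (f : A ⟶ B) :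
    (⨁ F).obj.map f =
      ∑ j, (biproduct.π F j).hom.app A ≫ (F j).obj.map f ≫ (biproduct.ι F j).hom.app B := by
  have h := congrArg (fun z : ⨁ F ⟶ ⨁ F => (⨁ F).obj.map f ≫ z.hom.app B) (biproduct.total (f := F))
  rw [fullSubcategory_sum_hom, NatTrans.app_sum, Preadditive.comp_sum] at h
  refine ((Category.comp_id _).symm.trans h.symm).trans (Finset.sum_congr rfl fun j _ => ?_)
  rw [poly_comp_app, ← Category.assoc, (biproduct.π F j).hom.naturality, Category.assoc]

theorem isHomog_biproduct {d n : ℕ} (F : Fin n → PolyFun k ℬ) (hF : ∀ j, isHomog k ℬ d (F j)) :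
    isHomog k ℬ d (⨁ F) := by
  intro A B c f
  simp only [polyFun_map_eq, hF _ A B c f, Linear.smul_comp, Linear.comp_smul, Finset.smul_sum]

instance (d : ℕ) : HasFiniteBiproducts (isHomog k ℬ d).FullSubcategory :=
  hasFiniteBiproducts_of_closed _ fun _ F hF => isHomog_biproduct F hF

instance (d : ℕ) : IsIdempotentComplete (isHomog k ℬ d).FullSubcategory :=
  isIdempotentComplete_of_closed _ fun _ _ _ _ h hX => isHomog_retract h hX

end Closure

/-! ### Decomposition of polynomial functors into homogeneous parts. -/

section Homogeneous

variable {ℬ : Type (u + 1)} [Category.{u} ℬ] [Preadditive ℬ] [Linear k ℬ]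

/-- The action of scalars on a functor. -/
def scal (F : PolyFun k ℬ) (c : k) : F ⟶ F :=
  ObjectProperty.homMk
    { app X := F.obj.map (c • 𝟙 X)
      naturality X Y f := by rw [← F.obj.map_comp, ← F.obj.map_comp]; simp }

theorem scal_comp (F : PolyFun k ℬ) (c c' : k) : scal F c ≫ scal F c' = scal F (c * c') :=
  poly_ext fun X => by
    show F.obj.map (c • 𝟙 X) ≫ F.obj.map (c' • 𝟙 X) = F.obj.map ((c * c') • 𝟙 X)
    rw [← F.obj.map_comp]; simp [smul_smul, mul_comm]

theorem scal_one (F : PolyFun k ℬ) : scal F (1 : k) = 𝟙 F :=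
  poly_ext fun X => by
    show F.obj.map ((1 : k) • 𝟙 X) = 𝟙 _
    simp

theorem scal_naturality {F G : PolyFun k ℬ} (α : F ⟶ G) (c : k) : scal F c ≫ α = α ≫ scal G c :=
  poly_ext fun _ => α.hom.naturality _

theorem scal_homog {d : ℕ} {F : PolyFun k ℬ} (hF : isHomog k ℬ d F) (c : k) :
    scal F c = c ^ d • 𝟙 F :=
  poly_ext fun X => (hF X X c (𝟙 X)).trans (congrArg (c ^ d • ·) (F.obj.map_id X))

theorem isHomog_of_scal {d : ℕ} {F : PolyFun k ℬ} (h : ∀ c : k, scal F c = c ^ d • 𝟙 F) :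
    isHomog k ℬ d F := by
  intro X Y c f
  have h1 : F.obj.map (c • 𝟙 X) = c ^ d • 𝟙 (F.obj.obj X) :=
    congrArg (fun z : F ⟶ F => z.hom.app X) (h c)
  have h2 : c • f = (c • 𝟙 X) ≫ f := by simp
  rw [h2, F.obj.map_comp, h1, Linear.smul_comp, Category.id_comp]

variable [CharZero k]

/-- A natural transformation commutes with the action of the scalar `2`, which is `2 ^ d` on one
side and `2 ^ e` on the other. -/
theorem poly_hom_eq_zero {d e : ℕ} (h : d ≠ e) {F G : PolyFun k ℬ} (hF : isHomog k ℬ d F)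
    (hG : isHomog k ℬ e G) (α : F ⟶ G) : α = 0 := by
  have h1 := scal_naturality α 2
  rw [scal_homog hF, scal_homog hG, Linear.smul_comp, Linear.comp_smul, Category.id_comp,
    Category.comp_id] at h1
  have h2 : ((2 : k) ^ d - 2 ^ e) • α = 0 := by rw [sub_smul, h1, sub_self]
  refine (smul_eq_zero.1 h2).resolve_left (sub_ne_zero.2 fun h' => h ?_)
  exact Nat.pow_right_injective le_rfl (by exact_mod_cast h')

/-- Every polynomial functor is a finite direct sum of homogeneous ones. -/
theorem exists_homog_decomp (F : PolyFun k ℬ) :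
    Nonempty (Decomp (fun Y : {Y : PolyFun k ℬ // ∃ d, isHomog k ℬ d Y} => Y.1) F) := by
  obtain ⟨D, hD⟩ := F.property
  have hv : ∀ X, IsVPoly D fun c : k => (scal F c).hom.app X := fun X =>
    (hD X X).isVPoly_smul (𝟙 X)
  -- The coefficients of `c ↦ F(c · 𝟙)`, natural because interpolation is linear. They will be the
  -- projections to the homogeneous parts.
  let p : Fin (D + 1) → (F ⟶ F) := fun j => ObjectProperty.homMk
    { app X := coefAt D (fun c : k => (scal F c).hom.app X) j
      naturality X Y f := by
        refine (coefAt_map D _ (Linear.leftComp k _ (F.obj.map f)) j).symm.trans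
          (Eq.trans ?_ (coefAt_map D _ (Linear.rightComp k _ (F.obj.map f)) j))
        congr 1
        funext c
        exact (scal F c).hom.naturality f }
  have hp : ∀ c, scal F c = ∑ j : Fin (D + 1), c ^ (j : ℕ) • p j := fun c => poly_ext fun X => by
    rw [fullSubcategory_sum_hom, NatTrans.app_sum]
    exact (hv X).eq_sum c
  have hps : ∀ j c, p j ≫ scal F c = c ^ (j : ℕ) • p j := fun j c => poly_ext fun X => by
    refine (coefAt_map D _ (Linear.rightComp k _ ((scal F c).hom.app X)) j).symm.trans
      (coefAt_eq (w := fun j : Fin (D + 1) => c ^ (j : ℕ) • (p j).hom.app X) (fun t => ?_) j)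
    refine (congrArg (fun z : F ⟶ F => z.hom.app X) (scal_comp F t c)).trans ?_
    refine ((hv X).eq_sum (t * c)).trans (Finset.sum_congr rfl fun i _ => ?_)
    rw [mul_pow, mul_smul]
    rfl
  -- Compare coefficients in the multiplicativity of the scalar action: the `p j` are orthogonal
  -- idempotents, and their sum is the action of `c = 1`.
  have hpp : ∀ i j, p i ≫ p j = if i = j then p i else 0 := fun i j => poly_ext fun X => by
    refine (coefAt_map D _ (Linear.leftComp k _ ((p i).hom.app X)) j).symm.trans
      ((coefAt_eq (w := fun j : Fin (D + 1) => if i = j then (p i).hom.app X else 0)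
        (fun t => ?_) j).trans ?_)
    · refine (congrArg (fun z : F ⟶ F => z.hom.app X) (hps i t)).trans ?_
      rw [Finset.sum_eq_single i]
      · rw [if_pos rfl]; rfl
      · intro b _ hb
        rw [if_neg hb.symm, smul_zero]
      · exact fun h => absurd (Finset.mem_univ _) h
    · split_ifs <;> rfl
  choose Y ι π h1 h2 using fun j => IsIdempotentComplete.idempotents_split F (p j)
    ((hpp j j).trans (if_pos rfl))
  refine Decomp.of_fintype (A := Fin (D + 1)) (fun j => ⟨Y j, (j : ℕ), ?_⟩) ι π h1 ?_ ?_
  · refine isHomog_of_scal fun c => ?_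
    have h3 : ι j = ι j ≫ p j := by rw [← h2 j, ← Category.assoc, h1, Category.id_comp]
    rw [← Category.comp_id (scal (Y j) c), ← h1 j, ← Category.assoc, scal_naturality, h3,
      Category.assoc, Category.assoc, ← Category.assoc (p j), hps, Linear.smul_comp,
      Linear.comp_smul, Category.assoc]
  · intro a b hab
    have h3 : ι a ≫ p a ≫ p b ≫ π b = 0 := by
      rw [← Category.assoc (p a), hpp, if_neg hab]; simp
    rw [← h2 a, ← h2 b] at h3
    simpa [h1, reassoc_of% h1] using h3
  · simp only [h2]
    have h3 := hp 1
    simpa [scal_one] using h3.symm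

end Homogeneous

/-- A decomposition is a biproduct. -/
theorem Decomp.exists_bicone {C : Type*} [Category* C] [Preadditive C] {R : Type*} {e : R → C} {X : C}
    (D : Decomp e X) {A : Type} [Fintype A] (q : A ≃ D.n) :
    ∃ b : Bicone (fun a => e (D.l (q a))), Nonempty b.IsBilimit ∧ Nonempty (b.pt ≅ X) := by
  classical
  refine ⟨⟨X, fun a => D.π (q a), fun a => D.ι (q a), fun a a' => ?_⟩, ⟨isBilimitOfTotal _ ?_⟩,
    ⟨Iso.refl _⟩⟩
  · split_ifs with h
    · subst h; exact D.ι_π _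
    · exact D.ι_π_ne _ _ (q.injective.ne h)
  · exact (q.sum_comp fun a => D.π a ≫ D.ι a).trans D.total

/-! ### Tensor products of representable functors as generators. -/

section TensHom

variable {ℬ : Type (u + 1)} [Category.{u} ℬ] [Preadditive ℬ] [Linear k ℬ]
  [∀ X Y : ℬ, Module.Finite k (X ⟶ Y)] {α : Type} [Finite α]

/-- The functor `V ↦ ⨂_a Hom(E_a, V)`. -/
def tensHomFun (E : α → ℬ) : ℬ ⥤ FGModuleCat.{u} k where
  obj V := tens fun a => FGModuleCat.of k (E a ⟶ V)
  map f := tensMap fun a => FGModuleCat.ofHom (Linear.rightComp k (E a) f)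
  map_id V := tens_ext fun x => (tensMap_tmk _ _).trans
    (congrArg tmk (funext fun a => Category.comp_id (X := E a) (Y := V) (x a)))
  map_comp {U _ _} f g := tens_ext fun x => (tensMap_tmk _ _).trans
    ((congrArg tmk (funext fun a => (Category.assoc (x a : E a ⟶ U) f g).symm)).trans
    ((congrArg (el _) (tensMap_tmk _ _)).trans (tensMap_tmk _ _)).symm)

theorem tensHomFun_map_tmk (E : α → ℬ) {V W : ℬ} (f : V ⟶ W) (x : ∀ a, E a ⟶ V) :
    el ((tensHomFun E).map f) (tmk (V := fun a => FGModuleCat.of k (E a ⟶ V)) x) =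
      tmk (V := fun a => FGModuleCat.of k (E a ⟶ W)) fun a => x a ≫ f :=
  tensMap_tmk _ _

/-- The action of morphisms on `Hom(E, -)`. -/
def homLin (E V W : ℬ) : (V ⟶ W) →ₗ[k] (FGModuleCat.of k (E ⟶ V) ⟶ FGModuleCat.of k (E ⟶ W)) where
  toFun f := FGModuleCat.ofHom (Linear.rightComp k E f)
  map_add' f g := el_ext fun x => Preadditive.comp_add E V W x f g
  map_smul' c f := el_ext fun x => Linear.comp_smul E V W x c f

theorem isPolyMap_homLin (E V W : ℬ) : IsPolyMap k 1 (fun f : V ⟶ W => homLin (k := k) E V W f) := by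
  simpa using isPolyMap_affine (homLin (k := k) E V W) 0

theorem tensHomFun_isPoly (E : α → ℬ) : isPoly k ℬ (tensHomFun E) := by
  have := Fintype.ofFinite α
  refine ⟨∑ _ : α, 1, fun V W => ?_⟩
  exact IsPolyMap.multilinear (fun a => isPolyMap_homLin (E a) V W)
    (tensMulti (fun a => FGModuleCat.of k (E a ⟶ V)) fun a => FGModuleCat.of k (E a ⟶ W))

/-- The polynomial functor `V ↦ ⨂_a Hom(E_a, V)`. -/
def tensHom (E : α → ℬ) : PolyFun k ℬ := ⟨tensHomFun E, tensHomFun_isPoly E⟩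

theorem tmk_smul {V : α → FGModuleCat.{u} k} (c : k) (x : ∀ a, (V a : Type u)) :
    tmk (fun a => c • x a) = c ^ Nat.card α • tmk x := by
  have := Fintype.ofFinite α
  refine ((PiTensorProduct.tprod k).map_smul_univ (fun _ => c) x).trans ?_
  rw [Finset.prod_const, Finset.card_univ, Nat.card_eq_fintype_card]
  rfl

theorem tensHom_isHomog (E : α → ℬ) : isHomog k ℬ (Nat.card α) (tensHom E) := by
  intro V W c f
  refine tens_ext fun x => ?_
  refine (tensHomFun_map_tmk E (c • f) x).trans ?_
  refine Eq.trans ?_ (el_smul_apply _ _ _).symm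
  refine Eq.trans ?_ (congrArg (c ^ Nat.card α • ·) (tensHomFun_map_tmk E f x)).symm
  refine Eq.trans ?_ (tmk_smul (V := fun a => FGModuleCat.of k (E a ⟶ W)) c fun a => x a ≫ f)
  exact congrArg tmk (funext fun a => Linear.comp_smul _ _ _ _ _ _)

/-- Maps out of `tensHom` are given by natural multilinear maps. -/
theorem exists_tensHom_map (E : α → ℬ) (F : PolyFun k ℬ)
    (m : ∀ V, MultilinearMap k (fun a => E a ⟶ V) (F.obj.obj V : Type u))
    (hm : ∀ {V W} (f : V ⟶ W) x, el (F.obj.map f) (m V x) = m W fun a => x a ≫ f) :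
    ∃ φ : tensHom E ⟶ F, ∀ V (x : ∀ a, E a ⟶ V),
      el (φ.hom.app V) (tmk (V := fun a => FGModuleCat.of k (E a ⟶ V)) x) = m V x := by
  let app : ∀ V, (tens fun a => FGModuleCat.of k (E a ⟶ V)) ⟶ F.obj.obj V :=
    fun V => FGModuleCat.ofHom (PiTensorProduct.lift (m V))
  have happ : ∀ V (x : ∀ a, E a ⟶ V),
      el (app V) (tmk (V := fun a => FGModuleCat.of k (E a ⟶ V)) x) = m V x :=
    fun V x => PiTensorProduct.lift.tprod _
  refine ⟨ObjectProperty.homMk { app := app, naturality := fun V W f => tens_ext fun x => ?_ }, happ⟩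
  refine (congrArg (el (app W)) (tensHomFun_map_tmk E f x)).trans ((happ W _).trans ?_)
  exact (hm f x).symm.trans (congrArg (el (F.obj.map f)) (happ V x)).symm

variable [HasFiniteBiproducts ℬ] {R : Type} {e : R → ℬ}

/-- A Yoneda-type construction: `x ↦ ofWord x u` is multilinear in the letters and natural in `V`.
-/
theorem exists_tensHom_map_word {d : ℕ} {F : PolyFun k ℬ} (hF : IsDiagFun k d F.obj)
    (w : Fin d → R) (u : (F.obj.obj (word e w) : Type u)) :
    ∃ φ : tensHom (fun a => e (w a)) ⟶ F, ∀ V (x : ∀ a, e (w a) ⟶ V),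
      el (φ.hom.app V) (tmk (V := fun a => FGModuleCat.of k (e (w a) ⟶ V)) x) =
        el (ofWord F.obj x) u := by
  choose m hm using fun V => exists_ofWord (e := e) hF w V
  refine (exists_tensHom_map (fun a => e (w a)) F (fun V => (elAt u).compMultilinearMap (m V))
    fun {V W} f x => ?_).imp fun φ h V x => (h V x).trans (congrArg (elAt u) (hm V x).symm)
  show el (F.obj.map f) (el (m V x) u) = el (m W _) u
  rw [← hm, ← hm, ← ofWord_comp_map]
  rfl

/-- Otherwise every term in the expansion of `d! • u` through words would vanish. -/
theorem exists_ofWord_ne_zero [CharZero k] (hB : IsSplitBasis k e) {d : ℕ}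
    {F : ℬ ⥤ FGModuleCat.{u} k} (hF : IsDiagFun k d F) {X : ℬ} {u : (F.obj X : Type u)} (hu : u ≠ 0) :
    ∃ (w : Fin d → R) (x : ∀ a, e (w a) ⟶ X) (u' : (F.obj (word e w) : Type u)),
      el (ofWord F x) u' ≠ 0 := by
  obtain ⟨D⟩ := hB.decomp X
  by_contra! h
  have h1 := el_sum_toWord_ofWord hF D u
  rw [Finset.sum_eq_zero fun v _ => h _ _ _] at h1
  exact (smul_ne_zero (Nat.cast_ne_zero.2 d.factorial_ne_zero) hu) h1.symm

/-- A natural transformation commutes with `toWord` and `ofWord`, so `d!` times its value at `X` is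
a sum over its values at words. -/
theorem natTrans_ext_word [CharZero k] (hB : IsSplitBasis k e) {d : ℕ}
    {F G : ℬ ⥤ FGModuleCat.{u} k} (hF : IsDiagFun k d F) {α β : F ⟶ G}
    (h : ∀ w : Fin d → R, α.app (word e w) = β.app (word e w)) : α = β := by
  ext X : 2
  obtain ⟨D⟩ := hB.decomp X
  have hd : (d.factorial : k) ≠ 0 := Nat.cast_ne_zero.2 d.factorial_ne_zero
  have key : ∀ γ : F ⟶ G, (d.factorial : k) • γ.app X = ∑ v : Fin d → D.n,
      toWord F (w := fun a => D.l (v a)) (fun a => D.π (v a)) ≫ γ.app _ ≫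
        ofWord G (w := fun a => D.l (v a)) (fun a => D.ι (v a)) := by
    intro γ
    have h1 : (d.factorial : k) • γ.app X = ((d.factorial : k) • 𝟙 (F.obj X)) ≫ γ.app X := by
      rw [Linear.smul_comp, Category.id_comp]
    rw [h1, ← sum_toWord_ofWord hF D, Preadditive.sum_comp]
    refine Finset.sum_congr rfl fun v _ => ?_
    rw [Category.assoc]
    exact congrArg _ (pol_naturality γ _)
  refine smul_right_injective _ hd ?_
  dsimp only
  rw [key, key]
  exact Finset.sum_congr rfl fun v _ => by rw [h]

end TensHom

/-! ### Schur's lemma for simple functors. -/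

section Schur

variable {ℬ : Type (u + 1)} [Category.{u} ℬ] [Preadditive ℬ] [Linear k ℬ]

theorem stable_ker {F G : ℬ ⥤ FGModuleCat.{u} k} (α : F ⟶ G) :
    Stable F fun X => LinearMap.ker (el (α.app X)) := by
  intro X Y f u hu
  have h1 : el (α.app X) u = 0 := hu
  show el (α.app Y) (el (F.map f) u) = 0
  rw [el_naturality, h1, map_zero]

theorem stable_range {F G : ℬ ⥤ FGModuleCat.{u} k} (α : F ⟶ G) :
    Stable G fun X => LinearMap.range (el (α.app X)) := by
  rintro X Y f _ ⟨u, rfl⟩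
  exact ⟨el (F.map f) u, el_naturality α f u⟩

theorem isIso_of_bijective {V W : FGModuleCat.{u} k} (f : V ⟶ W) (h : Function.Bijective (el f)) :
    IsIso f :=
  ⟨(LinearEquiv.ofBijective (el f) h).toFGModuleCatIso.inv,
    (LinearEquiv.ofBijective (el f) h).toFGModuleCatIso.hom_inv_id,
    (LinearEquiv.ofBijective (el f) h).toFGModuleCatIso.inv_hom_id⟩

theorem SimpFun.isIso {F G : ℬ ⥤ FGModuleCat.{u} k} (hF : SimpFun F) (hG : SimpFun G) (α : F ⟶ G)
    (hα : α ≠ 0) : IsIso α := by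
  have h1 := (hF.2 _ (stable_ker α)).resolve_right fun h => hα (by
    ext X : 2
    refine el_ext fun u => ?_
    have : u ∈ LinearMap.ker (el (α.app X)) := by rw [h X]; trivial
    exact this)
  have h2 := (hG.2 _ (stable_range α)).resolve_left fun h => hα (by
    ext X : 2
    refine el_ext fun u => ?_
    have : el (α.app X) u ∈ LinearMap.range (el (α.app X)) := ⟨u, rfl⟩
    rw [h X] at this
    exact this)
  have := fun X => isIso_of_bijective (α.app X)
    ⟨LinearMap.ker_eq_bot.1 (h1 X), LinearMap.range_eq_top.1 (h2 X)⟩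
  exact NatIso.isIso_of_isIso_app α

end Schur

/-! ### Split bases of polynomial functors and graded 2-vector spaces. -/

section Basis

variable {ℬ : Type (u + 1)} [Category.{u} ℬ] [Preadditive ℬ] [Linear k ℬ] [HasFiniteBiproducts ℬ]
  [CharZero k] {R : Type} {e : R → ℬ} (hB : IsSplitBasis k e)

include hB

/-- The natural projection onto a subfunctor is an idempotent, so for an indecomposable functor it
is zero or the identity. -/
theorem simpFun_of_indec {d : ℕ} {F : (isHomog k ℬ d).FullSubcategory} (h : Indec F) :
    SimpFun F.obj.obj := by
  refine ⟨?_, fun N hN => ?_⟩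
  · by_contra! h0
    exact h.1 (ObjectProperty.hom_ext _ (poly_ext fun X => el_ext fun u => (h0 X u).trans (h0 X _).symm))
  · obtain ⟨p, h1, h2⟩ := hN.exists_idempotent hB (isDiagFun_of_isHomog F.property)
    let p' : F ⟶ F := ObjectProperty.homMk (ObjectProperty.homMk p)
    have hp : ∀ q : F ⟶ F, p' = q → p = q.hom.hom := fun q hq => congrArg (fun z => z.hom.hom) hq
    rcases h.2 p' (ObjectProperty.hom_ext _ (poly_ext fun X => el_ext fun u => h2 X _ (h1 X u))) with h3 | h3
    · refine Or.inl fun X => (Submodule.eq_bot_iff _).2 fun u hu => ?_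
      rw [← h2 X u hu, hp _ h3]
      rfl
    · refine Or.inr fun X => Submodule.eq_top_iff'.2 fun u => ?_
      have := h1 X u
      rw [hp _ h3] at this
      exact this

variable [Finite R]

/-- Homogeneous functors of a fixed degree have a finite split basis. -/
theorem exists_splitBasis_part (d : ℕ) :
    ∃ (n : ℕ) (E : Fin n → (isHomog k ℬ d).FullSubcategory), IsSplitBasis k E := by
  have := Fintype.ofFinite R
  have : ∀ X Y : ℬ, Module.Finite k (X ⟶ Y) := fun X Y => hB.finite_hom X Y
  refine exists_splitBasis_of_generators
    -- The total dimension at words serves as the size that drops when a proper summand is split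
    -- off.
    (fun F => ∑ w : Fin d → R, Module.finrank k (F.obj.obj.obj (word e w) : Type u)) ?_
    (fun w : Fin d → R => (⟨tensHom fun a => e (w a), by
      simpa using tensHom_isHomog fun a => e (w a)⟩ : (isHomog k ℬ d).FullSubcategory)) ?_ ?_ ?_
  · intro X Y i p hip hpi
    have h1 : ∀ A u, el (p.hom.hom.app A) (el (i.hom.hom.app A) u) = u := fun A u =>
      congrArg (fun z => el (z.hom.hom.app A) u) hip
    have hinj : ∀ A, Function.Injective (el (i.hom.hom.app A)) := fun A =>
      Function.LeftInverse.injective (h1 A)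
    refine Finset.sum_lt_sum (fun w _ => LinearMap.finrank_le_finrank_of_injective (hinj _)) ?_
    -- If no dimension drops, `i` is bijective at every word, so `p ≫ i` is the identity at words
    -- and hence everywhere.
    by_contra! h
    refine hpi (ObjectProperty.hom_ext _ (ObjectProperty.hom_ext _
      (natTrans_ext_word hB (isDiagFun_of_isHomog X.property) fun w => el_ext fun u => ?_)))
    have h2 := LinearMap.finrank_le_finrank_of_injective (hinj (word e w))
    obtain ⟨u, rfl⟩ := (LinearMap.injective_iff_surjective_of_finrank_eq_finrank
      (le_antisymm h2 (h w (Finset.mem_univ w)))).1 (hinj _) u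
    exact congrArg (el (i.hom.hom.app (word e w))) (h1 _ u)
  -- A nonzero homogeneous functor has a nonzero value of `ofWord`, which is the same as a nonzero
  -- map from a generator.
  · intro F hF
    obtain ⟨X, u, hu⟩ := (simpFun_of_indec hB hF).1
    obtain ⟨w, x, u', hu'⟩ := exists_ofWord_ne_zero hB (isDiagFun_of_isHomog F.property) hu
    obtain ⟨φ, hφ⟩ := exists_tensHom_map_word (isDiagFun_of_isHomog F.property) w u'
    refine ⟨w, ObjectProperty.homMk φ, fun h => hu' ?_⟩
    rw [← hφ X x, show φ = 0 from congrArg (fun z => z.hom) h]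
    rfl
  · intro X Y f hX hY hf
    have h1 := (simpFun_of_indec hB hX).isIso (simpFun_of_indec hB hY) f.hom.hom fun h =>
      hf (ObjectProperty.hom_ext _ (ObjectProperty.hom_ext _ h))
    have h1' : IsIso ((isPoly k ℬ).ι.map f.hom) := h1
    have h2 : IsIso ((isHomog k ℬ d).ι.map f) := isIso_of_reflects_iso f.hom (isPoly k ℬ).ι
    exact isIso_of_reflects_iso f (isHomog k ℬ d).ι
  · intro X f hX
    have := hasBinaryBiproducts_of_finite_biproducts ℬ
    obtain ⟨c, hc⟩ := (simpFun_of_indec hB hX).scalar hB (isDiagFun_of_isHomog X.property) f.hom.hom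
    exact ⟨c, ObjectProperty.hom_ext _ (ObjectProperty.hom_ext _ hc)⟩

/-- The polynomial functors on a split semisimple category have a split basis of homogeneous
functors. -/
theorem exists_splitBasis_poly : ∃ (n : ℕ → ℕ) (E : (Σ d, Fin (n d)) → PolyFun k ℬ),
    IsSplitBasis k E ∧ ∀ r, isHomog k ℬ r.1 (E r) := by
  choose n E hE using fun d => exists_splitBasis_part (d := d) hB
  refine ⟨n, fun r => (E r.1 r.2).obj, ⟨?_, fun r f => ?_, fun r h => ?_, fun F => ?_⟩,
    fun r => (E r.1 r.2).property⟩
  · rintro ⟨d, a⟩ ⟨d', a'⟩ h f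
    by_cases hd : d = d'
    · subst hd
      exact congrArg (fun z => z.hom) ((hE d).hom_zero (by simpa using h) (ObjectProperty.homMk f))
    · exact poly_hom_eq_zero hd (E d a).property (E d' a').property f
  · obtain ⟨c, hc⟩ := (hE r.1).hom_self r.2 (ObjectProperty.homMk f)
    exact ⟨c, congrArg (fun z => z.hom) hc⟩
  · exact (hE r.1).one_ne r.2 (ObjectProperty.hom_ext _ h)
  · obtain ⟨D⟩ := exists_homog_decomp F
    refine D.refine fun a => ?_
    obtain ⟨d, hd⟩ := (D.l a).2
    obtain ⟨D'⟩ := (hE d).decomp ⟨(D.l a).1, hd⟩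
    exact Decomp.of_fintype (A := D'.n) (fun b => ⟨d, D'.l b⟩) (fun b => (D'.ι b).hom)
      (fun b => (D'.π b).hom) (fun b => congrArg (fun z => z.hom) (D'.ι_π b))
      (fun b b' h => congrArg (fun z => z.hom) (D'.ι_π_ne b b' h))
      ((fullSubcategory_sum_hom _ _ _).symm.trans (congrArg (fun z => z.hom) D'.total))

theorem isGradedTwoVect_grPoly : IsGradedTwoVect (grPoly k ℬ) where
  closed d := ⟨fun i h => isHomog_retract i.inv_hom_id h⟩
  part d := by
    obtain ⟨n, E, hE⟩ := exists_splitBasis_part (d := d) hB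
    exact ⟨n, hE.exists_equiv⟩
  hom_eq_zero := fun h _ _ hX hY f => poly_hom_eq_zero h hX hY f
  hasFiniteBiproducts := inferInstanceAs (HasFiniteBiproducts (PolyFun k ℬ))
  decomp F := by
    obtain ⟨D⟩ := exists_homog_decomp (k := k) F
    have := D.fin
    let q := (Fintype.equivFin D.n).symm
    choose d hd using fun a => (D.l (q a)).2
    obtain ⟨b, h1, h2⟩ := D.exists_bicone q
    exact ⟨_, d, _, b, hd, h1, h2⟩

end Basis

/-! ### Skyscraper sheaves and the split basis of sheaves on a finite set. -/

section Sky

variable {𝒜 : Type w} [Category.{v} 𝒜] [Preadditive 𝒜] [Linear k 𝒜] {S : Type}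

theorem sh_sum_apply {V W : Sh S 𝒜} {A : Type*} (I : Finset A) (f : A → (V ⟶ W)) (s : S) :
    (∑ a ∈ I, f a) s = ∑ a ∈ I, f a s :=
  map_sum ({ toFun f := f s, map_zero' := rfl, map_add' _ _ := rfl } : (V ⟶ W) →+ (V s ⟶ W s)) f I

instance [HasFiniteBiproducts 𝒜] : HasFiniteBiproducts (Sh S 𝒜) := by
  refine ⟨fun n => ⟨fun F => ?_⟩⟩
  let b : Bicone F :=
    { pt s := ⨁ fun j => F j s
      π j s := biproduct.π (fun j => F j s) j
      ι j s := biproduct.ι (fun j => F j s) j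
      ι_π i j := by
        funext s
        refine (biproduct.ι_π (fun j => F j s) i j).trans ?_
        split_ifs with h
        · subst h; rfl
        · rfl }
  refine HasBiproduct.mk ⟨b, isBilimitOfTotal b ?_⟩
  funext s
  rw [sh_sum_apply]
  exact biproduct.total (f := fun j => F j s)

variable [HasZeroObject 𝒜]

open Classical in
/-- The skyscraper sheaf with stalk `A` at `s`. -/
def sky (s : S) (A : 𝒜) : Sh S 𝒜 := fun t => if t = s then A else HasZeroObject.zero' 𝒜 |>.zero

theorem sky_self (s : S) (A : 𝒜) : sky s A s = A := if_pos rfl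

theorem sky_isZero {s t : S} (h : t ≠ s) (A : 𝒜) : IsZero (sky s A t) := by
  rw [sky, if_neg h]
  exact isZero_zero 𝒜

/-- The stalk of a skyscraper. -/
def skyIso (s : S) (A : 𝒜) : sky s A s ≅ A := eqToIso (sky_self s A)

open Classical in
/-- The map out of a skyscraper with given stalk. -/
def skyOut {s : S} {A : 𝒜} {V : Sh S 𝒜} (f : A ⟶ V s) : sky s A ⟶ V := fun t =>
  if h : t = s then eqToHom (by rw [h]) ≫ (skyIso s A).hom ≫ f ≫ eqToHom (by rw [h]) else 0

open Classical in
/-- The map to a skyscraper with given stalk. -/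
def skyIn {s : S} {A : 𝒜} {V : Sh S 𝒜} (f : V s ⟶ A) : V ⟶ sky s A := fun t =>
  if h : t = s then eqToHom (by rw [h]) ≫ f ≫ (skyIso s A).inv ≫ eqToHom (by rw [h]) else 0

theorem skyOut_self {s : S} {A : 𝒜} {V : Sh S 𝒜} (f : A ⟶ V s) : skyOut f s = (skyIso s A).hom ≫ f := by
  simp [skyOut]

theorem skyIn_self {s : S} {A : 𝒜} {V : Sh S 𝒜} (f : V s ⟶ A) : skyIn f s = f ≫ (skyIso s A).inv := by
  simp [skyIn]

theorem skyOut_ne {s t : S} (h : t ≠ s) {A : 𝒜} {V : Sh S 𝒜} (f : A ⟶ V s) : skyOut f t = 0 := by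
  simp [skyOut, h]

theorem skyIn_ne {s t : S} (h : t ≠ s) {A : 𝒜} {V : Sh S 𝒜} (f : V s ⟶ A) : skyIn f t = 0 := by
  simp [skyIn, h]

theorem sky_hom_ext {s : S} {A : 𝒜} {V : Sh S 𝒜} {f g : sky s A ⟶ V}
    (h : (skyIso s A).inv ≫ f s = (skyIso s A).inv ≫ g s) : f = g := by
  funext t
  by_cases ht : t = s
  · subst ht
    exact (cancel_epi _).1 h
  · exact (sky_isZero ht A).eq_of_src _ _

variable {R : Type} {e : R → 𝒜}

/-- The skyscrapers on the members of a split basis. -/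
abbrev skyBasis (S : Type) (e : R → 𝒜) (p : S × R) : Sh S 𝒜 := sky p.1 (e p.2)

/-- A map out of a skyscraper is determined by its stalk at the one point, and a sheaf on a finite
discrete set is the direct sum of the skyscrapers on its stalks. -/
theorem isSplitBasis_sky [Finite S] (hB : IsSplitBasis k e) : IsSplitBasis k (skyBasis S e) where
  hom_zero := by
    rintro ⟨s, r⟩ ⟨s', r'⟩ h f
    refine sky_hom_ext ?_
    by_cases hs : s = s'
    · subst hs
      have hr : r ≠ r' := fun hr => h (by rw [hr])
      rw [← cancel_mono (skyIso s (e r')).hom]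
      exact (hB.hom_zero hr _).trans (hB.hom_zero hr _).symm
    · exact (sky_isZero hs _).eq_of_tgt _ _
  hom_self := by
    rintro ⟨s, r⟩ f
    obtain ⟨c, hc⟩ := hB.hom_self r ((skyIso s (e r)).inv ≫ f s ≫ (skyIso s (e r)).hom)
    refine ⟨c, sky_hom_ext ?_⟩
    rw [← cancel_mono (skyIso s (e r)).hom, Category.assoc, hc]
    show _ = ((skyIso s (e r)).inv ≫ (c • 𝟙 (sky s (e r) s))) ≫ (skyIso s (e r)).hom
    simp
  one_ne := by
    rintro ⟨s, r⟩ h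
    apply hB.one_ne r
    have h1 : 𝟙 (sky s (e r) s) = 0 := congrFun h s
    have := congrArg (fun z => (skyIso s (e r)).inv ≫ z ≫ (skyIso s (e r)).hom) h1
    simpa using this
  decomp V := by
    classical
    have := Fintype.ofFinite S
    let D := fun s => (hB.decomp (V s)).some
    refine Decomp.of_fintype (A := Σ s, (D s).n) (fun p => (p.1, (D p.1).l p.2))
      (fun p => skyOut ((D p.1).ι p.2)) (fun p => skyIn ((D p.1).π p.2)) ?_ ?_ ?_
    · rintro ⟨s, a⟩
      refine sky_hom_ext ?_
      show _ ≫ skyOut ((D s).ι a) s ≫ skyIn ((D s).π a) s = _ ≫ 𝟙 (sky s (e ((D s).l a)) s)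
      rw [skyOut_self, skyIn_self]
      simp [reassoc_of% (D s).ι_π a]
    · rintro ⟨s, a⟩ ⟨s', b⟩ h
      refine sky_hom_ext ?_
      show _ ≫ skyOut ((D s).ι a) s ≫ skyIn ((D s').π b) s = _ ≫ 0
      by_cases hs : s = s'
      · subst hs
        have hab : a ≠ b := fun hab => h (by rw [hab])
        rw [skyOut_self, skyIn_self]
        simp [reassoc_of% (D s).ι_π_ne a b hab]
      · rw [skyIn_ne hs]
        simp
    · funext t
      rw [sh_sum_apply, Fintype.sum_sigma, Finset.sum_eq_single t]
      · refine Eq.trans ?_ (D t).total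
        refine Finset.sum_congr rfl fun a _ => ?_
        show skyIn ((D t).π a) t ≫ skyOut ((D t).ι a) t = _
        rw [skyOut_self, skyIn_self]
        simp
      · intro s _ hs
        refine Finset.sum_eq_zero fun a _ => ?_
        show skyIn ((D s).π a) t ≫ skyOut ((D s).ι a) t = _
        rw [skyOut_ne hs.symm, comp_zero]
      · exact fun h => absurd (Finset.mem_univ t) h

end Sky

/-! ### Recovering a homogeneous functor from its value at a large object. -/

section Extend

variable {ℬ : Type (u + 1)} [Category.{u} ℬ] [Preadditive ℬ] [Linear k ℬ]
  {F G : ℬ ⥤ FGModuleCat.{u} k} {d : ℕ}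

theorem pol_intertwine {X : ℬ} {φ : F.obj X ⟶ G.obj X}
    (hφ : ∀ f : X ⟶ X, F.map f ≫ φ = φ ≫ G.map f) (f : Fin d → (X ⟶ X)) :
    pol d F f ≫ φ = φ ≫ pol d G f := by
  simp [pol, polar, Preadditive.sum_comp, Preadditive.comp_sum, hφ]

variable [HasFiniteBiproducts ℬ] [CharZero k] {R : Type} {e : R → ℬ} (hB : IsSplitBasis k e)

include hB in
/-- If all words are retracts of `X`, then homogeneous functors are determined by their values at
`X` with the action of the endomorphisms of `X`. -/
theorem exists_extension (hF : IsDiagFun k d F) (hG : IsDiagFun k d G) {X : ℬ}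
    (hX : ∀ w : Fin d → R, ∃ (i : word e w ⟶ X) (p : X ⟶ word e w), i ≫ p = 𝟙 _)
    (φ : F.obj X ⟶ G.obj X) (hφ : ∀ f : X ⟶ X, F.map f ≫ φ = φ ≫ G.map f) :
    ∃ α : F ⟶ G, α.app X = φ := by
  choose i p hip using hX
  have hd : (d.factorial : k) ≠ 0 := Nat.cast_ne_zero.2 d.factorial_ne_zero
  -- `φ` is transported to each word through its embedding into `X`, and the results are averaged.
  let q : ∀ w : Fin d → R, F.obj (word e w) ⟶ G.obj (word e w) := fun w =>
    F.map (i w) ≫ φ ≫ G.map (p w)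
  refine ⟨{ app := fun X => (d.factorial : k)⁻¹ • avgApp e q (hB.decomp X).some
            naturality := fun X Y f => by
              rw [Linear.comp_smul, Linear.smul_comp, avgApp_naturality hB hG hF] }, ?_⟩
  show (d.factorial : k)⁻¹ • avgApp e q (hB.decomp X).some = φ
  rw [inv_smul_eq_iff₀ hd, avgApp]
  have h1 : (d.factorial : k) • φ = φ ≫ ((d.factorial : k) • 𝟙 (G.obj X)) := by
    rw [Linear.comp_smul, Category.comp_id]
  rw [h1, ← sum_toWord_ofWord hG (hB.decomp X).some, Preadditive.comp_sum]
  refine Finset.sum_congr rfl fun v _ => ?_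
  -- Splitting `X` into letters and embedding the word back is a polarized endomorphism of `X`, and
  -- `φ` commutes with those.
  have h2 : ∀ (w : Fin d → R) (y : ∀ a, X ⟶ e (w a)) (x : ∀ a, e (w a) ⟶ X),
      toWord F y ≫ q w ≫ ofWord G x = φ ≫ toWord G y ≫ ofWord G x := by
    intro w y x
    have h3 : toWord F y ≫ F.map (i w) ≫ φ = φ ≫ toWord G y ≫ G.map (i w) := by
      rw [toWord, toWord, ← Category.assoc, pol_comp_map, pol_intertwine hφ, pol_comp_map]
    have h4 : G.map (i w) ≫ G.map (p w) = 𝟙 _ := by rw [← G.map_comp, hip, G.map_id]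
    have h5 := congrArg (· ≫ G.map (p w) ≫ ofWord G x) h3
    simpa [q, reassoc_of% h4] using h5
  exact h2 (fun a => (hB.decomp X).some.l (v a)) _ _

end Extend

/-! ### Matrix coefficients of maps between tensor products, one factor at a time. -/

section DualProd

variable {J : Type} [Finite J] {M N : J → FGModuleCat.{u} k}

/-- The product of functionals on the factors of a tensor product. -/
def dualProd (ξ : ∀ j, Module.Dual k (N j : Type u)) : (tens N : Type u) →ₗ[k] k :=
  PiTensorProduct.dualDistrib (PiTensorProduct.tprod k ξ)

theorem dualProd_tmk [Fintype J] (ξ : ∀ j, Module.Dual k (N j : Type u)) (x : ∀ j, (N j : Type u)) :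
    dualProd ξ (tmk x) = ∏ j, ξ j (x j) :=
  PiTensorProduct.dualDistrib_apply _ _

/-- In finite dimension the products of functionals span the dual of the tensor product. -/
theorem eq_of_dualProd {z z' : (tens N : Type u)} (h : ∀ ξ, dualProd ξ z = dualProd ξ z') : z = z' := by
  rw [← sub_eq_zero]
  refine (Module.forall_dual_apply_eq_zero_iff k (z - z')).1 fun l => ?_
  obtain ⟨t, rfl⟩ := (PiTensorProduct.dualDistribEquiv (R := k) (M := fun j => (N j : Type u))).surjective l
  have h1 : ∀ t, PiTensorProduct.dualDistrib (R := k) (M := fun j => (N j : Type u)) t (z - z') = 0 := by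
    intro t
    induction t using PiTensorProduct.induction_on with
    | smul_tprod c ξ =>
      rw [map_smul]
      show c • dualProd ξ (z - z') = 0
      rw [map_sub, h, sub_self, smul_zero]
    | add x y hx hy =>
      rw [map_add]
      show PiTensorProduct.dualDistrib x (z - z') + PiTensorProduct.dualDistrib y (z - z') = 0
      rw [hx, hy, add_zero]
  exact h1 t

theorem dualProd_tensMap (ξ : ∀ j, Module.Dual k (N j : Type u)) (g : ∀ j, M j ⟶ N j)
    (z : (tens M : Type u)) : dualProd ξ (el (tensMap g) z) = dualProd (fun j => ξ j ∘ₗ el (g j)) z := by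
  have := Fintype.ofFinite J
  have h : (dualProd ξ).comp (el (tensMap g)) = dualProd (fun j => ξ j ∘ₗ el (g j)) := by
    refine PiTensorProduct.ext (MultilinearMap.ext fun x => ?_)
    show dualProd ξ (el (tensMap g) (tmk x)) = dualProd (fun j => ξ j ∘ₗ el (g j)) (tmk x)
    rw [tensMap_tmk, dualProd_tmk, dualProd_tmk]
    rfl
  exact LinearMap.congr_fun h z

variable [DecidableEq J] (θ : tens M ⟶ tens N)

/-- The matrix coefficients of a map between tensor products. -/
def mcoef (x : ∀ j, (M j : Type u)) (ξ : ∀ j, Module.Dual k (N j : Type u)) : k :=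
  dualProd ξ (el θ (tmk x))

theorem eq_of_mcoef {θ θ' : tens M ⟶ tens N} (h : ∀ x ξ, mcoef θ x ξ = mcoef θ' x ξ) : θ = θ' :=
  tens_ext fun x => eq_of_dualProd fun ξ => h x ξ

/-- Varying a single factor. -/
theorem exists_slot (i : J) (x : ∀ j, (M j : Type u)) (ξ : ∀ j, Module.Dual k (N j : Type u)) :
    ∃ φ : M i ⟶ N i, ∀ y η, η (el φ y) = mcoef θ (Function.update x i y) (Function.update ξ i η) := by
  -- With the other slots frozen, the coefficient is bilinear in `y` and `η`; reflexivity of `N i`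
  -- turns it into a map `M i ⟶ N i`.
  let B : (M i : Type u) →ₗ[k] Module.Dual k (Module.Dual k (N i : Type u)) := LinearMap.mk₂ k
    (fun y η => mcoef θ (Function.update x i y) (Function.update ξ i η))
    (fun y y' η => by
      simp only [mcoef]
      rw [show tmk (Function.update x i (y + y')) = tmk (Function.update x i y) +
        tmk (Function.update x i y') from (PiTensorProduct.tprod k).map_update_add x i y y', map_add, map_add])
    (fun c y η => by
      simp only [mcoef]
      rw [show tmk (Function.update x i (c • y)) = c • tmk (Function.update x i y) from
        (PiTensorProduct.tprod k).map_update_smul x i c y, map_smul, map_smul])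
    (fun y η η' => by
      simp only [mcoef, dualProd]
      rw [(PiTensorProduct.tprod k).map_update_add, map_add]
      rfl)
    (fun c y η => by
      simp only [mcoef, dualProd]
      rw [(PiTensorProduct.tprod k).map_update_smul, map_smul]
      rfl)
  let φ : (M i : Type u) →ₗ[k] (N i : Type u) :=
    (Module.evalEquiv k (N i : Type u)).symm.toLinearMap.comp B
  refine ⟨FGModuleCat.ofHom φ, fun y η => ?_⟩
  show η ((Module.evalEquiv k (N i : Type u)).symm (B y)) = B y η
  exact Module.apply_evalEquiv_symm_apply (R := k) (M := (N i : Type u)) η (B y)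

theorem slot_intertwine {i : J} {x : ∀ j, (M j : Type u)} {ξ : ∀ j, Module.Dual k (N j : Type u)}
    {φ : M i ⟶ N i}
    (hφ : ∀ y η, η (el φ y) = mcoef θ (Function.update x i y) (Function.update ξ i η))
    {f : M i ⟶ M i} {f' : N i ⟶ N i}
    (h : tensMap (Function.update (fun j => 𝟙 (M j)) i f) ≫ θ =
      θ ≫ tensMap (Function.update (fun j => 𝟙 (N j)) i f')) : f ≫ φ = φ ≫ f' := by
  refine el_ext fun y => ?_
  rw [← sub_eq_zero]
  refine (Module.forall_dual_apply_eq_zero_iff k _).1 fun η => ?_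
  rw [map_sub, sub_eq_zero]
  show η (el φ (el f y)) = (η ∘ₗ el f') (el φ y)
  rw [hφ, hφ]
  have h1 : el (tensMap (Function.update (fun j => 𝟙 (M j)) i f)) (tmk (Function.update x i y)) =
      tmk (Function.update x i (el f y)) := by
    rw [tensMap_tmk]
    congr 1
    funext j
    by_cases hj : j = i
    · subst hj; simp
    · simp [hj]
  have h2 : (fun j => (Function.update ξ i η j) ∘ₗ el (Function.update (fun j => 𝟙 (N j)) i f' j)) =
      Function.update ξ i (η ∘ₗ el f') := by
    funext j
    by_cases hj : j = i
    · subst hj; simp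
    · simp only [Function.update_of_ne hj]
      rfl
  rw [mcoef, ← h1, mcoef, ← h2, ← dualProd_tensMap]
  exact congrArg (fun z => dualProd (Function.update ξ i η) (el z (tmk (Function.update x i y)))) h

variable {E : J → Type*} {f : ∀ j, E j → (M j ⟶ M j)} {f' : ∀ j, E j → (N j ⟶ N j)}

-- Every matrix coefficient of `θ` is a matrix coefficient of a map in slot `i`, and such a map
-- intertwines the actions there.
variable {θ} in
theorem tens_hom_zero (hθ : ∀ i (a : E i), tensMap (Function.update (fun j => 𝟙 (M j)) i (f i a)) ≫ θ =
      θ ≫ tensMap (Function.update (fun j => 𝟙 (N j)) i (f' i a))) (i : J)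
    (hi : ∀ φ : M i ⟶ N i, (∀ a, f i a ≫ φ = φ ≫ f' i a) → φ = 0) : θ = 0 := by
  refine eq_of_mcoef fun x ξ => ?_
  obtain ⟨φ, hφ⟩ := exists_slot θ i x ξ
  have h1 := hi φ fun a => slot_intertwine θ hφ (hθ i a)
  have h2 := hφ (x i) (ξ i)
  rw [h1, Function.update_eq_self, Function.update_eq_self] at h2
  rw [← h2]
  exact (map_zero (ξ i)).trans (map_zero (dualProd ξ)).symm

/-- Each slot map is a scalar, so the pair `(x j, ξ j)` in one slot may be exchanged for the
normalized pair `(m j, μ j)` at the cost of the factor `ξ j (x j)`. After all slots, the scalar is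
the coefficient at `(m, μ)`. -/
theorem tens_hom_scalar {θ : tens M ⟶ tens M} (hθ : ∀ i (a : E i),
      tensMap (Function.update (fun j => 𝟙 (M j)) i (f i a)) ≫ θ =
      θ ≫ tensMap (Function.update (fun j => 𝟙 (M j)) i (f i a)))
    (hi : ∀ i (φ : M i ⟶ M i), (∀ a, f i a ≫ φ = φ ≫ f i a) → ∃ c : k, φ = c • 𝟙 _)
    (m : ∀ j, (M j : Type u)) (μ : ∀ j, Module.Dual k (M j : Type u)) (hm : ∀ j, μ j (m j) = 1) :
    ∃ c : k, θ = c • 𝟙 _ := by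
  have := Fintype.ofFinite J
  have key : ∀ (I : Finset J) x ξ, mcoef θ x ξ =
      (∏ j ∈ I, ξ j (x j)) * mcoef θ (I.piecewise m x) (I.piecewise μ ξ) := by
    intro I x ξ
    induction I using Finset.induction_on with
    | empty => simp
    | insert i I hiI ih =>
      rw [ih, Finset.prod_insert hiI, Finset.piecewise_insert, Finset.piecewise_insert]
      set x' := I.piecewise m x with hx'
      set ξ' := I.piecewise μ ξ with hξ'
      obtain ⟨φ, hφ⟩ := exists_slot θ i x' ξ'
      obtain ⟨c, hc⟩ := hi i φ fun a => slot_intertwine θ hφ (hθ i a)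
      have h0 : ∀ y (η : Module.Dual k (M i : Type u)), η (el φ y) = c * η y := fun y η => by
        rw [hc, el_smul_apply, map_smul]; rfl
      have h1 := (h0 _ _).symm.trans (hφ (m i) (μ i))
      have h2 := (h0 _ _).symm.trans (hφ (x' i) (ξ' i))
      rw [Function.update_eq_self, Function.update_eq_self] at h2
      rw [hm, mul_one] at h1
      have h3 : x' i = x i := Finset.piecewise_eq_of_notMem _ _ _ hiI
      have h4 : ξ' i = ξ i := Finset.piecewise_eq_of_notMem _ _ _ hiI
      rw [h3, h4] at h2
      rw [← h1, ← h2]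
      ring
  refine ⟨mcoef θ m μ, eq_of_mcoef fun x ξ => ?_⟩
  rw [key Finset.univ, Finset.piecewise_univ, Finset.piecewise_univ, ← dualProd_tmk, mul_comm]
  exact (map_smul (dualProd ξ) (mcoef θ m μ) (tmk x)).symm

end DualProd

/-! ### Degrees of external products. -/

section ExtHomog

variable {𝒜 : Type (u + 1)} [Category.{u} 𝒜] [Preadditive 𝒜] [Linear k 𝒜]

theorem extProd_isHomog {J : Type} [Finite J] {S : J → Type} {T : Type} (a : ∀ j, S j → T)
    {F : ∀ j, PolyFun k (Sh (S j) 𝒜)} {d : J → ℕ} (hF : ∀ j, isHomog k _ (d j) (F j)) :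
    isHomog k _ (∑ᶠ j, d j) ((extProd a).obj F) := by
  intro X Y c f
  have := Fintype.ofFinite J
  rw [finsum_eq_sum_of_fintype, ← Finset.prod_pow_eq_pow_sum]
  have h : ∀ j, (F j).obj.map ((pull (a j)).map (c • f)) = c ^ d j • (F j).obj.map ((pull (a j)).map f) :=
    fun j => hF j _ _ c ((pull (a j)).map f)
  refine Eq.trans (congrArg tensMap (funext h)) ?_
  exact (tensMulti (fun j => (F j).obj.obj ((pull (a j)).obj X))
    (fun j => (F j).obj.obj ((pull (a j)).obj Y))).map_smul_univ _ _

end ExtHomog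

/-! ### Large constant sheaves contain all short words. -/

section Const

variable {𝒜 : Type (u + 1)} [Category.{u} 𝒜] [Preadditive 𝒜] [Linear k 𝒜] [HasFiniteBiproducts 𝒜]
  {R : Type} [Finite R] {e : R → 𝒜}

/-- The sum of `D` copies of every basis object. -/
def bigObj (e : R → 𝒜) (D : ℕ) : 𝒜 := ⨁ fun p : Fin D × R => e p.2

/-- A constant sheaf containing `D` copies of every basis object. -/
abbrev bigConst (S : Type) (e : R → 𝒜) (D : ℕ) : Sh S 𝒜 := fun _ => bigObj e D

variable {S : Type} [HasZeroObject 𝒜]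

theorem skyOut_skyIn_self {s : S} {C A : 𝒜} {f : A ⟶ C} {g : C ⟶ A} (h : f ≫ g = 𝟙 A) :
    skyOut (V := fun _ : S => C) (s := s) f ≫ skyIn (V := fun _ : S => C) (s := s) g = 𝟙 (sky s A) := by
  refine sky_hom_ext ?_
  show _ ≫ (skyOut (V := fun _ : S => C) (s := s) f s ≫ skyIn (V := fun _ : S => C) (s := s) g s) = _ ≫ 𝟙 _
  rw [skyOut_self, skyIn_self, Category.assoc, reassoc_of% h, Iso.inv_hom_id_assoc]
  exact (Category.comp_id _).symm

theorem skyOut_skyIn_zero {s s' : S} {C A B : 𝒜} {f : A ⟶ C} {g : C ⟶ B} (h : f ≫ g = 0) :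
    skyOut (V := fun _ : S => C) (s := s) f ≫ skyIn (V := fun _ : S => C) (s := s') g = 0 := by
  refine sky_hom_ext ?_
  show _ ≫ (skyOut (V := fun _ : S => C) (s := s) f s ≫ skyIn (V := fun _ : S => C) (s := s') g s) = _ ≫ 0
  by_cases hs : s = s'
  · subst hs
    rw [skyOut_self, skyIn_self]
    simp [reassoc_of% h]
  · rw [skyIn_ne hs]
    simp

/-- The letter in position `a` is placed in the `a`-th copy of its basis object in the stalk at its
point. Using different copies keeps distinct letters orthogonal. -/
theorem exists_word_retract {D m : ℕ} (hm : m ≤ D) (w : Fin m → S × R) :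
    ∃ (i : word (skyBasis S e) w ⟶ bigConst S e D) (p : bigConst S e D ⟶ word (skyBasis S e) w),
      i ≫ p = 𝟙 _ := by
  classical
  let E : Fin D × R → 𝒜 := fun p => e p.2
  let q : Fin m → Fin D × R := fun a => (Fin.castLE hm a, (w a).2)
  let i : ∀ a, skyBasis S e (w a) ⟶ bigConst S e D := fun a =>
    skyOut (V := bigConst S e D) (biproduct.ι E (q a))
  let p : ∀ a, bigConst S e D ⟶ skyBasis S e (w a) := fun a =>
    skyIn (V := bigConst S e D) (biproduct.π E (q a))
  refine ⟨biproduct.desc i, biproduct.lift p, ?_⟩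
  refine biproduct.hom_ext' _ _ fun a => biproduct.hom_ext _ _ fun b => ?_
  rw [Category.assoc, Category.assoc, biproduct.lift_π, biproduct.ι_desc_assoc, Category.comp_id]
  by_cases hab : a = b
  · subst hab
    rw [biproduct.ι_π_self]
    exact skyOut_skyIn_self (biproduct.ι_π_self E (q a))
  · rw [biproduct.ι_π_ne _ hab]
    refine skyOut_skyIn_zero (biproduct.ι_π_ne E fun h => hab ?_)
    exact Fin.castLE_injective hm (congrArg Prod.fst h)

variable [CharZero k] [Finite S] (hB : IsSplitBasis k e) {d D : ℕ}

include hB in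
theorem natTrans_ext_const (hd : d ≤ D) {F G : Sh S 𝒜 ⥤ FGModuleCat.{u} k} (hF : IsDiagFun k d F)
    {α β : F ⟶ G} (h : α.app (bigConst S e D) = β.app (bigConst S e D)) : α = β := by
  have hB' := isSplitBasis_sky (S := S) hB
  have := hB'.finite_hom
  refine natTrans_ext_word hB' hF fun w => ?_
  obtain ⟨i, p, hip⟩ := exists_word_retract (e := e) hd w
  have key : ∀ γ : F ⟶ G, γ.app (word (skyBasis S e) w) =
      F.map i ≫ γ.app (bigConst S e D) ≫ G.map p := fun γ => by
    rw [← γ.naturality, ← F.map_comp_assoc, hip, F.map_id, Category.id_comp]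
  rw [key, key, h]

include hB in
theorem poly_ext_const (hd : d ≤ D) {F G : PolyFun k (Sh S 𝒜)} (hF : isHomog k _ d F)
    {α β : F ⟶ G} (h : α.hom.app (bigConst S e D) = β.hom.app (bigConst S e D)) : α = β :=
  ObjectProperty.hom_ext _ (natTrans_ext_const hB hd (isDiagFun_of_isHomog hF) h)

include hB in
/-- Homogeneous functors are determined by their values on a large constant sheaf. -/
theorem exists_extension_const {d' : ℕ} (hd : d ≤ D) {F G : PolyFun k (Sh S 𝒜)} (hF : isHomog k _ d F)
    (hG : isHomog k _ d' G) (φ : F.obj.obj (bigConst S e D) ⟶ G.obj.obj (bigConst S e D))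
    (hφ : ∀ f, F.obj.map f ≫ φ = φ ≫ G.obj.map f) :
    ∃ α : F ⟶ G, α.hom.app (bigConst S e D) = φ := by
  by_cases h : d = d'
  · subst h
    obtain ⟨α, hα⟩ := exists_extension (isSplitBasis_sky hB) (isDiagFun_of_isHomog hF)
      (isDiagFun_of_isHomog hG) (exists_word_retract (e := e) hd) φ hφ
    exact ⟨ObjectProperty.homMk α, hα⟩
  -- In different degrees, compatibility with the scalar `2` forces `φ = 0`.
  · refine ⟨0, ?_⟩
    have h1 := hφ ((2 : k) • 𝟙 _)
    rw [hF, hG, F.obj.map_id, G.obj.map_id, Linear.smul_comp, Linear.comp_smul, Category.id_comp,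
      Category.comp_id] at h1
    have h2 : ((2 : k) ^ d - 2 ^ d') • φ = 0 := by rw [sub_smul, h1, sub_self]
    refine ((smul_eq_zero.1 h2).resolve_left fun h3 => h ?_).symm
    have h4 : ((2 ^ d : ℕ) : k) = ((2 ^ d' : ℕ) : k) := by push_cast; exact sub_eq_zero.1 h3
    exact Nat.pow_right_injective le_rfl (Nat.cast_injective h4)

end Const

/-! ### Maps between external products of basis functors. -/

section ExtBasis

variable {𝒜 : Type (u + 1)} [Category.{u} 𝒜] [Preadditive 𝒜] [Linear k 𝒜] [HasFiniteBiproducts 𝒜]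
  [HasZeroObject 𝒜] [CharZero k] {R : Type} [Finite R] {e : R → 𝒜} (hB : IsSplitBasis k e)
  {J : Type} [Finite J] {S : J → Type} [∀ j, Finite (S j)] {T : Type} [Finite T] {a : ∀ j, S j → T}

/-- The maps out of the `S j` present `T` as their disjoint union. -/
abbrev IsCoprodMap (a : ∀ j, S j → T) : Prop := Function.Bijective fun p : Σ j, S j => a p.1 p.2

-- On a disjoint union, extend `f` by the identity over the other pieces. Constant sheaves are used
-- because they pull back to constant sheaves on the nose.
open Classical in
theorem exists_const_slot (ha : IsCoprodMap a) (D : ℕ) (i : J)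
    (f : bigConst (S i) e D ⟶ bigConst (S i) e D) :
    ∃ g : bigConst T e D ⟶ bigConst T e D, ∀ j, (pull (a j)).map g =
      Function.update (β := fun (j : J) => bigConst (S j) e D ⟶ bigConst (S j) e D) (fun j => 𝟙 _) i f j := by
  let f' : S i → (bigObj e D ⟶ bigObj e D) := f
  refine ⟨fun t => if h : ∃ s, a i s = t then f' h.choose else 𝟙 _, fun j => funext fun s => ?_⟩
  show (if h : ∃ s', a i s' = a j s then f' h.choose else 𝟙 _) = _
  by_cases hj : j = i
  · subst hj
    have h : ∃ s', a j s' = a j s := ⟨s, rfl⟩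
    rw [dif_pos h, Function.update_self]
    have h1 : (⟨j, h.choose⟩ : Σ j, S j) = ⟨j, s⟩ := ha.1 h.choose_spec
    have h2 : h.choose = s := by simpa using h1
    exact congrArg f' h2
  · rw [dif_neg, Function.update_of_ne hj]
    · rfl
    · rintro ⟨s', h⟩
      have h1 : (⟨i, s'⟩ : Σ j, S j) = ⟨j, s⟩ := ha.1 h
      exact hj (congrArg Sigma.fst h1).symm

open Classical in
/-- The value at a large constant sheaf of a map between external tensor products commutes with
endomorphisms of every factor. -/
theorem ext_slot (ha : IsCoprodMap a) (D : ℕ) {F G : ∀ j, PolyFun k (Sh (S j) 𝒜)}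
    (θ : (extProd a).obj F ⟶ (extProd a).obj G) (i : J)
    (f : bigConst (S i) e D ⟶ bigConst (S i) e D) :
    tensMap (Function.update (fun j => 𝟙 ((F j).obj.obj (bigConst (S j) e D))) i ((F i).obj.map f)) ≫
      θ.hom.app (bigConst T e D) =
    θ.hom.app (bigConst T e D) ≫
      tensMap (Function.update (fun j => 𝟙 ((G j).obj.obj (bigConst (S j) e D))) i ((G i).obj.map f)) := by
  obtain ⟨g, hg⟩ := exists_const_slot (e := e) ha D i f
  have h1 : ∀ H : ∀ j, PolyFun k (Sh (S j) 𝒜), (fun j => (H j).obj.map ((pull (a j)).map g)) =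
      Function.update (fun j => 𝟙 ((H j).obj.obj (bigConst (S j) e D))) i ((H i).obj.map f) := by
    intro H
    funext j
    refine (congrArg (H j).obj.map (hg j)).trans ?_
    by_cases hj : j = i
    · subst hj
      rw [Function.update_self, Function.update_self]
    · rw [Function.update_of_ne hj, Function.update_of_ne hj]
      exact (H j).obj.map_id _
  exact (congrArg (tensMap · ≫ θ.hom.app (bigConst T e D)) (h1 F)).symm.trans
    ((θ.hom.naturality g).trans (congrArg (θ.hom.app (bigConst T e D) ≫ tensMap ·) (h1 G)))

variable {Q : J → Type*} {E : ∀ j, Q j → PolyFun k (Sh (S j) 𝒜)} {δ : ∀ j, Q j → ℕ}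
  (hE : ∀ j, IsSplitBasis k (E j)) (hδ : ∀ j r, isHomog k _ (δ j r) (E j r))

include hB hE hδ

/-- At a large constant sheaf, a slot map at an index where `r` and `r'` differ extends to a natural
transformation between different basis functors, so it is zero; `tens_hom_zero` applies. -/
theorem ext_hom_zero (ha : IsCoprodMap a) {r r' : ∀ j, Q j} (h : r ≠ r')
    (θ : (extProd a).obj (tup E r) ⟶ (extProd a).obj (tup E r')) : θ = 0 := by
  classical
  have := Fintype.ofFinite J
  obtain ⟨i, hi⟩ := Function.ne_iff.1 h
  -- The total degree bounds the degree of the external product and that of each factor, so one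
  -- constant sheaf serves for all.
  let D := ∑ j, δ j (r j)
  have hD : ∑ᶠ j, δ j (r j) ≤ D := (finsum_eq_sum_of_fintype _).le
  refine poly_ext_const hB hD (extProd_isHomog a fun j => hδ j (r j)) ?_
  refine tens_hom_zero (θ := θ.hom.app (bigConst T e D)) (f := fun i => (E i (r i)).obj.map)
    (f' := fun i => (E i (r' i)).obj.map) (hθ := ext_slot (e := e) ha D θ) i fun φ hφ => ?_
  obtain ⟨α, rfl⟩ := exists_extension_const hB (Finset.single_le_sum (f := fun j => δ j (r j)) (fun _ _ => Nat.zero_le _)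
    (Finset.mem_univ i) : δ i (r i) ≤ D) (hδ i (r i)) (hδ i (r' i)) φ hφ
  rw [(hE i).hom_zero hi α]
  rfl

/-- A nonzero homogeneous functor cannot vanish at a large constant sheaf; this supplies the
normalized pairs for `tens_hom_scalar`. -/
theorem exists_dual_one {j : J} (r : Q j) {D : ℕ} (hD : δ j r ≤ D) :
    ∃ (m : ((E j r).obj.obj (bigConst (S j) e D) : Type u))
      (μ : Module.Dual k ((E j r).obj.obj (bigConst (S j) e D) : Type u)), μ m = 1 := by
  have h : ∃ m : ((E j r).obj.obj (bigConst (S j) e D) : Type u), m ≠ 0 := by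
    by_contra! h
    refine (hE j).one_ne r (poly_ext_const hB hD (hδ j r) (el_ext fun u => ?_))
    exact (h _).trans (h _).symm
  obtain ⟨m, hm⟩ := h
  obtain ⟨μ, hμ⟩ := not_forall.1 fun h => hm ((Module.forall_dual_apply_eq_zero_iff k m).1 h)
  exact ⟨m, (μ m)⁻¹ • μ, inv_mul_cancel₀ hμ⟩

theorem ext_hom_self (ha : IsCoprodMap a) (r : ∀ j, Q j)
    (θ : (extProd a).obj (tup E r) ⟶ (extProd a).obj (tup E r)) : ∃ c : k, θ = c • 𝟙 _ := by
  classical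
  have := Fintype.ofFinite J
  let D := ∑ j, δ j (r j)
  have hD : ∑ᶠ j, δ j (r j) ≤ D := (finsum_eq_sum_of_fintype _).le
  have hD' : ∀ i, δ i (r i) ≤ D := fun i =>
    Finset.single_le_sum (f := fun j => δ j (r j)) (fun _ _ => Nat.zero_le _) (Finset.mem_univ i)
  choose m μ hm using fun j => exists_dual_one hB hE hδ (r j) (hD' j)
  obtain ⟨c, hc⟩ := tens_hom_scalar (f := fun i => (E i (r i)).obj.map) (ext_slot (e := e) ha D θ)
    (fun i φ hφ => by
      obtain ⟨α, rfl⟩ := exists_extension_const hB (hD' i) (hδ i (r i)) (hδ i (r i)) φ hφ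
      obtain ⟨c, rfl⟩ := (hE i).hom_self (r i) α
      exact ⟨c, rfl⟩) m μ hm
  exact ⟨c, poly_ext_const hB hD (extProd_isHomog a fun j => hδ j (r j)) hc⟩

theorem ext_one_ne (r : ∀ j, Q j) : 𝟙 ((extProd a).obj (tup E r)) ≠ 0 := by
  have := Fintype.ofFinite J
  let D := ∑ j, δ j (r j)
  have hD' : ∀ i, δ i (r i) ≤ D := fun i =>
    Finset.single_le_sum (f := fun j => δ j (r j)) (fun _ _ => Nat.zero_le _) (Finset.mem_univ i)
  choose m μ hm using fun j => exists_dual_one hB hE hδ (r j) (hD' j)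
  intro h
  have h1 : tmk (V := fun j => (E j (r j)).obj.obj (bigConst (S j) e D)) m = 0 :=
    congrArg (fun z => el (z.hom.app (bigConst T e D))
      (tmk (V := fun j => (E j (r j)).obj.obj (bigConst (S j) e D)) m)) h
  have h2 := dualProd_tmk μ m
  rw [h1, map_zero, Finset.prod_congr rfl fun j _ => hm j, Finset.prod_const_one] at h2
  exact zero_ne_one h2

end ExtBasis

/-! ### Regrouping tensor factors along a map. -/

section FibreNest

open TensorProduct

variable {A J : Type} [Finite A] [Finite J] (p : A → J)

theorem fibre_update [DecidableEq A] [DecidableEq J] [∀ j, DecidableEq {a // p a = j}] {M : A → Type*}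
    {N : J → Type*} (n : ∀ j, (∀ a : {a // p a = j}, M a.1) → N j) (x : ∀ a, M a) (i : A) (y : M i) :
    (fun j => n j fun a => Function.update x i y a.1) =
      Function.update (fun j => n j fun a => x a.1) (p i)
        (n (p i) (Function.update (fun a : {a // p a = p i} => x a.1) ⟨i, rfl⟩ y)) := by
  funext j
  by_cases h : j = p i
  · subst h
    rw [Function.update_self]
    congr 1
    funext a
    by_cases h' : a = ⟨i, rfl⟩
    · subst h'
      rw [Function.update_self (⟨i, rfl⟩ : {a // p a = p i})]
      exact Function.update_self i y x
    · rw [Function.update_of_ne h', Function.update_of_ne]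
      exact fun h2 => h' (Subtype.ext h2)
  · rw [Function.update_of_ne h]
    congr 1
    funext a
    rw [Function.update_of_ne]
    intro h2
    exact h (by rw [← a.2, h2])

/-- Plugging multilinear maps, one for each fibre, into a multilinear map. -/
def fibreMultilinear {M : A → Type*} {N : J → Type*} {P : Type*}
    [∀ a, AddCommGroup (M a)] [∀ a, Module k (M a)] [∀ j, AddCommGroup (N j)]
    [∀ j, Module k (N j)] [AddCommGroup P] [Module k P] (m : MultilinearMap k N P)
    (n : ∀ j, MultilinearMap k (fun a : {a // p a = j} => M a.1) (N j)) :
    MultilinearMap k M P where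
  toFun x := m fun j => n j fun a => x a.1
  map_update_add' x i y y' := by
    classical
    simp only [fibre_update p (fun j => n j) x i, MultilinearMap.map_update_add]
  map_update_smul' x i c y := by
    classical
    simp only [fibre_update p (fun j => n j) x i, MultilinearMap.map_update_smul]

/-- Grouping the factors of a tensor product along the fibres of a map. -/
def fibreMap (M : A → Type u) [∀ a, AddCommGroup (M a)] [∀ a, Module k (M a)] :
    (⨂[k] a, M a) →ₗ[k] ⨂[k] j, ⨂[k] a : {a // p a = j}, M a.1 :=
  PiTensorProduct.lift (fibreMultilinear p (PiTensorProduct.tprod k) fun _ => PiTensorProduct.tprod k)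

theorem fibreMap_tprod (M : A → Type u) [∀ a, AddCommGroup (M a)] [∀ a, Module k (M a)] (x : ∀ a, M a) :
    fibreMap (k := k) p M (PiTensorProduct.tprod k x) =
      PiTensorProduct.tprod k fun j => PiTensorProduct.tprod k fun a : {a // p a = j} => x a.1 :=
  PiTensorProduct.lift.tprod _

theorem fibre_bijective (κ : A → Type*) :
    Function.Bijective fun (x : ∀ a, κ a) (j : J) (a : {a // p a = j}) => x a.1 := by
  refine ⟨fun x y h => funext fun a => congrFun (congrFun h (p a)) ⟨a, rfl⟩, fun y =>
    ⟨fun a => y (p a) ⟨a, rfl⟩, ?_⟩⟩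
  funext j a
  obtain ⟨a, rfl⟩ := a
  rfl

theorem fibreMap_bijective (M : A → Type u) [∀ a, AddCommGroup (M a)] [∀ a, Module k (M a)] :
    Function.Bijective (fibreMap (k := k) p M) := by
  let b := fun a => Module.Basis.ofVectorSpace k (M a)
  let B := Basis.piTensorProduct b
  let B' := Basis.piTensorProduct fun j => Basis.piTensorProduct fun a : {a // p a = j} => b a.1
  let e := B.equiv B' (Equiv.ofBijective _ (fibre_bijective p _))
  have : fibreMap (k := k) p M = e.toLinearMap := by
    refine B.ext fun q => ?_
    rw [LinearEquiv.coe_coe, Module.Basis.equiv_apply, Basis.piTensorProduct_apply, fibreMap_tprod,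
      Basis.piTensorProduct_apply]
    simp only [Basis.piTensorProduct_apply]
    rfl
  rw [this]
  exact e.bijective

/-- Grouping the factors of a tensor product along the fibres of a map. -/
def tensFibre (M : A → FGModuleCat.{u} k) : tens M ≅ tens fun j => tens fun a : {a // p a = j} => M a.1 :=
  (LinearEquiv.ofBijective _ (fibreMap_bijective (k := k) p fun a => (M a : Type u))).toFGModuleCatIso

theorem tensFibre_tmk (M : A → FGModuleCat.{u} k) (x : ∀ a, (M a : Type u)) :
    el (tensFibre p M).hom (tmk x) = tmk (V := fun j => tens fun a : {a // p a = j} => M a.1) fun j =>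
      tmk fun a : {a // p a = j} => x a.1 :=
  fibreMap_tprod p _ x

theorem tensFibre_naturality {M N : A → FGModuleCat.{u} k} (f : ∀ a, M a ⟶ N a) :
    tensMap f ≫ (tensFibre p N).hom =
      (tensFibre p M).hom ≫ tensMap fun j => tensMap fun a : {a // p a = j} => f a.1 := by
  refine tens_ext fun x => ?_
  refine (congrArg (el (tensFibre p N).hom) (tensMap_tmk f x)).trans ((tensFibre_tmk p N _).trans ?_)
  refine Eq.trans ?_ ((congrArg (el (tensMap _)) (tensFibre_tmk p M x)).trans (tensMap_tmk _ _)).symm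
  exact congrArg tmk (funext fun j => (tensMap_tmk _ _).symm)

end FibreNest

theorem exists_section {V W : FGModuleCat.{u} k} (f : V ⟶ W) (h : Function.Surjective (el f)) :
    ∃ r : W ⟶ V, r ≫ f = 𝟙 W := by
  obtain ⟨g, hg⟩ := (el f).exists_rightInverse_of_surjective (LinearMap.range_eq_top.2 h)
  exact ⟨FGModuleCat.ofHom g, FGModuleCat.hom_ext hg⟩

theorem tensMap_section {ι : Type} [Finite ι] {V W : ι → FGModuleCat.{u} k} (f : ∀ i, V i ⟶ W i)
    (h : ∀ i, ∃ r, r ≫ f i = 𝟙 _) : ∃ r, r ≫ tensMap f = 𝟙 _ := by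
  choose r hr using h
  exact ⟨tensMap r, (tensMap_comp _ _).symm.trans ((congrArg tensMap (funext hr)).trans tensMap_id)⟩

/-! ### Generators on a disjoint union are quotients of external products. -/

section ExtGen

variable {𝒜 : Type (u + 1)} [Category.{u} 𝒜] [Preadditive 𝒜] [Linear k 𝒜] [HasZeroObject 𝒜]

/-- Skyscrapers are left adjoint to stalks. -/
theorem exists_sky_transpose {S T : Type} {a : S → T} {s : S} {t : T} (h : a s = t) (A : 𝒜) :
    ∃ L : ∀ V : Sh T 𝒜, (sky s A ⟶ (pull a).obj V) →ₗ[k] (sky t A ⟶ V),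
      (∀ V, Function.Surjective (L V)) ∧ ∀ {V W : Sh T 𝒜} (g : V ⟶ W) (f : sky s A ⟶ (pull a).obj V),
        L V f ≫ g = L W (f ≫ (pull a).map g) := by
  subst h
  have h1 : ∀ {V : Sh T 𝒜} (f : A ⟶ V (a s)), (skyIso (a s) A).inv ≫ skyOut f (a s) = f := fun f => by
    rw [skyOut_self, Iso.inv_hom_id_assoc]
  refine ⟨fun V =>
    { toFun := fun f => skyOut ((skyIso s A).inv ≫ f s)
      map_add' := fun f g => sky_hom_ext ?_
      map_smul' := fun c f => sky_hom_ext ?_ }, fun V g => ?_, fun {V W} g f => sky_hom_ext ?_⟩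
  · refine (h1 _).trans (Eq.trans ?_ (Preadditive.comp_add _ _ _ _ _ _).symm)
    rw [h1, h1]
    exact Preadditive.comp_add _ _ _ _ _ _
  · refine (h1 _).trans (Eq.trans ?_ (Linear.comp_smul _ _ _ _ _ _).symm)
    rw [h1]
    exact Linear.comp_smul _ _ _ _ _ _
  · refine ⟨skyOut ((skyIso (a s) A).inv ≫ g (a s)), sky_hom_ext ?_⟩
    refine (h1 _).trans ?_
    rw [skyOut_self, Iso.inv_hom_id_assoc]
  · refine Eq.trans ?_ (h1 _).symm
    refine (Category.assoc _ _ _).symm.trans ?_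
    exact (congrArg (· ≫ g (a s)) (h1 _)).trans (Category.assoc _ _ _)

variable [∀ X Y : 𝒜, Module.Finite k (X ⟶ Y)] {J : Type} [Finite J] {S : J → Type} [∀ j, Finite (S j)]
  {T : Type} [Finite T] {a : ∀ j, S j → T}

instance {S : Type} [Finite S] (V W : Sh S 𝒜) : Module.Finite k (V ⟶ W) :=
  inferInstanceAs (Module.Finite k (∀ s, V s ⟶ W s))

/-- External products of the functors `tensHom` map onto the functors `tensHom`. -/
theorem exists_ext_tensHom (ha : IsCoprodMap a) {A : Type} [Finite A] (t : A → T) (E : A → 𝒜) :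
    ∃ (p : A → J) (s : ∀ j, {c // p c = j} → S j)
      (θ : (extProd a).obj (fun j => tensHom (k := k) fun c : {c // p c = j} => sky (s j c) (E c.1)) ⟶
        tensHom fun c => sky (t c) (E c)), ∀ V : Sh T 𝒜, ∃ r, r ≫ θ.hom.app V = 𝟙 _ := by
  -- Each point `t c` lies in a unique piece; `p` sorts the letters by piece and `s` records their
  -- points there.
  choose q hq using fun c => ha.2 (t c)
  let p : A → J := fun c => (q c).1
  let s : ∀ j, {c // p c = j} → S j := fun j c => c.2 ▸ (q c.1).2
  have hs : ∀ j (c : {c // p c = j}), a j (s j c) = t c.1 := by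
    rintro _ ⟨c, rfl⟩
    exact hq c
  choose L hL hL' using fun j (c : {c // p c = j}) => exists_sky_transpose (k := k) (hs j c) (E c.1)
  let M : Sh T 𝒜 → A → FGModuleCat.{u} k := fun V c => FGModuleCat.of k (sky (t c) (E c) ⟶ V)
  let M' : Sh T 𝒜 → ∀ j, {c // p c = j} → FGModuleCat.{u} k := fun V j c =>
    FGModuleCat.of k (sky (s j c) (E c.1) ⟶ (pull (a j)).obj V)
  let l : ∀ V j, (tens (M' V j) ⟶ tens fun c : {c // p c = j} => M V c.1) := fun V j =>
    tensMap fun c => FGModuleCat.ofHom (L j c V)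
  let θ : ∀ V, (tens fun j => tens (M' V j)) ⟶ tens (M V) := fun V =>
    tensMap (l V) ≫ (tensFibre p (M V)).inv
  have hθ : ∀ {V W : Sh T 𝒜} (g : V ⟶ W),
      ((extProd a).obj (fun j => tensHom (k := k) fun c : {c // p c = j} => sky (s j c) (E c.1))).obj.map g ≫ θ W =
        θ V ≫ (tensHom fun c => sky (t c) (E c)).obj.map g := by
    intro V W g
    let m : ∀ c, M V c ⟶ M W c := fun c => FGModuleCat.ofHom (Linear.rightComp k (sky (t c) (E c)) g)
    let m' : ∀ j (c : {c // p c = j}), M' V j c ⟶ M' W j c := fun j c =>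
      FGModuleCat.ofHom (Linear.rightComp k (sky (s j c) (E c.1)) ((pull (a j)).map g))
    have h1 := tensFibre_naturality p m
    have h2 : ∀ j, tensMap (m' j) ≫ l W j = l V j ≫ tensMap fun c : {c // p c = j} => m c.1 := fun j => by
      refine (tensMap_comp _ _).symm.trans (Eq.trans (congrArg tensMap (funext fun c => ?_)) (tensMap_comp _ _))
      exact el_ext fun f => (hL' j c g f).symm
    have h3 : (tensMap fun j => tensMap (m' j)) ≫ tensMap (l W) =
        tensMap (l V) ≫ tensMap fun j => tensMap fun c : {c // p c = j} => m c.1 :=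
      (tensMap_comp _ _).symm.trans (Eq.trans (congrArg tensMap (funext h2)) (tensMap_comp _ _))
    have h4 : (tensMap fun j => tensMap fun c : {c // p c = j} => m c.1) ≫ (tensFibre p (M W)).inv =
        (tensFibre p (M V)).inv ≫ tensMap m := by
      rw [Iso.comp_inv_eq, Category.assoc, h1, Iso.inv_hom_id_assoc]
    show (tensMap fun j => tensMap (m' j)) ≫ tensMap (l W) ≫ (tensFibre p (M W)).inv =
      (tensMap (l V) ≫ (tensFibre p (M V)).inv) ≫ tensMap m
    rw [← Category.assoc, h3, Category.assoc, h4, Category.assoc]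
  refine ⟨p, s, ObjectProperty.homMk { app := θ, naturality := fun V W g => hθ g }, fun V => ?_⟩
  -- Surjections of vector spaces split, and splittings can be tensored; naturality of the section
  -- is not required.
  obtain ⟨r, hr⟩ := tensMap_section (l V) fun j => tensMap_section _ fun c => exists_section _ (hL j c V)
  refine ⟨(tensFibre p (M V)).hom ≫ r, ?_⟩
  show ((tensFibre p (M V)).hom ≫ r) ≫ tensMap (l V) ≫ (tensFibre p (M V)).inv = _
  rw [Category.assoc, reassoc_of% hr, Iso.hom_inv_id]
  rfl

end ExtGen

/-! ### Recognizing members of a split basis. -/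

section Schur

variable {C : Type*} [Category* C] [Preadditive C] [Linear k C] {R : Type*} {e : R → C}

/-- A nonzero map to `e r` exhibits `e r` as a summand of `X`. The corresponding idempotent of `X`
is a scalar, and it is nonzero, so it is the identity. -/
theorem IsSplitBasis.nonempty_iso (hB : IsSplitBasis k e) {X : C} (hX : ∀ f : X ⟶ X, ∃ c : k, f = c • 𝟙 X)
    {r : R} {f : X ⟶ e r} (hf : f ≠ 0) : Nonempty (e r ≅ X) := by
  obtain ⟨D⟩ := hB.decomp X
  obtain ⟨a, ha⟩ := D.exists_comp_ne_zero hf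
  have hr : D.l a = r := by
    by_contra h
    exact ha (hB.hom_zero h _)
  subst hr
  obtain ⟨c, hc⟩ := hX (D.π a ≫ D.ι a)
  have h1 : c • D.ι a = D.ι a := by
    have := congrArg (D.ι a ≫ ·) hc
    simpa [reassoc_of% D.ι_π a] using this.symm
  have h2 : c = 1 := by
    have h3 : (c - 1) • D.ι a = 0 := by rw [sub_smul, h1, one_smul, sub_self]
    refine sub_eq_zero.1 ((smul_eq_zero.1 h3).resolve_right fun h4 => hB.one_ne (D.l a) ?_)
    rw [← D.ι_π, h4, zero_comp]
  exact ⟨⟨D.ι a, D.π a, D.ι_π a, by rw [hc, h2, one_smul]⟩⟩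

end Schur

/-! ### External products of basis functors form a split basis. -/

section ExtSplit

variable {𝒜 : Type (u + 1)} [Category.{u} 𝒜] [Preadditive 𝒜] [Linear k 𝒜] [HasFiniteBiproducts 𝒜]
  [HasZeroObject 𝒜] [CharZero k] {R : Type} [Finite R] {e : R → 𝒜} (hB : IsSplitBasis k e)
  {J : Type} [Finite J] {S : J → Type} [∀ j, Finite (S j)] {T : Type} [Finite T] {a : ∀ j, S j → T}
  {Q : J → Type*} {E : ∀ j, Q j → PolyFun k (Sh (S j) 𝒜)} {δ : ∀ j, Q j → ℕ}
  (hE : ∀ j, IsSplitBasis k (E j)) (hδ : ∀ j r, isHomog k _ (δ j r) (E j r))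

-- Some `tensHom` maps nontrivially to `F`; an external product of such functors surjects onto it
-- objectwise. Decomposing each factor of this product into basis functors, one of the summands maps
-- nontrivially.
include hB hE in
theorem exists_ext_hom_ne_zero (ha : IsCoprodMap a) {d : ℕ} {F : PolyFun k (Sh T 𝒜)}
    (hF : isHomog k _ d F) (h0 : 𝟙 F ≠ 0) : ∃ (r : ∀ j, Q j) (f : (extProd a).obj (tup E r) ⟶ F), f ≠ 0 := by
  classical
  have := Fintype.ofFinite J
  have := hB.finite_hom
  have hB' := isSplitBasis_sky (S := T) hB
  have hd := isDiagFun_of_isHomog hF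
  obtain ⟨X, u, hu⟩ : ∃ (X : Sh T 𝒜) (u : (F.obj.obj X : Type u)), u ≠ 0 := by
    by_contra! h
    exact h0 (poly_ext fun X => el_ext fun u => (h X u).trans (h X _).symm)
  obtain ⟨w, x, u', hx⟩ := exists_ofWord_ne_zero hB' hd hu
  obtain ⟨φ, hφ⟩ := exists_tensHom_map_word hd w u'
  obtain ⟨p, s, θ, hθ⟩ := exists_ext_tensHom (k := k) ha (fun c => (w c).1) fun c => e (w c).2
  have h1 : θ ≫ φ ≠ 0 := by
    intro h
    obtain ⟨r, hr⟩ := hθ X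
    have h2 : φ.hom.app X = 0 := by
      have h3 : θ.hom.app X ≫ φ.hom.app X = 0 := congrArg (fun z => z.hom.app X) h
      have h4 := congrArg (r ≫ ·) h3
      simpa [reassoc_of% hr] using h4
    refine hx ((hφ X x).symm.trans ?_)
    rw [h2]
    rfl
  by_contra! h
  refine h1 ?_
  let D := fun j => ((hE j).decomp (tensHom fun c : {c // p c = j} => sky (s j c) (e (w c.1).2))).some
  have h2 := congrArg (· ≫ (θ ≫ φ)) ((ext_lin a).total D)
  rw [Preadditive.sum_comp, Finset.sum_eq_zero fun v _ => ?_] at h2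
  · exact ((Category.id_comp _).symm.trans h2.symm)
  · exact (Category.assoc _ _ _).trans ((congrArg (_ ≫ ·) (h (fun j => (D j).l (v j)) _)).trans comp_zero)

include hB hE hδ in
/-- External products of basis objects form a basis. -/
theorem isSplitBasis_extProd (ha : IsCoprodMap a) :
    IsSplitBasis k fun r : ∀ j, Q j => (extProd a).obj (tup E r) where
  hom_zero h f := ext_hom_zero hB hE hδ ha h f
  hom_self r f := ext_hom_self hB hE hδ ha r f
  one_ne r := ext_one_ne hB hE hδ r
  decomp X := by
    -- The existing split basis on `T` is compared with the external products: each member receives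
    -- a nonzero map from one of them, and these have scalar endomorphisms.
    obtain ⟨n, E', hE', hh⟩ := exists_splitBasis_poly (isSplitBasis_sky (S := T) hB)
    obtain ⟨D⟩ := hE'.decomp X
    refine D.refine fun b => ?_
    obtain ⟨r, f, hf⟩ := exists_ext_hom_ne_zero hB hE ha (hh (D.l b)) (hE'.one_ne _)
    obtain ⟨i⟩ := hE'.nonempty_iso (ext_hom_self hB hE hδ ha r) hf
    exact Decomp.single r i.symm

end ExtSplit

/-! ### Multilinear functors and decompositions. -/

section MultiDecomp

variable {J : Type} [Finite J] {D : J → Type w} [∀ j, Category.{v} (D j)] [∀ j, Preadditive (D j)]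
  [∀ j, Linear k (D j)] {Z : Type w} [Category.{v} Z] [Preadditive Z] [Linear k Z]
  {R : J → Type*} {e : ∀ j, R j → D j}

/-- Multilinear functors preserve decompositions. -/
theorem IsMultilinear.exists_decomp {E : (∀ j, D j) ⥤ Z} (hE : IsMultilinear k E) {X : ∀ j, D j}
    (d : TupDecomp e X) : ∃ δ : Decomp (fun ρ : ∀ j, R j => E.obj (tup e ρ)) (E.obj X),
      ∀ a, ∃ v : ∀ j, (d j).n, δ.l a = fun j => (d j).l (v j) := by
  classical
  have := Fintype.ofFinite J
  refine ⟨{ n := ∀ j, (d j).n, l := fun v j => (d j).l (v j), ι := fun v => E.map fun j => (d j).ι (v j),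
            π := fun v => E.map fun j => (d j).π (v j), ι_π := fun v => ?_, ι_π_ne := fun v v' h => ?_,
            total := hE.total d }, fun v => ⟨v, rfl⟩⟩
  · rw [← E.map_comp, ← E.map_id]
    congr 1
    exact funext fun j => (d j).ι_π (v j)
  · obtain ⟨j, hj⟩ := Function.ne_iff.1 h
    rw [← E.map_comp]
    exact hE.map_zero j ((d j).ι_π_ne _ _ hj)

end MultiDecomp

/-! ### Zero objects and direct sums in the degrees of a graded 2-vector space. -/

section Graded

variable {C : GrLinCat.{v, w} k} (hC : IsGradedTwoVect C)

include hC

theorem IsGradedTwoVect.hasFiniteBiproducts_part (d : ℕ) : HasFiniteBiproducts (C.part d) := by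
  obtain ⟨n, E, h1, h2⟩ := hC.part d
  have : HasFiniteProducts (C.part d) := ⟨fun m => Adjunction.hasLimitsOfShape_of_equivalence E.functor⟩
  exact HasFiniteBiproducts.of_hasFiniteProducts

theorem IsGradedTwoVect.deg_of_isZero (d : ℕ) {X : C.carrier} (hX : IsZero X) : C.deg d X := by
  have := hC.hasFiniteBiproducts_part d
  have := hC.closed d
  obtain ⟨O, hO⟩ := (inferInstance : HasZeroObject (C.part d))
  have h1 : 𝟙 O.obj = 0 := congrArg (fun z => z.hom) (hO.eq_of_src (𝟙 O) 0)
  exact (C.deg d).prop_of_iso (((IsZero.iff_id_eq_zero _).2 h1).iso hX) O.property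

/-- The direct sum formed inside degree `d` satisfies the same equations in the whole category, so
it is isomorphic to `X`. -/
theorem IsGradedTwoVect.deg_of_decomp (d : ℕ) {R : Type*} {e : R → C.carrier} {X : C.carrier}
    (D : Decomp e X) (h : ∀ a, C.deg d (e (D.l a))) : C.deg d X := by
  classical
  have := hC.hasFiniteBiproducts_part d
  have := hC.closed d
  let F : D.n → C.part d := fun a => ⟨e (D.l a), h a⟩
  let i : ∀ a, e (D.l a) ⟶ (⨁ F).obj := fun a => (biproduct.ι F a).hom
  let p : ∀ a, (⨁ F).obj ⟶ e (D.l a) := fun a => (biproduct.π F a).hom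
  have hip : ∀ a, i a ≫ p a = 𝟙 _ := fun a => congrArg (fun z => z.hom) (biproduct.ι_π_self F a)
  have hne : ∀ a b, a ≠ b → i a ≫ p b = 0 := fun a b hab =>
    congrArg (fun z => z.hom) (biproduct.ι_π_ne F hab)
  have ht : ∑ a, p a ≫ i a = 𝟙 _ := by
    have := congrArg (fun z => z.hom) (biproduct.total (f := F))
    rw [fullSubcategory_sum_hom] at this
    exact this
  have key : ∀ {A B : C.carrier} (i₁ : ∀ a, e (D.l a) ⟶ A) (p₁ : ∀ a, A ⟶ e (D.l a))
      (i₂ : ∀ a, e (D.l a) ⟶ B) (p₂ : ∀ a, B ⟶ e (D.l a)), (∀ a, i₂ a ≫ p₂ a = 𝟙 _) →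
      (∀ a b, a ≠ b → i₂ a ≫ p₂ b = 0) → ∑ a, p₁ a ≫ i₁ a = 𝟙 A →
      (∑ a, p₁ a ≫ i₂ a) ≫ (∑ a, p₂ a ≫ i₁ a) = 𝟙 A := by
    intro A B i₁ p₁ i₂ p₂ h1 h2 h3
    rw [Preadditive.sum_comp, ← h3]
    refine Finset.sum_congr rfl fun a _ => ?_
    rw [Preadditive.comp_sum, Finset.sum_eq_single a]
    · rw [Category.assoc, reassoc_of% h1]
    · intro b _ hb
      rw [Category.assoc, ← Category.assoc (i₂ a), h2 a b hb.symm, zero_comp, comp_zero]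
    · simp
  exact (C.deg d).prop_of_iso ⟨∑ a, p a ≫ D.ι a, ∑ a, D.π a ≫ i a,
    key i p D.ι D.π D.ι_π D.ι_π_ne ht, key D.ι D.π i p hip hne D.total⟩ (⨁ F).property

end Graded

theorem finsum_fibre {I J L : Type} [Finite I] [Finite J] {φ : I → Option J} {ψ : J → Option L} {l : L}
    {M : Type*} [AddCommMonoid M] (f : {i // (φ i).bind ψ = some l} → M) :
    ∑ᶠ i, f i = ∑ᶠ j : {j // ψ j = some l}, ∑ᶠ i : {i // φ i = some j.1}, f ⟨i.1, bind_some i.2 j.2⟩ := by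
  have := Fintype.ofFinite {i // (φ i).bind ψ = some l}
  have := Fintype.ofFinite {j // ψ j = some l}
  have := fun j => Fintype.ofFinite {i // φ i = some j}
  simp only [finsum_eq_sum_of_fintype]
  let q : (Σ j : {j // ψ j = some l}, {i // φ i = some j.1}) → {i // (φ i).bind ψ = some l} :=
    fun p => ⟨p.2.1, bind_some p.2.2 p.1.2⟩
  have hq : Function.Bijective q := by
    constructor
    · rintro ⟨⟨j, hj⟩, ⟨i, hi⟩⟩ ⟨⟨j', hj'⟩, ⟨i', hi'⟩⟩ h
      obtain rfl : i = i' := congrArg Subtype.val h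
      obtain rfl : j = j' := Option.some.inj (hi.symm.trans hi')
      rfl
    · intro i
      obtain ⟨j, hj⟩ := exists_mid i
      exact ⟨⟨j, i.1, hj⟩, rfl⟩
  exact (hq.sum_comp f).symm.trans (Fintype.sum_sigma' fun j i => f (q ⟨j, i⟩)).symm.symm

/-! ### CoCartesian arrows from split bases. -/

section CoCart

variable {X Y : GrFam.{v, w} k} (u : MHom X Y) {L : Type} (ψ : Y.I → Option L) (l : L)

/-- The functors of a 1-morphism with targets over `l`, together. -/
def MHom.fibFun : (∀ i : {i // (u.base i).bind ψ = some l}, (X.C i).carrier) ⥤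
    ∀ j : {j // ψ j = some l}, (Y.C j).carrier where
  obj A j := (u.fn j).obj fun i => A ⟨i.1, bind_some i.2 j.2⟩
  map a j := (u.fn j).map fun i => a ⟨i.1, bind_some i.2 j.2⟩
  map_id A := funext fun j => (u.fn j).map_id _
  map_comp a b := funext fun j => (u.fn j).map_comp _ _

variable {Z : Type w} [Category.{v} Z] [Preadditive Z] [Linear k Z]

theorem MHom.fibFun_lin {E : (∀ j : {j // ψ j = some l}, (Y.C j).carrier) ⥤ Z}
    (hE : IsMultilinear k E) : IsMultilinear k (u.fibFun ψ l ⋙ E) := by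
  intro A B
  obtain ⟨m, hm⟩ := hE ((u.fibFun ψ l).obj A) ((u.fibFun ψ l).obj B)
  choose n hn using fun j : {j // ψ j = some l} =>
    u.lin j.1 (fun i => A ⟨i.1, bind_some i.2 j.2⟩) (fun i => B ⟨i.1, bind_some i.2 j.2⟩)
  refine ⟨nestMultilinear m n, fun a => (hm _).trans (congrArg m ?_)⟩
  funext j
  exact hn j _

variable {Q : X.I → Type*} {e : ∀ i, Q i → (X.C i).carrier}

/-- The 1-morphism `u` maps tuples of basis objects to basis objects. -/
structure IsBasisMap (u : MHom X Y) (e : ∀ i, Q i → (X.C i).carrier) : Prop where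
  src (i : X.I) : IsSplitBasis k (e i)
  tgt (j : Y.I) : IsSplitBasis k fun r : ∀ i : {i // u.base i = some j}, Q i.1 =>
    (u.fn j).obj (tup (fun i : {i // u.base i = some j} => e i.1) r)

variable {u} (hu : IsBasisMap u e)

/-- Tuples over the fibre of a composite. -/
def fibEquiv {I J L : Type} [Finite I] [Finite J] (φ : I → Option J) (ψ : J → Option L) (l : L) (Q : I → Type*) :
    (∀ i : {i // (φ i).bind ψ = some l}, Q i.1) ≃
      ∀ j : {j // ψ j = some l}, ∀ i : {i // φ i = some j.1}, Q i.1 :=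
  Equiv.ofBijective _ (nest_bijective (φ := φ) (ψ := ψ) (l := l) fun i => Q i.1)

variable {E₁ E₂ : (∀ j : {j // ψ j = some l}, (Y.C j).carrier) ⥤ Z}

include hu in
theorem IsBasisMap.natTrans_ext (h₁ : IsMultilinear k E₁) {α β : E₁ ⟶ E₂}
    (h : ∀ A, α.app ((u.fibFun ψ l).obj A) = β.app ((u.fibFun ψ l).obj A)) : α = β := by
  refine IsMultilinear.natTrans_ext (fun j : {j // ψ j = some l} => hu.tgt j.1) h₁ fun ρ => ?_
  obtain ⟨r, rfl⟩ := (fibEquiv u.base ψ l Q).surjective ρ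
  exact h fun i => e i.1 (r i)

-- Basis tuples of `Y` are the images of basis tuples of `X`, so `θ` prescribes the components of
-- `η` there. Agreement with `θ` everywhere follows from uniqueness on the side of `X`.
include hu in
theorem IsBasisMap.exists_natTrans (h₁ : IsMultilinear k E₁) (h₂ : IsMultilinear k E₂)
    (θ : u.fibFun ψ l ⋙ E₁ ⟶ u.fibFun ψ l ⋙ E₂) :
    ∃ η : E₁ ⟶ E₂, ∀ A, η.app ((u.fibFun ψ l).obj A) = θ.app A := by
  let F := fibEquiv u.base ψ l Q
  let t := tup fun j : {j // ψ j = some l} => fun r : ∀ i : {i // u.base i = some j.1}, Q i.1 =>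
    (u.fn j.1).obj (tup (fun i : {i // u.base i = some j.1} => e i.1) r)
  let α : ∀ ρ, E₁.obj (t ρ) ⟶ E₂.obj (t ρ) :=
    Equiv.piCongrLeft (fun ρ => E₁.obj (t ρ) ⟶ E₂.obj (t ρ)) F fun r => θ.app fun i => e i.1 (r i)
  obtain ⟨η, hη⟩ := IsMultilinear.exists_natTrans (fun j : {j // ψ j = some l} => hu.tgt j.1) h₁ h₂ α
  refine ⟨η, fun A => ?_⟩
  have h : Functor.whiskerLeft (u.fibFun ψ l) η = θ := by
    refine IsMultilinear.natTrans_ext (fun i : {i // (u.base i).bind ψ = some l} => hu.src i.1)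
      (u.fibFun_lin ψ l h₁) fun r => ?_
    exact (hη (F r)).trans (Equiv.piCongrLeft_apply_apply _ F _ r)
  exact congrArg (fun z => z.app A) h

include hu in
theorem IsBasisMap.exists_functor [HasFiniteBiproducts Z]
    {W : (∀ i : {i // (u.base i).bind ψ = some l}, (X.C i).carrier) ⥤ Z} (hW : IsMultilinear k W) :
    ∃ E : (∀ j : {j // ψ j = some l}, (Y.C j).carrier) ⥤ Z, IsMultilinear k E ∧
      Nonempty (u.fibFun ψ l ⋙ E ≅ W) := by
  let F := fibEquiv u.base ψ l Q
  obtain ⟨E, hE, hT⟩ := exists_multilinear_functor (fun j : {j // ψ j = some l} => hu.tgt j.1)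
    fun ρ => W.obj (tup (fun i : {i // (u.base i).bind ψ = some l} => e i.1) (F.symm ρ))
  refine ⟨E, hE, ?_⟩
  obtain ⟨η, -⟩ := IsMultilinear.exists_iso
    (fun i : {i // (u.base i).bind ψ = some l} => hu.src i.1) (u.fibFun_lin ψ l hE) hW
    fun r => (hT (F r)).some ≪≫ eqToIso (by rw [F.symm_apply_apply])
  exact ⟨η⟩

include hu in
/-- Extensions along `u` of homogeneous functors are homogeneous. -/
theorem IsBasisMap.homogeneous {δ : ∀ i, Q i → ℕ} (hδ : ∀ i r, (X.C i).deg (δ i r) (e i r))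
    (h0 : IsDegreeZero (X := X) (Y := Y) u) (hY : ∀ j, IsGradedTwoVect (Y.C j)) {Z : GrLinCat.{v, w} k}
    (hZ : IsGradedTwoVect Z)
    {W : (∀ i : {i // (u.base i).bind ψ = some l}, (X.C i).carrier) ⥤ Z.carrier}
    {E : (∀ j : {j // ψ j = some l}, (Y.C j).carrier) ⥤ Z.carrier} (hE : IsMultilinear k E)
    (η : u.fibFun ψ l ⋙ E ≅ W) {r : ℤ}
    (hW : IsHomogeneousOfDegree (fun i : {i // (u.base i).bind ψ = some l} => X.C i.1) Z r W) :
    IsHomogeneousOfDegree (fun j : {j // ψ j = some l} => Y.C j.1) Z r E := by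
  classical
  intro d A hA
  let t : ∀ (j : {j // ψ j = some l}) (r : ∀ i : {i // u.base i = some j.1}, Q i.1), (Y.C j.1).carrier :=
    fun j r => (u.fn j.1).obj (tup (fun i : {i // u.base i = some j.1} => e i.1) r)
  let D : TupDecomp t A := fun j => ((hu.tgt j.1).decomp (A j)).some
  obtain ⟨B, hB⟩ := hE.exists_decomp D
  -- There are no nonzero maps between different degrees, so the basis summands of an object of
  -- degree `d j` have degree `d j`.
  have hdeg : ∀ j a, (∑ᶠ i : {i // u.base i = some j.1}, δ i.1 ((D j).l a i)) = d j := by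
    intro j a
    by_contra hne
    have h1 := h0 j.1 (fun i => δ i.1 ((D j).l a i)) _ fun i => hδ i.1 ((D j).l a i)
    have h2 := (hY j.1).hom_eq_zero hne h1 (hA j) ((D j).ι a)
    refine (hu.tgt j.1).one_ne ((D j).l a) ?_
    rw [← (D j).ι_π a]
    exact (congrArg (· ≫ (D j).π a) h2).trans zero_comp
  have key : ∀ a, (∃ e : ℕ, (e : ℤ) = (∑ᶠ j, (d j : ℤ)) + r ∧ Z.deg e (E.obj (tup t (B.l a)))) ∨
      IsZero (E.obj (tup t (B.l a))) := by
    intro a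
    obtain ⟨v, hv⟩ := hB a
    rw [hv]
    obtain ⟨q, hq⟩ := (fibEquiv u.base ψ l Q).surjective fun j => (D j).l (v j)
    have h1 : (fun j => (D j).l (v j)) = fibEquiv u.base ψ l Q q := hq.symm
    have h2 : ∀ j : {j // ψ j = some l}, (d j : ℤ) = ∑ᶠ i : {i // u.base i = some j.1},
        (δ i.1 (q ⟨i.1, bind_some i.2 j.2⟩) : ℤ) := by
      intro j
      have h3 := hdeg j (v j)
      rw [congrFun h1 j] at h3
      rw [← h3]
      have := Fintype.ofFinite {i // u.base i = some j.1}
      rw [finsum_eq_sum_of_fintype, finsum_eq_sum_of_fintype, Nat.cast_sum]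
      rfl
    rw [h1, finsum_congr h2, ← finsum_fibre fun i : {i // (u.base i).bind ψ = some l} => (δ i.1 (q i) : ℤ)]
    let i : E.obj (tup t (fibEquiv u.base ψ l Q q)) ≅
        W.obj (tup (fun i : {i // (u.base i).bind ψ = some l} => e i.1) q) :=
      η.app (tup (fun i : {i // (u.base i).bind ψ = some l} => e i.1) q)
    rcases hW (fun i => δ i.1 (q i)) _ fun i => hδ i.1 (q i) with ⟨m, hm, h⟩ | h
    · have := hZ.closed m
      exact Or.inl ⟨m, hm, (Z.deg m).prop_of_iso i.symm h⟩
    · exact Or.inr (h.of_iso i)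
  -- If `∑ d j + r` is negative, no summand can lie in that degree, so all summands and hence the
  -- value of `E` are zero.
  by_cases hm : ∃ m : ℕ, (m : ℤ) = (∑ᶠ j, (d j : ℤ)) + r
  · obtain ⟨m, hm⟩ := hm
    refine Or.inl ⟨m, hm, hZ.deg_of_decomp m B fun a => ?_⟩
    rcases key a with ⟨m', hm', h⟩ | h
    · obtain rfl : m = m' := by exact_mod_cast hm.trans hm'.symm
      exact h
    · exact hZ.deg_of_isZero m h
  · refine Or.inr ((IsZero.iff_id_eq_zero _).2 ?_)
    rw [← B.total]
    refine Finset.sum_eq_zero fun a _ => ?_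
    rcases key a with ⟨m', hm', h⟩ | h
    · exact absurd ⟨m', hm'⟩ hm
    · rw [h.eq_of_src (B.ι a) 0, comp_zero]

include hu in
/-- Extensions along `u` of finite sums of homogeneous functors are finite sums of homogeneous
functors. -/
theorem IsBasisMap.bounded {δ : ∀ i, Q i → ℕ} (hδ : ∀ i r, (X.C i).deg (δ i r) (e i r))
    (h0 : IsDegreeZero (X := X) (Y := Y) u) (hY : ∀ j, IsGradedTwoVect (Y.C j)) {Z : GrLinCat.{v, w} k}
    (hZ : IsGradedTwoVect Z)
    {F : (∀ i : {i // (u.base i).bind ψ = some l}, (X.C i).carrier) ⥤ Z.carrier}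
    {E : (∀ j : {j // ψ j = some l}, (Y.C j).carrier) ⥤ Z.carrier} (hE : IsMultilinear k E)
    (η : u.fibFun ψ l ⋙ E ≅ F) {n : ℕ} {r : Fin n → ℤ}
    {W : Fin n → ((∀ i : {i // (u.base i).bind ψ = some l}, (X.C i).carrier) ⥤ Z.carrier)} {b : Bicone W}
    (hW : ∀ a, IsMultilinear k (W a) ∧
      IsHomogeneousOfDegree (fun i : {i // (u.base i).bind ψ = some l} => X.C i.1) Z (r a) (W a))
    (hb : Nonempty b.IsBilimit) (hbF : Nonempty (b.pt ≅ F)) :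
    ∃ (W' : Fin n → ((∀ j : {j // ψ j = some l}, (Y.C j).carrier) ⥤ Z.carrier)) (b' : Bicone W'),
      (∀ a, IsMultilinear k (W' a) ∧
        IsHomogeneousOfDegree (fun j : {j // ψ j = some l} => Y.C j.1) Z (r a) (W' a)) ∧
      Nonempty b'.IsBilimit ∧ Nonempty (b'.pt ≅ E) := by
  classical
  have := hZ.hasFiniteBiproducts
  obtain ⟨hb⟩ := hb
  obtain ⟨i⟩ := hbF
  choose W' hlin ζ using fun a => hu.exists_functor ψ l (hW a).1
  let ζ := fun a => (ζ a).some
  -- The inclusions and projections of the direct sum on the side of `X` extend along `u`; their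
  -- relations hold because they hold on the image of `u`.
  choose I hI using fun a => hu.exists_natTrans ψ l (hlin a) hE ((ζ a).hom ≫ b.ι a ≫ i.hom ≫ η.inv)
  choose P hP using fun a => hu.exists_natTrans ψ l hE (hlin a) (η.hom ≫ i.inv ≫ b.π a ≫ (ζ a).inv)
  have hIP : ∀ a a' A, (I a ≫ P a').app ((u.fibFun ψ l).obj A) =
      ((ζ a).hom ≫ (b.ι a ≫ b.π a') ≫ (ζ a').inv).app A := fun a a' A => by
    rw [NatTrans.comp_app, hI, hP, ← NatTrans.comp_app]
    simp
  have htot := IsBilimit.total hb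
  refine ⟨W', ⟨E, P, I, fun a a' => ?_⟩, fun a => ⟨hlin a, hu.homogeneous ψ l hδ h0 hY hZ (hlin a) (ζ a) (hW a).2⟩,
    ⟨isBilimitOfTotal _ ?_⟩, ⟨Iso.refl _⟩⟩
  · split_ifs with h
    · subst h
      refine hu.natTrans_ext ψ l (hlin a) fun A => ?_
      rw [hIP, bicone_ι_π_self b, Category.id_comp, Iso.hom_inv_id]
      rfl
    · refine hu.natTrans_ext ψ l (hlin a) fun A => ?_
      rw [hIP, bicone_ι_π_ne b h, zero_comp, comp_zero]
      rfl
  · refine hu.natTrans_ext ψ l hE fun A => ?_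
    have h1 : ∀ a, (P a ≫ I a).app ((u.fibFun ψ l).obj A) =
        (η.hom ≫ i.inv ≫ (b.π a ≫ b.ι a) ≫ i.hom ≫ η.inv).app A := fun a => by
      rw [NatTrans.comp_app, hI, hP, ← NatTrans.comp_app]
      simp
    have h2 : (∑ a, P a ≫ I a).app ((u.fibFun ψ l).obj A) = ∑ a, (P a ≫ I a).app ((u.fibFun ψ l).obj A) :=
      NatTrans.app_sum _ _ _
    refine h2.trans ?_
    rw [Finset.sum_congr rfl fun a _ => h1 a, ← NatTrans.app_sum, ← Preadditive.comp_sum,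
      ← Preadditive.comp_sum, ← Preadditive.sum_comp, htot]
    simp

end CoCart

section

variable {X Y : GrFam.{v, w} k} {u : MHom X Y} {Q : X.I → Type*} {e : ∀ i, Q i → (X.C i).carrier}

theorem MHom₂.congr_app {f g : MHom X Y} {α β : MHom₂ f g} (h : α = β) (j : Y.I)
    (A : ∀ i : {i // f.base i = some j}, (X.C i).carrier) : α.app j A = β.app j A := by
  rw [h]

/-- Over each target index this is unique extension of natural transformations and existence of
extensions of functors along `fibFun`; `bounded` keeps the extensions finite sums of homogeneous
ones. -/
theorem IsBasisMap.isCoCartesian (hu : IsBasisMap u e) {δ : ∀ i, Q i → ℕ}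
    (hδ : ∀ i r, (X.C i).deg (δ i r) (e i r)) (h0 : IsDegreeZero (X := X) (Y := Y) u)
    (hY : ∀ j, IsGradedTwoVect (Y.C j)) : IsCoCartesian (X := X) (Y := Y) u where
  fullyFaithful {Z} hZ f g hf hg hfg := by
    obtain ⟨fb, F, hF⟩ := f
    obtain ⟨gb, G, hG⟩ := g
    obtain rfl : fb = gb := hfg
    constructor
    · intro η θ h
      apply MHom₂.ext
      funext l B
      let η' : F l ⟶ G l := ⟨fun A => MHom₂.app η l A, fun _ _ a => MHom₂.naturality η l a⟩
      let θ' : F l ⟶ G l := ⟨fun A => MHom₂.app θ l A, fun _ _ a => MHom₂.naturality θ l a⟩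
      let U : X ⟶ Y := u
      have h0 : U ◁ η = U ◁ θ := h
      have h1 : η' = θ' := hu.natTrans_ext fb l (hF l) fun A =>
        MHom₂.congr_app (f := u.comp ⟨fb, F, hF⟩) (g := u.comp ⟨fb, G, hG⟩) h0 l A
      exact congrArg (fun z => z.app B) h1
    · intro θ
      have h1 := fun l => hu.exists_natTrans fb l (hF l) (hG l)
        ⟨fun A => MHom₂.app θ l A, fun _ _ a => MHom₂.naturality θ l a⟩
      choose η hη using h1
      refine ⟨(⟨rfl, fun l A => (η l).app A, fun l _ _ a => (η l).naturality a⟩ :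
        MHom₂ (⟨fb, F, hF⟩ : MHom Y Z) ⟨fb, G, hG⟩), ?_⟩
      apply MHom₂.ext
      funext l A
      exact hη l A
  essSurj {Z} hZ g f hf hfg := by
    obtain ⟨fb, F, hF⟩ := f
    obtain rfl : fb = fun i => (u.base i).bind g := hfg
    have := fun l => (hZ l).hasFiniteBiproducts
    choose E hE ζ using fun l => hu.exists_functor g l (hF l)
    refine ⟨(⟨g, E, hE⟩ : MHom Y Z), fun l => ?_, rfl, ⟨mkIso (u.comp ⟨g, E, hE⟩) ⟨_, F, hF⟩ rfl
      (fun l A => (ζ l).some.app A) fun l _ _ a => (ζ l).some.hom.naturality a⟩⟩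
    obtain ⟨n, r, W, b, hW, hb, hbF⟩ := hf l
    obtain ⟨W', b', h1, h2, h3⟩ := hu.bounded g l hδ h0 hY (hZ l) (hE l) (ζ l).some hW hb hbF
    exact ⟨n, r, W', b', h1, h2, h3⟩

end

/-! ### Pushforward of sheaves as a left adjoint of pullback. -/

section Push

variable {𝒜 : Type (u + 1)} [Category.{u} 𝒜] [Preadditive 𝒜] [Linear k 𝒜] [HasFiniteBiproducts 𝒜]
  {S T : Type} [Finite S] [Finite T] (c : S → T)

/-- Pushforward of sheaves, by summing over the fibres. -/
def push : Sh S 𝒜 ⥤ Sh T 𝒜 where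
  obj V t := ⨁ fun s : {s // c s = t} => V s.1
  map f t := biproduct.map fun s : {s // c s = t} => f s.1
  map_id V := funext fun t => by
    refine biproduct.hom_ext' _ _ fun s => ?_
    refine (biproduct.ι_map _ _).trans ?_
    exact (Category.id_comp _).trans (Category.comp_id _).symm
  map_comp {U V W} f g := funext fun t => by
    refine biproduct.hom_ext' _ _ fun s => ?_
    refine (biproduct.ι_map _ _).trans ?_
    show (f s.1 ≫ g s.1) ≫ _ = _ ≫ biproduct.map _ ≫ biproduct.map _
    rw [biproduct.ι_map_assoc, biproduct.ι_map, Category.assoc]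

/-- Inclusion of a stalk. -/
def pushι (V : Sh S 𝒜) (s : S) (t : T) (h : c s = t) : V s ⟶ (push c).obj V t :=
  biproduct.ι (fun s : {s // c s = t} => V s.1) ⟨s, h⟩

theorem push_hom_ext {V : Sh S 𝒜} {t : T} {A : 𝒜} {f g : (push c).obj V t ⟶ A}
    (h : ∀ s hs, pushι c V s t hs ≫ f = pushι c V s t hs ≫ g) : f = g :=
  biproduct.hom_ext' _ _ fun s => h s.1 s.2

theorem pushι_map {V W : Sh S 𝒜} (f : V ⟶ W) (s : S) (t : T) (h : c s = t) :
    pushι c V s t h ≫ (push c).map f t = f s ≫ pushι c W s t h :=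
  biproduct.ι_map (fun s : {s // c s = t} => f s.1) ⟨s, h⟩

instance : (push c : Sh S 𝒜 ⥤ Sh T 𝒜).Additive where
  map_add {V W f g} := funext fun t => push_hom_ext c fun s h => by
    refine (pushι_map c (f + g) s t h).trans (Eq.trans ?_ (Preadditive.comp_add _ _ _ _ _ _).symm)
    exact (Preadditive.add_comp _ _ _ (f s) (g s) _).trans
      (congrArg₂ (· + ·) (pushι_map c f s t h) (pushι_map c g s t h)).symm

instance : (push c : Sh S 𝒜 ⥤ Sh T 𝒜).Linear k where
  map_smul {V W} f r := funext fun t => push_hom_ext c fun s h => by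
    refine (pushι_map c (r • f) s t h).trans (Eq.trans ?_ (Linear.comp_smul _ _ _ _ _ _).symm)
    exact (Linear.smul_comp _ _ _ r (f s) _).trans (congrArg (r • ·) (pushι_map c f s t h)).symm

theorem pushι_eqToHom (V : Sh S 𝒜) (s : S) {t t' : T} (h : c s = t) (e : t = t')
    (e' : (push c).obj V t = (push c).obj V t') :
    pushι c V s t h ≫ eqToHom e' = pushι c V s t' (h.trans e) := by
  subst e
  exact Category.comp_id _

/-- The unit of the adjunction between `push` and `pull`. -/
def pushUnit (V : Sh S 𝒜) : V ⟶ (pull c).obj ((push c).obj V) := fun s => pushι c V s (c s) rfl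

/-- The counit of the adjunction between `push` and `pull`. -/
def pushCounit (W : Sh T 𝒜) : (push c).obj ((pull c).obj W) ⟶ W := fun t =>
  biproduct.desc fun s : {s // c s = t} => eqToHom (congrArg W s.2)

theorem pushι_counit (W : Sh T 𝒜) (s : S) (t : T) (h : c s = t) :
    pushι c ((pull c).obj W) s t h ≫ pushCounit c W t = eqToHom (congrArg W h) :=
  biproduct.ι_desc _ _

theorem pushUnit_naturality {V W : Sh S 𝒜} (f : V ⟶ W) :
    f ≫ pushUnit c W = pushUnit c V ≫ (pull c).map ((push c).map f) :=
  funext fun s => (pushι_map c f s (c s) rfl).symm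

theorem eqToHom_nat {V W : Sh T 𝒜} (f : V ⟶ W) {t t' : T} (h : t = t') :
    f t ≫ eqToHom (congrArg W h) = eqToHom (congrArg V h) ≫ f t' := by
  subst h
  exact (Category.comp_id _).trans (Category.id_comp _).symm

theorem pushCounit_naturality {V W : Sh T 𝒜} (f : V ⟶ W) :
    (push c).map ((pull c).map f) ≫ pushCounit c W = pushCounit c V ≫ f := by
  funext t
  refine push_hom_ext c fun s h => ?_
  show _ ≫ (push c).map ((pull c).map f) t ≫ pushCounit c W t = _ ≫ pushCounit c V t ≫ f t
  rw [← Category.assoc, pushι_map, Category.assoc, pushι_counit, ← Category.assoc, pushι_counit]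
  exact eqToHom_nat f h

theorem push_unit_counit (V : Sh S 𝒜) :
    (push c).map (pushUnit c V) ≫ pushCounit c ((push c).obj V) = 𝟙 _ := by
  funext t
  refine push_hom_ext c fun s h => ?_
  show _ ≫ (push c).map (pushUnit c V) t ≫ pushCounit c ((push c).obj V) t = _ ≫ 𝟙 _
  rw [← Category.assoc, pushι_map, Category.assoc, pushι_counit, Category.comp_id]
  exact pushι_eqToHom c V s rfl h _

theorem unit_pull_counit (W : Sh T 𝒜) :
    pushUnit c ((pull c).obj W) ≫ (pull c).map (pushCounit c W) = 𝟙 _ :=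
  funext fun s => pushι_counit c W s (c s) rfl

end Push

/-! ### Base change for pushforward and pullback. -/

section BaseChange

variable {𝒜 : Type (u + 1)} [Category.{u} 𝒜] [Preadditive 𝒜] [Linear k 𝒜] [HasFiniteBiproducts 𝒜]
  {S T R U : Type} [Finite S] [Finite T] [Finite R] [Finite U] {a : S → T} {c : S → R} {b : T → U}
  {d : R → U}

/-- The base change map of a commutative square. -/
def baseChange (h : b ∘ a = d ∘ c) (V : Sh T 𝒜) :
    (push c).obj ((pull a).obj V) ⟶ (pull d).obj ((push b).obj V) :=
  (push c).map ((pull a).map (pushUnit b V)) ≫ (push c).map (shEq h ((push b).obj V)) ≫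
    pushCounit c ((pull d).obj ((push b).obj V))

theorem pushι_baseChange (h : b ∘ a = d ∘ c) (V : Sh T 𝒜) (s : S) (r : R) (hs : c s = r) :
    pushι c ((pull a).obj V) s r hs ≫ baseChange h V r =
      pushι b V (a s) (d r) ((congrFun h s).trans (congrArg d hs)) := by
  show _ ≫ (push c).map ((pull a).map (pushUnit b V)) r ≫ (push c).map (shEq h ((push b).obj V)) r ≫
    pushCounit c ((pull d).obj ((push b).obj V)) r = _
  have e := (congrFun h s).trans (congrArg d hs)
  refine Eq.trans ?_ (pushι_eqToHom b V (a s) rfl e (congrArg ((push b).obj V) e))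
  rw [← Category.assoc, pushι_map, Category.assoc]
  refine congrArg (pushι b V (a s) (b (a s)) rfl ≫ ·) ?_
  rw [← Category.assoc, pushι_map, Category.assoc]
  refine (congrArg (shEq h ((push b).obj V) s ≫ ·)
    (pushι_counit c ((pull d).obj ((push b).obj V)) s r hs)).trans ?_
  exact eqToHom_trans _ _

/-- The comparison of fibres of a commutative square. -/
def fibreComparison (h : b ∘ a = d ∘ c) (r : R) (s : {s // c s = r}) : {t // b t = d r} :=
  ⟨a s.1, (congrFun h s.1).trans (congrArg d s.2)⟩

/-- On stalks the base change map reindexes a direct sum along the comparison of fibres. -/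
theorem isIso_baseChange (h : b ∘ a = d ∘ c) (hb : ∀ r, Function.Bijective (fibreComparison h r))
    (V : Sh T 𝒜) (r : R) : IsIso (baseChange h V r) := by
  let e := Equiv.ofBijective _ (hb r)
  let i : ((push c).obj ((pull a).obj V) r : 𝒜) ≅ (pull d).obj ((push b).obj V) r :=
    biproduct.whiskerEquiv (C := 𝒜) (f := fun s : {s // c s = r} => V (a s.1))
    (g := fun t : {t // b t = d r} => V t.1) e fun s => Iso.refl (V (a s.1))
  have hi : baseChange h V r = i.hom := by
    refine push_hom_ext c fun s hs => (pushι_baseChange h V s r hs).trans ?_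
    refine Eq.symm ((biproduct.ι_desc (fun s : {s // c s = r} => 𝟙 (V (a s.1)) ≫
      biproduct.ι (fun t : {t // b t = d r} => V t.1) (e s)) ⟨s, hs⟩).trans ?_)
    exact Category.id_comp (biproduct.ι (fun t : {t // b t = d r} => V t.1) (e ⟨s, hs⟩))
  rw [hi]
  infer_instance

end BaseChange

/-! ### Precomposition with linear functors as a 1-morphism. -/

section PreMap

variable {I : Type} [Finite I] {𝒞 𝒟 : I → Type (u + 1)} [∀ i, Category.{u} (𝒞 i)]
  [∀ i, Preadditive (𝒞 i)] [∀ i, Linear k (𝒞 i)] [∀ i, Category.{u} (𝒟 i)] [∀ i, Preadditive (𝒟 i)]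
  [∀ i, Linear k (𝒟 i)]

variable (k) in
/-- A family of categories of polynomial functors. -/
abbrev polyFam (𝒞 : I → Type (u + 1)) [∀ i, Category.{u} (𝒞 i)] [∀ i, Preadditive (𝒞 i)]
    [∀ i, Linear k (𝒞 i)] : GrFam.{u + 1, u + 1} k := ⟨I, fun i => grPoly k (𝒞 i)⟩

/-- Precomposition with linear functors, as a 1-morphism. -/
def preMap (F : ∀ i, 𝒞 i ⥤ 𝒟 i) [∀ i, (F i).Additive] [∀ i, (F i).Linear k] :
    polyFam k 𝒟 ⟶ polyFam k 𝒞 :=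
  (⟨some, fun j => Pi.eval (fun i : {i : I // some i = some j} => PolyFun k (𝒟 i)) ⟨j, rfl⟩ ⋙
      precomp (F j), fun j A B => by
    obtain ⟨m, hm⟩ := (MHom.id (polyFam k 𝒟)).lin j A B
    let L : (A ⟨j, rfl⟩ ⟶ B ⟨j, rfl⟩) →ₗ[k] ((precomp (F j)).obj (A ⟨j, rfl⟩) ⟶
        (precomp (F j)).obj (B ⟨j, rfl⟩)) :=
      { toFun := fun α => (precomp (F j)).map α
        map_add' := fun _ _ => rfl
        map_smul' := fun _ _ => rfl }
    exact ⟨L.compMultilinearMap m, fun f => congrArg L (hm f)⟩⟩ : MHom (polyFam k 𝒟) (polyFam k 𝒞))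

theorem precomp_isHomog {𝒞 𝒟 : Type (u + 1)} [Category.{u} 𝒞] [Preadditive 𝒞] [Linear k 𝒞]
    [Category.{u} 𝒟] [Preadditive 𝒟] [Linear k 𝒟] (F : 𝒞 ⥤ 𝒟) [F.Additive] [F.Linear k] {d : ℕ}
    {A : PolyFun k 𝒟} (hA : isHomog k 𝒟 d A) : isHomog k 𝒞 d ((precomp F).obj A) := fun X Y r f =>
  (congrArg A.obj.map (Functor.map_smul F r f)).trans (hA _ _ r (F.map f))

theorem preMap_isDegreeZero (F : ∀ i, 𝒞 i ⥤ 𝒟 i) [∀ i, (F i).Additive] [∀ i, (F i).Linear k] :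
    IsDegreeZero (preMap (k := k) F) := by
  intro j d A hA
  have := subsingleton_fibre j
  have h : ∑ᶠ i : {i : I // some i = some j}, d i = d ⟨j, rfl⟩ := by
    refine finsum_eq_single _ _ fun i hi => absurd (Subsingleton.elim (α := {i : I // some i = some j}) _ _) hi
  have h2 : isHomog k (𝒞 j) (d ⟨j, rfl⟩) ((precomp (F j)).obj (A ⟨j, rfl⟩)) := precomp_isHomog (F j) (hA ⟨j, rfl⟩)
  rw [← h] at h2
  exact h2

theorem IsDegreeZero.isBounded {X Y : GrFam.{v, w} k} {f : X ⟶ Y} (hf : IsDegreeZero f) : IsBounded f := by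
  intro j
  refine ⟨1, fun _ => 0, fun _ => MHom.fn f j, ⟨MHom.fn f j, fun _ => 𝟙 _, fun _ => 𝟙 _, ?_⟩,
    fun _ => ⟨MHom.lin f j, fun d A hA => Or.inl ⟨∑ᶠ i, d i, ?_, hf j d A hA⟩⟩,
    ⟨isBilimitOfTotal _ (by simp)⟩, ⟨Iso.refl _⟩⟩
  · intro a b
    obtain rfl : a = b := Subsingleton.elim _ _
    simp
  · have := Fintype.ofFinite {i // MHom.base f i = some j}
    rw [finsum_eq_sum_of_fintype, finsum_eq_sum_of_fintype, add_zero, Nat.cast_sum]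

end PreMap

theorem isIso_mhom {X Y : GrFam.{v, w} k} {f g : X ⟶ Y} (α : f ⟶ g)
    (h : ∀ j A, IsIso (MHom₂.app α j A)) : IsIso α := by
  have := h
  exact (mkIso (X := X) (Y := Y) f g (MHom₂.base_eq α) (fun j A => asIso (MHom₂.app α j A))
    fun j _ _ a => MHom₂.naturality α j a).isIso_hom

theorem isIso_poly {𝒞 : Type (u + 1)} [Category.{u} 𝒞] [Preadditive 𝒞] [Linear k 𝒞]
    {F G : PolyFun k 𝒞} (α : F ⟶ G) (h : ∀ V, IsIso (α.hom.app V)) : IsIso α := by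
  have := h
  exact (polyIso (fun V => asIso (α.hom.app V)) fun g => α.hom.naturality g).isIso_hom

theorem tensSingle_inv_apply {ι : Type} [Finite ι] [Subsingleton ι] (V : ι → FGModuleCat.{u} k)
    (i : ι) (x : ∀ i, (V i : Type u)) : el (tensSingle V i).inv (x i) = tmk x := by
  rw [← tensSingle_tmk i x]
  exact congrArg (fun z => el z (tmk x)) (tensSingle V i).hom_inv_id

theorem leftZigzag_eq {B : Type*} [Bicategory B] {a b : B} {f : a ⟶ b} {g : b ⟶ a}
    (η : 𝟙 a ⟶ f ≫ g) (θ : g ≫ f ⟶ 𝟙 b) :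
    leftZigzag η θ = η ▷ f ≫ (α_ f g f).hom ≫ f ◁ θ := by
  simp [leftZigzag, bicategoricalComp]

theorem rightZigzag_eq {B : Type*} [Bicategory B] {a b : B} {f : a ⟶ b} {g : b ⟶ a}
    (η : 𝟙 a ⟶ f ≫ g) (θ : g ≫ f ⟶ 𝟙 b) :
    rightZigzag η θ = g ◁ η ≫ (α_ g f g).inv ≫ θ ▷ g := by
  simp [rightZigzag, bicategoricalComp]

/-! ### The adjunction on polynomial functors induced by pushforward and pullback. -/

section Adjunction

variable {𝒜 : Type (u + 1)} [Category.{u} 𝒜] [Preadditive 𝒜] [Linear k 𝒜] [HasFiniteBiproducts 𝒜]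
  {S T : Type} [Finite S] [Finite T] (c : S → T)

variable (k 𝒜) in
/-- Precomposition with the pushforward. -/
abbrev coMap : HObj k 𝒜 (FinCop.single T) ⟶ HObj k 𝒜 (FinCop.single S) :=
  preMap (fun _ : Unit => (push c : Sh S 𝒜 ⥤ Sh T 𝒜))

instance (j : Unit) : Subsingleton {i : Unit // some i = some j} := subsingleton_fibre j

variable (k 𝒜) in
def adjUnit : 𝟙 (HObj k 𝒜 (FinCop.single S)) ⟶ HMap k 𝒜 (FinCop.singleMap c) ≫ coMap k 𝒜 c :=
  (⟨rfl, fun j A => ObjectProperty.homMk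
    { app V := (A ⟨j, rfl⟩).obj.map (pushUnit c V) ≫
        (tensSingle (fun i : {i : Unit // some i = some j} =>
          (A i).obj.obj ((pull c).obj ((push c).obj V))) ⟨j, rfl⟩).inv
      naturality V W f := by
        refine FGModuleCat.hom_ext (LinearMap.ext fun x => ?_)
        refine (tensSingle_inv_apply (fun i : {i : Unit // some i = some j} =>
          (A i).obj.obj ((pull c).obj ((push c).obj W))) ⟨j, rfl⟩ fun i =>
          el ((A i).obj.map (pushUnit c W)) (el ((A i).obj.map f) x)).trans ?_
        refine Eq.trans ?_ (congrArg (el (tensMap fun i : {i : Unit // some i = some j} =>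
          (A i).obj.map ((pull c).map ((push c).map f))))
          (tensSingle_inv_apply (fun i : {i : Unit // some i = some j} =>
          (A i).obj.obj ((pull c).obj ((push c).obj V))) ⟨j, rfl⟩ fun i =>
          el ((A i).obj.map (pushUnit c V)) x)).symm
        refine Eq.trans ?_ (tensMap_tmk _ _).symm
        refine congrArg tmk (funext fun i => ?_)
        exact (el_map_comp (F := (A i).obj) f (pushUnit c W) x).symm.trans
          ((congrArg (fun z => el ((A i).obj.map z) x) (pushUnit_naturality c f)).trans
          (el_map_comp (F := (A i).obj) _ _ x)) }, fun j A B a => by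
    refine poly_ext fun V => FGModuleCat.hom_ext (LinearMap.ext fun x => ?_)
    refine (tensSingle_inv_apply (fun i : {i : Unit // some i = some j} =>
          (B i).obj.obj ((pull c).obj ((push c).obj V))) ⟨j, rfl⟩ fun i =>
          el ((B i).obj.map (pushUnit c V)) (el ((a i).hom.app V) x)).trans ?_
    refine Eq.trans ?_ (congrArg (el (tensMap fun i : {i : Unit // some i = some j} =>
          (a i).hom.app ((pull c).obj ((push c).obj V))))
          (tensSingle_inv_apply (fun i : {i : Unit // some i = some j} =>
          (A i).obj.obj ((pull c).obj ((push c).obj V))) ⟨j, rfl⟩ fun i =>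
          el ((A i).obj.map (pushUnit c V)) x)).symm
    refine Eq.trans ?_ (tensMap_tmk _ _).symm
    exact congrArg tmk (funext fun i => (el_naturality (a i).hom (pushUnit c V) x).symm)⟩ :
    MHom₂ (MHom.id (HObj k 𝒜 (FinCop.single S)))
      (MHom.comp (HMap k 𝒜 (FinCop.singleMap c)) (coMap k 𝒜 c)))

theorem adjUnit_apply (j : Unit)
    (A : ∀ i : {i : Unit // some i = some j}, PolyFun k (Sh S 𝒜)) (V : Sh S 𝒜)
    (x : ((A ⟨j, rfl⟩).obj.obj V : Type u)) :
    el ((MHom₂.app (adjUnit k 𝒜 c) j A).hom.app V) x =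
      tmk fun i : {i : Unit // some i = some j} => el ((A i).obj.map (pushUnit c V)) x :=
  tensSingle_inv_apply (fun i : {i : Unit // some i = some j} =>
          (A i).obj.obj ((pull c).obj ((push c).obj V))) ⟨j, rfl⟩ fun i =>
          el ((A i).obj.map (pushUnit c V)) x

variable (k 𝒜) in
def adjCounit : coMap k 𝒜 c ≫ HMap k 𝒜 (FinCop.singleMap c) ⟶ 𝟙 (HObj k 𝒜 (FinCop.single T)) :=
  (⟨rfl, fun j A => ObjectProperty.homMk
    { app W := (tensSingle (fun i : {i : Unit // some i = some j} =>
          (A i).obj.obj ((push c).obj ((pull c).obj W))) ⟨j, rfl⟩).hom ≫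
          (A ⟨j, rfl⟩).obj.map (pushCounit c W)
      naturality V W f := by
        refine tens_ext fun x => ?_
        refine (congrArg (fun z => el ((A ⟨j, rfl⟩).obj.map (pushCounit c W)) (el (tensSingle
          (fun i : {i : Unit // some i = some j} =>
          (A i).obj.obj ((push c).obj ((pull c).obj W))) ⟨j, rfl⟩).hom z)) (tensMap_tmk _ x)).trans ?_
        refine (congrArg (el ((A ⟨j, rfl⟩).obj.map (pushCounit c W))) (tensSingle_tmk _ _)).trans ?_
        refine Eq.trans ?_ (congrArg (fun z => el ((A ⟨j, rfl⟩).obj.map f)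
          (el ((A ⟨j, rfl⟩).obj.map (pushCounit c V)) z)) (tensSingle_tmk _ x)).symm
        exact (el_map_comp (F := (A ⟨j, rfl⟩).obj) _ _ _).symm.trans ((congrArg
          (fun z => el ((A ⟨j, rfl⟩).obj.map z) (x ⟨j, rfl⟩)) (pushCounit_naturality c f)).trans
          (el_map_comp (F := (A ⟨j, rfl⟩).obj) _ _ _)) }, fun j A B a => by
    refine poly_ext fun V => tens_ext fun x => ?_
    refine (congrArg (fun z => el ((B ⟨j, rfl⟩).obj.map (pushCounit c V)) (el (tensSingle
          (fun i : {i : Unit // some i = some j} =>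
          (B i).obj.obj ((push c).obj ((pull c).obj V))) ⟨j, rfl⟩).hom z)) (tensMap_tmk _ x)).trans ?_
    refine (congrArg (el ((B ⟨j, rfl⟩).obj.map (pushCounit c V))) (tensSingle_tmk _ _)).trans ?_
    refine Eq.trans ?_ (congrArg (fun z => el ((a ⟨j, rfl⟩).hom.app V)
          (el ((A ⟨j, rfl⟩).obj.map (pushCounit c V)) z)) (tensSingle_tmk _ x)).symm
    exact (el_naturality (a ⟨j, rfl⟩).hom (pushCounit c V) _).symm⟩ :
    MHom₂ (MHom.comp (coMap k 𝒜 c) (HMap k 𝒜 (FinCop.singleMap c)))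
      (MHom.id (HObj k 𝒜 (FinCop.single T))))

theorem adjCounit_apply (j : Unit)
    (A : ∀ i : {i : Unit // some i = some j}, PolyFun k (Sh T 𝒜)) (V : Sh T 𝒜)
    (x : ∀ i, ((A i).obj.obj ((push c).obj ((pull c).obj V)) : Type u)) :
    el ((MHom₂.app (adjCounit k 𝒜 c) j A).hom.app V) (tmk x) =
      el ((A ⟨j, rfl⟩).obj.map (pushCounit c V)) (x ⟨j, rfl⟩) :=
  congrArg (el ((A ⟨j, rfl⟩).obj.map (pushCounit c V))) (tensSingle_tmk
    (V := (fun i : {i : Unit // some i = some j} =>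
          (A i).obj.obj ((push c).obj ((pull c).obj V)))) ⟨j, rfl⟩ x)

variable (k 𝒜) in
/-- Pullback along a map of finite sets has a right adjoint on polynomial functors. -/
def pullAdj : Bicategory.Adjunction (HMap k 𝒜 (FinCop.singleMap c)) (coMap k 𝒜 c) where
  unit := adjUnit k 𝒜 c
  counit := adjCounit k 𝒜 c
  left_triangle := by
    refine (leftZigzag_eq _ _).trans ?_
    apply MHom₂.ext
    funext j A
    refine poly_ext fun V => tens_ext fun x => ?_
    let A' : ∀ i : {i : Unit // some i = some j}, PolyFun k (Sh S 𝒜) := fun i => A ⟨i.1, i.2⟩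
    let B : ∀ i : {i : Unit // some i = some j}, PolyFun k (Sh T 𝒜) := fun i' =>
      (extProd fun i : {i : Unit // some i = some i'.1} => c).obj fun i => A' ⟨i.1, i.2.trans i'.2⟩
    let y : ∀ i, ((B i).obj.obj ((push c).obj ((pull c).obj V)) : Type u) := fun i' =>
      tmk fun i : {i : Unit // some i = some i'.1} =>
        el ((A' ⟨i.1, i.2.trans i'.2⟩).obj.map (pushUnit c ((pull c).obj V))) (x ⟨i.1, i.2.trans i'.2⟩)
    have e₁ : el ((MHom₂.app (adjUnit k 𝒜 c ▷ HMap k 𝒜 (FinCop.singleMap c)) j A).hom.app V)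
        (tmk x) = tmk y :=
      (tensMap_tmk _ _).trans (congrArg tmk (funext fun i' =>
        adjUnit_apply c i'.1 (fun i => A' ⟨i.1, i.2.trans i'.2⟩) ((pull c).obj V) (x i')))
    refine Eq.trans (congrArg (el ((MHom₂.app (adjCounit k 𝒜 c) j B).hom.app V)) e₁) ?_
    refine (adjCounit_apply c j B V y).trans ((tensMap_tmk _ _).trans (congrArg tmk (funext fun i => ?_)))
    refine (el_map_comp (F := (A' ⟨i.1, i.2⟩).obj) _ _ _).symm.trans ?_
    refine (congrArg (fun z => el ((A' ⟨i.1, i.2⟩).obj.map z) (x ⟨i.1, i.2⟩))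
      (unit_pull_counit c V)).trans ?_
    exact el_map_id _
  right_triangle := by
    refine (rightZigzag_eq _ _).trans ?_
    apply MHom₂.ext
    funext j A
    refine poly_ext fun V => FGModuleCat.hom_ext (LinearMap.ext fun x => ?_)
    let A' : ∀ i : {i : Unit // some i = some j}, PolyFun k (Sh T 𝒜) := fun i => A ⟨i.1, i.2⟩
    let B : ∀ i : {i : Unit // some i = some j}, PolyFun k (Sh S 𝒜) := fun i =>
      (precomp (push c)).obj (A' i)
    have e₁ := adjUnit_apply c j B V x
    refine Eq.trans (congrArg (el ((MHom₂.app (adjCounit k 𝒜 c) j A').hom.app ((push c).obj V))) e₁) ?_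
    refine (adjCounit_apply c j A' ((push c).obj V) _).trans ?_
    refine (el_map_comp (F := (A' ⟨j, rfl⟩).obj) _ _ _).symm.trans ?_
    refine (congrArg (fun z => el ((A' ⟨j, rfl⟩).obj.map z) x) (push_unit_counit c V)).trans ?_
    exact el_map_id _

end Adjunction

/-! ### Beck–Chevalley isomorphisms. -/

section BeckChevalley

variable {𝒜 : Type (u + 1)} [Category.{u} 𝒜] [Preadditive 𝒜] [Linear k 𝒜] [HasFiniteBiproducts 𝒜]
  {S T R U : Type} [Finite S] [Finite T] [Finite R] [Finite U] {a : S → T} {c : S → R} {b : T → U}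
  {d : R → U}

/-- The comparison isomorphisms of composites are explicit on pure tensors, and so is the canonical
`θ`; the equation `hα` then pins down `α` on nested pure tensors. -/
theorem canonical_comp_apply (h : b ∘ a = d ∘ c)
    {θ : HMap k 𝒜 (FinCop.Hom.comp (FinCop.singleMap a) (FinCop.singleMap b)) ⟶
      HMap k 𝒜 (FinCop.Hom.comp (FinCop.singleMap c) (FinCop.singleMap d))}
    (hθ : IsCanonical _ _ θ)
    {α : HMap k 𝒜 (FinCop.singleMap a) ≫ HMap k 𝒜 (FinCop.singleMap b) ⟶
      HMap k 𝒜 (FinCop.singleMap c) ≫ HMap k 𝒜 (FinCop.singleMap d)}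
    (hα : (HComp k 𝒜 (FinCop.singleMap a) (FinCop.singleMap b)).hom ≫ α =
      θ ≫ (HComp k 𝒜 (FinCop.singleMap c) (FinCop.singleMap d)).hom) (j : Unit)
    (A : ∀ i : {i : Unit // some i = some j}, PolyFun k (Sh S 𝒜)) (V : Sh U 𝒜)
    (x : ∀ i, ((A i).obj.obj ((pull a).obj ((pull b).obj V)) : Type u)) :
    el ((MHom₂.app α j A).hom.app V) (tmk fun i' : {i : Unit // some i = some j} =>
      tmk fun i : {i : Unit // some i = some i'.1} => x ⟨i.1, i.2.trans i'.2⟩) =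
    tmk fun i' : {i : Unit // some i = some j} => tmk fun i : {i : Unit // some i = some i'.1} =>
      el ((A ⟨i.1, i.2.trans i'.2⟩).obj.map (shEq h V)) (x ⟨i.1, i.2.trans i'.2⟩) := by
  have e₁ := compIso_tmk (k := k) (FinCop.singleMap a) (FinCop.singleMap b) j A V x
  have e₂ : el ((MHom₂.app ((HComp k 𝒜 (FinCop.singleMap a) (FinCop.singleMap b)).hom ≫ α) j
      A).hom.app V) (tmk x) = el ((MHom₂.app
      (θ ≫ (HComp k 𝒜 (FinCop.singleMap c) (FinCop.singleMap d)).hom) j A).hom.app V) (tmk x) := by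
    rw [hα]
  have e₃ := hθ j A V (fun _ _ _ => h) (fun h => h) x
  have e₄ := compIso_tmk (k := k) (FinCop.singleMap c) (FinCop.singleMap d) j A V
    fun i => el ((A i).obj.map (shEq h V)) (x i)
  refine Eq.trans (congrArg (el ((MHom₂.app α j A).hom.app V)) ?_)
    (e₂.trans ((congrArg (el ((compIso (FinCop.singleMap c) (FinCop.singleMap d) j A).hom.hom.app V))
    e₃).trans (e₄.trans ?_)))
  · refine Eq.trans ?_ e₁.symm
    exact congrArg tmk (funext fun i' => congrArg tmk (funext fun i => (el_map_id _).symm))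
  · exact congrArg tmk (funext fun i' => congrArg tmk (funext fun i => el_map_id _))

/-- The mate of the canonical isomorphism of a square is the base change map. -/
theorem mate_apply (h : b ∘ a = d ∘ c)
    {θ : HMap k 𝒜 (FinCop.Hom.comp (FinCop.singleMap a) (FinCop.singleMap b)) ⟶
      HMap k 𝒜 (FinCop.Hom.comp (FinCop.singleMap c) (FinCop.singleMap d))}
    (hθ : IsCanonical _ _ θ)
    {α : HMap k 𝒜 (FinCop.singleMap a) ≫ HMap k 𝒜 (FinCop.singleMap b) ⟶
      HMap k 𝒜 (FinCop.singleMap c) ≫ HMap k 𝒜 (FinCop.singleMap d)}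
    (hα : (HComp k 𝒜 (FinCop.singleMap a) (FinCop.singleMap b)).hom ≫ α =
      θ ≫ (HComp k 𝒜 (FinCop.singleMap c) (FinCop.singleMap d)).hom) (j : Unit)
    (B : ∀ i : {i : Unit // some i = some j}, PolyFun k (Sh R 𝒜)) (V : Sh T 𝒜) :
    (MHom₂.app (Bicategory.mateEquiv (pullAdj k 𝒜 c) (pullAdj k 𝒜 b) α) j B).hom.app V =
      tensMap fun i : {i : Unit // some i = some j} => (B i).obj.map (baseChange h V) := by
  rw [Bicategory.mateEquiv_apply, Adjunction.homEquiv₂_apply, Adjunction.homEquiv₁_apply]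
  refine tens_ext fun y => ?_
  refine Eq.trans ?_ (tensMap_tmk _ y).symm
  let A : ∀ i : {i : Unit // some i = some j}, PolyFun k (Sh S 𝒜) := fun i =>
    (precomp (push c)).obj (B i)
  let A₁ : ∀ i : {i : Unit // some i = some j}, PolyFun k (Sh T 𝒜) := fun i' =>
    (extProd fun i : {i : Unit // some i = some i'.1} => a).obj fun i => A ⟨i.1, i.2.trans i'.2⟩
  have e₁ : el ((MHom₂.app (adjUnit k 𝒜 b) j A₁).hom.app V) (tmk fun i => y i) = tmk
      fun i' : {i : Unit // some i = some j} => tmk fun i : {i : Unit // some i = some i'.1} =>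
        el ((A ⟨i.1, i.2.trans i'.2⟩).obj.map ((pull a).map (pushUnit b V))) (y ⟨i.1, i.2.trans i'.2⟩) :=
    (adjUnit_apply b j A₁ V _).trans (congrArg tmk (funext fun i' => tensMap_tmk _ _))
  have e₂ := canonical_comp_apply h hθ hα j A ((push b).obj V) fun i =>
    el ((A i).obj.map ((pull a).map (pushUnit b V))) (y i)
  let z : ∀ i, ((A i).obj.obj ((pull c).obj ((pull d).obj ((push b).obj V))) : Type u) := fun i =>
    el ((A i).obj.map (shEq h ((push b).obj V)))
      (el ((A i).obj.map ((pull a).map (pushUnit b V))) (y i))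
  let B₁ : ∀ i : {i : Unit // some i = some j}, PolyFun k (Sh R 𝒜) := fun i' =>
    (extProd fun i : {i : Unit // some i = some i'.1} => c).obj fun i => A ⟨i.1, i.2.trans i'.2⟩
  have e₃ : el (tensMap fun i' : {i : Unit // some i = some j} =>
      (MHom₂.app (adjCounit k 𝒜 c) i'.1 fun i => B ⟨i.1, i.2.trans i'.2⟩).hom.app
        ((pull d).obj ((push b).obj V)))
      (tmk fun i' : {i : Unit // some i = some j} => tmk fun i : {i : Unit // some i = some i'.1} =>
        z ⟨i.1, i.2.trans i'.2⟩) =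
      tmk fun i => el ((B i).obj.map (pushCounit c ((pull d).obj ((push b).obj V)))) (z i) :=
    (tensMap_tmk _ _).trans (congrArg tmk (funext fun i' => adjCounit_apply c i'.1 _ _ _))
  refine Eq.trans ?_ (e₃.trans (congrArg tmk (funext fun i => ?_)))
  · exact congrArg (el (tensMap fun i' : {i : Unit // some i = some j} =>
      (MHom₂.app (adjCounit k 𝒜 c) i'.1 fun i => B ⟨i.1, i.2.trans i'.2⟩).hom.app
        ((pull d).obj ((push b).obj V)))) ((congrArg (el ((MHom₂.app α j A).hom.app ((push b).obj V))) e₁).trans e₂)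
  · exact ((el_map_comp (F := (B i).obj) _ _ _).trans (el_map_comp (F := (B i).obj) _ _ _)).symm

theorem isIso_mate (h : b ∘ a = d ∘ c) (hb : ∀ r, Function.Bijective (fibreComparison h r))
    {θ : HMap k 𝒜 (FinCop.Hom.comp (FinCop.singleMap a) (FinCop.singleMap b)) ⟶
      HMap k 𝒜 (FinCop.Hom.comp (FinCop.singleMap c) (FinCop.singleMap d))}
    (hθ : IsCanonical _ _ θ)
    {α : HMap k 𝒜 (FinCop.singleMap a) ≫ HMap k 𝒜 (FinCop.singleMap b) ⟶
      HMap k 𝒜 (FinCop.singleMap c) ≫ HMap k 𝒜 (FinCop.singleMap d)}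
    (hα : (HComp k 𝒜 (FinCop.singleMap a) (FinCop.singleMap b)).hom ≫ α =
      θ ≫ (HComp k 𝒜 (FinCop.singleMap c) (FinCop.singleMap d)).hom) :
    IsIso (Bicategory.mateEquiv (pullAdj k 𝒜 c) (pullAdj k 𝒜 b) α) := by
  refine isIso_mhom _ fun j B => isIso_poly _ fun V => ?_
  have : IsIso (baseChange h V) := (isIso_pi_iff _).2 (isIso_baseChange h hb V)
  have e := mate_apply h hθ hα j B V
  have h' : IsIso (tensMap fun i : {i : Unit // some i = some j} => (B i).obj.map (baseChange h V)) :=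
    (tensCongr fun i : {i : Unit // some i = some j} =>
      asIso ((B i).obj.map (baseChange h V))).isIso_hom
  rw [← e] at h'
  exact h'

/-- This identifies the 2-cell of a square through the coherence of `F` and an `eqToHom`, which is
the form that `mate_apply` takes as input. -/
theorem mapComp_isoMapOfCommSq {B C : Type*} [Bicategory B] [Strict B] [Bicategory C]
    (F : Pseudofunctor B C) {W X Y Z : B} {t : W ⟶ X} {l : W ⟶ Y} {r : X ⟶ Z} {b : Y ⟶ Z}
    (sq : CommSq t l r b) : (F.mapComp t r).hom ≫ (F.isoMapOfCommSq sq).hom =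
      eqToHom (congrArg F.map sq.w) ≫ (F.mapComp l b).hom := by
  refine (congrArg ((F.mapComp t r).hom ≫ ·) (Iso.trans_hom _ _)).trans ?_
  refine ((F.mapComp t r).hom_inv_id_assoc _).trans ?_
  refine (Iso.trans_hom _ _).trans (congrArg (· ≫ (F.mapComp l b).hom) ?_)
  exact PrelaxFunctor.map₂_eqToHom _ _ _ sq.w

theorem fibreComparison_bijective (pb : IsPullback (C := Type) (↾a) (↾c) (↾b) (↾d))
    (h : b ∘ a = d ∘ c) (r : R) : Function.Bijective (fibreComparison h r) := by
  constructor
  · intro s s' hs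
    refine Subtype.ext (Types.ext_of_isPullback pb ?_ ?_)
    · exact congrArg Subtype.val hs
    · exact s.2.trans s'.2.symm
  · intro t
    obtain ⟨s, h₁, h₂⟩ := Types.exists_of_isPullback pb t.1 r t.2
    exact ⟨⟨s, h₂⟩, Subtype.ext h₁⟩

theorem beckChevalley_H (pb : IsPullback (C := Type) (↾a) (↾c) (↾b) (↾d))
    (sq : CommSq (FinCop.singleMap a).toLoc (FinCop.singleMap c).toLoc
      (FinCop.singleMap b).toLoc (FinCop.singleMap d).toLoc) : BeckChevalley (H k 𝒜) sq := by
  have h : b ∘ a = d ∘ c := funext fun s => congrArg (fun z => z s) pb.w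
  have p : FinCop.Hom.comp (FinCop.singleMap a) (FinCop.singleMap b) =
    FinCop.Hom.comp (FinCop.singleMap c) (FinCop.singleMap d) := congrArg (fun z => z.as) sq.w
  refine ⟨coMap k 𝒜 c, coMap k 𝒜 b, pullAdj k 𝒜 c, pullAdj k 𝒜 b,
    (preMap_isDegreeZero _).isBounded, (preMap_isDegreeZero _).isBounded, ?_⟩
  exact isIso_mate h (fibreComparison_bijective pb h)
    (isCanonical_eqToHom p (congrArg (H k 𝒜).map sq.w)) (mapComp_isoMapOfCommSq (H k 𝒜) sq)

/-- The product of a Cartesian square with `Irr` is Cartesian, so its fibres correspond bijectively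
as well. -/
theorem beckChevalley_HTimes {Irr : Type} [Finite Irr]
    (pb : IsPullback (C := Type) (↾a) (↾c) (↾b) (↾d))
    (sq : CommSq (FinCop.singleMap a).toLoc (FinCop.singleMap c).toLoc
      (FinCop.singleMap b).toLoc (FinCop.singleMap d).toLoc) : BeckChevalley (HTimes k Irr) sq := by
  let a' : S × Irr → T × Irr := fun s => (a s.1, s.2)
  let c' : S × Irr → R × Irr := fun s => (c s.1, s.2)
  let b' : T × Irr → U × Irr := fun s => (b s.1, s.2)
  let d' : R × Irr → U × Irr := fun s => (d s.1, s.2)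
  have h₀ : b ∘ a = d ∘ c := funext fun s => congrArg (fun z => z s) pb.w
  have h : b' ∘ a' = d' ∘ c' := funext fun s => Prod.ext (congrFun h₀ s.1) rfl
  have p : FinCop.Hom.comp (FinCop.singleMap a') (FinCop.singleMap b') =
    FinCop.Hom.comp (FinCop.singleMap c') (FinCop.singleMap d') :=
      congrArg (fun z => timesMap z.as Irr) sq.w
  refine ⟨coMap k (FGModuleCat.{u} k) c', coMap k (FGModuleCat.{u} k) b', pullAdj k _ c',
    pullAdj k _ b', (preMap_isDegreeZero _).isBounded, (preMap_isDegreeZero _).isBounded, ?_⟩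
  refine isIso_mate h (fun r => ?_) (isCanonical_eqToHom p (congrArg (HTimes k Irr).map sq.w)) ?_
  · constructor
    · intro s s' hs
      have e : a' s.1 = a' s'.1 := congrArg Subtype.val hs
      have e' : c' s.1 = c' s'.1 := s.2.trans s'.2.symm
      refine Subtype.ext (Prod.ext (Types.ext_of_isPullback pb ?_ ?_) ?_)
      · exact congrArg Prod.fst e
      · exact congrArg Prod.fst e'
      · have e₂ : (a' s.1).2 = (a' s'.1).2 := congrArg Prod.snd e
        exact e₂
    · intro t
      obtain ⟨s, h₁, h₂⟩ := Types.exists_of_isPullback pb t.1.1 r.1 (congrArg Prod.fst t.2)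
      exact ⟨⟨(s, r.2), Prod.ext h₂ rfl⟩, Subtype.ext (Prod.ext h₁ (congrArg Prod.snd t.2).symm)⟩
  · have e := mapComp_isoMapOfCommSq (HTimes k Irr) sq
    rw [HTimes_mapComp, HTimes_mapComp] at e
    exact e

end BeckChevalley

/-! ### CoCartesian arrows of finite sets, and the Hopf structures. -/

section CoCartesian

theorem FinCop.Hom.fn_congr {X Y : FinCop} {f g : FinCop.Hom X Y} (e : f = g) {i : X.I} {j : Y.I}
    (h : f.base i = some j) (h' : g.base i = some j) : f.fn i j h = g.fn i j h' := by
  subst e; rfl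

/-- CoCartesian arrows of families of finite sets are disjoint unions. -/
theorem isCoprodMap_of_isStronglyCocartesian {X Y : FinCop} (f : X ⟶ Y)
    (hf : FinCop.proj.IsStronglyCocartesian (FinCop.proj.map f) f) (j : Y.I) :
    IsCoprodMap fun i : {i // FinCop.Hom.base f i = some j} => FinCop.Hom.fn f i.1 j i.2 := by
  -- The tautological disjoint union of the `X.S i`. The universal property of `f` gives a map `χ`
  -- from `Y` to it, which is compared with the evident map `c` back.
  let Y' : FinCop := ⟨Y.I, fun j => Σ i : {i // FinCop.Hom.base f i = some j}, X.S i.1⟩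
  let f₀ : FinCop.Hom X Y := f
  let φ : X ⟶ Y' := (⟨f₀.base, fun i j h s => ⟨⟨i, h⟩, s⟩⟩ : FinCop.Hom X Y')
  let c : Y' ⟶ Y := (⟨some, fun j j' h p => f₀.fn p.1.1 j' (p.1.2.trans h) p.2⟩ :
    FinCop.Hom Y' Y)
  let g : FinCop.proj.obj Y ⟶ FinCop.proj.obj Y' := 𝟙 (FinCop.proj.obj Y)
  have l₁ : FinCop.proj.IsHomLift (FinCop.proj.map f ≫ g) φ := by
    rw [show FinCop.proj.map f ≫ g = FinCop.proj.map φ from funext fun i => Option.bind_fun_some _]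
    exact Functor.IsHomLift.map (p := FinCop.proj) φ
  have l₂ : FinCop.proj.IsHomLift (FinCop.proj.map f ≫ 𝟙 (FinCop.proj.obj Y)) f := by
    rw [Category.comp_id]
    exact Functor.IsHomLift.map (p := FinCop.proj) f
  obtain ⟨χ, ⟨hχ, hχφ⟩, -⟩ := hf.universal_property' (b' := Y') g φ
  have hb : FinCop.Hom.base χ = some := (IsHomLift.eq_of_isHomLift FinCop.proj g χ).symm
  have hφc : φ ≫ c = f := by
    refine FinCop.Hom.ext (funext fun i => Option.bind_fun_some _) ?_
    refine Function.hfunext rfl fun i i' hi => ?_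
    obtain rfl := eq_of_heq hi
    refine Function.hfunext rfl fun l l' hl => ?_
    obtain rfl := eq_of_heq hl
    have e : (FinCop.Hom.comp φ c).base i = FinCop.Hom.base f i := Option.bind_fun_some _
    refine Function.hfunext (by rw [← e]; rfl) fun h h' _ => heq_of_eq ?_
    exact FinCop.Hom.comp_fn φ c h' rfl h
  -- Both sides lie over the identity and restrict to `f` along `f`, so uniqueness in the universal
  -- property applies.
  have hχc : χ ≫ c = 𝟙 Y := by
    obtain ⟨ψ, -, hψ⟩ := hf.universal_property' (b' := Y) (𝟙 (FinCop.proj.obj Y)) f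
    refine (hψ (χ ≫ c) ⟨?_, ?_⟩).trans (hψ (𝟙 Y) ⟨?_, Category.comp_id f⟩).symm
    · have e : FinCop.proj.map (χ ≫ c) = 𝟙 (FinCop.proj.obj Y) :=
        funext fun i => (congrArg (Option.bind · some) (congrFun hb i))
      rw [← e]
      exact Functor.IsHomLift.map (p := FinCop.proj) (χ ≫ c)
    · rw [← Category.assoc, hχφ, hφc]
    · rw [← FinCop.proj.map_id]
      exact Functor.IsHomLift.map (p := FinCop.proj) (𝟙 Y)
  have h₁ : ∀ y, FinCop.Hom.fn c j j rfl (FinCop.Hom.fn χ j j (congrFun hb j) y) = y := fun y =>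
    congrFun ((FinCop.Hom.comp_fn χ c (congrFun hb j) rfl
      (bind_some (congrFun hb j) rfl)).symm.trans (FinCop.Hom.fn_congr hχc _ rfl)) y
  have h₂ : ∀ (i : {i // FinCop.Hom.base f i = some j}) (s : X.S i.1),
      FinCop.Hom.fn χ j j (congrFun hb j) (FinCop.Hom.fn f i.1 j i.2 s) = ⟨i, s⟩ := fun i s =>
    congrFun ((FinCop.Hom.comp_fn f χ i.2 (congrFun hb j)
      (bind_some i.2 (congrFun hb j))).symm.trans (FinCop.Hom.fn_congr hχφ _ i.2)) s
  -- Injectivity comes from `χ` undoing `f`, surjectivity from `c` undoing `χ`.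
  constructor
  · rintro ⟨i, s⟩ ⟨i', s'⟩ h
    exact (h₂ i s).symm.trans ((congrArg (FinCop.Hom.fn χ j j (congrFun hb j)) h).trans (h₂ i' s'))
  · exact fun y => ⟨_, h₁ y⟩

theorem IsCoprodMap.times {J : Type} {S : J → Type} {T : Type} {a : ∀ j, S j → T}
    (ha : IsCoprodMap a) (Q : Type) : IsCoprodMap fun j (s : S j × Q) => (a j s.1, s.2) := by
  constructor
  · rintro ⟨j, s, q⟩ ⟨j', s', q'⟩ h
    have e : (⟨j, s⟩ : Σ j, S j) = ⟨j', s'⟩ := ha.1 (congrArg Prod.fst h)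
    have e' : q = q' := congrArg Prod.snd h
    cases e
    cases e'
    rfl
  · rintro ⟨t, q⟩
    obtain ⟨⟨j, s⟩, rfl⟩ := ha.2 t
    exact ⟨⟨j, s, q⟩, rfl⟩

variable {𝒜 : Type (u + 1)} [Category.{u} 𝒜] [Preadditive 𝒜] [Linear k 𝒜]

theorem isDegreeZero_HMap {X Y : FinCop} (f : FinCop.Hom X Y) : IsDegreeZero (HMap k 𝒜 f) :=
  fun _ _ _ hA => extProd_isHomog _ hA

variable [HasFiniteBiproducts 𝒜] [HasZeroObject 𝒜] [CharZero k] {R : Type} [Finite R] {B : R → 𝒜}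
  (hB : IsSplitBasis k B)
include hB

theorem isGradedTwoVect_HObj (X : FinCop) (i : X.I) : IsGradedTwoVect ((HObj k 𝒜 X).C i) :=
  isGradedTwoVect_grPoly (isSplitBasis_sky (S := X.S i) hB)

/-- Choose homogeneous split bases on all the `X.S i`; their external products are split bases on
the disjoint unions, so the arrow carries bases to bases. -/
theorem isCoCartesian_HMap {X Y : FinCop} (f : FinCop.Hom X Y)
    (hf : ∀ j, IsCoprodMap fun i : {i // f.base i = some j} => f.fn i.1 j i.2) :
    IsCoCartesian (HMap k 𝒜 f) := by
  choose n E hE hd using fun i : X.I => exists_splitBasis_poly (isSplitBasis_sky (S := X.S i) hB)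
  have hu : IsBasisMap (X := HObj k 𝒜 X) (Y := HObj k 𝒜 Y) (HMap k 𝒜 f) E :=
    ⟨hE, fun j => isSplitBasis_extProd hB (fun i : {i // f.base i = some j} => hE i.1)
      (fun i r => hd i.1 r) (hf j)⟩
  exact hu.isCoCartesian hd (isDegreeZero_HMap f) (isGradedTwoVect_HObj hB Y)

theorem isSSH_H : IsSSH (H k 𝒜) where
  index_obj X := rfl
  index_map f i := Option.map_id'.symm
  gradedTwoVect X i := isGradedTwoVect_HObj hB X i
  degreeZero f := isDegreeZero_HMap f
  coCartesian f hf := isCoCartesian_HMap hB f (isCoprodMap_of_isStronglyCocartesian f hf)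
  beckChevalley pb sq := beckChevalley_H pb sq

end CoCartesian

theorem isSSH_HTimes [CharZero k] {R : Type} [Finite R] {B : R → FGModuleCat.{u} k}
    (hB : IsSplitBasis k B) (Irr : Type) [Finite Irr] : IsSSH (HTimes k Irr) where
  index_obj X := rfl
  index_map f i := Option.map_id'.symm
  gradedTwoVect X i := isGradedTwoVect_HObj hB (timesObj X Irr) i
  degreeZero f := isDegreeZero_HMap (timesMap f Irr)
  coCartesian f hf := isCoCartesian_HMap hB (timesMap f Irr) fun j =>
    (isCoprodMap_of_isStronglyCocartesian f hf j).times Irr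
  beckChevalley pb sq := beckChevalley_HTimes pb sq

theorem isCoCartesian_pointsMap [CharZero k] {R : Type} [Finite R] {B : R → FGModuleCat.{u} k}
    (hB : IsSplitBasis k B) (T : Type) [Finite T] :
    IsCoCartesian (HMap k (FGModuleCat.{u} k) (pointsMap T)) :=
  isCoCartesian_HMap hB (pointsMap T) fun j => by
    constructor
    · rintro ⟨⟨t, h⟩, s⟩ ⟨⟨t', h'⟩, s'⟩ (e : t = t')
      subst e
      rfl
    · exact fun t => ⟨⟨⟨t, rfl⟩, ()⟩, rfl⟩

variable (k) in
theorem isSplitBasis_line : IsSplitBasis k fun _ : Unit => FGModuleCat.of k k where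
  hom_zero h _ := absurd rfl h
  hom_self _ f := ⟨el f 1, el_ext fun x => by
    have e : el f (x • (1 : k)) = x • el f (1 : k) := (el f).map_smul x 1
    rw [smul_eq_mul, mul_one] at e
    exact e.trans (mul_comm (G := k) x _)⟩
  one_ne _ h := one_ne_zero (α := k) (congrArg (fun z => el z (1 : k)) h)
  decomp X := by
    classical
    let b := Module.finBasis k X
    refine Decomp.of_fintype (A := Fin (Module.finrank k X)) (fun _ => ())
      (fun a => FGModuleCat.ofHom (LinearMap.toSpanSingleton k X (b a)))
      (fun a => FGModuleCat.ofHom (b.coord a)) (fun a => ?_) (fun a a' h => ?_) ?_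
    · refine el_ext fun (x : k) => ?_
      show b.coord a (x • b a) = x
      simp
    · refine el_ext fun (x : k) => ?_
      show b.coord a' (x • b a) = 0
      simp [h]
    · refine el_ext fun x => ?_
      rw [el_sum_apply]
      exact b.sum_repr x

/-! ### Representations: Maschke's theorem and the functors to multiplicity spaces. -/

section Rep

variable {G : Type u} [Group G] [Finite G]

instance : HasFiniteBiproducts (FDRep k G) := Abelian.hasFiniteBiproducts

theorem finrank_lt_of_split {X Y : FDRep k G} (i : Y ⟶ X) (p : X ⟶ Y) (h : i ≫ p = 𝟙 Y)
    (h' : p ≫ i ≠ 𝟙 X) : Module.finrank k Y.V < Module.finrank k X.V := by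
  have hi : ∀ y, el p.hom (el i.hom y) = y := fun y => congrArg (fun z => el z.hom y) h
  have hinj : Function.Injective (el i.hom) := Function.LeftInverse.injective hi
  refine lt_of_le_of_ne (LinearMap.finrank_le_finrank_of_injective hinj) fun e => h' ?_
  have hs := (LinearMap.injective_iff_surjective_of_finrank_eq_finrank e).1 hinj
  refine Action.Hom.ext (el_ext fun x => ?_)
  obtain ⟨y, rfl⟩ := hs x
  exact congrArg (el i.hom) (hi y)

variable [CharZero k]

/-- Since `|G|` is invertible in `k`, all objects are injective. A monomorphism therefore splits,
and the resulting idempotent is zero or the identity. -/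
theorem simple_of_indec {X : FDRep k G} (h : Indec X) : Simple X := by
  have : NeZero (Nat.card G : k) := ⟨Nat.cast_ne_zero.2 Nat.card_pos.ne'⟩
  refine ⟨fun {Y} f hf => ⟨fun hi h0 => h.1 ?_, fun h0 => ?_⟩⟩
  · exact (IsIso.inv_hom_id f).symm.trans ((congrArg (inv f ≫ ·) h0).trans comp_zero)
  · have hr : f ≫ Injective.factorThru (𝟙 Y) f = 𝟙 Y := Injective.comp_factorThru (𝟙 Y) f
    set r := Injective.factorThru (𝟙 Y) f
    rcases h.2 (r ≫ f) (by rw [Category.assoc, reassoc_of% hr]) with e | e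
    · exact absurd (by rw [← Category.id_comp f, ← hr, Category.assoc, e, comp_zero]) h0
    · exact ⟨r, hr, e⟩

variable {Irr : Type} {ρ : Irr → FDRep k G}

theorem isSplitBasis_irr (hk : IsSplittingField k G) (hρ : IsIrrSystem ρ) : IsSplitBasis k ρ where
  hom_zero {r s} h f := by
    have := hρ.simple r
    have := hρ.simple s
    by_contra h0
    have := isIso_of_hom_simple h0
    exact h (hρ.inj ⟨asIso f⟩)
  hom_self r f := by
    have := hρ.simple r
    obtain ⟨c, hc⟩ := (finrank_eq_one_iff_of_nonzero' (𝟙 (ρ r)) (id_nonzero _)).1 (hk _ this) f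
    exact ⟨c, hc.symm⟩
  one_ne r := by
    have := hρ.simple r
    exact id_nonzero _
  decomp X := by
    obtain ⟨D⟩ := exists_indec_decomp (fun X : FDRep k G => Module.finrank k X.V)
      (fun _ _ i p h h' => finrank_lt_of_split i p h h') X
    refine D.refine fun b => ?_
    obtain ⟨r, ⟨i⟩⟩ := hρ.complete _ (simple_of_indec (D.l b).2)
    exact Decomp.single r i.symm

/-- The family of multiplicity spaces determines maps and can be prescribed arbitrarily, at each
point of `S` separately. -/
theorem homSh_isEquivalence [Finite Irr] (hB : IsSplitBasis k ρ) (S : Type) :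
    (homSh ρ S).IsEquivalence where
  faithful := ⟨fun {V W f g} h => funext fun s => hB.hom_ext fun r x =>
    congrArg (fun z => el (z (s, r)) x) h⟩
  full := ⟨fun {V W} h => by
    choose f hf using fun s => hB.exists_hom (X := V s) (Y := W s) fun r => el (h (s, r))
    exact ⟨f, funext fun p => el_ext fun x => hf p.1 p.2 x⟩⟩
  essSurj := ⟨fun W => by
    choose V hV using fun s => hB.exists_finrank_eq fun r => Module.finrank k (W (s, r))
    refine ⟨V, ⟨Pi.isoMk fun p => ?_⟩⟩
    exact (LinearEquiv.ofFinrankEq (ρ p.2 ⟶ V p.1) (W p) (hV p.1 p.2)).toFGModuleCatIso⟩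

theorem homPt_isEquivalence [Finite Irr] (hB : IsSplitBasis k ρ) : (homPt ρ).IsEquivalence := by
  have := homSh_isEquivalence hB Unit
  let e : Sh (Unit × Irr) (FGModuleCat.{u} k) ≌ Sh Irr (FGModuleCat.{u} k) :=
    { functor := pull fun r => ((), r)
      inverse := pull fun p => p.2
      unitIso := Iso.refl _
      counitIso := Iso.refl _ }
  have he := e.isEquivalence_functor
  exact @Functor.isEquivalence_trans _ _ _ _ _ _ (homSh ρ Unit) e.functor this he

end Rep

/-! ### Precomposition with an equivalence. -/

section Equivalence

variable {𝒞 𝒟 : Type (u + 1)} [Category.{u} 𝒞] [Preadditive 𝒞] [Linear k 𝒞] [Category.{u} 𝒟]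
  [Preadditive 𝒟] [Linear k 𝒟]

/-- Precomposition with two linear functors whose composite is isomorphic to the identity. -/
def precompIso (F : 𝒞 ⥤ 𝒟) (G : 𝒟 ⥤ 𝒞) [F.Additive] [F.Linear k] [G.Additive] [G.Linear k]
    (e : F ⋙ G ≅ 𝟭 𝒞) (A : PolyFun k 𝒞) : (precomp F).obj ((precomp G).obj A) ≅ A :=
  polyIso (fun V => A.obj.mapIso (e.app V)) fun g => by
    refine (A.obj.map_comp _ _).symm.trans (Eq.trans ?_ (A.obj.map_comp _ _))
    exact congrArg A.obj.map (e.hom.naturality g)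

theorem precompIso_nat (F : 𝒞 ⥤ 𝒟) (G : 𝒟 ⥤ 𝒞) [F.Additive] [F.Linear k] [G.Additive] [G.Linear k]
    (e : F ⋙ G ≅ 𝟭 𝒞) {A B : PolyFun k 𝒞} (a : A ⟶ B) :
    (precomp F).map ((precomp G).map a) ≫ (precompIso F G e B).hom =
      (precompIso F G e A).hom ≫ a :=
  poly_ext fun V => (a.hom.naturality (e.hom.app V)).symm

theorem inverse_additive (L : 𝒞 ⥤ 𝒟) [hL : L.Additive] [L.IsEquivalence] :
    L.asEquivalence.inverse.Additive :=
  have : L.asEquivalence.functor.Additive := hL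
  L.asEquivalence.inverse_additive

theorem inverse_linear (L : 𝒞 ⥤ 𝒟) [L.Additive] [hL : L.Linear k] [L.IsEquivalence] :
    L.asEquivalence.inverse.Linear k :=
  have : L.asEquivalence.functor.Linear k := hL
  L.asEquivalence.inverseLinear k

theorem precomp_isEquivalence (L : 𝒞 ⥤ 𝒟) [L.Additive] [L.Linear k] [L.IsEquivalence] :
    (precomp L : PolyFun k 𝒟 ⥤ PolyFun k 𝒞).IsEquivalence := by
  have : L.inv.Additive := inverse_additive L
  have : L.inv.Linear k := inverse_linear L
  let e := CategoryTheory.Equivalence.mk (precomp L : PolyFun k 𝒟 ⥤ PolyFun k 𝒞) (precomp L.inv)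
    (NatIso.ofComponents (fun A => precompIso L.inv L L.asEquivalence.counitIso A)
      fun a => precompIso_nat L.inv L L.asEquivalence.counitIso a).symm
    (NatIso.ofComponents (fun A => precompIso L L.inv L.asEquivalence.unitIso.symm A)
      fun a => precompIso_nat L L.inv L.asEquivalence.unitIso.symm a)
  exact e.isEquivalence_functor

end Equivalence

section PreMap

variable {I : Type} [Finite I] {𝒞 𝒟 : I → Type (u + 1)} [∀ i, Category.{u} (𝒞 i)]
  [∀ i, Preadditive (𝒞 i)] [∀ i, Linear k (𝒞 i)] [∀ i, Category.{u} (𝒟 i)] [∀ i, Preadditive (𝒟 i)]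
  [∀ i, Linear k (𝒟 i)]

theorem nonempty_preMap_iso (F : ∀ i, 𝒞 i ⥤ 𝒟 i) (G : ∀ i, 𝒟 i ⥤ 𝒞 i) [∀ i, (F i).Additive]
    [∀ i, (F i).Linear k] [∀ i, (G i).Additive] [∀ i, (G i).Linear k]
    (e : ∀ i, F i ⋙ G i ≅ 𝟭 (𝒞 i)) :
    Nonempty (preMap (k := k) G ≫ preMap (k := k) F ≅ 𝟙 (polyFam k 𝒞)) :=
  ⟨mkIso (MHom.comp (preMap (k := k) G) (preMap (k := k) F)) (MHom.id (polyFam k 𝒞)) rfl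
    (fun j A => precompIso (F j) (G j) (e j) (A ⟨j, rfl⟩))
    fun j _ _ a => precompIso_nat (F j) (G j) (e j) (a ⟨j, rfl⟩)⟩

end PreMap

/-! ### The equivalence of Hopf structures. -/

section Rep

variable {G : Type u} [Group G] [Finite G] [CharZero k] {Irr : Type} [Finite Irr] {ρ : Irr → FDRep k G}

theorem exists_inverse_YMap (hB : IsSplitBasis k ρ) (X : FinCop) :
    ∃ g : HObj k (FDRep k G) X ⟶ HObj k (FGModuleCat.{u} k) (timesObj X Irr), IsDegreeZero g ∧
      Nonempty (YMap ρ X ≫ g ≅ 𝟙 _) ∧ Nonempty (g ≫ YMap ρ X ≅ 𝟙 _) := by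
  have := fun i : X.I => homSh_isEquivalence hB (X.S i)
  have := fun i : X.I => inverse_additive (homSh ρ (X.S i))
  have := fun i : X.I => inverse_linear (k := k) (homSh ρ (X.S i))
  exact ⟨preMap fun i : X.I => (homSh ρ (X.S i)).asEquivalence.inverse, preMap_isDegreeZero _,
    nonempty_preMap_iso (fun i : X.I => (homSh ρ (X.S i)).asEquivalence.inverse)
      (fun i : X.I => homSh ρ (X.S i)) fun i => (homSh ρ (X.S i)).asEquivalence.counitIso,
    nonempty_preMap_iso (fun i : X.I => homSh ρ (X.S i))
      (fun i : X.I => (homSh ρ (X.S i)).asEquivalence.inverse)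
      fun i => (homSh ρ (X.S i)).asEquivalence.unitIso.symm⟩

theorem isSSHEquivalence_Ystar (hB : IsSplitBasis k ρ) (h₁ : IsSSH (HTimes k Irr))
    (h₂ : IsSSH (H k (FDRep k G))) : IsSSHEquivalence (Ystar ρ) h₁ h₂ where
  index X i := rfl
  degreeZero X := preMap_isDegreeZero fun i : X.I => homSh ρ (X.S i)
  equiv X := exists_inverse_YMap hB X

end Rep

/-! ### Precomposition is symmetric monoidal. -/

section Monoidal

open MonoidalCategory

variable {𝒞 𝒟 : Type (u + 1)} [Category.{u} 𝒞] [Preadditive 𝒞] [Linear k 𝒞] [Category.{u} 𝒟]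
  [Preadditive 𝒟] [Linear k 𝒟]

/-- The tensor product of functors is formed pointwise, so precomposition preserves it strictly and
all constraints are identities. -/
def precompCore (L : 𝒞 ⥤ 𝒟) [L.Additive] [L.Linear k] :
    (precomp L : PolyFun k 𝒟 ⥤ PolyFun k 𝒞).CoreMonoidal where
  εIso := Iso.refl _
  μIso A B := Iso.refl _
  μIso_hom_natural_left f B := (Category.comp_id _).trans (Category.id_comp _).symm
  μIso_hom_natural_right f B := (Category.comp_id _).trans (Category.id_comp _).symm
  associativity X Y Z := by
    refine (congrArg₂ (· ≫ ·) (MonoidalCategory.id_whiskerRight _ _) (Category.id_comp _)).trans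
      ((Category.id_comp _).trans ?_)
    refine Eq.symm ((congrArg (_ ≫ ·) ((Category.comp_id _).trans (MonoidalCategory.whiskerLeft_id _ _))).trans
      (Category.comp_id _))
  left_unitality X := by
    refine Eq.symm ((congrArg₂ (· ≫ ·) (MonoidalCategory.id_whiskerRight _ _) (Category.id_comp _)).trans
      (Category.id_comp _))
  right_unitality X := by
    refine Eq.symm ((congrArg₂ (· ≫ ·) (MonoidalCategory.whiskerLeft_id _ _) (Category.id_comp _)).trans
      (Category.id_comp _))

theorem nonempty_precomp_braided (L : 𝒞 ⥤ 𝒟) [L.Additive] [L.Linear k] :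
    Nonempty (precomp L : PolyFun k 𝒟 ⥤ PolyFun k 𝒞).Braided :=
  ⟨{ (precompCore L).toMonoidal with
      braided := fun X Y => (Category.id_comp _).trans (Category.comp_id _).symm }⟩

end Monoidal

/-! ### Tensor products indexed by two elements. -/

section Pair

open TensorProduct

theorem pair_eq {p : Fin 2 → Prop} (hp : ∀ i, p i) (i : {i // p i}) :
    i = ⟨0, hp 0⟩ ∨ i = ⟨1, hp 1⟩ := by
  obtain ⟨i, hi⟩ := i
  fin_cases i
  · exact Or.inl rfl
  · exact Or.inr rfl

variable {p : Fin 2 → Prop} (hp : ∀ i, p i) (V : {i // p i} → Type u) [∀ i, AddCommGroup (V i)]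
  [∀ i, Module k (V i)]

theorem pair_ne : (⟨0, hp 0⟩ : {i // p i}) ≠ ⟨1, hp 1⟩ := fun h =>
  zero_ne_one (congrArg Subtype.val h)

variable (k) in
def pairMulti : MultilinearMap k V (V ⟨0, hp 0⟩ ⊗[k] V ⟨1, hp 1⟩) where
  toFun x := x ⟨0, hp 0⟩ ⊗ₜ x ⟨1, hp 1⟩
  map_update_add' m i x y := by
    rcases pair_eq hp i with rfl | rfl
    · simp only [Function.update_self, Function.update_of_ne (pair_ne hp).symm, add_tmul]
    · simp only [Function.update_self, Function.update_of_ne (pair_ne hp), tmul_add]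
  map_update_smul' m i c x := by
    rcases pair_eq hp i with rfl | rfl
    · simp only [Function.update_self, Function.update_of_ne (pair_ne hp).symm, smul_tmul']
    · simp only [Function.update_self, Function.update_of_ne (pair_ne hp), tmul_smul]

variable {V} in
open Classical in
/-- Pairs, as families indexed by a copy of `Fin 2`. -/
def pair (a : V ⟨0, hp 0⟩) (b : V ⟨1, hp 1⟩) : ∀ i, V i :=
  Function.update (Function.update 0 ⟨0, hp 0⟩ a) ⟨1, hp 1⟩ b

theorem pair_zero (a : V ⟨0, hp 0⟩) (b : V ⟨1, hp 1⟩) : pair hp a b ⟨0, hp 0⟩ = a := by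
  rw [pair, Function.update_of_ne (pair_ne hp), Function.update_self]

theorem pair_one (a : V ⟨0, hp 0⟩) (b : V ⟨1, hp 1⟩) : pair hp a b ⟨1, hp 1⟩ = b :=
  Function.update_self _ _ _

theorem pair_eta (x : ∀ i, V i) : pair hp (x ⟨0, hp 0⟩) (x ⟨1, hp 1⟩) = x := by
  funext i
  rcases pair_eq hp i with rfl | rfl
  · exact pair_zero hp V _ _
  · exact pair_one hp V _ _

open Classical in
theorem pair_comm (a : V ⟨0, hp 0⟩) (b : V ⟨1, hp 1⟩) :
    pair hp a b = Function.update (Function.update (0 : ∀ i, V i) ⟨1, hp 1⟩ b) ⟨0, hp 0⟩ a :=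
  Function.update_comm (pair_ne hp) _ _ _

variable (k) in
def pairInv : (V ⟨0, hp 0⟩ ⊗[k] V ⟨1, hp 1⟩) →ₗ[k] ⨂[k] i, V i :=
  TensorProduct.lift (LinearMap.mk₂ k (fun a b => PiTensorProduct.tprod k (pair hp a b))
    (fun a a' b => by simp only [pair_comm, MultilinearMap.map_update_add])
    (fun c a b => by simp only [pair_comm, MultilinearMap.map_update_smul])
    (fun a b b' => by simp only [pair, MultilinearMap.map_update_add])
    (fun c a b => by simp only [pair, MultilinearMap.map_update_smul]))

variable (k) in
/-- A tensor product indexed by a copy of `Fin 2`. -/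
def pairEquiv : (⨂[k] i, V i) ≃ₗ[k] V ⟨0, hp 0⟩ ⊗[k] V ⟨1, hp 1⟩ :=
  LinearEquiv.ofLinearMap (PiTensorProduct.lift (pairMulti k hp V)) (pairInv k hp V)
    (TensorProduct.ext' fun a b => by
      show PiTensorProduct.lift (pairMulti k hp V) (PiTensorProduct.tprod k (pair hp a b)) = _
      rw [PiTensorProduct.lift.tprod]
      exact congrArg₂ (· ⊗ₜ[k] ·) (pair_zero hp V a b) (pair_one hp V a b))
    (PiTensorProduct.ext (MultilinearMap.ext fun x => by
      show pairInv k hp V (PiTensorProduct.lift (pairMulti k hp V) (PiTensorProduct.tprod k x)) = _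
      rw [PiTensorProduct.lift.tprod]
      exact congrArg (PiTensorProduct.tprod k) (pair_eta hp V x)))

theorem pairEquiv_tprod (x : ∀ i, V i) :
    pairEquiv k hp V (PiTensorProduct.tprod k x) = x ⟨0, hp 0⟩ ⊗ₜ x ⟨1, hp 1⟩ :=
  PiTensorProduct.lift.tprod x

end Pair

/-! ### The induced product and unit are pointwise. -/

section Pointwise

open TensorProduct MonoidalCategory

variable {𝒜 : Type (u + 1)} [Category.{u} 𝒜] [Preadditive 𝒜] [Linear k 𝒜]

/-- A tensor product of two spaces. -/
def tensPair {p : Fin 2 → Prop} (hp : ∀ i, p i) (V : {i // p i} → FGModuleCat.{u} k) :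
    tens V ≅ MonoidalCategory.tensorObj (V ⟨0, hp 0⟩) (V ⟨1, hp 1⟩) :=
  ((pairEquiv k hp fun i => (V i : Type u)).toFGModuleCatIso :
    FGModuleCat.of k (⨂[k] i, (V i : Type u)) ≅
      FGModuleCat.of k ((V ⟨0, hp 0⟩ : Type u) ⊗[k] (V ⟨1, hp 1⟩ : Type u)))

theorem tensPair_tmk {p : Fin 2 → Prop} (hp : ∀ i, p i) (V : {i // p i} → FGModuleCat.{u} k)
    (x : ∀ i, (V i : Type u)) :
    el (tensPair hp V).hom (tmk x) = x ⟨0, hp 0⟩ ⊗ₜ[k] x ⟨1, hp 1⟩ :=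
  pairEquiv_tprod hp _ x

/-- A tensor product of no spaces. -/
def tensEmpty {ι : Type} [Finite ι] [IsEmpty ι] (V : ι → FGModuleCat.{u} k) :
    tens V ≅ MonoidalCategory.tensorUnit (FGModuleCat.{u} k) :=
  ((PiTensorProduct.isEmptyEquiv (R := k) (s := fun i => (V i : Type u)) ι).toFGModuleCatIso :
    FGModuleCat.of k (⨂[k] i, (V i : Type u)) ≅ FGModuleCat.of k k)

theorem tensEmpty_tmk {ι : Type} [Finite ι] [IsEmpty ι] (V : ι → FGModuleCat.{u} k)
    (x : ∀ i, (V i : Type u)) : el (tensEmpty V).hom (tmk x) = (1 : k) :=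
  PiTensorProduct.isEmptyEquiv_apply_tprod (R := k) (s := fun i => (V i : Type u)) ι x

variable (k 𝒜) in
theorem inducesPointwiseTensor (S : Type) [Finite S] : InducesPointwiseTensor k 𝒜 S := by
  have hp : ∀ i : Fin 2, (foldMap S).base i = some () := fun _ => rfl
  have : IsEmpty {i : Fin 0 // (unitMap S).base i = some ()} := ⟨fun i => i.1.elim0⟩
  refine ⟨⟨NatIso.ofComponents (fun F => polyIso (fun V =>
    tensPair hp fun i : {i : Fin 2 // (foldMap S).base i = some ()} => (F i.1).obj.obj V)
      fun {V W} g => ?_) fun {F F'} a => ?_,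
    fun F V x => tensPair_tmk hp (fun i => (F i.1).obj.obj V) fun i => x i.1⟩,
    polyIso (fun V => tensEmpty fun i : {i : Fin 0 // (unitMap S).base i = some ()} =>
      (i.1.elim0 : PolyFun k (Sh S 𝒜)).obj.obj V) fun {V W} g => ?_,
    fun V => ?_⟩
  · refine tens_ext fun x => ?_
    refine (congrArg (el (tensPair hp fun i : {i : Fin 2 // (foldMap S).base i = some ()} =>
      (F i.1).obj.obj W).hom) (tensMap_tmk (fun i : {i : Fin 2 // (foldMap S).base i = some ()} => (F i.1).obj.map g) x)).trans ?_
    refine (tensPair_tmk hp (fun i => (F i.1).obj.obj W) _).trans (Eq.symm ?_)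
    exact congrArg (el (MonoidalCategory.tensorHom ((F 0).obj.map g) ((F 1).obj.map g)))
      (tensPair_tmk hp (fun i => (F i.1).obj.obj V) x)
  · refine poly_ext fun V => tens_ext fun x => ?_
    refine (congrArg (el (tensPair hp fun i : {i : Fin 2 // (foldMap S).base i = some ()} =>
      (F' i.1).obj.obj V).hom) (tensMap_tmk (fun i : {i : Fin 2 // (foldMap S).base i = some ()} => (a i.1).hom.app V) x)).trans ?_
    refine (tensPair_tmk hp (fun i => (F' i.1).obj.obj V) _).trans (Eq.symm ?_)
    exact congrArg (el (MonoidalCategory.tensorHom ((a 0).hom.app V) ((a 1).hom.app V)))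
      (tensPair_tmk hp (fun i => (F i.1).obj.obj V) x)
  · refine tens_ext fun x => ?_
    refine (congrArg (el (tensEmpty _).hom) (tensMap_tmk _ x)).trans ?_
    exact (tensEmpty_tmk _ _).trans (tensEmpty_tmk _ x).symm
  · exact tensEmpty_tmk _ _

end Pointwise

end SSH

end

theorem mainTheorem8 {k : Type u} [Field k] [CharZero k] {G : Type u} [Group G] [Finite G]
    (hk : SSH.IsSplittingField k G) {Irr : Type} [Finite Irr] (ρ : Irr → FDRep k G)
    (hρ : SSH.IsIrrSystem ρ) :
    (∀ (S : Type) [Finite S], (SSH.homSh ρ S).IsEquivalence) ∧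
    (∃ (h₁ : SSH.IsSSH (SSH.HTimes k Irr)) (h₂ : SSH.IsSSH (SSH.H k (FDRep k G))),
      SSH.IsSSHEquivalence (SSH.Ystar ρ) h₁ h₂) ∧
    (SSH.InducesPointwiseTensor k (FDRep k G) Unit ∧
      SSH.InducesPointwiseTensor k (FGModuleCat.{u} k) Irr ∧
      (SSH.precomp (SSH.homPt ρ) : SSH.PolyFun k (SSH.Sh Irr (FGModuleCat.{u} k)) ⥤
        SSH.PolyFun k (SSH.Sh Unit (FDRep k G))).IsEquivalence ∧
      Nonempty (SSH.precomp (SSH.homPt ρ) : SSH.PolyFun k (SSH.Sh Irr (FGModuleCat.{u} k)) ⥤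
        SSH.PolyFun k (SSH.Sh Unit (FDRep k G))).Braided) ∧
    SSH.IsCoCartesian (SSH.HMap k (FGModuleCat.{u} k) (SSH.pointsMap Irr)) := by
  -- The two split bases, for representations and for vector spaces, feed all four assertions.
  have hB := SSH.isSplitBasis_irr hk hρ
  have hL := SSH.isSplitBasis_line k
  have := SSH.homPt_isEquivalence hB
  exact ⟨fun S _ => SSH.homSh_isEquivalence hB S,
    ⟨SSH.isSSH_HTimes hL Irr, SSH.isSSH_H hB, SSH.isSSHEquivalence_Ystar hB _ _⟩,
    ⟨SSH.inducesPointwiseTensor k _ Unit, SSH.inducesPointwiseTensor k _ Irr,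
      SSH.precomp_isEquivalence _, SSH.nonempty_precomp_braided _⟩,
    SSH.isCoCartesian_pointsMap hL Irr⟩
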